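/- **Setting.** Let $T>0$, let $n,l,m,d_\varphi,d_\eta\ge 0$ be integers, and let $f_0,\dots,f_m:\mathbb R^{n+l}\to\mathbb R^n$, $\varphi_0,\dots,\varphi_{d_\varphi}:\mathbb R^{2n}\to\mathbb R$ and $\eta_1,\dots,\eta_{d_\eta}:\mathbb R^{2n}\to\mathbb R$ be of class $C^2$ with Lipschitz continuous second derivatives. Put $F(x,u,v)=f_0(x,u)+\sum_{i=1}^m v_if_i(x,u)$ and consider the problem (P): minimize $\varphi_0(x_0,x_T)$ over $(x,u,v)\in\mathcal W=W^{1,\infty}(0,T;\mathbb R^n)\times L^\infty(0,T;\mathbb R^l)\times L^\infty(0,T;\mathbb R^m)$ subject to $\dot x_t=F(x_t,u_t,v_t)$ a.e. on $[0,T]$, $\eta_j(x_0,x_T)=0$ for $1\le j\le d_\eta$, and $\varphi_i(x_0,x_T)\le 0$ for $1\le i\le d_\varphi$. A feasible $\hat w=(\hat x,\hat u,\hat v)$ is a *weak minimum* if for some $\varepsilon>0$ it minimizes the cost among all feasible $(x,u,v)$ with $\|x-\hat x\|_\infty,\|u-\hat u\|_\infty,\|v-\hat v\|_\infty<\varepsilon$.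 Assume that $\hat u,\hat v$ are $C^\infty$ on $[0,T]$ and that $\varphi_i(\hat x_0,\hat x_T)=0$ for $1\le i\le d_\varphi$. **Multipliers.** For $\lambda=(\alpha,\beta,p)\in\mathbb R^{d_\varphi+1}\times\mathbb R^{d_\eta}\times W^{1,\infty}(0,T;\mathbb R^{n,*})$ let $H[\lambda](x,u,v,t)=p_tF(x,u,v)$ and $\ell[\lambda]=\sum_{i=0}^{d_\varphi}\alpha_i\varphi_i+\sum_{j=1}^{d_\eta}\beta_j\eta_j$. Functions and derivatives whose arguments are omitted are evaluated along $\hat w$, and a dot is the derivative in $t$. The set $\Lambda$ consists of all $\lambda$ with $\sum_i|\alpha_i|+\sum_j|\beta_j|=1$, $\alpha\ge0$, $-\dot p=H_x[\lambda]$ a.e., $p_0=-D_{x_0}\ell[\lambda]$, $p_T=D_{x_T}\ell[\lambda]$, and $H_u[\lambda]=0$, $H_v[\lambda]=0$ a.e. Let $\mathcal H_2$ be the space of $(\bar x,\bar u,\bar v)\in W^{1,2}\times L^2\times L^2$ with $\dot{\bar x}=F_x\bar x+F_u\bar u+F_v\bar v$ a.e., and let $$\Omega[\lambda](\bar x,\bar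 u,\bar v)=\tfrac12D^2\ell[\lambda](\bar x_0,\bar x_T)^2+\int_0^T\big(\tfrac12\bar x^\top H_{xx}\bar x+\bar u^\top H_{ux}\bar x+\bar v^\top H_{vx}\bar x+\tfrac12\bar u^\top H_{uu}\bar u+\bar v^\top H_{vu}\bar u\big)\,dt .$$ Let $\Lambda^\#$ be the set of $\lambda\in\Lambda$ for which $\Omega[\lambda]$ is (sequentially) weakly lower semicontinuous on $\mathcal H_2$, and $\mathrm{co}\,\Lambda^\#$ its convex hull. **Goh transformation.** Put $B=F_xF_v-\frac{d}{dt}F_v$, $M=F_v^\top H_{xx}-\dot H_{vx}-H_{vx}F_x$, $E=F_v^\top H_{ux}^\top-H_{vx}F_u$, $S=\frac12(H_{vx}F_v+(H_{vx}F_v)^\top)$, $V=\frac12(H_{vx}F_v-(H_{vx}F_v)^\top)$, $R=F_v^\top H_{xx}F_v-(H_{vx}B+(H_{vx}B)^\top)-\dot S$, and $$g[\lambda](\zeta_0,\zeta_T,h)=\tfrac12D^2\ell[\lambda](\zeta_0,\zeta_T+F_{v,T}h)^2+h^\top\big(H_{vx,T}\zeta_T+\tfrac12S_Th\big),$$ $$\Omega_{\mathcal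 P}[\lambda](\bar\xi,\bar u,\bar y,\bar v,\bar h)=g[\lambda](\bar\xi_0,\bar\xi_T,\bar h)+\int_0^T\big(\tfrac12\bar\xi^\top H_{xx}\bar\xi+\bar u^\top H_{ux}\bar\xi+\bar y^\top M\bar\xi+\tfrac12\bar u^\top H_{uu}\bar u+\bar y^\top E\bar u+\tfrac12\bar y^\top R\bar y+\bar v^\top V\bar y\big)\,dt .$$ Thus $V_{ij}[\lambda]=\frac12\,p\,[f_i,f_j]^x$ with $[f_i,f_j]^x=(D_xf_i)f_j-(D_xf_j)f_i$. Let $\mathcal P$ be the set of $(\bar\xi,\bar u,\bar y,\bar h)\in W^{1,\infty}(0,T;\mathbb R^n)\times L^\infty(0,T;\mathbb R^l)\times W^{1,\infty}(0,T;\mathbb R^m)\times\mathbb R^m$ with $\bar y_0=0$, $\bar y_T=\bar h$, $\dot{\bar\xi}=F_x\bar\xi+F_u\bar u+B\bar y$ a.e., $D\eta_j(\hat x_0,\hat x_T)(\bar\xi_0,\bar\xi_T+F_{v,T}\bar h)=0$ for $1\le j\le d_\eta$, and $D\varphi_i(\hat x_0,\hat x_T)(\bar\xi_0,\bar\xi_T+F_{v,T}\bar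 h)\le0$ for $0\le i\le d_\varphi$. Let $G(\mathrm{co}\,\Lambda^\#)=\{\lambda\in\mathrm{co}\,\Lambda^\#: V[\lambda]\equiv0\text{ on }[0,T]\}$. **Theorem (new necessary condition).** If $\hat w$ is a weak minimum of (P), then for every $(\bar\xi,\bar u,\bar y,\bar h)\in\mathcal P$ (so that $\bar h=\bar y_T$) the maximum below is attained, and $$\max_{\lambda\in G(\mathrm{co}\,\Lambda^\#)}\Omega_{\mathcal P}[\lambda](\bar\xi,\bar u,\bar y,\dot{\bar y},\bar y_T)\ \ge\ 0 .$$ -/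

import Mathlib

open Set Filter Topology MeasureTheory
open scoped Matrix ENNReal ContDiff

noncomputable section

namespace PartiallyAffine

/-- Column (or row) vectors. The supremum norm of `Fin k → ℝ` is equivalent to the Euclidean one,
and every notion below that involves a norm (weak minimum, membership in Lebesgue and Sobolev
spaces, regularity of the data) depends on it only up to equivalence. -/
abbrev Vec (k : ℕ) : Type := Fin k → ℝ

/-- The data of the optimal control problem on `[0, T]`:
minimize `phi 0 (x 0, x T)` subject to `x' = f 0 (x, u) + ∑ i, v i • f (i + 1) (x, u)`,
`eta j (x 0, x T) = 0` for all `j`, and `phi i (x 0, x T) ≤ 0` for all `i ≥ 1`. -/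
structure Problem (n l m dphi deta : ℕ) where
  /-- final time -/
  T : ℝ
  /-- drift (index zero) and controlled vector fields (indices one to `m`) -/
  f : Fin (m + 1) → Vec n × Vec l → Vec n
  /-- cost (index zero) and inequality constraints (indices one to `dphi`) -/
  phi : Fin (dphi + 1) → Vec n × Vec n → ℝ
  /-- equality constraints -/
  eta : Fin deta → Vec n × Vec n → ℝ

/-- A triple `(x, u, v)`: state, nonlinear control, affine control. Only the values on `[0, T]`
are ever used. -/
structure Triple (n l m : ℕ) where
  x : ℝ → Vec n
  u : ℝ → Vec l
  v : ℝ → Vec m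

/-- The value at time `t`. -/
def Triple.val {n l m : ℕ} (w : Triple n l m) (t : ℝ) : Vec n × Vec l × Vec m :=
  (w.x t, w.u t, w.v t)

/-- Multipliers `(α, β, p)`. -/
abbrev Multiplier (n dphi deta : ℕ) : Type :=
  (Fin (dphi + 1) → ℝ) × (Fin deta → ℝ) × (ℝ → Vec n)

/-- Lebesgue measure on `[0, T]`. -/
def leb (T : ℝ) : Measure ℝ := volume.restrict (Icc 0 T)

/-- `x` is (the continuous representative of) an element of the Sobolev space
`W^{1,q}(0, T; ℝ^k)`: the primitive of a function of class `L^q`, which is then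
the derivative of `x` almost everywhere on `[0, T]`. -/
def IsSobolev {k : ℕ} (q : ℝ≥0∞) (T : ℝ) (x : ℝ → Vec k) : Prop :=
  ∃ z : ℝ → Vec k, MemLp z q (leb T) ∧ ∀ t ∈ Icc 0 T, x t = x 0 + ∫ s in (0 : ℝ)..t, z s

/-- `C²` with Lipschitz continuous second derivative. -/
def LipschitzSecondDeriv {E F : Type*} [NormedAddCommGroup E] [NormedSpace ℝ E]
    [NormedAddCommGroup F] [NormedSpace ℝ F] (g : E → F) : Prop :=
  ContDiff ℝ 2 g ∧ ∃ K : NNReal, LipschitzWith K (fderiv ℝ (fderiv ℝ g))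

/-- The time derivative of a matrix function, entry by entry. -/
def dotMatrix {a b : ℕ} (A : ℝ → Matrix (Fin a) (Fin b) ℝ) (t : ℝ) : Matrix (Fin a) (Fin b) ℝ :=
  Matrix.of fun i j => deriv (fun s => A s i j) t

/-- `(x, u, v)` lies in `W^{1,q} × L^q × L^q`; this is `𝓦` for `q = ∞` and `𝓦₂` for `q = 2`. -/
def Triple.InSpace {n l m : ℕ} (q : ℝ≥0∞) (T : ℝ) (w : Triple n l m) : Prop :=
  IsSobolev q T w.x ∧ MemLp w.u q (leb T) ∧ MemLp w.v q (leb T)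

/-- Weak convergence of a sequence of square integrable functions in `L²(0, T; ℝ^k)`. -/
def WeakL2Tendsto {k : ℕ} (T : ℝ) (g : ℕ → ℝ → Vec k) (g₀ : ℝ → Vec k) : Prop :=
  ∀ h : ℝ → Vec k, MemLp h 2 (leb T) →
    Tendsto (fun i => ∫ t, h t ⬝ᵥ g i t ∂(leb T)) atTop (𝓝 (∫ t, h t ⬝ᵥ g₀ t ∂(leb T)))

/-- Weak convergence of a sequence in `𝓦₂ = W^{1,2} × L² × L²`. -/
def WeakTendsto {n l m : ℕ} (T : ℝ) (w : ℕ → Triple n l m) (w₀ : Triple n l m) : Prop :=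
  WeakL2Tendsto T (fun i => (w i).x) w₀.x ∧
  WeakL2Tendsto T (fun i => deriv (w i).x) (deriv w₀.x) ∧
  WeakL2Tendsto T (fun i => (w i).u) w₀.u ∧
  WeakL2Tendsto T (fun i => (w i).v) w₀.v

namespace Problem

variable {n l m dphi deta : ℕ} (P : Problem n l m dphi deta)

/-- All data functions have Lipschitz continuous second derivatives. -/
def Regular : Prop :=
  (∀ i, LipschitzSecondDeriv (P.f i)) ∧ (∀ i, LipschitzSecondDeriv (P.phi i)) ∧
    ∀ j, LipschitzSecondDeriv (P.eta j)

/-- The dynamics `F(x, u, v) = ∑_{i=0}^m v_i f_i(x, u)` with `v_0 = 1`. -/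
def F (z : Vec n × Vec l × Vec m) : Vec n :=
  P.f 0 (z.1, z.2.1) + ∑ i : Fin m, z.2.2 i • P.f i.succ (z.1, z.2.1)

/-- The end points `(x_0, x_T)` of a state. -/
def ends (x : ℝ → Vec n) : Vec n × Vec n := (x 0, x P.T)

/-- Trajectories: elements of `𝓦` that satisfy the state equation. -/
def IsTrajectory (w : Triple n l m) : Prop :=
  w.InSpace ∞ P.T ∧ ∀ᵐ t ∂(leb P.T), deriv w.x t = P.F (w.val t)

def IsFeasible (w : Triple n l m) : Prop :=
  P.IsTrajectory w ∧ (∀ j, P.eta j (P.ends w.x) = 0) ∧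
    ∀ i : Fin dphi, P.phi i.succ (P.ends w.x) ≤ 0

def IsWeakMinimum (wh : Triple n l m) : Prop :=
  P.IsFeasible wh ∧ ∃ ε : ℝ, 0 < ε ∧ ∀ w : Triple n l m, P.IsFeasible w →
    eLpNorm (w.x - wh.x) ∞ (leb P.T) < ENNReal.ofReal ε →
    eLpNorm (w.u - wh.u) ∞ (leb P.T) < ENNReal.ofReal ε →
    eLpNorm (w.v - wh.v) ∞ (leb P.T) < ENNReal.ofReal ε →
    P.phi 0 (P.ends wh.x) ≤ P.phi 0 (P.ends w.x)

/-- The pre-Hamiltonian `H[λ](x, u, v, t) = p_t F(x, u, v)`. -/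
def H (lam : Multiplier n dphi deta) (t : ℝ) (z : Vec n × Vec l × Vec m) : ℝ :=
  lam.2.2 t ⬝ᵥ P.F z

/-- The endpoint Lagrangian `ℓ[λ]`. -/
def ell (lam : Multiplier n dphi deta) (q : Vec n × Vec n) : ℝ :=
  ∑ i, lam.1 i * P.phi i q + ∑ j, lam.2.1 j * P.eta j q

variable (wh : Triple n l m)

/-- The set `Λ` of Lagrange multipliers associated with the trajectory `wh`. -/
def multipliers : Set (Multiplier n dphi deta) :=
  {lam |
    -- normalization and signs
    ∑ i, |lam.1 i| + ∑ j, |lam.2.1 j| = 1 ∧ (∀ i, 0 ≤ lam.1 i) ∧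
    -- costate equation
    IsSobolev ∞ P.T lam.2.2 ∧
    (∀ᵐ t ∂(leb P.T), ∀ y : Vec n,
      -(deriv lam.2.2 t ⬝ᵥ y) = fderiv ℝ (P.H lam t) (wh.val t) (y, 0, 0)) ∧
    -- transversality conditions
    (∀ y : Vec n, lam.2.2 0 ⬝ᵥ y = -fderiv ℝ (P.ell lam) (P.ends wh.x) (y, 0)) ∧
    (∀ y : Vec n, lam.2.2 P.T ⬝ᵥ y = fderiv ℝ (P.ell lam) (P.ends wh.x) (0, y)) ∧
    -- stationarity conditions
    (∀ᵐ t ∂(leb P.T),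
      (∀ a : Vec l, fderiv ℝ (P.H lam t) (wh.val t) (0, a, 0) = 0) ∧
      ∀ b : Vec m, fderiv ℝ (P.H lam t) (wh.val t) (0, 0, b) = 0)}

/-! First order partial derivatives of the dynamics along `wh`. -/

def Fx (t : ℝ) : Matrix (Fin n) (Fin n) ℝ :=
  Matrix.of fun i j => fderiv ℝ P.F (wh.val t) (Pi.single j 1, 0, 0) i

def Fu (t : ℝ) : Matrix (Fin n) (Fin l) ℝ :=
  Matrix.of fun i j => fderiv ℝ P.F (wh.val t) (0, Pi.single j 1, 0) i

def Fv (t : ℝ) : Matrix (Fin n) (Fin m) ℝ :=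
  Matrix.of fun i j => fderiv ℝ P.F (wh.val t) (0, 0, Pi.single j 1) i

/-- The linearized state equation. -/
def IsLinearized (w : Triple n l m) : Prop :=
  ∀ᵐ t ∂(leb P.T), deriv w.x t =
    P.Fx wh t *ᵥ w.x t + P.Fu wh t *ᵥ w.u t + P.Fv wh t *ᵥ w.v t

/-- The space `𝓗₂`. -/
def H2 : Set (Triple n l m) := {w | w.InSpace 2 P.T ∧ P.IsLinearized wh w}

variable (lam : Multiplier n dphi deta)

/-! Second order derivatives of the endpoint Lagrangian and of the pre-Hamiltonian along `wh`. -/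

/-- `D²ℓ[λ](x̂_0, x̂_T)` as a bilinear form. -/
def D2ell (q r : Vec n × Vec n) : ℝ :=
  fderiv ℝ (fderiv ℝ (P.ell lam)) (P.ends wh.x) q r

/-- The second derivative of `H[λ](·, ·, ·, t)` at the value of `wh` at time `t`. -/
def D2H (t : ℝ) (z z₁ : Vec n × Vec l × Vec m) : ℝ :=
  fderiv ℝ (fderiv ℝ (P.H lam t)) (wh.val t) z z₁

def Hxx (t : ℝ) : Matrix (Fin n) (Fin n) ℝ :=
  Matrix.of fun i j => P.D2H wh lam t (Pi.single i 1, 0, 0) (Pi.single j 1, 0, 0)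

def Hux (t : ℝ) : Matrix (Fin l) (Fin n) ℝ :=
  Matrix.of fun i j => P.D2H wh lam t (0, Pi.single i 1, 0) (Pi.single j 1, 0, 0)

def Hvx (t : ℝ) : Matrix (Fin m) (Fin n) ℝ :=
  Matrix.of fun i j => P.D2H wh lam t (0, 0, Pi.single i 1) (Pi.single j 1, 0, 0)

def Huu (t : ℝ) : Matrix (Fin l) (Fin l) ℝ :=
  Matrix.of fun i j => P.D2H wh lam t (0, Pi.single i 1, 0) (0, Pi.single j 1, 0)

def Hvu (t : ℝ) : Matrix (Fin m) (Fin l) ℝ :=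
  Matrix.of fun i j => P.D2H wh lam t (0, 0, Pi.single i 1) (0, Pi.single j 1, 0)

/-- The second variation `Ω[λ]`. -/
def Omega (w : Triple n l m) : ℝ :=
  (1 / 2) * P.D2ell wh lam (P.ends w.x) (P.ends w.x) +
  ∫ t in (0 : ℝ)..P.T,
    ((1 / 2) * (w.x t ⬝ᵥ P.Hxx wh lam t *ᵥ w.x t)
      + w.u t ⬝ᵥ P.Hux wh lam t *ᵥ w.x t
      + w.v t ⬝ᵥ P.Hvx wh lam t *ᵥ w.x t
      + (1 / 2) * (w.u t ⬝ᵥ P.Huu wh lam t *ᵥ w.u t)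
      + w.v t ⬝ᵥ P.Hvu wh lam t *ᵥ w.u t)

/-- `Ω[λ]` is weakly lower semicontinuous on `𝓗₂`, i.e. lower semicontinuous along weakly
convergent sequences. -/
def OmegaWeaklyLsc : Prop :=
  ∀ (w : ℕ → Triple n l m) (w₀ : Triple n l m),
    (∀ i, w i ∈ P.H2 wh) → w₀ ∈ P.H2 wh → WeakTendsto P.T w w₀ →
    ∀ c < P.Omega wh lam w₀, ∀ᶠ i in atTop, c < P.Omega wh lam (w i)

/-- The set `Λ^#` of the Lagrange multipliers for which `Ω[λ]` is weakly lower semicontinuous. -/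
def multipliersSharp : Set (Multiplier n dphi deta) :=
  {lam | lam ∈ P.multipliers wh ∧ P.OmegaWeaklyLsc wh lam}

/-! The matrices that arise from Goh's transformation. -/

def B (t : ℝ) : Matrix (Fin n) (Fin m) ℝ :=
  P.Fx wh t * P.Fv wh t - dotMatrix (P.Fv wh) t

def M (t : ℝ) : Matrix (Fin m) (Fin n) ℝ :=
  (P.Fv wh t)ᵀ * P.Hxx wh lam t - dotMatrix (P.Hvx wh lam) t - P.Hvx wh lam t * P.Fx wh t

def E (t : ℝ) : Matrix (Fin m) (Fin l) ℝ :=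
  (P.Fv wh t)ᵀ * (P.Hux wh lam t)ᵀ - P.Hvx wh lam t * P.Fu wh t

def S (t : ℝ) : Matrix (Fin m) (Fin m) ℝ :=
  (1 / 2 : ℝ) • (P.Hvx wh lam t * P.Fv wh t + (P.Hvx wh lam t * P.Fv wh t)ᵀ)

def V (t : ℝ) : Matrix (Fin m) (Fin m) ℝ :=
  (1 / 2 : ℝ) • (P.Hvx wh lam t * P.Fv wh t - (P.Hvx wh lam t * P.Fv wh t)ᵀ)

def R (t : ℝ) : Matrix (Fin m) (Fin m) ℝ :=
  (P.Fv wh t)ᵀ * P.Hxx wh lam t * P.Fv wh t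
    - (P.Hvx wh lam t * P.B wh t + (P.Hvx wh lam t * P.B wh t)ᵀ)
    - dotMatrix (P.S wh lam) t

def g (ζ₀ ζT : Vec n) (h : Vec m) : ℝ :=
  (1 / 2) * P.D2ell wh lam (ζ₀, ζT + P.Fv wh P.T *ᵥ h) (ζ₀, ζT + P.Fv wh P.T *ᵥ h)
    + h ⬝ᵥ (P.Hvx wh lam P.T *ᵥ ζT + (1 / 2 : ℝ) • (P.S wh lam P.T *ᵥ h))

/-- The transformed second variation `Ω_𝓟[λ]`. -/
def OmegaP (ξ : ℝ → Vec n) (u : ℝ → Vec l) (y v : ℝ → Vec m) (h : Vec m) : ℝ :=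
  P.g wh lam (ξ 0) (ξ P.T) h +
  ∫ t in (0 : ℝ)..P.T,
    ((1 / 2) * (ξ t ⬝ᵥ P.Hxx wh lam t *ᵥ ξ t)
      + u t ⬝ᵥ P.Hux wh lam t *ᵥ ξ t
      + y t ⬝ᵥ P.M wh lam t *ᵥ ξ t
      + (1 / 2) * (u t ⬝ᵥ P.Huu wh lam t *ᵥ u t)
      + y t ⬝ᵥ P.E wh lam t *ᵥ u t
      + (1 / 2) * (y t ⬝ᵥ P.R wh lam t *ᵥ y t)
      + v t ⬝ᵥ P.V wh lam t *ᵥ y t)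

/-- The transformed critical cone `𝓟`, as a set of quadruples `(ξ, u, y, h)`. -/
def coneP : Set ((ℝ → Vec n) × (ℝ → Vec l) × (ℝ → Vec m) × Vec m) :=
  {d | IsSobolev ∞ P.T d.1 ∧ MemLp d.2.1 ∞ (leb P.T) ∧ IsSobolev ∞ P.T d.2.2.1 ∧
    d.2.2.1 0 = 0 ∧ d.2.2.1 P.T = d.2.2.2 ∧
    (∀ᵐ t ∂(leb P.T), deriv d.1 t =
      P.Fx wh t *ᵥ d.1 t + P.Fu wh t *ᵥ d.2.1 t + P.B wh t *ᵥ d.2.2.1 t) ∧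
    (∀ j, fderiv ℝ (P.eta j) (P.ends wh.x)
      (d.1 0, d.1 P.T + P.Fv wh P.T *ᵥ d.2.2.2) = 0) ∧
    ∀ i, fderiv ℝ (P.phi i) (P.ends wh.x)
      (d.1 0, d.1 P.T + P.Fv wh P.T *ᵥ d.2.2.2) ≤ 0}

/-- `G(co Λ^#)`: the elements of the convex hull of `Λ^#` for which `V[λ]` vanishes identically
on `[0, T]`. -/
def gohMultipliers : Set (Multiplier n dphi deta) :=
  {lam | lam ∈ convexHull ℝ (P.multipliersSharp wh) ∧ ∀ t ∈ Icc 0 P.T, P.V wh lam t = 0}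

end Problem

end PartiallyAffine

end

/-!
The admissible trajectories near the reference process are treated as the domain of a smooth map
with finite dimensional values, the endpoint map `(φ₀, …, φ_d, η₁, …, η_d) ∘ (x₀, x_T)`. Its first
variation `L` and second variation `B` are defined on bounded measurable controls together with
initial values. The classical second order condition for a weak minimum yields, for a critical
direction `d`, a multiplier `λ ≥ 0` with `λ ∘ L = 0` and `λ (B d d) ≥ 0`, but says nothing about the
position of `λ` in the set of multipliers. The theorem asks for a multiplier in the convex hull of
`Λ^#` that annihilates `V`; the proof finds one in `Λ^#` itself.

*Index refinement.* Call `a` an essential value of `B / 2` if it is approximated by values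
`B z z / 2` with `z` in the kernel of any prescribed finite set of linear maps (`IsEssentialValue`).
`ControlSystem.exists_multiplier` shows that the multiplier can be chosen with `λ a ≥ 0` for all
essential values `a` at once. Otherwise every multiplier that is nonnegative on `B d d` is negative
on some essential value. By compactness finitely many essential values suffice, and they are attained
up to small errors at variations that are mutually `B`-orthogonal and `B`-orthogonal to `d`
(`exists_orthogonal_family`): this is where finite codimension enters. The second order values of
these variations, the range of `L` and the nonnegative orthant then generate a convex cone with
trivial polar, which is therefore the whole space (`cone_eq_univ`). Hence positive weights exist for
which all cost and inequality components decrease to second order while the equality components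
vanish and can be corrected in every direction (`exists_descent_family`). This second order descent
is realized by true trajectories (`ControlSystem.exists_trajectory`), because the scaled defect of a
two-scale perturbation `w + t a + t² b` is close to a surjective linear map. That contradicts
minimality.

*Essential values.* A control concentrated near an interior time `t₀` produces a state that is
negligible in the second variation, so the values at `t₀` of the Legendre form of the
pre-Hamiltonian are essential (`ControlSystem.isEssentialValue_legendre`). An affine control `ẏ`,
with `y` a small, concentrated, rapidly rotating curve in a plane, makes every term of the second
variation negligible except `∫ ẏ · V y`, so the entries of `± V(t₀)` are essential
(`Problem.Reference.isEssentialValue_goh`). A multiplier that is nonnegative on all essential values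
thus has `V = 0` and satisfies the Legendre condition. The Legendre condition makes `Ω[λ]` weakly
lower semicontinuous (`omegaWeaklyLsc_of_legendre`), and since the pre-Hamiltonian is affine in `v`
it also gives `H_vu = 0` (`D2H_mixed_eq_zero`). Therefore `λ` lies in `Λ^#` and annihilates `V`
(`exists_sharp_multiplier`).

*Goh's transformation.* An element `(ξ, u, y, h)` of the critical cone corresponds to the variation
with controls `(u, ẏ)`, whose state is `ξ + F_v y` (`exists_variation`). Integration by parts
(`goh_identity`) expresses half of `λ (B d d)` as the transformed quadratic form plus the term with
`H_vu`, which vanishes here. So the transformed form is nonnegative at `λ`.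

*Attainment.* A multiplier is determined by its finite dimensional part `(α, β)`, since the costate
solves the adjoint equation, and all objects are linear in `(α, β)`. In these coordinates `Λ^#` is
compact (`isCompact_sharp`), because on a weakly convergent sequence `Ω` is uniformly bounded. Its
convex hull is then compact, the condition `V = 0` is closed, and the transformed form is continuous,
so the maximum over the transported set (`image_gohMultipliers`) is attained.
-/

noncomputable section

set_option linter.unusedSectionVars false

namespace PartiallyAffine

open scoped BoundedContinuousFunction

/-! ### Primitives and linear Volterra equations -/

section Volterra

variable {X Y W : Type*} [NormedAddCommGroup X] [NormedSpace ℝ X] [NormedAddCommGroup Y]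
  [NormedSpace ℝ Y] [NormedAddCommGroup W] [NormedSpace ℝ W]

/-- Projection of the real line to `[0, T]`. Functions on `[0, T]` are encoded as functions on the
line that are composed with it, which turns `C([0, T]; X)` into a subspace of `ℝ →ᵇ X`. -/
def clamp (T t : ℝ) : ℝ := max 0 (min T t)

theorem continuous_clamp (T : ℝ) : Continuous (clamp T) := by
  unfold clamp; fun_prop

theorem clamp_mem {T : ℝ} (hT : 0 ≤ T) (t : ℝ) : clamp T t ∈ Icc 0 T :=
  ⟨le_max_left _ _, max_le hT (min_le_left _ _)⟩

theorem clamp_of_mem {T t : ℝ} (ht : t ∈ Icc 0 T) : clamp T t = t := by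
  simp [clamp, ht.1, ht.2]

/-- Strongly measurable and bounded everywhere. -/
def BddMeas (f : ℝ → X) : Prop := StronglyMeasurable f ∧ ∃ C, ∀ t, ‖f t‖ ≤ C

theorem BddMeas.add {f g : ℝ → X} (hf : BddMeas f) (hg : BddMeas g) :
    BddMeas (fun t => f t + g t) := by
  obtain ⟨hf, C, hC⟩ := hf
  obtain ⟨hg, D, hD⟩ := hg
  exact ⟨hf.add hg, C + D, fun t => norm_add_le_of_le (hC t) (hD t)⟩

theorem BddMeas.smul {f : ℝ → X} (c : ℝ) (hf : BddMeas f) : BddMeas (fun t => c • f t) := by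
  obtain ⟨hf, C, hC⟩ := hf
  refine ⟨hf.const_smul c, |c| * C, fun t => ?_⟩
  rw [norm_smul, Real.norm_eq_abs]
  exact mul_le_mul_of_nonneg_left (hC t) (abs_nonneg c)

theorem BddMeas.neg {f : ℝ → X} (hf : BddMeas f) : BddMeas (fun t => -f t) := by
  simpa using hf.smul (-1)

theorem BddMeas.sub {f g : ℝ → X} (hf : BddMeas f) (hg : BddMeas g) :
    BddMeas (fun t => f t - g t) := by
  simpa [sub_eq_add_neg] using hf.add hg.neg

theorem bddMeas_zero : BddMeas (fun _ : ℝ => (0 : X)) :=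
  ⟨stronglyMeasurable_const, 0, by simp⟩

theorem bddMeas_bcf (x : ℝ →ᵇ X) : BddMeas x :=
  ⟨x.continuous.stronglyMeasurable, ‖x‖, x.norm_coe_le_norm⟩

theorem BddMeas.prodMk {f : ℝ → X} {g : ℝ → Y} (hf : BddMeas f) (hg : BddMeas g) :
    BddMeas (fun t => (f t, g t)) := by
  obtain ⟨hf, C, hC⟩ := hf
  obtain ⟨hg, D, hD⟩ := hg
  exact ⟨hf.prodMk hg, max C D, fun t => max_le_max (hC t) (hD t)⟩

theorem BddMeas.clm {A : ℝ → X →L[ℝ] Y} {f : ℝ → X} (hA : BddMeas A) (hf : BddMeas f) :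
    BddMeas (fun t => A t (f t)) := by
  obtain ⟨hA, C, hC⟩ := hA
  obtain ⟨hf, D, hD⟩ := hf
  refine ⟨?_, C * D, fun t => (A t).le_of_opNorm_le_of_le (hC t) (hD t)⟩
  exact (isBoundedBilinearMap_apply.continuous.comp_stronglyMeasurable (hA.prodMk hf) :)

theorem BddMeas.clmConst {f : ℝ → X} (A : X →L[ℝ] Y) (hf : BddMeas f) :
    BddMeas (fun t => A (f t)) :=
  BddMeas.clm (A := fun _ => A) ⟨stronglyMeasurable_const, ‖A‖, by simp⟩ hf

theorem BddMeas.comp_continuous [ProperSpace X] {f : ℝ → X} (hf : BddMeas f) {g : X → Y}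
    (hg : Continuous g) : BddMeas (fun t => g (f t)) := by
  obtain ⟨hf, C, hC⟩ := hf
  refine ⟨hg.comp_stronglyMeasurable hf, ?_⟩
  obtain ⟨D, hD⟩ := ((isCompact_closedBall (0 : X) C).image hg).isBounded.exists_norm_le
  exact ⟨D, fun t => hD _ ⟨f t, by simpa using hC t, rfl⟩⟩

theorem BddMeas.integrableOn {f : ℝ → X} (hf : BddMeas f) (T : ℝ) : IntegrableOn f (Icc 0 T) := by
  obtain ⟨hf, C, hC⟩ := hf
  exact Measure.integrableOn_of_bounded (by simp) hf.aestronglyMeasurable (ae_of_all _ hC)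

theorem BddMeas.intervalIntegrable {f : ℝ → X} (hf : BddMeas f) (a b : ℝ) :
    IntervalIntegrable f volume a b := by
  obtain ⟨hf, C, hC⟩ := hf
  rw [intervalIntegrable_iff]
  exact Measure.integrableOn_of_bounded (by simp) hf.aestronglyMeasurable (ae_of_all _ hC)

open Classical in
/-- The primitive `t ↦ ∫₀ᵗ f` on `[0, T]`, extended by constants. -/
def primitive (T : ℝ) (f : ℝ → X) : ℝ →ᵇ X :=
  if h : 0 ≤ T ∧ IntegrableOn f (Icc 0 T) then
    BoundedContinuousFunction.ofNormedAddCommGroup (fun t => ∫ s in (0 : ℝ)..clamp T t, f s)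
      (by
        have h1 : ContinuousOn (fun x => ∫ s in (0 : ℝ)..x, f s) (Icc 0 T) := by
          have := intervalIntegral.continuousOn_primitive_interval (μ := volume) (f := f) (a := 0)
            (b := T) (by rw [uIcc_of_le h.1]; exact h.2)
          rwa [uIcc_of_le h.1] at this
        exact h1.comp_continuous (continuous_clamp T) (clamp_mem h.1))
      (∫ s in Icc 0 T, ‖f s‖)
      (by
        intro t
        have ht := clamp_mem h.1 t
        rw [intervalIntegral.integral_of_le ht.1]
        refine (norm_integral_le_integral_norm _).trans ?_
        refine setIntegral_mono_set h.2.norm (ae_of_all _ fun _ => norm_nonneg _) ?_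
        exact LE.le.eventuallyLE fun s hs => ⟨hs.1.le, hs.2.trans ht.2⟩)
  else 0

variable {T : ℝ}

theorem primitive_apply (hT : 0 ≤ T) {f : ℝ → X} (hf : IntegrableOn f (Icc 0 T)) (t : ℝ) :
    primitive T f t = ∫ s in (0 : ℝ)..clamp T t, f s := by
  simp [primitive, hT, hf]

theorem intervalIntegrable_clamp {f : ℝ → X} (hT : 0 ≤ T)
    (hf : IntegrableOn f (Icc 0 T)) (t : ℝ) : IntervalIntegrable f volume 0 (clamp T t) := by
  have ht := clamp_mem hT t
  rw [intervalIntegrable_iff, uIoc_of_le ht.1]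
  exact hf.mono_set fun s hs => ⟨hs.1.le, hs.2.trans ht.2⟩

theorem primitive_add (hT : 0 ≤ T) {f g : ℝ → X} (hf : IntegrableOn f (Icc 0 T))
    (hg : IntegrableOn g (Icc 0 T)) :
    primitive T (fun t => f t + g t) = primitive T f + primitive T g := by
  ext t : 1
  have h : IntegrableOn (fun t => f t + g t) (Icc 0 T) := hf.add hg
  rw [primitive_apply hT h, BoundedContinuousFunction.add_apply, primitive_apply hT hf,
    primitive_apply hT hg]
  exact intervalIntegral.integral_add (intervalIntegrable_clamp hT hf t)
    (intervalIntegrable_clamp hT hg t)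

theorem primitive_smul (hT : 0 ≤ T) (c : ℝ) {f : ℝ → X} (hf : IntegrableOn f (Icc 0 T)) :
    primitive T (fun t => c • f t) = c • primitive T f := by
  ext t : 1
  have h : IntegrableOn (fun t => c • f t) (Icc 0 T) := hf.smul c
  rw [primitive_apply hT h, BoundedContinuousFunction.smul_apply, primitive_apply hT hf]
  exact intervalIntegral.integral_smul _ _

theorem primitive_sub (hT : 0 ≤ T) {f g : ℝ → X} (hf : IntegrableOn f (Icc 0 T))
    (hg : IntegrableOn g (Icc 0 T)) :
    primitive T (fun t => f t - g t) = primitive T f - primitive T g := by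
  have h2 : IntegrableOn (fun t => (-1 : ℝ) • g t) (Icc 0 T) := hg.smul _
  have := primitive_add hT hf h2
  rw [primitive_smul hT _ hg] at this
  simpa [sub_eq_add_neg] using this

theorem norm_primitive_le (hT : 0 ≤ T) {f : ℝ → X} {C : ℝ} (hC : ∀ t ∈ Icc 0 T, ‖f t‖ ≤ C) :
    ‖primitive T f‖ ≤ T * C := by
  have hC0 : 0 ≤ C := (norm_nonneg _).trans (hC 0 ⟨le_rfl, hT⟩)
  by_cases hf : IntegrableOn f (Icc 0 T)
  · refine (BoundedContinuousFunction.norm_le (by positivity)).2 fun t => ?_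
    have ht := clamp_mem hT t
    rw [primitive_apply hT hf]
    refine (intervalIntegral.norm_integral_le_of_norm_le_const (C := C) ?_).trans ?_
    · intro s hs
      rw [uIoc_of_le ht.1] at hs
      exact hC s ⟨hs.1.le, hs.2.trans ht.2⟩
    · rw [sub_zero, abs_of_nonneg ht.1, mul_comm]
      exact mul_le_mul_of_nonneg_right ht.2 hC0
  · simp only [primitive, hf, and_false, dif_neg, not_false_eq_true, norm_zero]
    positivity

theorem primitive_zero_time (f : ℝ → X) : primitive T f 0 = 0 := by
  by_cases h : 0 ≤ T ∧ IntegrableOn f (Icc 0 T)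
  · rw [primitive_apply h.1 h.2]
    simp [clamp, h.1]
  · simp [primitive, h]

/-- The Volterra operator `x ↦ ∫₀ᵗ A x`. -/
def volterra (hT : 0 ≤ T) (A : ℝ →ᵇ (X →L[ℝ] X)) : (ℝ →ᵇ X) →L[ℝ] (ℝ →ᵇ X) :=
  LinearMap.mkContinuous
    { toFun := fun x => primitive T (fun s => A s (x s))
      map_add' := fun x y => by
        have hx := (BddMeas.clm (bddMeas_bcf A) (bddMeas_bcf x)).integrableOn T
        have hy := (BddMeas.clm (bddMeas_bcf A) (bddMeas_bcf y)).integrableOn T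
        simpa using primitive_add hT hx hy
      map_smul' := fun c x => by
        have hx := (BddMeas.clm (bddMeas_bcf A) (bddMeas_bcf x)).integrableOn T
        simpa using primitive_smul hT c hx }
    (T * ‖A‖)
    (fun x => by
      rw [mul_assoc]
      exact norm_primitive_le hT fun t _ =>
        (A t).le_of_opNorm_le_of_le (A.norm_coe_le_norm t) (x.norm_coe_le_norm t))

theorem volterra_apply (hT : 0 ≤ T) (A : ℝ →ᵇ (X →L[ℝ] X)) (x : ℝ →ᵇ X) :
    volterra hT A x = primitive T (fun s => A s (x s)) := rfl

theorem norm_volterra_pow_apply_le (hT : 0 ≤ T) (A : ℝ →ᵇ (X →L[ℝ] X)) (x : ℝ →ᵇ X) (k : ℕ)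
    (t : ℝ) :
    ‖((volterra hT A) ^ k) x t‖ ≤ ‖A‖ ^ k * (clamp T t) ^ k / k.factorial * ‖x‖ := by
  induction k generalizing t with
  | zero => simpa using x.norm_coe_le_norm t
  | succ k ih =>
    set y := ((volterra hT A) ^ k) x with hy
    have hs : ((volterra hT A) ^ (k + 1)) x = volterra hT A y := by
      rw [pow_succ']; rfl
    have ht := clamp_mem hT t
    rw [hs, volterra_apply,
      primitive_apply hT ((BddMeas.clm (bddMeas_bcf A) (bddMeas_bcf y)).integrableOn T)]
    have hb : ∀ s ∈ Ioc 0 (clamp T t), ‖A s (y s)‖ ≤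
        ‖A‖ ^ (k + 1) / k.factorial * ‖x‖ * s ^ k := by
      intro s hs
      have h1 := ih s
      rw [clamp_of_mem ⟨hs.1.le, hs.2.trans ht.2⟩] at h1
      refine ((A s).le_of_opNorm_le_of_le (A.norm_coe_le_norm s) h1).trans (le_of_eq ?_)
      ring
    refine (intervalIntegral.norm_integral_le_of_norm_le ht.1 (ae_of_all _ hb)
      (Continuous.intervalIntegrable (by fun_prop) _ _)).trans (le_of_eq ?_)
    rw [intervalIntegral.integral_const_mul, integral_pow, Nat.factorial_succ]
    push_cast
    field_simp
    simp

theorem isUnit_one_sub_volterra [CompleteSpace X] (hT : 0 ≤ T) (A : ℝ →ᵇ (X →L[ℝ] X)) :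
    IsUnit (1 - volterra hT A) := by
  set L := volterra hT A with hL
  have hbound : ∀ k : ℕ, ‖L ^ k‖ ≤ (‖A‖ * T) ^ k / k.factorial := by
    intro k
    refine ContinuousLinearMap.opNorm_le_bound _ (by positivity) fun x => ?_
    refine (BoundedContinuousFunction.norm_le (by positivity)).2 fun t => ?_
    refine (norm_volterra_pow_apply_le hT A x k t).trans ?_
    have ht := clamp_mem hT t
    rw [mul_pow]
    gcongr
    · exact ht.1
    · exact ht.2
  have hlim := FloorSemiring.tendsto_pow_div_factorial_atTop (‖A‖ * T)
  obtain ⟨k, hk⟩ := (hlim.eventually (gt_mem_nhds one_pos)).exists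
  have hu : IsUnit (1 - L ^ k) := isUnit_one_sub_of_norm_lt_one ((hbound k).trans_lt hk)
  have hc : Commute (1 - L) (∑ i ∈ Finset.range k, L ^ i) := by
    refine Commute.sub_left (Commute.one_left _) (Commute.sum_right _ _ _ fun i _ => ?_)
    exact (Commute.refl L).pow_right i
  have he : (1 - L) * ∑ i ∈ Finset.range k, L ^ i = 1 - L ^ k := mul_neg_geom_sum L k
  rw [← he] at hu
  exact (hc.isUnit_mul_iff.1 hu).1

/-- The solution operator `h ↦ x` of the linear integral equation `x = h + ∫₀ᵗ A x`. -/
def solve (hT : 0 ≤ T) (A : ℝ →ᵇ (X →L[ℝ] X)) : (ℝ →ᵇ X) →L[ℝ] (ℝ →ᵇ X) :=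
  Ring.inverse (1 - volterra hT A)

theorem eq_solve_iff [CompleteSpace X] (hT : 0 ≤ T) (A : ℝ →ᵇ (X →L[ℝ] X)) (x h : ℝ →ᵇ X) :
    x = solve hT A h ↔ x = h + volterra hT A x := by
  have hu := isUnit_one_sub_volterra hT A
  have h1 : solve hT A * (1 - volterra hT A) = 1 := Ring.inverse_mul_cancel _ hu
  have h2 : (1 - volterra hT A) * solve hT A = 1 := Ring.mul_inverse_cancel _ hu
  constructor
  · intro hx
    have := DFunLike.congr_fun h2 h
    rw [mul_apply_eq_comp, ← hx] at this
    rw [sub_apply] at this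
    simpa [sub_eq_iff_eq_add] using this
  · intro hx
    have := DFunLike.congr_fun h1 x
    rw [mul_apply_eq_comp, sub_apply] at this
    have h3 : (1 : (ℝ →ᵇ X) →L[ℝ] (ℝ →ᵇ X)) x - volterra hT A x = h := by
      rw [one_apply_eq_self]
      exact sub_eq_iff_eq_add.2 hx
    rw [h3] at this
    exact this.symm

theorem solve_eq [CompleteSpace X] (hT : 0 ≤ T) (A : ℝ →ᵇ (X →L[ℝ] X)) (h : ℝ →ᵇ X) :
    solve hT A h = h + volterra hT A (solve hT A h) :=
  (eq_solve_iff hT A _ h).1 rfl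

end Volterra

/-! ### Second order Taylor expansion along two scales -/

section Taylor

variable {E Y : Type*} [NormedAddCommGroup E] [NormedSpace ℝ E] [NormedAddCommGroup Y]
  [NormedSpace ℝ Y]

/-- The remainder, divided by `t²`, of the second order expansion of `F (w + t z₁ + t² z₂)`
in powers of `t`. -/
def taylorRem (F : E → Y) (t : ℝ) (w : E) (z : E × E) : Y :=
  (t ^ 2)⁻¹ • (F (w + t • z.1 + t ^ 2 • z.2) - F w - t • fderiv ℝ F w z.1)
    - fderiv ℝ F w z.2 - (1 / 2 : ℝ) • fderiv ℝ (fderiv ℝ F) w z.1 z.1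

theorem taylorRem_zero (F : E → Y) (t : ℝ) (w : E) : taylorRem F t w 0 = 0 := by
  simp [taylorRem]

theorem eq_taylorRem (F : E → Y) {t : ℝ} (ht : t ≠ 0) (w : E) (z : E × E) :
    F (w + t • z.1 + t ^ 2 • z.2) = F w + t • fderiv ℝ F w z.1 + t ^ 2 •
      (fderiv ℝ F w z.2 + (1 / 2 : ℝ) • fderiv ℝ (fderiv ℝ F) w z.1 z.1 + taylorRem F t w z) := by
  have : t ^ 2 • taylorRem F t w z = (F (w + t • z.1 + t ^ 2 • z.2) - F w - t • fderiv ℝ F w z.1)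
      - t ^ 2 • fderiv ℝ F w z.2 - t ^ 2 • (1 / 2 : ℝ) • fderiv ℝ (fderiv ℝ F) w z.1 z.1 := by
    rw [taylorRem, smul_sub, smul_sub, smul_inv_smul₀ (pow_ne_zero 2 ht)]
  rw [smul_add, smul_add, this]
  abel

theorem sndDeriv_symm {F : E → Y} (hF : ContDiff ℝ 2 F) (w z z' : E) :
    fderiv ℝ (fderiv ℝ F) w z z' = fderiv ℝ (fderiv ℝ F) w z' z :=
  (hF.contDiffAt.isSymmSndFDerivAt (by simp)).eq z z'

theorem contDiff_fderiv {F : E → Y} (hF : ContDiff ℝ 2 F) : ContDiff ℝ 1 (fderiv ℝ F) :=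
  hF.fderiv_right (by norm_num)

theorem continuous_sndDeriv {F : E → Y} (hF : ContDiff ℝ 2 F) :
    Continuous (fderiv ℝ (fderiv ℝ F)) :=
  (contDiff_fderiv hF).continuous_fderiv one_ne_zero

/-- The derivative of a `C²` function has a first order expansion that is uniform on balls. -/
theorem exists_fderiv_expansion [ProperSpace E] {F : E → Y} (hF : ContDiff ℝ 2 F) (M : ℝ) {η : ℝ}
    (hη : 0 < η) : ∃ δ > 0, ∀ w q : E, ‖w‖ ≤ M → ‖q‖ ≤ δ →
      ‖fderiv ℝ F (w + q) - fderiv ℝ F w - fderiv ℝ (fderiv ℝ F) w q‖ ≤ η * ‖q‖ := by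
  have huc := (isCompact_closedBall (0 : E) (M + 1)).uniformContinuousOn_of_continuous
    (continuous_sndDeriv hF).continuousOn
  obtain ⟨δ, hδ, h⟩ := (Metric.uniformContinuousOn_iff (β := E →L[ℝ] E →L[ℝ] Y)).1 huc η hη
  refine ⟨min (δ / 2) 1, by positivity, fun w q hw hq => ?_⟩
  have hconv : Convex ℝ (Metric.closedBall w ‖q‖) := convex_closedBall _ _
  have hmv := hconv.norm_image_sub_le_of_norm_fderiv_le' (𝕜 := ℝ) (f := fderiv ℝ F)
    (φ := fderiv ℝ (fderiv ℝ F) w) (C := η) (x := w) (y := w + q)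
    (fun x _ => ((contDiff_fderiv hF).differentiable one_ne_zero) x) ?_ (by simp) (by simp)
  · simpa using hmv
  · intro x hx
    rw [← dist_eq_norm]
    have hx' : dist x w ≤ ‖q‖ := hx
    refine (h x ?_ w ?_ ?_).le
    · have : ‖x‖ ≤ ‖x - w‖ + ‖w‖ := by simpa using norm_add_le (x - w) w
      rw [dist_eq_norm] at hx'
      have := hq.trans (min_le_right _ _)
      simp only [Metric.mem_closedBall, dist_zero_right]
      linarith
    · simp only [Metric.mem_closedBall, dist_zero_right]
      linarith
    · have := hq.trans (min_le_left _ _)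
      linarith

/-- The scaled remainder is Lipschitz on bounded sets, with a constant that tends to zero. -/
theorem exists_taylorRem_lipschitz [ProperSpace E] {F : E → Y} (hF : ContDiff ℝ 2 F) {M : ℝ}
    (hM : 0 ≤ M) {ε : ℝ} (hε : 0 < ε) :
    ∃ t₀ > 0, ∀ t, 0 < t → t < t₀ → ∀ w : E, ‖w‖ ≤ M → ∀ z z' : E × E, ‖z‖ ≤ M → ‖z'‖ ≤ M →
      ‖taylorRem F t w z - taylorRem F t w z'‖ ≤ ε * ‖z - z'‖ := by
  obtain ⟨C, hC⟩ := (isCompact_closedBall (0 : E) M).exists_bound_of_continuousOn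
    (E := E →L[ℝ] E →L[ℝ] Y)
    (continuous_sndDeriv hF).continuousOn
  have hC0 : 0 ≤ C := (norm_nonneg _).trans (hC 0 (by simpa using hM))
  obtain ⟨δ, hδ, hexp⟩ := exists_fderiv_expansion hF M (η := ε / (8 * (M + 1))) (by positivity)
  refine ⟨min 1 (min (δ / (2 * M + 1)) (ε / (8 * (C + 1) * (M + 1)))), by positivity,
    fun t ht0 ht w hw z z' hz hz' => ?_⟩
  have ht1 : t ≤ 1 := ht.le.trans (min_le_left _ _)
  have ht2 : t * (2 * M + 1) ≤ δ := by
    have := ht.le.trans ((min_le_right _ _).trans (min_le_left _ _))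
    rwa [le_div_iff₀ (by positivity)] at this
  have ht3 : t * (8 * (C + 1) * (M + 1)) ≤ ε := by
    have := ht.le.trans ((min_le_right _ _).trans (min_le_right _ _))
    rwa [le_div_iff₀ (by positivity)] at this
  set D := fderiv ℝ F with hD
  set D2 := fderiv ℝ (fderiv ℝ F) w with hD2
  have hDF : ∀ x, HasFDerivAt F (D x) x := fun x => (hF.differentiable (by norm_num) x).hasFDerivAt
  -- the derivative of the remainder
  let L : E × E → (E × E →L[ℝ] E) := fun _ => t • ContinuousLinearMap.fst ℝ E E +
    t ^ 2 • ContinuousLinearMap.snd ℝ E E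
  have hderiv : ∀ z : E × E, HasFDerivAt (taylorRem F t w)
      ((t ^ 2)⁻¹ • ((D (w + t • z.1 + t ^ 2 • z.2)).comp (L z)
        - t • (D w).comp (ContinuousLinearMap.fst ℝ E E))
        - (D w).comp (ContinuousLinearMap.snd ℝ E E)
        - (D2 z.1).comp (ContinuousLinearMap.fst ℝ E E)) z := by
    intro z
    have h1 : HasFDerivAt (fun z : E × E => w + t • z.1 + t ^ 2 • z.2) (L z) z := by
      have := (((hasFDerivAt_fst (𝕜 := ℝ) (p := z)).const_smul t).const_add w).add
        ((hasFDerivAt_snd (𝕜 := ℝ) (p := z)).const_smul (t ^ 2))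
      exact this
    have h2 := (hDF (w + t • z.1 + t ^ 2 • z.2)).comp z h1
    have h3 : HasFDerivAt (fun z : E × E => D w z.1)
        ((D w).comp (ContinuousLinearMap.fst ℝ E E)) z :=
      ((D w).comp (ContinuousLinearMap.fst ℝ E E)).hasFDerivAt
    have h4 : HasFDerivAt (fun z : E × E => D w z.2)
        ((D w).comp (ContinuousLinearMap.snd ℝ E E)) z :=
      ((D w).comp (ContinuousLinearMap.snd ℝ E E)).hasFDerivAt
    have h5 : HasFDerivAt (fun z : E × E => (1 / 2 : ℝ) • D2 z.1 z.1)
        ((D2 z.1).comp (ContinuousLinearMap.fst ℝ E E)) z := by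
      have h6 : HasFDerivAt (fun z : E × E => D2 z.1)
          (D2.comp (ContinuousLinearMap.fst ℝ E E)) z :=
        (D2.comp (ContinuousLinearMap.fst ℝ E E)).hasFDerivAt
      have := (h6.clm_apply (hasFDerivAt_fst (𝕜 := ℝ) (p := z))).const_smul (1 / 2 : ℝ)
      refine HasFDerivAt.congr_fderiv this (ContinuousLinearMap.ext fun y => ?_)
      have hs : D2 y.1 z.1 = D2 z.1 y.1 := sndDeriv_symm hF w _ _
      simp [hs, ← two_smul ℝ]
    exact (((h2.sub_const (F w)).sub (h3.const_smul t)).const_smul ((t ^ 2)⁻¹)).sub h4 |>.sub h5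
  have hconv : Convex ℝ (Metric.closedBall (0 : E × E) M) := convex_closedBall _ _
  refine hconv.norm_image_sub_le_of_norm_hasFDerivWithin_le
    (fun z _ => (hderiv z).hasFDerivWithinAt) (fun z hz => ?_) (by simpa using hz')
    (by simpa using hz)
  have hzM : ‖z‖ ≤ M := by simpa using hz
  have hz1 : ‖z.1‖ ≤ M := (norm_fst_le z).trans hzM
  have hz2 : ‖z.2‖ ≤ M := (norm_snd_le z).trans hzM
  set q := t • z.1 + t ^ 2 • z.2 with hq
  have hqn : ‖q‖ ≤ t * (2 * M) := by
    refine (norm_add_le _ _).trans ?_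
    rw [norm_smul, norm_smul, Real.norm_of_nonneg ht0.le, Real.norm_of_nonneg (by positivity)]
    have : t ^ 2 * ‖z.2‖ ≤ t * M := by
      calc t ^ 2 * ‖z.2‖ = t * (t * ‖z.2‖) := by ring
        _ ≤ t * (1 * M) := by gcongr
        _ = t * M := by ring
    nlinarith [mul_le_mul_of_nonneg_left hz1 ht0.le]
  have hqδ : ‖q‖ ≤ δ := hqn.trans (by nlinarith)
  have hx := hexp w q hw hqδ
  have hCw : ‖D2‖ ≤ C := hC w (by simpa using hw)
  refine ContinuousLinearMap.opNorm_le_bound _ hε.le fun h => ?_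
  -- The derivative of the remainder splits into three terms. The first is small by the uniform
  -- expansion of the derivative of `F`, since `‖q‖ = O(t)`; the other two are `O(t)`.
  set Δ := D (w + q) - D w with hΔ
  have heq : ((t ^ 2)⁻¹ • ((D (w + t • z.1 + t ^ 2 • z.2)).comp (L z)
        - t • (D w).comp (ContinuousLinearMap.fst ℝ E E))
        - (D w).comp (ContinuousLinearMap.snd ℝ E E)
        - (D2 z.1).comp (ContinuousLinearMap.fst ℝ E E)) h
      = t⁻¹ • (Δ - D2 q) h.1 + t • D2 z.2 h.1 + Δ h.2 := by
    have e1 : w + t • z.1 + t ^ 2 • z.2 = w + q := by rw [hq, add_assoc]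
    have e2 : D2 q = t • D2 z.1 + t ^ 2 • D2 z.2 := by rw [hq, map_add, map_smul, map_smul]
    rw [e1, e2]
    simp only [L, Δ, sub_apply, smul_apply, ContinuousLinearMap.comp_apply,
      add_apply, ContinuousLinearMap.coe_fst', ContinuousLinearMap.coe_snd',
      map_add, map_smul, smul_sub, smul_add, smul_smul]
    have a1 : (t ^ 2)⁻¹ * t = t⁻¹ := by field_simp
    have a2 : (t ^ 2)⁻¹ * t ^ 2 = 1 := by field_simp
    have a3 : t⁻¹ * t = 1 := by field_simp
    have a4 : t⁻¹ * t ^ 2 = t := by field_simp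
    rw [a1, a2, a3, a4, one_smul, one_smul]
    abel
  rw [heq]
  have hh1 : ‖h.1‖ ≤ ‖h‖ := norm_fst_le h
  have hh2 : ‖h.2‖ ≤ ‖h‖ := norm_snd_le h
  have b1 : ‖t⁻¹ • (Δ - D2 q) h.1‖ ≤ ε / 4 * ‖h‖ := by
    rw [norm_smul, Real.norm_of_nonneg (by positivity)]
    have c1 : ‖(Δ - D2 q) h.1‖ ≤ ε / (8 * (M + 1)) * (t * (2 * M)) * ‖h‖ :=
      (Δ - D2 q).le_of_opNorm_le_of_le (hx.trans (by gcongr)) hh1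
    calc t⁻¹ * ‖(Δ - D2 q) h.1‖ ≤ t⁻¹ * (ε / (8 * (M + 1)) * (t * (2 * M)) * ‖h‖) := by gcongr
      _ = ε / 4 * ‖h‖ * (M / (M + 1)) := by field_simp; ring
      _ ≤ ε / 4 * ‖h‖ * 1 := by
          gcongr
          rw [div_le_one (by positivity)]; linarith
      _ = ε / 4 * ‖h‖ := by ring
  have b2 : ‖t • D2 z.2 h.1‖ ≤ ε / 4 * ‖h‖ := by
    rw [norm_smul, Real.norm_of_nonneg ht0.le]
    have c1 : ‖D2 z.2 h.1‖ ≤ C * M * ‖h‖ :=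
      (D2 z.2).le_of_opNorm_le_of_le (D2.le_of_opNorm_le_of_le hCw hz2) hh1
    calc t * ‖D2 z.2 h.1‖ ≤ t * (C * M * ‖h‖) := by gcongr
      _ = (t * (C * M)) * ‖h‖ := by ring
      _ ≤ ε / 4 * ‖h‖ := by
          gcongr
          nlinarith [mul_nonneg ht0.le hC0, mul_nonneg ht0.le hM, mul_nonneg hC0 hM,
            mul_nonneg ht0.le (mul_nonneg hC0 hM)]
  have b3 : ‖Δ h.2‖ ≤ ε / 2 * ‖h‖ := by
    have c1 : ‖Δ‖ ≤ ε / 2 := by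
      have c2 : ‖Δ‖ ≤ ‖Δ - D2 q‖ + ‖D2 q‖ := by simpa using norm_add_le (Δ - D2 q) (D2 q)
      have c3 : ‖D2 q‖ ≤ C * (t * (2 * M)) := D2.le_of_opNorm_le_of_le hCw hqn
      have c4 : ‖Δ - D2 q‖ ≤ ε / (8 * (M + 1)) * (t * (2 * M)) := hx.trans (by gcongr)
      have c5 : ε / (8 * (M + 1)) * (t * (2 * M)) ≤ ε / 4 := by
        calc ε / (8 * (M + 1)) * (t * (2 * M)) = ε / 4 * (t * (M / (M + 1))) := by
              field_simp; ring
          _ ≤ ε / 4 * (1 * 1) := by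
              gcongr
              rw [div_le_one (by positivity)]; linarith
          _ = ε / 4 := by ring
      nlinarith [mul_nonneg ht0.le hC0, mul_nonneg ht0.le hM, mul_nonneg hC0 hM,
            mul_nonneg ht0.le (mul_nonneg hC0 hM)]
    exact Δ.le_of_opNorm_le_of_le c1 hh2
  calc _ ≤ ‖t⁻¹ • (Δ - D2 q) h.1‖ + ‖t • D2 z.2 h.1‖ + ‖Δ h.2‖ := norm_add₃_le
    _ ≤ ε * ‖h‖ := by linarith

end Taylor

/-! ### Control systems, linearization and second order response -/

section System

variable {X U Y : Type*} [NormedAddCommGroup X] [NormedSpace ℝ X] [ProperSpace X]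
  [NormedAddCommGroup U] [NormedSpace ℝ U] [ProperSpace U]
  [NormedAddCommGroup Y] [NormedSpace ℝ Y]

/-- The composition of a bounded continuous function with a continuous map on a proper space. -/
def bcfComp {E W : Type*} [NormedAddCommGroup E] [ProperSpace E] [NormedAddCommGroup W]
    (g : E → W) (hg : Continuous g) (w : ℝ →ᵇ E) : ℝ →ᵇ W :=
  BoundedContinuousFunction.ofNormedAddCommGroup (fun t => g (w t)) (hg.comp w.continuous)
    ((isCompact_closedBall (0 : E) ‖w‖).exists_bound_of_continuousOn hg.continuousOn).choose
    (fun t => ((isCompact_closedBall (0 : E) ‖w‖).exists_bound_of_continuousOn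
      hg.continuousOn).choose_spec _ (by simpa using w.norm_coe_le_norm t))

variable (X U Y) in
/-- A control system `x' = F (x, u)` on `[0, T]` with an endpoint map `G`, and a continuous
reference process `w`, extended by constants outside `[0, T]`. -/
structure ControlSystem where
  T : ℝ
  T_nonneg : 0 ≤ T
  F : X × U → X
  contDiff_F : ContDiff ℝ 2 F
  G : X × X → Y
  contDiff_G : ContDiff ℝ 2 G
  w : ℝ →ᵇ X × U
  w_eq : ∀ t, (w t).1 = (w 0).1 + ∫ s in (0 : ℝ)..clamp T t, F (w s)

variable (X U) in
/-- Variations of the initial state and of the control. -/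
def Variation : Submodule ℝ (X × (ℝ → U)) where
  carrier := {z | BddMeas z.2}
  add_mem' ha hb := BddMeas.add ha hb
  zero_mem' := bddMeas_zero
  smul_mem' c _ hz := BddMeas.smul c hz

namespace ControlSystem

variable (Q : ControlSystem X U Y)

/-- The state of the reference process. -/
def xh : ℝ →ᵇ X := bcfComp Prod.fst continuous_fst Q.w

/-- The derivative of the dynamics along the reference process. -/
def dF : ℝ →ᵇ (X × U →L[ℝ] X) :=
  bcfComp (fderiv ℝ Q.F) (contDiff_fderiv Q.contDiff_F).continuous Q.w

/-- The second derivative of the dynamics along the reference process. -/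
def d2F : ℝ →ᵇ (X × U →L[ℝ] X × U →L[ℝ] X) :=
  bcfComp (fderiv ℝ (fderiv ℝ Q.F)) (continuous_sndDeriv Q.contDiff_F) Q.w

/-- The partial derivative of the dynamics with respect to the state. -/
def A : ℝ →ᵇ (X →L[ℝ] X) :=
  bcfComp (fun e => (fderiv ℝ Q.F e).comp (ContinuousLinearMap.inl ℝ X U))
    ((contDiff_fderiv Q.contDiff_F).continuous.clm_comp continuous_const) Q.w

theorem A_apply (t : ℝ) (x : X) : Q.A t x = Q.dF t (x, 0) := rfl

/-- The pair of end points. -/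
def ends : (ℝ →ᵇ X) →L[ℝ] X × X :=
  (BoundedContinuousFunction.evalCLM ℝ 0).prod (BoundedContinuousFunction.evalCLM ℝ Q.T)

@[simp] theorem ends_apply (x : ℝ →ᵇ X) : Q.ends x = (x 0, x Q.T) := rfl

/-- The derivative of the endpoint map. -/
def dG : X × X →L[ℝ] Y := fderiv ℝ Q.G (Q.ends Q.xh)

/-- The second derivative of the endpoint map. -/
def d2G : X × X →L[ℝ] X × X →L[ℝ] Y := fderiv ℝ (fderiv ℝ Q.G) (Q.ends Q.xh)

theorem bddMeas_dF {z : ℝ → X × U} (hz : BddMeas z) : BddMeas (fun s => Q.dF s (z s)) :=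
  BddMeas.clm (bddMeas_bcf Q.dF) hz

theorem bddMeas_d2F {z z' : ℝ → X × U} (hz : BddMeas z) (hz' : BddMeas z') :
    BddMeas (fun s => Q.d2F s (z s) (z' s)) :=
  BddMeas.clm (BddMeas.clm (Y := X × U →L[ℝ] X)
    (bddMeas_bcf (X := X × U →L[ℝ] X × U →L[ℝ] X) Q.d2F) hz) hz'

/-- The inhomogeneity `t ↦ x₀ + ∫₀ᵗ F_u u` of the linearized state equation. -/
def forcing : Variation X U →ₗ[ℝ] (ℝ →ᵇ X) where
  toFun z := BoundedContinuousFunction.const ℝ z.1.1 +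
    primitive Q.T (fun s => Q.dF s (0, z.1.2 s))
  map_add' z z' := by
    have h (z : Variation X U) : IntegrableOn (fun s => Q.dF s (0, z.1.2 s)) (Icc 0 Q.T) :=
      (Q.bddMeas_dF (bddMeas_zero.prodMk z.2)).integrableOn Q.T
    have h1 := primitive_add Q.T_nonneg (h z) (h z')
    have h2 : (fun s => Q.dF s (0, (z + z').1.2 s)) =
        fun s => Q.dF s (0, z.1.2 s) + Q.dF s (0, z'.1.2 s) := by
      ext s
      rw [← map_add]
      simp
    rw [h2, h1]
    ext t
    simp only [BoundedContinuousFunction.add_apply, BoundedContinuousFunction.const_apply,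
      Submodule.coe_add, Prod.fst_add]
    abel
  map_smul' c z := by
    have h : IntegrableOn (fun s => Q.dF s (0, z.1.2 s)) (Icc 0 Q.T) :=
      (Q.bddMeas_dF (bddMeas_zero.prodMk z.2)).integrableOn Q.T
    have h1 := primitive_smul Q.T_nonneg c h
    have h2 : (fun s => Q.dF s (0, (c • z).1.2 s)) = fun s => c • Q.dF s (0, z.1.2 s) := by
      ext s
      rw [← map_smul]
      simp
    rw [h2, h1]
    ext t
    simp

/-- The linearized state. -/
def resp : Variation X U →ₗ[ℝ] (ℝ →ᵇ X) := (solve Q.T_nonneg Q.A).toLinearMap ∘ₗ Q.forcing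

/-- The linearized process: state and control. -/
def traj (z : Variation X U) (s : ℝ) : X × U := (Q.resp z s, z.1.2 s)

theorem traj_add (z z' : Variation X U) (s : ℝ) : Q.traj (z + z') s = Q.traj z s + Q.traj z' s := by
  simp [traj]

theorem traj_smul (c : ℝ) (z : Variation X U) (s : ℝ) : Q.traj (c • z) s = c • Q.traj z s := by
  simp [traj]

/-- The value of the linearized process, as a linear map. -/
def trajLin (s : ℝ) : Variation X U →ₗ[ℝ] X × U where
  toFun z := Q.traj z s
  map_add' z z' := Q.traj_add z z' s
  map_smul' c z := Q.traj_smul c z s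

theorem bddMeas_traj (z : Variation X U) : BddMeas (Q.traj z) := (bddMeas_bcf _).prodMk z.2

theorem resp_eq (z : Variation X U) : Q.resp z = BoundedContinuousFunction.const ℝ z.1.1 +
    primitive Q.T (fun s => Q.dF s (Q.traj z s)) := by
  have h1 : Q.resp z = Q.forcing z + volterra Q.T_nonneg Q.A (Q.resp z) := solve_eq _ _ _
  have h2 := (Q.bddMeas_dF (bddMeas_zero.prodMk z.2)).integrableOn Q.T
  have h3 : IntegrableOn (fun s => Q.A s (Q.resp z s)) (Icc 0 Q.T) :=
    (BddMeas.clm (bddMeas_bcf Q.A) (bddMeas_bcf _)).integrableOn Q.T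
  have h4 := primitive_add Q.T_nonneg h2 h3
  have h5 : (fun s => Q.dF s (Q.traj z s)) =
      fun s => Q.dF s (0, z.1.2 s) + Q.A s (Q.resp z s) := by
    ext s
    rw [A_apply, ← map_add]
    simp [traj]
  rw [h5, h4, ← add_assoc]
  exact h1

theorem eq_resp {z : Variation X U} {x : ℝ →ᵇ X}
    (hx : x = BoundedContinuousFunction.const ℝ z.1.1 +
      primitive Q.T (fun s => Q.dF s (x s, z.1.2 s))) : x = Q.resp z := by
  refine (eq_solve_iff Q.T_nonneg Q.A _ _).2 ?_
  have h2 := (Q.bddMeas_dF (bddMeas_zero.prodMk z.2)).integrableOn Q.T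
  have h3 : IntegrableOn (fun s => Q.A s (x s)) (Icc 0 Q.T) :=
    (BddMeas.clm (bddMeas_bcf Q.A) (bddMeas_bcf _)).integrableOn Q.T
  have h4 := primitive_add Q.T_nonneg h2 h3
  have h5 : (fun s => Q.dF s (x s, z.1.2 s)) =
      fun s => Q.dF s (0, z.1.2 s) + Q.A s (x s) := by
    ext s
    rw [A_apply, ← map_add]
    simp
  rw [h5, h4, ← add_assoc] at hx
  exact hx

theorem resp_zero_time (z : Variation X U) : Q.resp z 0 = z.1.1 := by
  rw [resp_eq]
  simp [primitive_zero_time]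

/-- The second order response: the state generated by the second derivative of the dynamics. -/
def resp₂ (z z' : Variation X U) : ℝ →ᵇ X :=
  solve Q.T_nonneg Q.A (primitive Q.T fun s => Q.d2F s (Q.traj z s) (Q.traj z' s))

theorem integrableOn_d2F (z z' : Variation X U) :
    IntegrableOn (fun s => Q.d2F s (Q.traj z s) (Q.traj z' s)) (Icc 0 Q.T) :=
  (Q.bddMeas_d2F (Q.bddMeas_traj z) (Q.bddMeas_traj z')).integrableOn Q.T

theorem resp₂_add_left (z₁ z₂ z' : Variation X U) :
    Q.resp₂ (z₁ + z₂) z' = Q.resp₂ z₁ z' + Q.resp₂ z₂ z' := by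
  simp only [resp₂, traj_add, map_add, add_apply]
  rw [primitive_add Q.T_nonneg (Q.integrableOn_d2F _ _) (Q.integrableOn_d2F _ _), map_add]

theorem resp₂_smul_left (c : ℝ) (z z' : Variation X U) :
    Q.resp₂ (c • z) z' = c • Q.resp₂ z z' := by
  simp only [resp₂, traj_smul, map_smul, smul_apply]
  rw [primitive_smul Q.T_nonneg c (Q.integrableOn_d2F _ _), map_smul]

theorem resp₂_symm (z z' : Variation X U) : Q.resp₂ z z' = Q.resp₂ z' z := by
  have h (s : ℝ) : Q.d2F s (Q.traj z s) (Q.traj z' s) = Q.d2F s (Q.traj z' s) (Q.traj z s) :=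
    sndDeriv_symm Q.contDiff_F _ _ _
  simp only [resp₂, h]

theorem resp₂_eq (z z' : Variation X U) : Q.resp₂ z z' =
    primitive Q.T (fun s => Q.d2F s (Q.traj z s) (Q.traj z' s)) +
      primitive Q.T (fun s => Q.A s (Q.resp₂ z z' s)) := solve_eq _ _ _

theorem resp₂_zero_time (z z' : Variation X U) : Q.resp₂ z z' 0 = 0 := by
  rw [resp₂_eq]
  simp [primitive_zero_time]

/-- The second order response as a bilinear map. -/
def respBilin : Variation X U →ₗ[ℝ] Variation X U →ₗ[ℝ] (ℝ →ᵇ X) :=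
  LinearMap.mk₂ ℝ Q.resp₂ Q.resp₂_add_left Q.resp₂_smul_left
    (fun z z₁ z₂ => by simp only [Q.resp₂_symm z, Q.resp₂_add_left])
    (fun c z z' => by simp only [Q.resp₂_symm z, Q.resp₂_smul_left])

/-- The derivative of the composition of the endpoint map with the control-to-state map. -/
def first : Variation X U →ₗ[ℝ] Y :=
  Q.dG.toLinearMap ∘ₗ Q.ends.toLinearMap ∘ₗ Q.resp

/-- The second derivative of the composition of the endpoint map with the control-to-state map. -/
def second : Variation X U →ₗ[ℝ] Variation X U →ₗ[ℝ] Y :=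
  LinearMap.mk₂ ℝ
    (fun z z' => Q.d2G (Q.ends (Q.resp z)) (Q.ends (Q.resp z')) + Q.dG (Q.ends (Q.respBilin z z')))
    (fun z₁ z₂ z' => by
      simp only [map_add, LinearMap.add_apply, add_apply]; abel)
    (fun c z z' => by
      simp only [map_smul, LinearMap.smul_apply, smul_apply, smul_add])
    (fun z z₁ z₂ => by simp only [map_add]; abel)
    (fun c z z' => by simp only [map_smul, smul_add])

theorem first_apply (z : Variation X U) : Q.first z = Q.dG (Q.ends (Q.resp z)) := rfl

theorem second_apply (z z' : Variation X U) : Q.second z z' =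
    Q.d2G (Q.ends (Q.resp z)) (Q.ends (Q.resp z')) + Q.dG (Q.ends (Q.resp₂ z z')) := rfl

theorem second_symm (z z' : Variation X U) : Q.second z z' = Q.second z' z := by
  rw [second_apply, second_apply, resp₂_symm]
  congr 1
  exact sndDeriv_symm Q.contDiff_G _ _ _

theorem xh_eq : Q.xh = BoundedContinuousFunction.const ℝ (Q.w 0).1 +
    primitive Q.T (fun s => Q.F (Q.w s)) := by
  ext t
  have h := ((bddMeas_bcf Q.w).comp_continuous Q.contDiff_F.continuous).integrableOn Q.T
  rw [BoundedContinuousFunction.add_apply, primitive_apply Q.T_nonneg h]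
  exact Q.w_eq t

end ControlSystem

end System

/-! ### Realization of second order descent directions by trajectories -/

section Quadratic

variable {E ι κ : Type*} [NormedAddCommGroup E] [NormedSpace ℝ E] [Fintype ι] [Fintype κ]

/-- First and second order part of a perturbation with coefficients `x` (of order `t`)
and `y` (of order `t²`). -/
def twoScale (a : ι → E) (b : ι → ι → E) (e : κ → E) (x : ι → ℝ) (y : κ → ℝ) (g : E) : E × E :=
  (∑ i, x i • a i, ∑ i, ∑ j, (x i * x j) • b i j + ∑ j, y j • e j + g)

theorem norm_sum_smul_le (x : ι → ℝ) (a : ι → E) {B C : ℝ} (hB : 0 ≤ B) (hx : ∀ i, |x i| ≤ B)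
    (ha : ∀ i, ‖a i‖ ≤ C) : ‖∑ i, x i • a i‖ ≤ Fintype.card ι * (B * C) := by
  refine (norm_sum_le_of_le (f := fun i => x i • a i) (n := fun _ => B * C) _
    fun i _ => ?_).trans (by simp)
  rw [norm_smul, Real.norm_eq_abs]
  exact mul_le_mul (hx i) (ha i) (norm_nonneg _) hB

theorem norm_sum_sum_smul_le (x : ι → ι → ℝ) (b : ι → ι → E) {B C : ℝ} (hB : 0 ≤ B)
    (hx : ∀ i j, |x i j| ≤ B) (hb : ∀ i j, ‖b i j‖ ≤ C) :
    ‖∑ i, ∑ j, x i j • b i j‖ ≤ Fintype.card ι * (Fintype.card ι * (B * C)) := by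
  refine (norm_sum_le_of_le (f := fun i => ∑ j, x i j • b i j)
    (n := fun _ => Fintype.card ι * (B * C)) _ fun i _ => ?_).trans (by simp)
  exact norm_sum_smul_le _ _ hB (hx i) (hb i)

/-- Perturbations with bounded coefficients are bounded and depend Lipschitz continuously on the
coefficients, uniformly in the data. -/
theorem exists_twoScale_bound (C D : ℝ) (hC : 0 ≤ C) (hD : 0 ≤ D) : ∃ K : ℝ, 0 ≤ K ∧
    ∀ (a : ι → E) (b : ι → ι → E) (e : κ → E), (∀ i, ‖a i‖ ≤ C) → (∀ i j, ‖b i j‖ ≤ C) →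
      (∀ j, ‖e j‖ ≤ C) → ∀ (x x' : ι → ℝ) (y y' : κ → ℝ) (g g' : E) (d : ℝ),
      (∀ i, |x i| ≤ D) → (∀ i, |x' i| ≤ D) → (∀ j, |y j| ≤ D) → ‖g‖ ≤ D →
      (∀ i, |x i - x' i| ≤ d) → (∀ j, |y j - y' j| ≤ d) → ‖g - g'‖ ≤ d → 0 ≤ d →
      ‖twoScale a b e x y g‖ ≤ K ∧
        ‖twoScale a b e x y g - twoScale a b e x' y' g'‖ ≤ K * d := by
  set N : ℝ := (Fintype.card ι : ℝ) with hN
  set N' : ℝ := (Fintype.card κ : ℝ) with hN'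
  have hN0 : 0 ≤ N := by positivity
  have hN0' : 0 ≤ N' := by positivity
  refine ⟨N * (D * C) + N * (N * (D * D * C)) + N' * (D * C) + D + N * C +
    N * (N * (2 * D * C)) + N' * C + 1, by positivity, ?_⟩
  intro a b e ha hb he x x' y y' g g' d hx hx' hy hg hxx hyy hgg hd
  have p1 : 0 ≤ N * (D * C) := by positivity
  have p2 : 0 ≤ N * (N * (D * D * C)) := by positivity
  have p3 : 0 ≤ N' * (D * C) := by positivity
  have p4 : 0 ≤ N * C := by positivity
  have p5 : 0 ≤ N * (N * (2 * D * C)) := by positivity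
  have p6 : 0 ≤ N' * C := by positivity
  constructor
  · refine max_le ?_ ?_
    · have := norm_sum_smul_le x a hD hx ha
      show ‖∑ i, x i • a i‖ ≤ _
      linarith
    · have h1 := norm_sum_sum_smul_le (fun i j => x i * x j) b (B := D * D) (by positivity)
        (fun i j => by rw [abs_mul]; exact mul_le_mul (hx i) (hx j) (abs_nonneg _) hD) hb
      have h2 := norm_sum_smul_le y e hD hy he
      refine (norm_add₃_le).trans ?_
      linarith
  · refine max_le ?_ ?_
    · have h0 : (twoScale a b e x y g - twoScale a b e x' y' g').1 =
          ∑ i, (x i - x' i) • a i := by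
        simp [twoScale, sub_smul, Finset.sum_sub_distrib]
      have := norm_sum_smul_le (fun i => x i - x' i) a hd hxx ha
      rw [h0]
      have h3 : N * (d * C) = N * C * d := by ring
      nlinarith [mul_nonneg p1 hd, mul_nonneg p2 hd, mul_nonneg p3 hd, mul_nonneg p5 hd,
        mul_nonneg p6 hd, mul_nonneg hD hd]
    · have h0 : (twoScale a b e x y g - twoScale a b e x' y' g').2 =
          ∑ i, ∑ j, (x i * x j - x' i * x' j) • b i j + ∑ j, (y j - y' j) • e j + (g - g') := by
        simp only [twoScale, Prod.snd_sub, sub_smul, Finset.sum_sub_distrib]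
        abel
      have h1 := norm_sum_sum_smul_le (fun i j => x i * x j - x' i * x' j) b (B := 2 * D * d)
        (by positivity) (fun i j => by
          have : x i * x j - x' i * x' j = x i * (x j - x' j) + (x i - x' i) * x' j := by ring
          rw [this]
          refine (abs_add_le _ _).trans ?_
          rw [abs_mul, abs_mul]
          have := mul_le_mul (hx i) (hxx j) (abs_nonneg _) hD
          have := mul_le_mul (hxx i) (hx' j) (abs_nonneg _) hd
          linarith) hb
      have h2 := norm_sum_smul_le (fun j => y j - y' j) e hd hyy he
      rw [h0]
      refine (norm_add₃_le).trans ?_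
      have h3 : N * (N * (2 * D * d * C)) = N * (N * (2 * D * C)) * d := by ring
      have h4 : N' * (d * C) = N' * C * d := by ring
      nlinarith [mul_nonneg p1 hd, mul_nonneg p2 hd, mul_nonneg p3 hd, mul_nonneg p4 hd,
        mul_nonneg hD hd]

end Quadratic

section Realization

variable {X U Y₁ Y₂ : Type*} [NormedAddCommGroup X] [NormedSpace ℝ X] [ProperSpace X]
  [NormedAddCommGroup U] [NormedSpace ℝ U] [ProperSpace U]
  [NormedAddCommGroup Y₁] [NormedSpace ℝ Y₁] [NormedAddCommGroup Y₂] [NormedSpace ℝ Y₂]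
  [CompleteSpace Y₂]
  {ι κ : Type*} [Fintype ι] [Fintype κ]

namespace ControlSystem

variable (Q : ControlSystem X U (Y₁ × Y₂))

/-- The perturbation of the reference process generated by variations `z` of order `t`, variations
`ζ` of order `t²` and a correction `ρ` of the state of order `t²`. -/
def perturb (z : ι → Variation X U) (ζ : κ → Variation X U) (x : ι → ℝ) (y : κ → ℝ)
    (ρ : ℝ →ᵇ X) (s : ℝ) : (X × U) × (X × U) :=
  twoScale (fun i => Q.traj (z i) s) (fun i j => ((1 / 2 : ℝ) • Q.resp₂ (z i) (z j) s, (0 : U)))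
    (fun j => Q.traj (ζ j) s) x y (ρ s, 0)

theorem perturb_fst (z : ι → Variation X U) (ζ : κ → Variation X U) (x : ι → ℝ) (y : κ → ℝ)
    (ρ : ℝ →ᵇ X) (s : ℝ) : (Q.perturb z ζ x y ρ s).1 = Q.traj (∑ i, x i • z i) s := by
  have := map_sum (Q.trajLin s) (fun i => x i • z i) Finset.univ
  simp only [map_smul] at this
  exact this.symm

theorem perturb_snd (z : ι → Variation X U) (ζ : κ → Variation X U) (x : ι → ℝ) (y : κ → ℝ)
    (ρ : ℝ →ᵇ X) (s : ℝ) : (Q.perturb z ζ x y ρ s).2 =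
      ((1 / 2 : ℝ) • Q.resp₂ (∑ i, x i • z i) (∑ i, x i • z i) s, 0) +
        Q.traj (∑ j, y j • ζ j) s + (ρ s, 0) := by
  have h1 := map_sum (Q.trajLin s) (fun i => y i • ζ i) Finset.univ
  simp only [map_smul] at h1
  have h2 : Q.respBilin (∑ i, x i • z i) (∑ i, x i • z i) =
      ∑ i, ∑ j, (x i * x j) • Q.resp₂ (z i) (z j) := by
    simp only [map_sum, LinearMap.sum_apply, map_smul, LinearMap.smul_apply, Finset.smul_sum,
      smul_smul]
    rw [Finset.sum_comm]
    simp only [mul_comm]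
    rfl
  have h3 : Q.resp₂ (∑ i, x i • z i) (∑ i, x i • z i) s =
      ∑ i, ∑ j, (x i * x j) • Q.resp₂ (z i) (z j) s := by
    have := DFunLike.congr_fun h2 s
    simp only [BoundedContinuousFunction.sum_apply, BoundedContinuousFunction.smul_apply] at this
    exact this
  change _ + _ + _ = _
  refine congrArg₂ _ (congrArg₂ _ ?_ h1.symm) rfl
  rw [h3]
  ext
  · simp [Prod.fst_sum, Finset.smul_sum, smul_smul, mul_comm]
  · simp [Prod.snd_sum]

theorem bddMeas_perturb (z : ι → Variation X U) (ζ : κ → Variation X U) (x : ι → ℝ) (y : κ → ℝ)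
    (ρ : ℝ →ᵇ X) : BddMeas (fun s => (Q.perturb z ζ x y ρ s).1) ∧
      BddMeas (fun s => (Q.perturb z ζ x y ρ s).2) := by
  simp only [perturb_fst, perturb_snd]
  refine ⟨Q.bddMeas_traj _, BddMeas.add (BddMeas.add ?_ (Q.bddMeas_traj _)) ?_⟩
  · exact ((bddMeas_bcf _).smul _).prodMk bddMeas_zero
  · exact (bddMeas_bcf _).prodMk bddMeas_zero

/-- End points of a pair of processes. -/
def endsPair (f : ℝ → (X × U) × (X × U)) : (X × X) × (X × X) :=
  (((f 0).1.1, (f Q.T).1.1), ((f 0).2.1, (f Q.T).2.1))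

theorem norm_endsPair_le {f : ℝ → (X × U) × (X × U)} {C : ℝ} (hf : ∀ s, ‖f s‖ ≤ C) :
    ‖Q.endsPair f‖ ≤ C := by
  have h (s : ℝ) : ‖(f s).1.1‖ ≤ C ∧ ‖(f s).2.1‖ ≤ C :=
    ⟨(norm_fst_le _).trans ((norm_fst_le _).trans (hf s)),
      (norm_fst_le _).trans ((norm_snd_le _).trans (hf s))⟩
  exact max_le (max_le (h 0).1 (h Q.T).1) (max_le (h 0).2 (h Q.T).2)

theorem bddMeas_taylorRem {f : ℝ → (X × U) × (X × U)} (t : ℝ) (h1 : BddMeas fun s => (f s).1)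
    (h2 : BddMeas fun s => (f s).2) : BddMeas (fun s => taylorRem Q.F t (Q.w s) (f s)) := by
  have hF (g : ℝ → X × U) (hg : BddMeas g) : BddMeas (fun s => Q.F (g s)) :=
    hg.comp_continuous Q.contDiff_F.continuous
  have hw := bddMeas_bcf Q.w
  have e1 := hF _ ((hw.add (h1.smul t)).add (h2.smul (t ^ 2)))
  have e2 := (Q.bddMeas_dF h1).smul t
  have e3 := ((Q.bddMeas_d2F h1 h1).smul (1 / 2 : ℝ))
  exact ((((e1.sub (hF _ hw)).sub e2).smul (t ^ 2)⁻¹).sub (Q.bddMeas_dF h2)).sub e3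

/-- A perturbation whose scaled defect vanishes is a trajectory. -/
theorem trajectory_of_defect_eq_zero {t : ℝ} (ht : 0 < t) (z : ι → Variation X U)
    (ζ : κ → Variation X U) (x : ι → ℝ) (y : κ → ℝ) (ρ : ℝ →ᵇ X)
    (hρ : ρ - volterra Q.T_nonneg Q.A ρ -
      primitive Q.T (fun s => taylorRem Q.F t (Q.w s) (Q.perturb z ζ x y ρ s)) = 0) :
    ∃ p : ℝ → X × U, BddMeas p ∧ Continuous (fun s => (p s).1) ∧
      (∀ s, p s = Q.w s + t • (Q.perturb z ζ x y ρ s).1 + t ^ 2 • (Q.perturb z ζ x y ρ s).2) ∧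
      ∀ s, (p s).1 = (p 0).1 + ∫ σ in (0 : ℝ)..clamp Q.T s, Q.F (p σ) := by
  obtain ⟨b1, b2⟩ := Q.bddMeas_perturb z ζ x y ρ
  set f := Q.perturb z ζ x y ρ with hf
  set zc := ∑ i, x i • z i with hzc
  set ζc := ∑ j, y j • ζ j with hζc
  let q : ℝ →ᵇ X := Q.xh + t • Q.resp zc +
    t ^ 2 • ((1 / 2 : ℝ) • Q.resp₂ zc zc + Q.resp ζc + ρ)
  let p : ℝ → X × U := fun s => Q.w s + t • (f s).1 + t ^ 2 • (f s).2
  have hpq : ∀ s, (p s).1 = q s := by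
    intro s
    simp only [p, q, hf, perturb_fst, perturb_snd]
    rfl
  have hp : BddMeas p := ((bddMeas_bcf Q.w).add (b1.smul t)).add (b2.smul (t ^ 2))
  refine ⟨p, hp, ?_, fun s => rfl, ?_⟩
  · simp only [hpq]
    exact q.continuous
  have i0 : IntegrableOn (fun s => Q.F (Q.w s)) (Icc 0 Q.T) :=
    ((bddMeas_bcf Q.w).comp_continuous Q.contDiff_F.continuous).integrableOn _
  have i1 := (Q.bddMeas_dF (Q.bddMeas_traj zc)).integrableOn Q.T
  have i2 := (Q.bddMeas_dF (Q.bddMeas_traj ζc)).integrableOn Q.T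
  have i3 := Q.integrableOn_d2F zc zc
  have i4 (r : ℝ →ᵇ X) : IntegrableOn (fun s => Q.A s (r s)) (Icc 0 Q.T) :=
    (BddMeas.clm (bddMeas_bcf Q.A) (bddMeas_bcf r)).integrableOn _
  have i5 := (Q.bddMeas_taylorRem t b1 b2).integrableOn Q.T
  -- the dynamics along the perturbation, ordered by powers of `t`
  have hFp : (fun s => Q.F (p s)) = fun s => Q.F (Q.w s) + (t • Q.dF s (Q.traj zc s) + t ^ 2 •
      ((1 / 2 : ℝ) • (Q.d2F s (Q.traj zc s) (Q.traj zc s) + Q.A s (Q.resp₂ zc zc s)) +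
        (Q.dF s (Q.traj ζc s) + (Q.A s (ρ s) + taylorRem Q.F t (Q.w s) (f s))))) := by
    ext s
    have h1 := eq_taylorRem Q.F ht.ne' (Q.w s) (f s)
    have h2 : fderiv ℝ Q.F (Q.w s) (f s).2 = (1 / 2 : ℝ) • Q.A s (Q.resp₂ zc zc s) +
        Q.dF s (Q.traj ζc s) + Q.A s (ρ s) := by
      rw [hf, perturb_snd]
      change Q.dF s _ = _
      rw [map_add, map_add, A_apply, A_apply, ← ContinuousLinearMap.map_smul (Q.dF s)]
      simp only [Prod.smul_mk, smul_zero, hzc, hζc]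
    have h3 : fderiv ℝ (fderiv ℝ Q.F) (Q.w s) (f s).1 (f s).1 =
        Q.d2F s (Q.traj zc s) (Q.traj zc s) := by
      rw [hf, perturb_fst]; rfl
    have h4 : fderiv ℝ Q.F (Q.w s) (f s).1 = Q.dF s (Q.traj zc s) := by
      rw [hf, perturb_fst]; rfl
    change Q.F (Q.w s + t • (f s).1 + t ^ 2 • (f s).2) = _
    rw [h1, h2, h3, h4, add_assoc, smul_add (1 / 2 : ℝ)]
    congr 2
    abel_nf
  -- Integration of the expansion: the terms of order `t` and `t ^ 2` are the integral equations of
  -- the first order and second order responses and the equation `hρ` for `ρ`.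
  have hprim : q = BoundedContinuousFunction.const ℝ (q 0) +
      primitive Q.T (fun s => Q.F (p s)) := by
    have j1 : IntegrableOn (fun s => Q.A s (ρ s) + taylorRem Q.F t (Q.w s) (f s)) (Icc 0 Q.T) :=
      (i4 ρ).add i5
    have j2 : IntegrableOn (fun s => Q.dF s (Q.traj ζc s) +
      (Q.A s (ρ s) + taylorRem Q.F t (Q.w s) (f s))) (Icc 0 Q.T) := i2.add j1
    have j3 : IntegrableOn (fun s => Q.d2F s (Q.traj zc s) (Q.traj zc s) +
      Q.A s (Q.resp₂ zc zc s)) (Icc 0 Q.T) := i3.add (i4 _)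
    have j4 : IntegrableOn (fun s => (1 / 2 : ℝ) • (Q.d2F s (Q.traj zc s) (Q.traj zc s) +
      Q.A s (Q.resp₂ zc zc s))) (Icc 0 Q.T) := j3.smul _
    have j5 : IntegrableOn (fun s => (1 / 2 : ℝ) • (Q.d2F s (Q.traj zc s) (Q.traj zc s) +
      Q.A s (Q.resp₂ zc zc s)) + (Q.dF s (Q.traj ζc s) +
      (Q.A s (ρ s) + taylorRem Q.F t (Q.w s) (f s)))) (Icc 0 Q.T) := j4.add j2
    have j6 : IntegrableOn (fun s => t • Q.dF s (Q.traj zc s)) (Icc 0 Q.T) := i1.smul _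
    have j7 : IntegrableOn (fun s => t ^ 2 • ((1 / 2 : ℝ) • (Q.d2F s (Q.traj zc s) (Q.traj zc s) +
      Q.A s (Q.resp₂ zc zc s)) + (Q.dF s (Q.traj ζc s) +
      (Q.A s (ρ s) + taylorRem Q.F t (Q.w s) (f s))))) (Icc 0 Q.T) := j5.smul _
    have j8 : IntegrableOn (fun s => t • Q.dF s (Q.traj zc s) + t ^ 2 • ((1 / 2 : ℝ) •
      (Q.d2F s (Q.traj zc s) (Q.traj zc s) +
      Q.A s (Q.resp₂ zc zc s)) + (Q.dF s (Q.traj ζc s) +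
      (Q.A s (ρ s) + taylorRem Q.F t (Q.w s) (f s))))) (Icc 0 Q.T) := j6.add j7
    have hT := Q.T_nonneg
    rw [hFp, primitive_add hT i0 j8, primitive_add hT j6 j7, primitive_smul hT _ i1,
      primitive_smul hT _ j5, primitive_add hT j4 j2, primitive_smul hT _ j3,
      primitive_add hT i3 (i4 _), primitive_add hT i2 j1, primitive_add hT (i4 ρ) i5,
      ← resp₂_eq]
    have k1 := Q.xh_eq
    have k2 := Q.resp_eq zc
    have k3 := Q.resp_eq ζc
    have k4 : primitive Q.T (fun s => Q.A s (ρ s)) +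
        primitive Q.T (fun s => taylorRem Q.F t (Q.w s) (f s)) = ρ := by
      rw [sub_sub, sub_eq_zero] at hρ
      exact hρ.symm
    rw [k4]
    have k1' : primitive Q.T (fun s => Q.F (Q.w s)) =
        Q.xh - BoundedContinuousFunction.const ℝ (Q.w 0).1 := eq_sub_of_add_eq' k1.symm
    have k2' : primitive Q.T (fun s => Q.dF s (Q.traj zc s)) =
        Q.resp zc - BoundedContinuousFunction.const ℝ zc.1.1 := eq_sub_of_add_eq' k2.symm
    have k3' : primitive Q.T (fun s => Q.dF s (Q.traj ζc s)) =
        Q.resp ζc - BoundedContinuousFunction.const ℝ ζc.1.1 := eq_sub_of_add_eq' k3.symm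
    have hρ0 : ρ 0 = 0 := by
      rw [← k4]
      simp [primitive_zero_time]
    have hq0 : q 0 = (Q.w 0).1 + t • zc.1.1 + t ^ 2 • ζc.1.1 := by
      simp only [q, BoundedContinuousFunction.add_apply, BoundedContinuousFunction.smul_apply,
        resp_zero_time, resp₂_zero_time, hρ0, smul_zero, zero_add, add_zero]
      rfl
    rw [k1', k2', k3', hq0]
    ext s
    simp only [q, BoundedContinuousFunction.add_apply, BoundedContinuousFunction.smul_apply,
      BoundedContinuousFunction.sub_apply, BoundedContinuousFunction.const_apply, smul_add,
      smul_sub]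
    abel
  intro s
  have hint : IntegrableOn (fun s => Q.F (p s)) (Icc 0 Q.T) :=
    (hp.comp_continuous Q.contDiff_F.continuous).integrableOn _
  rw [hpq, hpq, ← primitive_apply Q.T_nonneg hint]
  exact DFunLike.congr_fun hprim s

/-- Expansion of the endpoint map along a perturbation with mutually orthogonal variations. -/
theorem endpoint_expansion {t : ℝ} (ht : 0 < t) (z : ι → Variation X U) (ζ : κ → Variation X U)
    (horth : ∀ i j, i ≠ j → Q.second (z i) (z j) = 0) (x : ι → ℝ) (y : κ → ℝ) (ρ : ℝ →ᵇ X) :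
    Q.G (Q.ends Q.xh + t • (Q.endsPair (Q.perturb z ζ x y ρ)).1 +
        t ^ 2 • (Q.endsPair (Q.perturb z ζ x y ρ)).2) =
      Q.G (Q.ends Q.xh) + t • Q.first (∑ i, x i • z i) +
      t ^ 2 • (Q.dG (Q.ends ρ) + (1 / 2 : ℝ) • ∑ i, (x i) ^ 2 • Q.second (z i) (z i) +
        ∑ j, y j • Q.first (ζ j) +
        taylorRem Q.G t (Q.ends Q.xh) (Q.endsPair (Q.perturb z ζ x y ρ))) := by
  rw [eq_taylorRem Q.G ht.ne']
  set zc := ∑ i, x i • z i with hzc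
  set ζc := ∑ j, y j • ζ j with hζc
  have h1 : (Q.endsPair (Q.perturb z ζ x y ρ)).1 = Q.ends (Q.resp zc) := by
    simp only [endsPair, perturb_fst]
    rfl
  have h2 : (Q.endsPair (Q.perturb z ζ x y ρ)).2 = (1 / 2 : ℝ) • Q.ends (Q.resp₂ zc zc) +
      Q.ends (Q.resp ζc) + Q.ends ρ := by
    simp only [endsPair, perturb_snd]
    rfl
  have h3 : Q.second zc zc = ∑ i, (x i) ^ 2 • Q.second (z i) (z i) := by
    simp only [hzc, map_sum, LinearMap.sum_apply, map_smul, LinearMap.smul_apply]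
    refine Finset.sum_congr rfl fun i _ => ?_
    rw [Finset.sum_eq_single i]
    · rw [smul_smul, pow_two]
    · intro j _ hj
      rw [horth _ _ hj, smul_zero]
    · simp
  have h4 : Q.first ζc = ∑ j, y j • Q.first (ζ j) := by
    simp only [hζc, map_sum, map_smul]
  rw [← h3, ← h4, second_apply, first_apply, first_apply]
  change _ + t • Q.dG _ + t ^ 2 • (Q.dG _ + (1 / 2 : ℝ) • Q.d2G _ _ + _) = _
  rw [h1]
  congr 3
  rw [h2, map_add, map_add, map_smul, smul_add]
  abel

set_option maxHeartbeats 1600000 in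
/-- If second order variations, together with first order ones, produce a direction in the kernel of
the second component of the endpoint map, in a nondegenerate way, then this direction is realized
by trajectories that preserve the value of that component. -/
theorem exists_trajectory (z : ι → Variation X U) (ζ : κ → Variation X U)
    (horth : ∀ i j, i ≠ j → Q.second (z i) (z j) = 0) (hz : ∀ i, (Q.first (z i)).2 = 0)
    (c : ι → ℝ) (r : κ → ℝ)
    (hval : ((1 / 2 : ℝ) • ∑ i, (c i) ^ 2 • Q.second (z i) (z i) + ∑ j, r j • Q.first (ζ j)).2 = 0)
    (hsurj : ∀ e : Y₂, ∃ τ : ι → ℝ, ∃ σ : κ → ℝ,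
      ∑ i, τ i • (c i • (Q.second (z i) (z i)).2) + ∑ j, σ j • (Q.first (ζ j)).2 = e)
    {ε : ℝ} (hε : 0 < ε) :
    ∃ t : ℝ, 0 < t ∧ ∃ c' : ι → ℝ, (∀ i, |c' i - c i| ≤ ε) ∧ ∃ p : ℝ → X × U, BddMeas p ∧
      Continuous (fun s => (p s).1) ∧ (∀ s, ‖p s - Q.w s‖ ≤ ε) ∧
      (∀ s, (p s).1 = (p 0).1 + ∫ σ in (0 : ℝ)..clamp Q.T s, Q.F (p σ)) ∧
      (Q.G ((p 0).1, (p Q.T).1)).2 = (Q.G (Q.ends Q.xh)).2 ∧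
      ‖(Q.G ((p 0).1, (p Q.T).1)).1 - (Q.G (Q.ends Q.xh)).1 - t • ∑ i, c' i • (Q.first (z i)).1 -
        t ^ 2 • ((1 / 2 : ℝ) • ∑ i, (c i) ^ 2 • Q.second (z i) (z i) +
          ∑ j, r j • Q.first (ζ j)).1‖ ≤ t ^ 2 * ε := by
  classical
  set q : ι → Y₁ × Y₂ := fun i => Q.second (z i) (z i) with hq
  set b : κ → Y₁ × Y₂ := fun j => Q.first (ζ j) with hb
  -- the linear approximation of the defect
  let Λ : ((ℝ →ᵇ X) × (ι → ℝ) × (κ → ℝ)) →L[ℝ] (ℝ →ᵇ X) × Y₂ :=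
    ((1 - volterra Q.T_nonneg Q.A).comp (ContinuousLinearMap.fst ℝ _ _)).prod
      ((ContinuousLinearMap.snd ℝ Y₁ Y₂).comp
        ((Q.dG.comp (Q.ends.comp (ContinuousLinearMap.fst ℝ _ _))) +
          ((∑ i, (ContinuousLinearMap.proj (R := ℝ) (φ := fun _ : ι => ℝ) i).smulRight
            (c i • q i)).comp ((ContinuousLinearMap.fst ℝ _ _).comp
              (ContinuousLinearMap.snd ℝ _ _))) +
          ((∑ j, (ContinuousLinearMap.proj (R := ℝ) (φ := fun _ : κ => ℝ) j).smulRight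
            (b j)).comp ((ContinuousLinearMap.snd ℝ _ _).comp
              (ContinuousLinearMap.snd ℝ _ _)))))
  have hΛ : ∀ p, Λ p = (p.1 - volterra Q.T_nonneg Q.A p.1,
      (Q.dG (Q.ends p.1) + ∑ i, p.2.1 i • (c i • q i) + ∑ j, p.2.2 j • b j).2) := by
    intro p
    simp [Λ, Prod.snd_sum]
  have hΛsurj : Λ.range = ⊤ := by
    rw [LinearMap.range_eq_top]
    rintro ⟨g, e⟩
    obtain ⟨τ, σ, hτ⟩ := hsurj (e - (Q.dG (Q.ends (solve Q.T_nonneg Q.A g))).2)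
    refine ⟨(solve Q.T_nonneg Q.A g, τ, σ), ?_⟩
    change Λ _ = _
    rw [hΛ]
    refine Prod.ext ?_ ?_
    · exact sub_eq_of_eq_add (solve_eq Q.T_nonneg Q.A g)
    · simp only [Prod.snd_add, Prod.snd_sum, Prod.smul_snd, add_assoc]
      rw [hτ]
      abel
  set S := Λ.nonlinearRightInverseOfSurjective hΛsurj with hS
  have hSpos : 0 < (S.nnnorm : ℝ) := Λ.nonlinearRightInverseOfSurjective_nnnorm_pos hΛsurj
  -- uniform bounds
  have hT := Q.T_nonneg
  obtain ⟨C, hC0, hC1, hC2, hC3⟩ : ∃ C : ℝ, 0 ≤ C ∧ (∀ i s, ‖Q.traj (z i) s‖ ≤ C) ∧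
      (∀ i j s, ‖((1 / 2 : ℝ) • Q.resp₂ (z i) (z j) s, (0 : U))‖ ≤ C) ∧
      (∀ j s, ‖Q.traj (ζ j) s‖ ≤ C) := by
    choose C₁ h1 using fun i => (Q.bddMeas_traj (z i)).2
    choose C₃ h3 using fun j => (Q.bddMeas_traj (ζ j)).2
    have h10 : ∀ i, 0 ≤ C₁ i := fun i => (norm_nonneg _).trans (h1 i 0)
    have h30 : ∀ i, 0 ≤ C₃ i := fun i => (norm_nonneg _).trans (h3 i 0)
    refine ⟨∑ i, C₁ i + ∑ i, ∑ j, ‖Q.resp₂ (z i) (z j)‖ + ∑ j, C₃ j, ?_, ?_, ?_, ?_⟩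
    · have := Finset.sum_nonneg fun i (_ : i ∈ Finset.univ) => h10 i
      have := Finset.sum_nonneg fun i (_ : i ∈ Finset.univ) => h30 i
      positivity
    all_goals
      have k1 := Finset.sum_nonneg fun i (_ : i ∈ Finset.univ) => h10 i
      have k3 := Finset.sum_nonneg fun i (_ : i ∈ Finset.univ) => h30 i
      have k2 : 0 ≤ ∑ i, ∑ j, ‖Q.resp₂ (z i) (z j)‖ := by positivity
    · intro i s
      have := Finset.single_le_sum (fun i _ => h10 i) (Finset.mem_univ i)
      linarith [h1 i s]
    · intro i j s
      have e1 := Finset.single_le_sum (f := fun i => ∑ j, ‖Q.resp₂ (z i) (z j)‖)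
        (fun i _ => by positivity) (Finset.mem_univ i)
      have e2 := Finset.single_le_sum (f := fun j => ‖Q.resp₂ (z i) (z j)‖)
        (fun i _ => by positivity) (Finset.mem_univ j)
      have e3 := (Q.resp₂ (z i) (z j)).norm_coe_le_norm s
      have e4 : ‖((1 / 2 : ℝ) • Q.resp₂ (z i) (z j) s, (0 : U))‖ ≤ ‖Q.resp₂ (z i) (z j) s‖ := by
        refine max_le ?_ (by simp)
        rw [norm_smul]
        norm_num
        linarith [norm_nonneg (Q.resp₂ (z i) (z j) s)]
      linarith
    · intro j s
      have := Finset.single_le_sum (fun i _ => h30 i) (Finset.mem_univ j)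
      linarith [h3 j s]
  set D : ℝ := ‖c‖ + ‖r‖ + 1 with hD
  obtain ⟨K, hK0, hK⟩ := exists_twoScale_bound (E := X × U) (ι := ι) (κ := κ) C D hC0
    (by positivity)
  -- the perturbation as a function of the unknown
  let f : ((ℝ →ᵇ X) × (ι → ℝ) × (κ → ℝ)) → ℝ → (X × U) × (X × U) := fun p =>
    Q.perturb z ζ (c + p.2.1) (r + p.2.2) p.1
  have hf : ∀ p p' : (ℝ →ᵇ X) × (ι → ℝ) × (κ → ℝ), ‖p‖ ≤ 1 → ‖p'‖ ≤ 1 → ∀ s,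
      ‖f p s‖ ≤ K ∧ ‖f p s - f p' s‖ ≤ K * ‖p - p'‖ := by
    intro p p' hp hp' s
    have hx (p : (ℝ →ᵇ X) × (ι → ℝ) × (κ → ℝ)) (hp : ‖p‖ ≤ 1) (i : ι) :
        |(c + p.2.1) i| ≤ D := by
      have h1 := norm_le_pi_norm c i
      have h2 := norm_le_pi_norm p.2.1 i
      have h3 : ‖p.2.1‖ ≤ ‖p‖ := (norm_fst_le _).trans (norm_snd_le _)
      have h4 := norm_add_le (c i) (p.2.1 i)
      have := norm_nonneg r
      change ‖c i + p.2.1 i‖ ≤ D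
      linarith
    have hy (j : κ) : |(r + p.2.2) j| ≤ D := by
      have h1 := norm_le_pi_norm r j
      have h2 := norm_le_pi_norm p.2.2 j
      have h3 : ‖p.2.2‖ ≤ ‖p‖ := (norm_snd_le _).trans (norm_snd_le _)
      have h4 := norm_add_le (r j) (p.2.2 j)
      have := norm_nonneg c
      change ‖r j + p.2.2 j‖ ≤ D
      linarith
    refine hK _ _ _ (fun i => hC1 i s) (fun i j => hC2 i j s) (fun j => hC3 j s) _ _ _ _ _ _ _
      (hx p hp) (hx p' hp') hy ?_ ?_ ?_ ?_ (norm_nonneg (p - p'))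
    · refine max_le ((p.1.norm_coe_le_norm s).trans ((norm_fst_le p).trans (hp.trans ?_)))
        (by simpa using by positivity)
      have := norm_nonneg c
      have := norm_nonneg r
      linarith
    · intro i
      have h2 := norm_le_pi_norm (p - p').2.1 i
      have h3 : ‖(p - p').2.1‖ ≤ ‖p - p'‖ := (norm_fst_le _).trans (norm_snd_le _)
      have h4 : (c + p.2.1) i - (c + p'.2.1) i = (p - p').2.1 i := by
        simp
      rw [h4]
      exact h2.trans h3
    · intro i
      have h2 := norm_le_pi_norm (p - p').2.2 i
      have h3 : ‖(p - p').2.2‖ ≤ ‖p - p'‖ := (norm_snd_le _).trans (norm_snd_le _)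
      have h4 : (r + p.2.2) i - (r + p'.2.2) i = (p - p').2.2 i := by
        simp
      rw [h4]
      exact h2.trans h3
    · have h2 := (p - p').1.norm_coe_le_norm s
      have h3 : ‖(p - p').1‖ ≤ ‖p - p'‖ := norm_fst_le _
      have h4 : ((p.1 s, (0 : U)) - (p'.1 s, (0 : U))) = ((p - p').1 s, (0 : U)) := by
        simp
      rw [h4]
      exact max_le (h2.trans h3) (by simp)
  -- the quadratic term and its bounds
  set N : ℝ := ∑ i, ‖q i‖ with hN
  set N' : ℝ := ∑ j, ‖b j‖ with hN'
  have hN0 : 0 ≤ N := by positivity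
  have hN0' : 0 ≤ N' := by positivity
  set κ₀ : ℝ := (S.nnnorm : ℝ)⁻¹ with hκ₀
  have hκ₀pos : 0 < κ₀ := by positivity
  -- radius of the ball of unknowns
  set L : ℝ := ‖Q.dG‖ + D * N + N' + N + 1 with hL
  have hDpos : 0 < D := by positivity
  have hLpos : 0 < L := by positivity
  obtain ⟨δ, hδ, hδ1, hδN, hδε, hδL⟩ : ∃ δ : ℝ, 0 < δ ∧ δ ≤ 1 ∧ δ * N ≤ κ₀ / 4 ∧ δ ≤ ε ∧
      δ * L ≤ ε / 2 := by
    refine ⟨min (min 1 ε) (min (κ₀ / (4 * (N + 1))) (ε / (2 * L))), by positivity, ?_, ?_, ?_, ?_⟩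
    · exact (min_le_left _ _).trans (min_le_left _ _)
    · calc min (min 1 ε) (min (κ₀ / (4 * (N + 1))) (ε / (2 * L))) * N
          ≤ (κ₀ / (4 * (N + 1))) * (N + 1) := by
            gcongr
            · exact (min_le_right _ _).trans (min_le_left _ _)
            · linarith
        _ = κ₀ / 4 := by field_simp
    · exact (min_le_left _ _).trans (min_le_right _ _)
    · calc min (min 1 ε) (min (κ₀ / (4 * (N + 1))) (ε / (2 * L))) * L
          ≤ (ε / (2 * L)) * L := by
            gcongr
            exact (min_le_right _ _).trans (min_le_right _ _)
        _ = ε / 2 := by field_simp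
  -- precision of the Taylor expansion
  set M : ℝ := K + ‖Q.w‖ + ‖Q.ends Q.xh‖ with hM
  have hM0 : 0 ≤ M := by positivity
  obtain ⟨η, hη, hη1, hη2, hη3⟩ : ∃ η : ℝ, 0 < η ∧ (Q.T + 1) * η * K ≤ κ₀ / 4 ∧
      (Q.T + 1) * η * K ≤ κ₀ / 4 * δ ∧ η * K ≤ ε / 2 := by
    have hTK : 0 < (Q.T + 1) * (K + 1) := by positivity
    refine ⟨min (ε / (2 * (K + 1))) (κ₀ / 4 * δ / ((Q.T + 1) * (K + 1))), by positivity, ?_, ?_, ?_⟩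
    · calc (Q.T + 1) * min (ε / (2 * (K + 1))) (κ₀ / 4 * δ / ((Q.T + 1) * (K + 1))) * K
          ≤ (Q.T + 1) * (κ₀ / 4 * δ / ((Q.T + 1) * (K + 1))) * (K + 1) := by
            gcongr
            · exact min_le_right _ _
            · linarith
        _ = κ₀ / 4 * δ := by field_simp
        _ ≤ κ₀ / 4 := mul_le_of_le_one_right (by positivity) hδ1
    · calc (Q.T + 1) * min (ε / (2 * (K + 1))) (κ₀ / 4 * δ / ((Q.T + 1) * (K + 1))) * K
          ≤ (Q.T + 1) * (κ₀ / 4 * δ / ((Q.T + 1) * (K + 1))) * (K + 1) := by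
            gcongr
            · exact min_le_right _ _
            · linarith
        _ = κ₀ / 4 * δ := by field_simp
    · calc min (ε / (2 * (K + 1))) (κ₀ / 4 * δ / ((Q.T + 1) * (K + 1))) * K
          ≤ (ε / (2 * (K + 1))) * (K + 1) := by
            gcongr
            · exact min_le_left _ _
            · linarith
        _ = ε / 2 := by field_simp
  obtain ⟨t₁, ht₁, hF⟩ := exists_taylorRem_lipschitz Q.contDiff_F hM0 hη
  obtain ⟨t₂, ht₂, hG⟩ := exists_taylorRem_lipschitz Q.contDiff_G hM0 hη
  obtain ⟨t, ht, htt₁, htt₂, htε, ht1⟩ : ∃ t : ℝ, 0 < t ∧ t < t₁ ∧ t < t₂ ∧ t * (2 * K) ≤ ε ∧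
      t ≤ 1 := by
    refine ⟨min (min (t₁ / 2) (t₂ / 2)) (min 1 (ε / (2 * K + 1))), by positivity, ?_, ?_, ?_, ?_⟩
    · exact ((min_le_left _ _).trans (min_le_left _ _)).trans_lt (half_lt_self ht₁)
    · exact ((min_le_left _ _).trans (min_le_right _ _)).trans_lt (half_lt_self ht₂)
    · calc min (min (t₁ / 2) (t₂ / 2)) (min 1 (ε / (2 * K + 1))) * (2 * K)
          ≤ (ε / (2 * K + 1)) * (2 * K + 1) := by
            gcongr
            · exact (min_le_right _ _).trans (min_le_right _ _)
            · linarith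
        _ = ε := by field_simp
    · exact (min_le_right _ _).trans (min_le_left _ _)
  have hwM (s : ℝ) : ‖Q.w s‖ ≤ M := by
    have := Q.w.norm_coe_le_norm s
    have := norm_nonneg (Q.ends Q.xh)
    linarith
  have hxM : ‖Q.ends Q.xh‖ ≤ M := by
    have := norm_nonneg Q.w
    linarith
  have hKM : K ≤ M := by
    have := norm_nonneg Q.w
    have := norm_nonneg (Q.ends Q.xh)
    linarith
  -- the scaled defect
  let RF : ((ℝ →ᵇ X) × (ι → ℝ) × (κ → ℝ)) → (ℝ →ᵇ X) := fun p =>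
    primitive Q.T (fun s => taylorRem Q.F t (Q.w s) (f p s))
  let RG : ((ℝ →ᵇ X) × (ι → ℝ) × (κ → ℝ)) → Y₁ × Y₂ := fun p =>
    taylorRem Q.G t (Q.ends Q.xh) (Q.endsPair (f p))
  let Φ : ((ℝ →ᵇ X) × (ι → ℝ) × (κ → ℝ)) → Y₁ × Y₂ := fun p =>
    Q.dG (Q.ends p.1) + (1 / 2 : ℝ) • ∑ i, ((c + p.2.1) i) ^ 2 • q i + ∑ j, (r + p.2.2) j • b j +
      RG p
  let Ψ : ((ℝ →ᵇ X) × (ι → ℝ) × (κ → ℝ)) → (ℝ →ᵇ X) × Y₂ := fun p =>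
    (p.1 - volterra Q.T_nonneg Q.A p.1 - RF p, (Φ p).2)
  have hRF : ∀ p p' : (ℝ →ᵇ X) × (ι → ℝ) × (κ → ℝ), ‖p‖ ≤ 1 → ‖p'‖ ≤ 1 →
      ‖RF p - RF p'‖ ≤ Q.T * (η * (K * ‖p - p'‖)) := by
    intro p p' hp hp'
    obtain ⟨a1, a2⟩ := Q.bddMeas_perturb z ζ (c + p.2.1) (r + p.2.2) p.1
    obtain ⟨a1', a2'⟩ := Q.bddMeas_perturb z ζ (c + p'.2.1) (r + p'.2.2) p'.1
    have i1 := (Q.bddMeas_taylorRem t a1 a2).integrableOn Q.T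
    have i2 := (Q.bddMeas_taylorRem t a1' a2').integrableOn Q.T
    have := primitive_sub hT i1 i2
    change ‖primitive Q.T _ - primitive Q.T _‖ ≤ _
    rw [← this]
    refine norm_primitive_le hT fun s _ => ?_
    refine (hF t ht htt₁ (Q.w s) (hwM s) (f p s) (f p' s) ((hf p p' hp hp' s).1.trans hKM)
      ((hf p' p hp' hp s).1.trans hKM)).trans ?_
    exact mul_le_mul_of_nonneg_left (hf p p' hp hp' s).2 hη.le
  have hRG : ∀ p p' : (ℝ →ᵇ X) × (ι → ℝ) × (κ → ℝ), ‖p‖ ≤ 1 → ‖p'‖ ≤ 1 →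
      ‖RG p - RG p'‖ ≤ η * (K * ‖p - p'‖) := by
    intro p p' hp hp'
    refine (hG t ht htt₂ _ hxM _ _
      ((Q.norm_endsPair_le fun s => (hf p p' hp hp' s).1).trans hKM)
      ((Q.norm_endsPair_le fun s => (hf p' p hp' hp s).1).trans hKM)).trans ?_
    refine mul_le_mul_of_nonneg_left ?_ hη.le
    have : Q.endsPair (f p) - Q.endsPair (f p') = Q.endsPair (fun s => f p s - f p' s) := rfl
    rw [this]
    exact Q.norm_endsPair_le fun s => (hf p p' hp hp' s).2
  have hRF0 : ∀ p : (ℝ →ᵇ X) × (ι → ℝ) × (κ → ℝ), ‖p‖ ≤ 1 → ‖RF p‖ ≤ Q.T * (η * K) := by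
    intro p hp
    refine norm_primitive_le hT fun s _ => ?_
    have := hF t ht htt₁ (Q.w s) (hwM s) (f p s) 0 ((hf p p hp hp s).1.trans hKM)
      (by simpa using hM0)
    rw [taylorRem_zero, sub_zero, sub_zero] at this
    exact this.trans (mul_le_mul_of_nonneg_left (hf p p hp hp s).1 hη.le)
  have hRG0 : ∀ p : (ℝ →ᵇ X) × (ι → ℝ) × (κ → ℝ), ‖p‖ ≤ 1 → ‖RG p‖ ≤ η * K := by
    intro p hp
    have h1 := Q.norm_endsPair_le fun s => (hf p p hp hp s).1
    have := hG t ht htt₂ (Q.ends Q.xh) hxM (Q.endsPair (f p)) 0 (h1.trans hKM)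
      (by simpa using hM0)
    rw [taylorRem_zero, sub_zero, sub_zero] at this
    exact this.trans (mul_le_mul_of_nonneg_left h1 hη.le)
  -- the defect is close to its linear approximation
  have happ : ApproximatesLinearOn Ψ Λ (Metric.closedBall 0 δ) (Real.toNNReal (κ₀ / 2)) := by
    intro p hp p' hp'
    have hpδ : ‖p‖ ≤ δ := by simpa using hp
    have hpδ' : ‖p'‖ ≤ δ := by simpa using hp'
    rw [Real.coe_toNNReal _ (by positivity)]
    have e1 : Ψ p - Ψ p' - Λ (p - p') = (-(RF p - RF p'),
        ((1 / 2 : ℝ) • ∑ i, ((p.2.1 i) ^ 2 - (p'.2.1 i) ^ 2) • q i + (RG p - RG p')).2) := by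
      rw [hΛ]
      refine Prod.ext ?_ ?_
      · simp only [Ψ, Prod.fst_sub, map_sub]
        abel
      · have e2 : Φ p - Φ p' - (Q.dG (Q.ends (p - p').1) +
            ∑ i, (p - p').2.1 i • (c i • q i) + ∑ j, (p - p').2.2 j • b j) =
            (1 / 2 : ℝ) • ∑ i, ((p.2.1 i) ^ 2 - (p'.2.1 i) ^ 2) • q i + (RG p - RG p') := by
          have e3 : (1 / 2 : ℝ) • ∑ i, ((c + p.2.1) i) ^ 2 • q i -
              (1 / 2 : ℝ) • ∑ i, ((c + p'.2.1) i) ^ 2 • q i - ∑ i, (p - p').2.1 i • (c i • q i) =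
              (1 / 2 : ℝ) • ∑ i, ((p.2.1 i) ^ 2 - (p'.2.1 i) ^ 2) • q i := by
            rw [Finset.smul_sum, Finset.smul_sum, Finset.smul_sum, ← Finset.sum_sub_distrib,
              ← Finset.sum_sub_distrib]
            refine Finset.sum_congr rfl fun i _ => ?_
            simp only [smul_smul, ← sub_smul, Pi.add_apply, Prod.snd_sub, Prod.fst_sub,
              Pi.sub_apply]
            congr 1
            ring
          have e4 : ∑ j, (r + p.2.2) j • b j - ∑ j, (r + p'.2.2) j • b j =
              ∑ j, (p - p').2.2 j • b j := by
            rw [← Finset.sum_sub_distrib]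
            refine Finset.sum_congr rfl fun i _ => ?_
            rw [← sub_smul]
            simp
          rw [← e3, ← e4]
          simp only [Φ, Prod.fst_sub, map_sub]
          abel
        have := congrArg Prod.snd e2
        exact this
    rw [e1]
    have hp1 : ‖p‖ ≤ 1 := hpδ.trans hδ1
    have hp1' : ‖p'‖ ≤ 1 := hpδ'.trans hδ1
    have g1 := hRF p p' hp1 hp1'
    have g2 := hRG p p' hp1 hp1'
    have hd := norm_nonneg (p - p')
    have g3 : ‖(1 / 2 : ℝ) • ∑ i, ((p.2.1 i) ^ 2 - (p'.2.1 i) ^ 2) • q i‖ ≤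
        δ * N * ‖p - p'‖ := by
      have g4 : ‖∑ i, ((p.2.1 i) ^ 2 - (p'.2.1 i) ^ 2) • q i‖ ≤
          ∑ i, 2 * δ * ‖p - p'‖ * ‖q i‖ := by
        refine norm_sum_le_of_le _ fun i _ => ?_
        rw [norm_smul]
        refine mul_le_mul_of_nonneg_right ?_ (norm_nonneg _)
        have k1 : ‖p.2.1 i‖ ≤ δ :=
          (norm_le_pi_norm _ i).trans (((norm_fst_le _).trans (norm_snd_le _)).trans hpδ)
        have k2 : ‖p'.2.1 i‖ ≤ δ :=
          (norm_le_pi_norm _ i).trans (((norm_fst_le _).trans (norm_snd_le _)).trans hpδ')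
        have k3 : ‖p.2.1 i - p'.2.1 i‖ ≤ ‖p - p'‖ :=
          (norm_le_pi_norm (p - p').2.1 i).trans ((norm_fst_le _).trans (norm_snd_le _))
        have k4 : (p.2.1 i) ^ 2 - (p'.2.1 i) ^ 2 = (p.2.1 i + p'.2.1 i) * (p.2.1 i - p'.2.1 i) := by
          ring
        rw [k4, norm_mul]
        refine mul_le_mul ?_ k3 (norm_nonneg _) (by positivity)
        exact (norm_add_le _ _).trans (by linarith)
      rw [← Finset.mul_sum] at g4
      rw [norm_smul]
      norm_num
      nlinarith
    have hKd : 0 ≤ η * (K * ‖p - p'‖) := by positivity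
    refine max_le ?_ ?_
    · rw [norm_neg]
      refine g1.trans ?_
      nlinarith [mul_le_mul_of_nonneg_right hη1 hd]
    · change ‖((1 / 2 : ℝ) • ∑ i, ((p.2.1 i) ^ 2 - (p'.2.1 i) ^ 2) • q i + (RG p - RG p')).2‖ ≤ _
      refine (norm_snd_le _).trans ((norm_add_le _ _).trans ?_)
      nlinarith [mul_le_mul_of_nonneg_right hη1 hd, mul_le_mul_of_nonneg_right hδN hd,
        mul_nonneg hT hKd]
  -- Quantitative surjectivity: the image of the ball of radius `δ` contains a ball around `Ψ 0`,
  -- whose radius exceeds `‖Ψ 0‖` by the choice of `η`. So the defect has a zero `p` in the ball.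
  have hsub := happ.surjOn_closedBall_of_nonlinearRightInverse S hδ.le
    (b := 0) (Subset.refl _)
  have hzero : (0 : (ℝ →ᵇ X) × Y₂) ∈ Metric.closedBall (Ψ 0)
      (((S.nnnorm : ℝ)⁻¹ - (Real.toNNReal (κ₀ / 2) : ℝ)) * δ) := by
    rw [Real.coe_toNNReal _ (by positivity)]
    have h0 : ‖(0 : (ℝ →ᵇ X) × (ι → ℝ) × (κ → ℝ))‖ ≤ 1 := by simp
    have e1 : Ψ 0 = (-RF 0, (RG 0).2) := by
      refine Prod.ext ?_ ?_
      · simp [Ψ]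
      · have : Φ 0 = ((1 / 2 : ℝ) • ∑ i, (c i) ^ 2 • q i + ∑ j, r j • b j) + RG 0 := by
          simp only [Φ, Prod.fst_zero, map_zero, zero_add, Prod.snd_zero, add_zero]
        change (Φ 0).2 = _
        rw [this, Prod.snd_add, hval, zero_add]
    rw [Metric.mem_closedBall, dist_zero_left, e1]
    have hKη : 0 ≤ η * K := by positivity
    refine max_le ?_ ?_
    · rw [norm_neg]
      refine (hRF0 0 h0).trans ?_
      nlinarith
    · change ‖(RG 0).2‖ ≤ _
      refine (norm_snd_le _).trans ((hRG0 0 h0).trans ?_)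
      nlinarith [mul_nonneg hT hKη]
  obtain ⟨p, hp, hp0⟩ := hsub hzero
  have hpδ : ‖p‖ ≤ δ := by simpa using hp
  have hp1 : ‖p‖ ≤ 1 := hpδ.trans hδ1
  have hΨ1 : p.1 - volterra Q.T_nonneg Q.A p.1 - RF p = 0 := congrArg Prod.fst hp0
  have hΨ2 : (Φ p).2 = 0 := congrArg Prod.snd hp0
  obtain ⟨π, hπ1, hπ2, hπ3, hπ4⟩ := Q.trajectory_of_defect_eq_zero ht z ζ (c + p.2.1) (r + p.2.2)
    p.1 hΨ1
  have hends : ((π 0).1, (π Q.T).1) = Q.ends Q.xh + t • (Q.endsPair (f p)).1 +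
      t ^ 2 • (Q.endsPair (f p)).2 := by
    rw [hπ3, hπ3]
    rfl
  have hexp := Q.endpoint_expansion ht z ζ horth (c + p.2.1) (r + p.2.2) p.1
  change Q.G (Q.ends Q.xh + t • (Q.endsPair (f p)).1 + t ^ 2 • (Q.endsPair (f p)).2) =
    Q.G (Q.ends Q.xh) + t • Q.first (∑ i, (c + p.2.1) i • z i) + t ^ 2 • Φ p at hexp
  rw [← hends] at hexp
  have hτ (i : ι) : |p.2.1 i| ≤ δ :=
    (norm_le_pi_norm p.2.1 i).trans (((norm_fst_le _).trans (norm_snd_le _)).trans hpδ)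
  have hσ (j : κ) : |p.2.2 j| ≤ δ :=
    (norm_le_pi_norm p.2.2 j).trans (((norm_snd_le _).trans (norm_snd_le _)).trans hpδ)
  refine ⟨t, ht, c + p.2.1, fun i => ?_, π, hπ1, hπ2, fun s => ?_, hπ4, ?_, ?_⟩
  · simpa using (hτ i).trans hδε
  · rw [hπ3, add_assoc, add_sub_cancel_left]
    have h1 := (hf p p hp1 hp1 s).1
    have h2 : ‖(f p s).1‖ ≤ K := (norm_fst_le _).trans h1
    have h3 : ‖(f p s).2‖ ≤ K := (norm_snd_le _).trans h1
    refine (norm_add_le _ _).trans ?_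
    change ‖t • (f p s).1‖ + ‖t ^ 2 • (f p s).2‖ ≤ ε
    rw [norm_smul, norm_smul, Real.norm_of_nonneg ht.le, Real.norm_of_nonneg (by positivity)]
    have h4 : t ^ 2 * ‖(f p s).2‖ ≤ t * K := by
      calc t ^ 2 * ‖(f p s).2‖ = t * (t * ‖(f p s).2‖) := by ring
        _ ≤ t * (1 * K) := by gcongr
        _ = t * K := by ring
    nlinarith [mul_le_mul_of_nonneg_left h2 ht.le]
  · rw [hexp, Prod.snd_add, Prod.snd_add, Prod.smul_snd, Prod.smul_snd, hΨ2, smul_zero, add_zero,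
      map_sum, Prod.snd_sum]
    have : ∑ i, (Q.first ((c + p.2.1) i • z i)).2 = 0 := by
      refine Finset.sum_eq_zero fun i _ => ?_
      rw [map_smul, Prod.smul_snd, hz, smul_zero]
    rw [this, smul_zero, add_zero]
  · have e1 : (Q.G ((π 0).1, (π Q.T).1)).1 - (Q.G (Q.ends Q.xh)).1 -
        t • ∑ i, (c + p.2.1) i • (Q.first (z i)).1 -
        t ^ 2 • ((1 / 2 : ℝ) • ∑ i, (c i) ^ 2 • q i + ∑ j, r j • b j).1 =
        t ^ 2 • (Φ p - ((1 / 2 : ℝ) • ∑ i, (c i) ^ 2 • q i + ∑ j, r j • b j)).1 := by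
      have : (Q.first (∑ i, (c + p.2.1) i • z i)).1 = ∑ i, (c + p.2.1) i • (Q.first (z i)).1 := by
        simp only [map_sum, map_smul, Prod.fst_sum, Prod.smul_fst]
      rw [hexp, Prod.fst_add, Prod.fst_add, Prod.smul_fst, Prod.smul_fst, this, Prod.fst_sub,
        smul_sub]
      abel
    rw [e1, norm_smul, Real.norm_of_nonneg (by positivity)]
    refine mul_le_mul_of_nonneg_left ((norm_fst_le _).trans ?_) (by positivity)
    have e2 : Φ p - ((1 / 2 : ℝ) • ∑ i, (c i) ^ 2 • q i + ∑ j, r j • b j) =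
        Q.dG (Q.ends p.1) + (1 / 2 : ℝ) • ∑ i, (p.2.1 i * (2 * c i + p.2.1 i)) • q i +
          ∑ j, p.2.2 j • b j + RG p := by
      have e3 : (1 / 2 : ℝ) • ∑ i, ((c + p.2.1) i) ^ 2 • q i =
          (1 / 2 : ℝ) • ∑ i, (c i) ^ 2 • q i +
            (1 / 2 : ℝ) • ∑ i, (p.2.1 i * (2 * c i + p.2.1 i)) • q i := by
        rw [← smul_add, ← Finset.sum_add_distrib]
        congr 1
        refine Finset.sum_congr rfl fun i _ => ?_
        rw [← add_smul, Pi.add_apply]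
        congr 1
        ring
      have e4 : ∑ j, (r + p.2.2) j • b j = ∑ j, r j • b j + ∑ j, p.2.2 j • b j := by
        rw [← Finset.sum_add_distrib]
        refine Finset.sum_congr rfl fun i _ => ?_
        rw [← add_smul]
        rfl
      simp only [Φ]
      rw [e3, e4]
      abel
    rw [e2]
    have n1 : ‖Q.dG (Q.ends p.1)‖ ≤ ‖Q.dG‖ * δ := by
      refine Q.dG.le_opNorm_of_le (max_le ?_ ?_)
      · exact (p.1.norm_coe_le_norm _).trans ((norm_fst_le _).trans hpδ)
      · exact (p.1.norm_coe_le_norm _).trans ((norm_fst_le _).trans hpδ)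
    have n2 : ‖(1 / 2 : ℝ) • ∑ i, (p.2.1 i * (2 * c i + p.2.1 i)) • q i‖ ≤ δ * D * N := by
      have n3 : ‖∑ i, (p.2.1 i * (2 * c i + p.2.1 i)) • q i‖ ≤ ∑ i, δ * (2 * D) * ‖q i‖ := by
        refine norm_sum_le_of_le _ fun i _ => ?_
        rw [norm_smul]
        refine mul_le_mul_of_nonneg_right ?_ (norm_nonneg _)
        rw [norm_mul]
        refine mul_le_mul (hτ i) ?_ (norm_nonneg _) hδ.le
        have h1 := norm_le_pi_norm c i
        have h2 : ‖2 * c i‖ = 2 * ‖c i‖ := by rw [norm_mul]; norm_num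
        have h3 : ‖p.2.1 i‖ ≤ δ := hτ i
        have := norm_nonneg r
        refine (norm_add_le _ _).trans ?_
        linarith
      rw [← Finset.mul_sum] at n3
      rw [norm_smul]
      norm_num
      nlinarith
    have n4 : ‖∑ j, p.2.2 j • b j‖ ≤ δ * N' := by
      rw [hN', Finset.mul_sum]
      refine norm_sum_le_of_le _ fun j _ => ?_
      rw [norm_smul]
      exact mul_le_mul_of_nonneg_right (hσ j) (norm_nonneg _)
    have n5 := hRG0 p hp1
    refine (norm_add_le _ _).trans ?_
    have n6 := norm_add₃_le (a := Q.dG (Q.ends p.1))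
      (b := (1 / 2 : ℝ) • ∑ i, (p.2.1 i * (2 * c i + p.2.1 i)) • q i) (c := ∑ j, p.2.2 j • b j)
    have n7 : δ * L = ‖Q.dG‖ * δ + δ * D * N + δ * N' + δ * N + δ := by rw [hL]; ring
    linarith [mul_nonneg hδ.le hN0]

end ControlSystem

end Realization

/-! ### Selection of mutually orthogonal second order variations -/

section Selection

/-- A convex cone in a finite dimensional space whose polar is trivial is the whole space. -/
theorem cone_eq_univ {V : Type*} [NormedAddCommGroup V] [NormedSpace ℝ V] [FiniteDimensional ℝ V]
    {C : Set V} (h0 : (0 : V) ∈ C) (hadd : ∀ x ∈ C, ∀ y ∈ C, x + y ∈ C)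
    (hsmul : ∀ c : ℝ, 0 ≤ c → ∀ x ∈ C, c • x ∈ C)
    (hpolar : ∀ f : V →L[ℝ] ℝ, (∀ x ∈ C, 0 ≤ f x) → f = 0) : C = univ := by
  have hconv : Convex ℝ C := fun x hx y hy a b ha hb _ =>
    hadd _ (hsmul a ha x hx) _ (hsmul b hb y hy)
  have hspan : affineSpan ℝ C = ⊤ := by
    rw [AffineSubspace.affineSpan_eq_top_iff_vectorSpan_eq_top_of_nonempty ℝ V V ⟨0, h0⟩]
    by_contra hne
    obtain ⟨f, hf, hle⟩ := Submodule.exists_le_ker_of_lt_top _ (lt_top_iff_ne_top.2 hne)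
    refine hf ?_
    have hz : ∀ x ∈ C, f x = 0 := fun x hx => by
      have : x -ᵥ (0 : V) ∈ vectorSpan ℝ C := vsub_mem_vectorSpan ℝ hx h0
      simpa using hle this
    have := hpolar (LinearMap.toContinuousLinearMap f) (fun x hx => (hz x hx).ge)
    ext x
    simpa using DFunLike.congr_fun this x
  have hint : (interior C).Nonempty := hconv.interior_nonempty_iff_affineSpan_eq_top.2 hspan
  -- A convex set and its interior have the same polar, so a hyperplane that separates `0` from the
  -- interior would give a nonzero element of the polar.
  have hmem : (0 : V) ∈ interior C := by
    by_contra hnot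
    obtain ⟨f, hf⟩ := geometric_hahn_banach_open_point hconv.interior isOpen_interior hnot
    have hle : ∀ x ∈ C, 0 ≤ (-f) x := by
      intro x hx
      have hx' : x ∈ closure (interior C) := by
        rw [hconv.closure_interior_eq_closure_of_nonempty_interior hint]
        exact subset_closure hx
      have hcl : closure (interior C) ⊆ {y | f y ≤ 0} :=
        closure_minimal (fun y hy => by simpa using (hf y hy).le)
          (isClosed_le f.continuous continuous_const)
      simpa using hcl hx'
    have hf0 := hpolar (-f) hle
    obtain ⟨x, hx⟩ := hint
    have := hf x hx
    have h2 := DFunLike.congr_fun hf0 x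
    simp at h2 this
    linarith
  -- a cone that is a neighborhood of `0` contains every point after scaling
  refine eq_univ_of_forall fun x => ?_
  have hnhds : C ∈ 𝓝 (0 : V) := mem_interior_iff_mem_nhds.1 hmem
  have hlim : Tendsto (fun r : ℝ => r • x) (𝓝[>] 0) (𝓝 0) := by
    have : Tendsto (fun r : ℝ => r • x) (𝓝 0) (𝓝 ((0 : ℝ) • x)) :=
      (continuous_id.smul continuous_const).tendsto 0
    rw [zero_smul] at this
    exact this.mono_left nhdsWithin_le_nhds
  obtain ⟨r, hr, hr0⟩ := ((hlim.eventually hnhds).and self_mem_nhdsWithin).exists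
  have hr0' : (0 : ℝ) < r := hr0
  have := hsmul r⁻¹ (by positivity) _ hr
  rwa [inv_smul_smul₀ hr0'.ne'] at this

variable {ι₁ ι₂ : Type*} [Fintype ι₁] [Fintype ι₂]

/-- The duality pairing on `ℝ^a × ℝ^b`. -/
def pair (lam y : (ι₁ → ℝ) × (ι₂ → ℝ)) : ℝ := ∑ i, lam.1 i * y.1 i + ∑ j, lam.2 j * y.2 j

theorem pair_add (lam y y' : (ι₁ → ℝ) × (ι₂ → ℝ)) :
    pair lam (y + y') = pair lam y + pair lam y' := by
  simp only [pair, Prod.fst_add, Prod.snd_add, Pi.add_apply, mul_add, Finset.sum_add_distrib]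
  ring

theorem pair_smul (c : ℝ) (lam y : (ι₁ → ℝ) × (ι₂ → ℝ)) : pair lam (c • y) = c * pair lam y := by
  simp only [pair, Prod.smul_fst, Prod.smul_snd, Pi.smul_apply, smul_eq_mul, mul_add,
    Finset.mul_sum]
  congr 1 <;> exact Finset.sum_congr rfl fun i _ => by ring

theorem pair_comm (lam y : (ι₁ → ℝ) × (ι₂ → ℝ)) : pair lam y = pair y lam := by
  simp only [pair, mul_comm]

theorem pair_smul_left (c : ℝ) (lam y : (ι₁ → ℝ) × (ι₂ → ℝ)) :
    pair (c • lam) y = c * pair lam y := by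
  rw [pair_comm, pair_smul, pair_comm]

/-- The pairing as a linear form in the second variable. -/
def pairLin (lam : (ι₁ → ℝ) × (ι₂ → ℝ)) : (ι₁ → ℝ) × (ι₂ → ℝ) →ₗ[ℝ] ℝ where
  toFun := pair lam
  map_add' := pair_add lam
  map_smul' c y := pair_smul c lam y

theorem abs_pair_le (lam y : (ι₁ → ℝ) × (ι₂ → ℝ)) :
    |pair lam y| ≤ (Fintype.card ι₁ + Fintype.card ι₂ : ℝ) * (‖lam‖ * ‖y‖) := by
  have h1 : ‖∑ i, lam.1 i * y.1 i‖ ≤ Fintype.card ι₁ * (‖lam‖ * ‖y‖) := by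
    refine (norm_sum_le_of_le (f := fun i => lam.1 i * y.1 i) (n := fun _ => ‖lam‖ * ‖y‖) _
      fun i _ => ?_).trans (by simp)
    rw [norm_mul]
    exact mul_le_mul ((norm_le_pi_norm _ i).trans (norm_fst_le _))
      ((norm_le_pi_norm _ i).trans (norm_fst_le _)) (norm_nonneg _) (norm_nonneg _)
  have h2 : ‖∑ i, lam.2 i * y.2 i‖ ≤ Fintype.card ι₂ * (‖lam‖ * ‖y‖) := by
    refine (norm_sum_le_of_le (f := fun i => lam.2 i * y.2 i) (n := fun _ => ‖lam‖ * ‖y‖) _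
      fun i _ => ?_).trans (by simp)
    rw [norm_mul]
    exact mul_le_mul ((norm_le_pi_norm _ i).trans (norm_snd_le _))
      ((norm_le_pi_norm _ i).trans (norm_snd_le _)) (norm_nonneg _) (norm_nonneg _)
  rw [add_mul]
  exact (norm_add_le (∑ i, lam.1 i * y.1 i) (∑ j, lam.2 j * y.2 j)).trans (add_le_add h1 h2)

theorem continuous_pair_left (y : (ι₁ → ℝ) × (ι₂ → ℝ)) :
    Continuous fun lam : (ι₁ → ℝ) × (ι₂ → ℝ) => pair lam y := by
  unfold pair; fun_prop

theorem exists_pair_eq (f : (ι₁ → ℝ) × (ι₂ → ℝ) →ₗ[ℝ] ℝ) :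
    ∃ lam, ∀ y, f y = pair lam y := by
  classical
  refine ⟨(fun i => f (fun j => if i = j then 1 else 0, 0),
    fun i => f (0, fun j => if i = j then 1 else 0)), fun y => ?_⟩
  have h1 := LinearMap.pi_apply_eq_sum_univ (f ∘ₗ LinearMap.inl ℝ (ι₁ → ℝ) (ι₂ → ℝ)) y.1
  have h2 := LinearMap.pi_apply_eq_sum_univ (f ∘ₗ LinearMap.inr ℝ (ι₁ → ℝ) (ι₂ → ℝ)) y.2
  have h3 : f y = f (y.1, 0) + f (0, y.2) := by rw [← map_add]; simp
  simp only [LinearMap.comp_apply, LinearMap.inl_apply, LinearMap.inr_apply, smul_eq_mul] at h1 h2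
  rw [h3, h1, h2, pair]
  simp only [mul_comm]

variable {Z : Type*} [AddCommGroup Z] [Module ℝ Z]

/-- Approximate values of a vector valued quadratic map that are attained in the common kernel of
any finite set of linear maps. -/
def IsEssentialValue {Y : Type*} [NormedAddCommGroup Y] [NormedSpace ℝ Y] (B : Z →ₗ[ℝ] Z →ₗ[ℝ] Y)
    (a : Y) : Prop :=
  ∀ (S : Finset (Z →ₗ[ℝ] Y)) (ε : ℝ), 0 < ε →
    ∃ z : Z, (∀ ℓ ∈ S, ℓ z = 0) ∧ ‖(1 / 2 : ℝ) • B z z - a‖ ≤ ε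

/-- Since essential values are attained in spaces of finite codimension, finitely many of them
can be attained at mutually orthogonal points. -/
theorem exists_orthogonal_family {Y : Type*} [NormedAddCommGroup Y] [NormedSpace ℝ Y]
    (B : Z →ₗ[ℝ] Z →ₗ[ℝ] Y) (hB : ∀ x y, B x y = B y x) (S : Finset (Z →ₗ[ℝ] Y))
    {ι : Type*} (s : Finset ι) (a : ι → Y) (ha : ∀ i ∈ s, IsEssentialValue B (a i)) (ε : ι → ℝ)
    (hε : ∀ i ∈ s, 0 < ε i) :
    ∃ z : ι → Z, (∀ i ∈ s, ∀ ℓ ∈ S, ℓ (z i) = 0) ∧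
      (∀ i ∈ s, ∀ j ∈ s, i ≠ j → B (z i) (z j) = 0) ∧
      ∀ i ∈ s, ‖(1 / 2 : ℝ) • B (z i) (z i) - a i‖ ≤ ε i := by
  classical
  induction s using Finset.induction_on with
  | empty => exact ⟨fun _ => 0, by simp, by simp, by simp⟩
  | insert i₀ s hi₀ ih =>
    obtain ⟨z, h1, h2, h3⟩ := ih (fun i hi => ha i (by simp [hi])) (fun i hi => hε i (by simp [hi]))
    obtain ⟨y, hy1, hy2⟩ := ha i₀ (by simp) (S ∪ s.image fun i => B (z i)) (ε i₀)
      (hε i₀ (by simp))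
    have hne : ∀ i ∈ s, i ≠ i₀ := fun i hi h => hi₀ (h ▸ hi)
    have hyz : ∀ i ∈ s, B (z i) y = 0 := fun i hi => hy1 _
      (Finset.mem_union_right _ (Finset.mem_image_of_mem _ hi))
    refine ⟨Function.update z i₀ y, ?_, ?_, ?_⟩
    · intro i hi ℓ hℓ
      rcases Finset.mem_insert.1 hi with rfl | hi
      · simpa using hy1 ℓ (Finset.mem_union_left _ hℓ)
      · rw [Function.update_of_ne (hne i hi)]
        exact h1 i hi ℓ hℓ
    · intro i hi j hj hij
      rcases Finset.mem_insert.1 hi with rfl | hi' <;> rcases Finset.mem_insert.1 hj with rfl | hj'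
      · exact absurd rfl hij
      · rw [Function.update_self, Function.update_of_ne (hne j hj'), hB]
        exact hyz j hj'
      · rw [Function.update_self, Function.update_of_ne (hne i hi')]
        exact hyz i hi'
      · rw [Function.update_of_ne (hne i hi'), Function.update_of_ne (hne j hj')]
        exact h2 i hi' j hj' hij
    · intro i hi
      rcases Finset.mem_insert.1 hi with rfl | hi
      · simpa using hy2
      · rw [Function.update_of_ne (hne i hi)]
        exact h3 i hi

/-- If every multiplier is negative on the second order value of the critical direction `d` or on
some essential value, then finitely many mutually orthogonal variations, among them `d`, produce a
second order descent direction in a nondegenerate way. -/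
theorem exists_descent_family (L : Z →ₗ[ℝ] (ι₁ → ℝ) × (ι₂ → ℝ))
    (B : Z →ₗ[ℝ] Z →ₗ[ℝ] (ι₁ → ℝ) × (ι₂ → ℝ)) (hB : ∀ x y, B x y = B y x) (d : Z)
    (h : ∀ lam : (ι₁ → ℝ) × (ι₂ → ℝ), (∀ i, 0 ≤ lam.1 i) → (∀ z, pair lam (L z) = 0) → lam ≠ 0 →
      0 ≤ pair lam (B d d) → ∃ a, IsEssentialValue B a ∧ pair lam a < 0) :
    ∃ (ι : Type) (_ : Fintype ι) (i₀ : ι) (z : ι → Z) (k : ℕ) (ζ : Fin k → Z) (c : ι → ℝ)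
      (r : Fin k → ℝ), z i₀ = d ∧ (∀ i, i ≠ i₀ → L (z i) = 0) ∧
      (∀ i j, i ≠ j → B (z i) (z j) = 0) ∧ (∀ i, 0 < c i) ∧
      ((1 / 2 : ℝ) • ∑ i, (c i) ^ 2 • B (z i) (z i) + ∑ j, r j • L (ζ j)).2 = 0 ∧
      (∀ i, ((1 / 2 : ℝ) • ∑ i, (c i) ^ 2 • B (z i) (z i) + ∑ j, r j • L (ζ j)).1 i < 0) ∧
      ∀ e, ∃ τ : ι → ℝ, ∃ σ : Fin k → ℝ,
        ∑ i, τ i • (c i • (B (z i) (z i)).2) + ∑ j, σ j • (L (ζ j)).2 = e := by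
  classical
  set K : ℝ := Fintype.card ι₁ + Fintype.card ι₂ with hK
  have hK0 : 0 ≤ K := by positivity
  -- the compact set of normalized multipliers that are not negative on `d`
  let M : Set ((ι₁ → ℝ) × (ι₂ → ℝ)) := Metric.sphere 0 1 ∩ {lam | (∀ i, 0 ≤ lam.1 i) ∧
    (∀ z, pair lam (L z) = 0) ∧ 0 ≤ pair lam (B d d)}
  have hM : IsCompact M := by
    refine (isCompact_sphere _ _).inter_right ?_
    refine IsClosed.inter ?_ (IsClosed.inter ?_ ?_)
    · have : {lam : (ι₁ → ℝ) × (ι₂ → ℝ) | ∀ i, 0 ≤ lam.1 i} = ⋂ i, {lam | 0 ≤ lam.1 i} := by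
        ext; simp
      change IsClosed {lam : (ι₁ → ℝ) × (ι₂ → ℝ) | ∀ i, 0 ≤ lam.1 i}
      rw [this]
      exact isClosed_iInter fun i => isClosed_le continuous_const (by fun_prop)
    · have : {lam : (ι₁ → ℝ) × (ι₂ → ℝ) | ∀ z, pair lam (L z) = 0} =
          ⋂ z, {lam | pair lam (L z) = 0} := by
        ext; simp
      change IsClosed {lam : (ι₁ → ℝ) × (ι₂ → ℝ) | ∀ z, pair lam (L z) = 0}
      rw [this]
      exact isClosed_iInter fun z => isClosed_eq (continuous_pair_left _) continuous_const
    · exact isClosed_le continuous_const (continuous_pair_left _)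
  have hex : ∀ lam : M, ∃ a, IsEssentialValue B a ∧ pair lam.1 a < 0 := by
    rintro ⟨lam, hlam, h1, h2, h3⟩
    refine h lam h1 h2 ?_ h3
    rintro rfl
    simp at hlam
  choose a ha hneg using hex
  -- an error of size `ε lam` in the essential value costs at most half of `-pair lam (a lam)`
  let ε : M → ℝ := fun lam => -pair lam.1 (a lam) / (2 * (K + 1))
  have hεpos : ∀ lam, 0 < ε lam := fun lam => div_pos (neg_pos.2 (hneg lam)) (by positivity)
  obtain ⟨s, hs⟩ := hM.elim_finite_subcover
    (fun lam : M => {mu | pair mu (a lam) < -(ε lam * K)})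
    (fun lam => isOpen_lt (continuous_pair_left _) continuous_const) (by
      intro lam hlam
      refine mem_iUnion.2 ⟨⟨lam, hlam⟩, ?_⟩
      have h1 := hneg ⟨lam, hlam⟩
      change pair lam (a ⟨lam, hlam⟩) < -(ε ⟨lam, hlam⟩ * K)
      have h2 : ε ⟨lam, hlam⟩ * (2 * (K + 1)) = -pair lam (a ⟨lam, hlam⟩) := by
        simp only [ε]
        field_simp
      have := hεpos ⟨lam, hlam⟩
      nlinarith)
  obtain ⟨y, hy1, hy2, hy3⟩ := exists_orthogonal_family B hB {L, B d} s a (fun i _ => ha i) ε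
    (fun i _ => hεpos i)
  have hyL : ∀ i ∈ s, L (y i) = 0 := fun i hi => hy1 i hi L (by simp)
  have hyd : ∀ i ∈ s, B d (y i) = 0 := fun i hi => hy1 i hi (B d) (by simp)
  -- the family of variations; the index `none` carries the critical direction
  let N := Fintype.card s
  let e : Fin N ≃ s := (Fintype.equivFin s).symm
  let z : Option (Fin N) → Z := fun o => o.elim d (fun i => y (e i).1)
  have hzL : ∀ i, i ≠ none → L (z i) = 0 := by
    rintro (_ | i) hi
    · exact absurd rfl hi
    · exact hyL _ (e i).2
  have hzB : ∀ i j, i ≠ j → B (z i) (z j) = 0 := by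
    rintro (_ | i) (_ | j) hij
    · exact absurd rfl hij
    · exact hyd _ (e j).2
    · rw [hB]; exact hyd _ (e i).2
    · refine hy2 _ (e i).2 _ (e j).2 fun h => hij ?_
      rw [e.injective (Subtype.ext h)]
  have hzneg : ∀ lam ∈ M, ∃ i, pair lam (B (z i) (z i)) < 0 := by
    intro lam hlam
    obtain ⟨i, hi, hlt⟩ := mem_iUnion₂.1 (hs hlam)
    refine ⟨some (e.symm ⟨i, hi⟩), ?_⟩
    have hlt' : pair lam (a i) < -(ε i * K) := hlt
    have e1 : z (some (e.symm ⟨i, hi⟩)) = y i := by simp [z]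
    rw [e1]
    have e2 : (1 / 2 : ℝ) • B (y i) (y i) = a i + ((1 / 2 : ℝ) • B (y i) (y i) - a i) := by abel
    have e3 := congrArg (pair lam) e2
    rw [pair_smul, pair_add] at e3
    have e4 := abs_pair_le lam ((1 / 2 : ℝ) • B (y i) (y i) - a i)
    have hn : ‖lam‖ = 1 := by simpa using hlam.1
    rw [hn, one_mul] at e4
    have e5 := hy3 i hi
    have e6 := (le_abs_self _).trans e4
    have e7 := mul_le_mul_of_nonneg_left e5 hK0
    change _ ≤ K * _ at e6
    linarith
  -- the cone generated by the second order values, the first order ones and the nonnegative orthant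
  let C : Set ((ι₁ → ℝ) × (ι₂ → ℝ)) := {v | ∃ (γ : Option (Fin N) → ℝ) (x : Z) (σ : ι₁ → ℝ),
    (∀ i, 0 ≤ γ i) ∧ (∀ i, 0 ≤ σ i) ∧ v = ∑ i, γ i • B (z i) (z i) + L x + (σ, 0)}
  have hC : C = univ := by
    refine cone_eq_univ ⟨0, 0, 0, by simp, by simp, by ext <;> simp⟩ ?_ ?_ ?_
    · rintro _ ⟨γ, x, σ, h1, h2, rfl⟩ _ ⟨γ', x', σ', h1', h2', rfl⟩
      refine ⟨γ + γ', x + x', σ + σ', fun i => add_nonneg (h1 i) (h1' i),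
        fun i => add_nonneg (h2 i) (h2' i), ?_⟩
      have : ((σ + σ', 0) : (ι₁ → ℝ) × (ι₂ → ℝ)) = (σ, 0) + (σ', 0) := by simp
      rw [this, map_add]
      simp only [Pi.add_apply, add_smul, Finset.sum_add_distrib]
      abel
    · rintro c hc _ ⟨γ, x, σ, h1, h2, rfl⟩
      refine ⟨c • γ, c • x, c • σ, fun i => mul_nonneg hc (h1 i), fun i => mul_nonneg hc (h2 i), ?_⟩
      have : ((c • σ, 0) : (ι₁ → ℝ) × (ι₂ → ℝ)) = c • (σ, 0) := by simp
      rw [this, map_smul, smul_add, smul_add, Finset.smul_sum]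
      simp only [Pi.smul_apply, smul_smul, smul_eq_mul]
    · intro f hf
      obtain ⟨lam, hlam⟩ := exists_pair_eq f.toLinearMap
      have hlam' : ∀ v, f v = pair lam v := hlam
      by_contra hne
      have hlam0 : lam ≠ 0 := by
        rintro rfl
        refine hne (ContinuousLinearMap.ext fun v => ?_)
        rw [hlam']
        simp [pair]
      have hpos : ∀ v ∈ C, 0 ≤ pair lam v := fun v hv => by rw [← hlam']; exact hf v hv
      have hn : 0 < ‖lam‖ := norm_pos_iff.2 hlam0
      have hB0 (i) : 0 ≤ pair lam (B (z i) (z i)) := by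
        refine hpos _ ⟨Pi.single i 1, 0, 0, fun j => ?_, by simp, ?_⟩
        · by_cases hij : j = i
          · subst hij; simp
          · simp [Pi.single_eq_of_ne hij]
        · rw [Finset.sum_eq_single i]
          · simp
          · intro j _ hj; simp [Pi.single_eq_of_ne hj]
          · simp
      have hL0 (x) : 0 ≤ pair lam (L x) := hpos _ ⟨0, x, 0, by simp, by simp, by simp⟩
      have hL1 (x) : pair lam (L x) = 0 := by
        refine le_antisymm ?_ (hL0 x)
        have h1 := hL0 (-x)
        rw [map_neg, ← neg_one_smul ℝ, pair_smul] at h1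
        linarith
      have hσ (i) : 0 ≤ lam.1 i := by
        have := hpos (Pi.single i 1, 0) ⟨0, 0, Pi.single i 1, by simp, fun j => ?_, by simp⟩
        · simpa [pair, Pi.single_apply] using this
        · by_cases hij : j = i
          · subst hij; simp
          · simp [Pi.single_eq_of_ne hij]
      have hmem : ‖lam‖⁻¹ • lam ∈ M := by
        refine ⟨by simp [norm_smul, hn.ne'], fun i => ?_, fun x => ?_, ?_⟩
        · exact mul_nonneg (inv_nonneg.2 hn.le) (hσ i)
        · rw [pair_smul_left, hL1, mul_zero]
        · rw [pair_smul_left]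
          exact mul_nonneg (inv_nonneg.2 hn.le) (hB0 none)
      obtain ⟨i, hi⟩ := hzneg _ hmem
      rw [pair_smul_left] at hi
      have := mul_nonneg (inv_nonneg.2 hn.le) (hB0 i)
      linarith
  -- first order variations that span the range of `L`
  obtain ⟨k, ζ, hζ⟩ : ∃ (k : ℕ) (ζ : Fin k → Z), ∀ x, ∃ r : Fin k → ℝ,
      ∑ j, r j • L (ζ j) = L x := by
    let b := Module.finBasis ℝ (LinearMap.range L)
    choose ζ hζ using fun j => (b j).2
    refine ⟨_, ζ, fun x => ⟨fun j => b.repr ⟨L x, x, rfl⟩ j, ?_⟩⟩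
    have := congrArg (LinearMap.range L).subtype (b.sum_repr ⟨L x, x, rfl⟩)
    rw [map_sum] at this
    simp only [map_smul, Submodule.subtype_apply] at this
    simpa only [hζ] using this
  have hall : ∀ v, v ∈ C := fun v => hC ▸ mem_univ v
  -- Since the whole space is generated, minus the sum of all second order values, lowered by one in
  -- the first component, lies in the cone. Moving that sum to the other side makes all weights
  -- `1 + γ i` positive; the factors `√(2 * (1 + γ i))` turn `1 / 2 * c ^ 2` into these weights.
  obtain ⟨γ, x, σ, h1, h2, hv⟩ := hall (-(∑ i, B (z i) (z i) + (fun _ => 1, 0)))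
  obtain ⟨r, hr⟩ := hζ x
  have hpos : ∀ i, 0 < 2 * (1 + γ i) := fun i => by linarith [h1 i]
  have hval : (1 / 2 : ℝ) • ∑ i, (√(2 * (1 + γ i))) ^ 2 • B (z i) (z i) + ∑ j, r j • L (ζ j) =
      -(fun i => 1 + σ i, 0) := by
    rw [hr, Finset.smul_sum]
    have e1 : ∀ i, (1 / 2 : ℝ) • (√(2 * (1 + γ i))) ^ 2 • B (z i) (z i) =
        B (z i) (z i) + γ i • B (z i) (z i) := by
      intro i
      rw [Real.sq_sqrt (hpos i).le, smul_smul, ← one_smul ℝ (B (z i) (z i)), smul_smul, smul_smul,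
        ← add_smul]
      congr 1
      ring
    simp only [e1, Finset.sum_add_distrib]
    have e2 : ((fun i => 1 + σ i, 0) : (ι₁ → ℝ) × (ι₂ → ℝ)) = (fun _ => 1, 0) + (σ, 0) := by
      ext <;> simp
    rw [e2]
    have e3 : ∑ i, γ i • B (z i) (z i) + L x =
        -(∑ i, B (z i) (z i) + ((fun _ => 1 : ι₁ → ℝ), (0 : ι₂ → ℝ))) - (σ, 0) :=
      eq_sub_of_add_eq hv.symm
    rw [add_assoc, e3]
    abel
  refine ⟨Option (Fin N), inferInstance, none, z, k, ζ, fun i => √(2 * (1 + γ i)), r, rfl, hzL, hzB,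
    fun i => Real.sqrt_pos.2 (hpos i), ?_, fun i => ?_, fun v => ?_⟩
  · rw [hval]; simp
  · rw [hval]
    simp only [Prod.fst_neg, Pi.neg_apply]
    linarith [h2 i]
  -- the orthant does not contribute to the second component, so the remaining generators span it
  · obtain ⟨γ', x', σ', -, -, hv'⟩ := hall (0, v)
    obtain ⟨r', hr'⟩ := hζ x'
    refine ⟨fun i => γ' i / √(2 * (1 + γ i)), r', ?_⟩
    have e1 : ∀ i, (γ' i / √(2 * (1 + γ i))) • √(2 * (1 + γ i)) • (B (z i) (z i)).2 =
        γ' i • (B (z i) (z i)).2 := by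
      intro i
      rw [smul_smul, div_mul_cancel₀ _ (Real.sqrt_pos.2 (hpos i)).ne']
    simp only [e1]
    have e2 := congrArg Prod.snd hv'
    simp only [Prod.snd_add, Prod.snd_sum, Prod.smul_snd, add_zero] at e2
    have e3 := congrArg Prod.snd hr'
    simp only [Prod.snd_sum, Prod.smul_snd] at e3
    rw [e3]
    exact e2.symm

end Selection

/-! ### The index theorem for control systems -/

section Index

variable {X U : Type*} [NormedAddCommGroup X] [NormedSpace ℝ X] [ProperSpace X]
  [NormedAddCommGroup U] [NormedSpace ℝ U] [ProperSpace U]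
  {ι₁ ι₂ : Type*} [Fintype ι₁] [Fintype ι₂]

/-- A local minimum admits, for every critical direction `d`, a multiplier which is nonnegative on
the second variation along `d` and on all essential values of the second variation. -/
theorem ControlSystem.exists_multiplier (Q : ControlSystem X U ((ι₁ → ℝ) × (ι₂ → ℝ)))
    (d : Variation X U) (hd₁ : ∀ i, (Q.first d).1 i ≤ 0) (hd₂ : (Q.first d).2 = 0) {ε : ℝ}
    (hε : 0 < ε)
    (hmin : ∀ p : ℝ → X × U, BddMeas p → Continuous (fun s => (p s).1) →
      (∀ s, ‖p s - Q.w s‖ ≤ ε) →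
      (∀ s, (p s).1 = (p 0).1 + ∫ σ in (0 : ℝ)..clamp Q.T s, Q.F (p σ)) →
      (Q.G ((p 0).1, (p Q.T).1)).2 = (Q.G (Q.ends Q.xh)).2 →
      ∃ i, (Q.G (Q.ends Q.xh)).1 i ≤ (Q.G ((p 0).1, (p Q.T).1)).1 i) :
    ∃ lam : (ι₁ → ℝ) × (ι₂ → ℝ), lam ≠ 0 ∧ (∀ i, 0 ≤ lam.1 i) ∧
      (∀ z, pair lam (Q.first z) = 0) ∧ 0 ≤ pair lam (Q.second d d) ∧
      ∀ a, IsEssentialValue Q.second a → 0 ≤ pair lam a := by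
  by_contra hcon
  push Not at hcon
  obtain ⟨ι, _, i₀, z, k, ζ, c, r, hz0, hzL, horth, hc, hv2, hv1, hsurj⟩ :=
    exists_descent_family Q.first Q.second Q.second_symm d
      (fun lam h1 h2 h3 h4 => hcon lam h3 h1 h2 h4)
  set v := (1 / 2 : ℝ) • ∑ i, (c i) ^ 2 • Q.second (z i) (z i) + ∑ j, r j • Q.first (ζ j) with hv
  -- a tolerance below the second order decrease, which keeps the coefficient of `d` nonnegative
  obtain ⟨δ, hδ, hδε, hδc, hδv⟩ : ∃ δ : ℝ, 0 < δ ∧ δ ≤ ε ∧ δ ≤ c i₀ ∧ ∀ i, δ < -v.1 i := by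
    have h1 : ∀ᶠ δ : ℝ in 𝓝[>] 0, ∀ i, δ < -v.1 i := by
      refine eventually_all.2 fun i => ?_
      exact nhdsWithin_le_nhds (gt_mem_nhds (neg_pos.2 (hv1 i)))
    have h2 : ∀ᶠ δ : ℝ in 𝓝[>] 0, δ < ε := nhdsWithin_le_nhds (gt_mem_nhds hε)
    have h3 : ∀ᶠ δ : ℝ in 𝓝[>] 0, δ < c i₀ := nhdsWithin_le_nhds (gt_mem_nhds (hc i₀))
    obtain ⟨δ, ⟨⟨h1, h2⟩, h3⟩, h4⟩ :=
      (((h1.and h2).and h3).and self_mem_nhdsWithin).exists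
    exact ⟨δ, h4, h2.le, h3.le, h1⟩
  have hz2 : ∀ i, (Q.first (z i)).2 = 0 := by
    intro i
    by_cases hi : i = i₀
    · rw [hi, hz0, hd₂]
    · rw [hzL i hi, Prod.snd_zero]
  obtain ⟨t, ht, c', hc', p, hp, hpc, hpε, hpeq, hp2, hp1⟩ :=
    Q.exists_trajectory z ζ horth hz2 c r hv2 hsurj hδ
  obtain ⟨i, hi⟩ := hmin p hp hpc (fun s => (hpε s).trans hδε) hpeq hp2
  have hsum : ∑ i, c' i • (Q.first (z i)).1 = c' i₀ • (Q.first d).1 := by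
    rw [Finset.sum_eq_single i₀, hz0]
    · intro j _ hj
      rw [hzL j hj, Prod.fst_zero, smul_zero]
    · simp
  rw [hsum, ← hv] at hp1
  have hi' := (norm_le_pi_norm _ i).trans hp1
  simp only [Pi.sub_apply, Pi.smul_apply, smul_eq_mul, Real.norm_eq_abs] at hi'
  have h1 := (abs_le.1 hi').2
  have hc0 : 0 ≤ c' i₀ := by
    have := (abs_le.1 (hc' i₀)).1
    linarith
  -- the first order term comes from `d` alone and does not increase any component
  have h2 : t * (c' i₀ * (Q.first d).1 i) ≤ 0 :=
    mul_nonpos_of_nonneg_of_nonpos ht.le (mul_nonpos_of_nonneg_of_nonpos hc0 (hd₁ i))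
  have h3 : t ^ 2 * δ < t ^ 2 * -v.1 i := mul_lt_mul_of_pos_left (hδv i) (by positivity)
  linarith

end Index

/-! ### Lipschitz curves and the costate -/

section Costate

variable {X U : Type*} [NormedAddCommGroup X] [NormedSpace ℝ X]

theorem lipschitzOnWith_of_eq_integral {T : ℝ} {x g : ℝ → X} {C : NNReal}
    (hg : IntegrableOn g (Icc 0 T)) (hC : ∀ᵐ t ∂(volume.restrict (Icc 0 T)), ‖g t‖ ≤ C)
    (hx : ∀ t ∈ Icc 0 T, x t = x 0 + ∫ s in (0 : ℝ)..t, g s) :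
    LipschitzOnWith C x (Icc 0 T) := by
  have hint : ∀ t ∈ Icc 0 T, IntervalIntegrable g volume 0 t := fun t ht => by
    rw [intervalIntegrable_iff, uIoc_of_le ht.1]
    exact hg.mono_set fun s hs => ⟨hs.1.le, hs.2.trans ht.2⟩
  refine LipschitzOnWith.of_dist_le_mul fun s hs t ht => ?_
  rw [dist_eq_norm, hx s hs, hx t ht, add_sub_add_left_eq_sub,
    intervalIntegral.integral_interval_sub_left (hint s hs) (hint t ht), Real.dist_eq]
  refine intervalIntegral.norm_integral_le_of_norm_le_const_ae ?_
  rw [ae_restrict_iff' measurableSet_Icc] at hC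
  filter_upwards [hC] with r hr hr'
  refine hr (uIcc_subset_Icc ht hs (uIoc_subset_uIcc hr'))

theorem ae_hasDerivAt_of_eq_integral [CompleteSpace X] {T : ℝ} (hT : 0 ≤ T) {x g : ℝ → X}
    (hg : IntegrableOn g (Icc 0 T)) (hx : ∀ t ∈ Icc 0 T, x t = x 0 + ∫ s in (0 : ℝ)..t, g s) :
    ∀ᵐ t ∂(volume.restrict (Icc 0 T)), HasDerivAt x (g t) t := by
  have hint : IntervalIntegrable g volume 0 T := by
    rw [intervalIntegrable_iff, uIoc_of_le hT]
    exact hg.mono_set Ioc_subset_Icc_self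
  have h1 := hint.ae_hasDerivAt_integral
  rw [uIcc_of_le hT] at h1
  rw [ae_restrict_iff' measurableSet_Icc]
  have h2 : ∀ᵐ t : ℝ, t ≠ 0 ∧ t ≠ T := by
    refine Filter.Eventually.and ?_ ?_ <;> simp [ae_iff, measure_singleton]
  filter_upwards [h1, h2] with t ht htne htT
  have hio : Icc 0 T ∈ 𝓝 t :=
    Icc_mem_nhds (lt_of_le_of_ne htT.1 (Ne.symm htne.1)) (lt_of_le_of_ne htT.2 htne.2)
  refine ((ht htT 0 ⟨le_rfl, hT⟩).const_add (x 0)).congr_of_eventuallyEq ?_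
  filter_upwards [hio] with s hs using hx s hs

theorem integral_eq_sub_of_lipschitz {T : ℝ} (hT : 0 ≤ T) {f g : ℝ → ℝ} {C : NNReal}
    (hf : LipschitzOnWith C f (Icc 0 T))
    (hg : ∀ᵐ t ∂(volume.restrict (Icc 0 T)), HasDerivAt f (g t) t) :
    ∫ t in (0 : ℝ)..T, g t = f T - f 0 := by
  have hac : AbsolutelyContinuousOnInterval f 0 T := by
    refine LipschitzOnWith.absolutelyContinuousOnInterval (K := C) ?_
    rwa [uIcc_of_le hT]
  rw [← hac.integral_deriv_eq_sub]
  refine intervalIntegral.integral_congr_ae ?_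
  rw [ae_restrict_iff' measurableSet_Icc] at hg
  filter_upwards [hg] with t ht ht'
  rw [uIoc_of_le hT] at ht'
  exact (ht ⟨ht'.1.le, ht'.2⟩).deriv.symm

theorem integrable_of_lipschitz {T : ℝ} (hT : 0 ≤ T) {f g : ℝ → ℝ} {C : NNReal}
    (hf : LipschitzOnWith C f (Icc 0 T))
    (hg : ∀ᵐ t ∂(volume.restrict (Icc 0 T)), HasDerivAt f (g t) t) :
    IntervalIntegrable g volume 0 T := by
  have hac : AbsolutelyContinuousOnInterval f 0 T := by
    refine LipschitzOnWith.absolutelyContinuousOnInterval (K := C) ?_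
    rwa [uIcc_of_le hT]
  refine hac.intervalIntegrable_deriv.congr_ae ?_
  rw [ae_restrict_iff' measurableSet_Icc] at hg
  rw [EventuallyEq, uIoc_of_le hT, ae_restrict_iff' measurableSet_Ioc]
  filter_upwards [hg] with t ht ht'
  exact (ht ⟨ht'.1.le, ht'.2⟩).deriv

theorem LipschitzOnWith.clm_apply' {Y : Type*} [NormedAddCommGroup Y] [NormedSpace ℝ Y]
    {T : ℝ} {A : ℝ → X →L[ℝ] Y} {x : ℝ → X} {C D : NNReal} (hA : LipschitzOnWith C A (Icc 0 T))
    (hx : LipschitzOnWith D x (Icc 0 T)) :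
    ∃ K, LipschitzOnWith K (fun t => A t (x t)) (Icc 0 T) := by
  obtain ⟨a, ha⟩ := isCompact_Icc.exists_bound_of_continuousOn hA.continuousOn
  obtain ⟨b, hb⟩ := isCompact_Icc.exists_bound_of_continuousOn hx.continuousOn
  refine ⟨C * b.toNNReal + a.toNNReal * D, LipschitzOnWith.of_dist_le_mul fun s hs t ht => ?_⟩
  have h1 : A s (x s) - A t (x t) = (A s - A t) (x s) + A t (x s - x t) := by
    rw [sub_apply, map_sub]; abel
  rw [dist_eq_norm, h1]
  have h2 := hA.dist_le_mul s hs t ht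
  have h3 := hx.dist_le_mul s hs t ht
  rw [dist_eq_norm] at h2 h3
  have h4 := (A s - A t).le_of_opNorm_le_of_le h2 ((hb s hs).trans (Real.le_coe_toNNReal b))
  have h5 := (A t).le_of_opNorm_le_of_le ((ha t ht).trans (Real.le_coe_toNNReal a)) h3
  refine (norm_add_le_of_le h4 h5).trans (le_of_eq ?_)
  push_cast
  ring

variable [ProperSpace X] [NormedAddCommGroup U] [NormedSpace ℝ U] [ProperSpace U]
  {ι₁ ι₂ : Type*} [Fintype ι₁] [Fintype ι₂]

namespace ControlSystem

variable (Q : ControlSystem X U ((ι₁ → ℝ) × (ι₂ → ℝ))) (lam : (ι₁ → ℝ) × (ι₂ → ℝ))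

/-- The derivative of the endpoint Lagrangian. -/
def dEll : X × X →L[ℝ] ℝ := (LinearMap.toContinuousLinearMap (pairLin lam)).comp Q.dG

theorem dEll_apply (q : X × X) : Q.dEll lam q = pair lam (Q.dG q) := rfl

/-- Transpose of the linearized dynamics, in reversed time. -/
def adjointA : ℝ →ᵇ ((X →L[ℝ] ℝ) →L[ℝ] (X →L[ℝ] ℝ)) :=
  BoundedContinuousFunction.ofNormedAddCommGroup
    (fun s => (ContinuousLinearMap.compL ℝ X X ℝ).flip (Q.A (Q.T - s)))
    (by
      have : Continuous fun s => Q.A (Q.T - s) := Q.A.continuous.comp (by fun_prop)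
      exact ((ContinuousLinearMap.compL ℝ X X ℝ).flip).continuous.comp this)
    (‖(ContinuousLinearMap.compL ℝ X X ℝ).flip‖ * ‖Q.A‖)
    (fun s => ((ContinuousLinearMap.compL ℝ X X ℝ).flip).le_opNorm_of_le
      (Q.A.norm_coe_le_norm _))

theorem adjointA_apply (s : ℝ) (q : X →L[ℝ] ℝ) : Q.adjointA s q = q.comp (Q.A (Q.T - s)) := rfl

/-- The costate in reversed time. -/
def revCostate : ℝ →ᵇ (X →L[ℝ] ℝ) :=
  solve Q.T_nonneg Q.adjointA (BoundedContinuousFunction.const ℝ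
    ((Q.dEll lam).comp (ContinuousLinearMap.inr ℝ X X)))

/-- The costate: the solution of the adjoint equation with the terminal value prescribed by the
endpoint Lagrangian. -/
def costate (t : ℝ) : X →L[ℝ] ℝ := Q.revCostate lam (Q.T - t)

theorem continuous_costate : Continuous (Q.costate lam) :=
  (Q.revCostate lam).continuous.comp (by fun_prop)

theorem bddMeas_costate : BddMeas (Q.costate lam) :=
  ⟨(Q.continuous_costate lam).stronglyMeasurable, ‖Q.revCostate lam‖,
    fun _ => (Q.revCostate lam).norm_coe_le_norm _⟩

theorem costate_terminal_sub {t : ℝ} (ht : t ∈ Icc 0 Q.T) : Q.costate lam t =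
    (Q.dEll lam).comp (ContinuousLinearMap.inr ℝ X X) +
      ∫ s in t..Q.T, (Q.costate lam s).comp (Q.A s) := by
  have h1 := DFunLike.congr_fun (solve_eq Q.T_nonneg Q.adjointA (BoundedContinuousFunction.const ℝ
    ((Q.dEll lam).comp (ContinuousLinearMap.inr ℝ X X)))) (Q.T - t)
  have hint : IntegrableOn (fun s => Q.adjointA s (Q.revCostate lam s)) (Icc 0 Q.T) :=
    (BddMeas.clm (bddMeas_bcf _) (bddMeas_bcf _)).integrableOn _
  rw [BoundedContinuousFunction.add_apply, volterra_apply] at h1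
  change Q.revCostate lam (Q.T - t) = _ +
    primitive Q.T (fun s => Q.adjointA s (Q.revCostate lam s)) (Q.T - t) at h1
  rw [primitive_apply Q.T_nonneg hint, clamp_of_mem ⟨by linarith [ht.2], by linarith [ht.1]⟩] at h1
  have h2 := intervalIntegral.integral_comp_sub_left (a := t) (b := Q.T)
    (fun s => Q.adjointA s (Q.revCostate lam s)) Q.T
  rw [sub_self] at h2
  rw [← h2] at h1
  change Q.revCostate lam (Q.T - t) = _
  rw [h1]
  simp only [adjointA_apply, sub_sub_cancel]
  rfl

theorem costate_T (x : X) : Q.costate lam Q.T x = Q.dEll lam (0, x) := by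
  rw [Q.costate_terminal_sub lam ⟨Q.T_nonneg, le_rfl⟩, intervalIntegral.integral_same, add_zero]
  rfl

theorem bddMeas_costate_comp_A : BddMeas (fun s => (Q.costate lam s).comp (Q.A s)) := by
  have h : Continuous fun s => (Q.costate lam s).comp (Q.A s) :=
    (Q.continuous_costate lam).clm_comp Q.A.continuous
  refine ⟨h.stronglyMeasurable, ‖Q.revCostate lam‖ * ‖Q.A‖, fun t => ?_⟩
  exact (ContinuousLinearMap.opNorm_comp_le _ _).trans (mul_le_mul
    ((Q.revCostate lam).norm_coe_le_norm _) (Q.A.norm_coe_le_norm _) (norm_nonneg _)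
    (norm_nonneg (Q.revCostate lam)))

theorem costate_eq {t : ℝ} (ht : t ∈ Icc 0 Q.T) : Q.costate lam t =
    Q.costate lam 0 + ∫ s in (0 : ℝ)..t, -(Q.costate lam s).comp (Q.A s) := by
  have hi := (Q.bddMeas_costate_comp_A lam).intervalIntegrable
  rw [Q.costate_terminal_sub lam ht, Q.costate_terminal_sub lam ⟨le_rfl, Q.T_nonneg⟩,
    intervalIntegral.integral_neg, add_assoc]
  congr 1
  rw [← intervalIntegral.integral_add_adjacent_intervals (hi 0 t) (hi t Q.T)]
  abel

theorem exists_lipschitz_costate : ∃ C, LipschitzOnWith C (Q.costate lam) (Icc 0 Q.T) := by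
  obtain ⟨C, hC⟩ := (Q.bddMeas_costate_comp_A lam).neg.2
  refine ⟨C.toNNReal, lipschitzOnWith_of_eq_integral
    ((Q.bddMeas_costate_comp_A lam).neg.integrableOn _) (ae_of_all _ fun t => ?_)
    (fun t ht => Q.costate_eq lam ht)⟩
  exact (hC t).trans (Real.le_coe_toNNReal C)

theorem ae_hasDerivAt_costate : ∀ᵐ t ∂(volume.restrict (Icc 0 Q.T)),
    HasDerivAt (Q.costate lam) (-(Q.costate lam t).comp (Q.A t)) t :=
  ae_hasDerivAt_of_eq_integral Q.T_nonneg ((Q.bddMeas_costate_comp_A lam).neg.integrableOn _)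
    (fun _ ht => Q.costate_eq lam ht)

/-- Duality between the linearized state equation and the adjoint equation. -/
theorem costate_duality (x : ℝ →ᵇ X) (x₀ : X) (f : ℝ → X) (hf : BddMeas f)
    (hx : x = BoundedContinuousFunction.const ℝ x₀ +
      primitive Q.T (fun s => f s + Q.A s (x s))) :
    Q.dEll lam (0, x Q.T) = Q.costate lam 0 x₀ + ∫ t in (0 : ℝ)..Q.T, Q.costate lam t (f t) := by
  have hT := Q.T_nonneg
  have hg : BddMeas (fun s => f s + Q.A s (x s)) :=
    hf.add (BddMeas.clm (bddMeas_bcf _) (bddMeas_bcf _))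
  have hx0 : x 0 = x₀ := by rw [hx]; simp [primitive_zero_time]
  have hxe : ∀ t ∈ Icc 0 Q.T, x t = x 0 + ∫ s in (0 : ℝ)..t, f s + Q.A s (x s) := by
    intro t ht
    have := DFunLike.congr_fun hx t
    rw [BoundedContinuousFunction.add_apply, primitive_apply hT (hg.integrableOn _),
      clamp_of_mem ht] at this
    rw [hx0]
    exact this
  obtain ⟨C, hC⟩ := hg.2
  have hxl := lipschitzOnWith_of_eq_integral (C := C.toNNReal) (hg.integrableOn Q.T)
    (ae_of_all _ fun t => (hC t).trans (Real.le_coe_toNNReal C)) hxe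
  obtain ⟨D, hD⟩ := Q.exists_lipschitz_costate lam
  obtain ⟨K, hK⟩ := LipschitzOnWith.clm_apply' hD hxl
  have hder : ∀ᵐ t ∂(volume.restrict (Icc 0 Q.T)),
      HasDerivAt (fun t => Q.costate lam t (x t)) (Q.costate lam t (f t)) t := by
    filter_upwards [Q.ae_hasDerivAt_costate lam,
      ae_hasDerivAt_of_eq_integral hT (hg.integrableOn _) hxe] with t h1 h2
    refine (h1.clm_apply h2).congr_deriv ?_
    rw [neg_apply, ContinuousLinearMap.comp_apply, map_add]
    abel
  have := integral_eq_sub_of_lipschitz hT hK hder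
  rw [this, costate_T, hx0]
  ring

/-- The first variation of the endpoint Lagrangian in terms of the costate. -/
theorem pair_first (z : Variation X U) : pair lam (Q.first z) = Q.dEll lam (z.1.1, 0) +
    Q.costate lam 0 z.1.1 + ∫ t in (0 : ℝ)..Q.T, Q.costate lam t (Q.dF t (0, z.1.2 t)) := by
  have h1 : Q.resp z = BoundedContinuousFunction.const ℝ z.1.1 +
      primitive Q.T (fun s => Q.dF s (0, z.1.2 s) + Q.A s (Q.resp z s)) := by
    have h5 : (fun s => Q.dF s (Q.traj z s)) =
        fun s => Q.dF s (0, z.1.2 s) + Q.A s (Q.resp z s) := by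
      ext s
      rw [A_apply, ← map_add]
      simp [traj]
    rw [← h5]
    exact Q.resp_eq z
  have h2 := Q.costate_duality lam _ _ _ (Q.bddMeas_dF (bddMeas_zero.prodMk z.2)) h1
  rw [add_assoc, ← h2, ← map_add]
  change Q.dEll lam (Q.resp z 0, Q.resp z Q.T) = _
  rw [resp_zero_time]
  simp

/-- The second variation in terms of the costate. -/
theorem pair_second (z z' : Variation X U) : pair lam (Q.second z z') =
    pair lam (Q.d2G (Q.ends (Q.resp z)) (Q.ends (Q.resp z'))) +
      ∫ t in (0 : ℝ)..Q.T, Q.costate lam t (Q.d2F t (Q.traj z t) (Q.traj z' t)) := by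
  have hf := Q.bddMeas_d2F (Q.bddMeas_traj z) (Q.bddMeas_traj z')
  have h3 : IntegrableOn (fun s => Q.A s (Q.resp₂ z z' s)) (Icc 0 Q.T) :=
    (BddMeas.clm (bddMeas_bcf Q.A) (bddMeas_bcf _)).integrableOn Q.T
  have h1 : Q.resp₂ z z' = BoundedContinuousFunction.const ℝ 0 +
      primitive Q.T (fun s => Q.d2F s (Q.traj z s) (Q.traj z' s) + Q.A s (Q.resp₂ z z' s)) := by
    rw [primitive_add Q.T_nonneg (hf.integrableOn _) h3]
    have : BoundedContinuousFunction.const ℝ (0 : X) = 0 := rfl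
    rw [this, zero_add]
    exact Q.resp₂_eq z z'
  have h2 := Q.costate_duality lam _ _ _ hf h1
  rw [map_zero, zero_add] at h2
  rw [second_apply, pair_add, ← h2, dEll_apply, ends_apply, ends_apply, ends_apply, resp₂_zero_time]

/-- A multiplier annihilates the first variation only if the transversality condition at the initial
time and the stationarity conditions hold. -/
theorem stationarity (hT : 0 < Q.T) (h : ∀ z, pair lam (Q.first z) = 0) :
    (∀ x : X, Q.costate lam 0 x = -Q.dEll lam (x, 0)) ∧
      ∀ t ∈ Icc 0 Q.T, ∀ a : U, Q.costate lam t (Q.dF t (0, a)) = 0 := by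
  constructor
  · intro x
    have := h ⟨(x, fun _ => 0), bddMeas_zero⟩
    rw [pair_first, eq_comm] at this
    have h0 : ∀ t, Q.costate lam t (Q.dF t ((0 : X), (0 : U))) = 0 := fun t => by
      rw [Prod.mk_zero_zero, map_zero, map_zero]
    have h1 : ∫ t in (0 : ℝ)..Q.T, Q.costate lam t (Q.dF t ((0 : X), (0 : U))) = 0 :=
      (intervalIntegral.integral_congr fun t _ => h0 t).trans intervalIntegral.integral_zero
    change 0 = Q.dEll lam (x, 0) + Q.costate lam 0 x +
      ∫ t in (0 : ℝ)..Q.T, Q.costate lam t (Q.dF t ((0 : X), (0 : U))) at this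
    linarith
  · intro t ht a
    let φ : ℝ → ℝ := fun t => Q.costate lam t (Q.dF t (0, a))
    have hφ : Continuous φ :=
      (Q.continuous_costate lam).clm_apply (Q.dF.continuous.clm_apply continuous_const)
    have hb : BddMeas φ := BddMeas.clm (Q.bddMeas_costate lam)
      (Q.bddMeas_dF (z := fun _ => (0, a)) ⟨stronglyMeasurable_const, ‖((0 : X), a)‖, by simp⟩)
    have hz : BddMeas (fun s => φ s • a) := by
      obtain ⟨C, hC⟩ := hb.2
      refine ⟨hb.1.smul stronglyMeasurable_const, C * ‖a‖, fun s => ?_⟩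
      rw [norm_smul]
      exact mul_le_mul_of_nonneg_right (hC s) (norm_nonneg _)
    have := h ⟨(0, fun s => φ s • a), hz⟩
    rw [pair_first] at this
    simp only [Prod.mk_zero_zero, map_zero, zero_add] at this
    have h1 : ∀ s, Q.costate lam s (Q.dF s (0, φ s • a)) = φ s ^ 2 := by
      intro s
      have : ((0 : X), φ s • a) = φ s • ((0 : X), a) := by simp
      rw [this, map_smul, map_smul, smul_eq_mul, pow_two]
    simp only [h1] at this
    by_contra hne
    have hpos : 0 < ∫ s in (0 : ℝ)..Q.T, φ s ^ 2 :=
      intervalIntegral.integral_pos hT (by fun_prop) (fun s _ => sq_nonneg _)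
        ⟨t, ht, by positivity⟩
    linarith

end ControlSystem

end Costate

/-! ### Derivatives of the dynamics and of the pre-Hamiltonian -/

section Matrices

theorem of_apply_single_mulVec {a b : ℕ} (L : Vec b →ₗ[ℝ] Vec a) (x : Vec b) :
    (Matrix.of fun i j => L (Pi.single j 1) i) *ᵥ x = L x :=
  LinearMap.toMatrix'_mulVec L x

theorem dotProduct_of_single_mulVec {a b : ℕ} (L : Vec a →ₗ[ℝ] Vec b →ₗ[ℝ] ℝ) (x : Vec a)
    (y : Vec b) :
    x ⬝ᵥ (Matrix.of fun i j => L (Pi.single i 1) (Pi.single j 1)) *ᵥ y = L x y := by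
  rw [← Matrix.toLinearMap₂'_apply']
  have : (Matrix.of fun i j => L (Pi.single i 1) (Pi.single j 1)) = LinearMap.toMatrix₂' ℝ L := by
    ext i j
    rw [LinearMap.toMatrix₂'_apply]
    rfl
  rw [this, Matrix.toLinearMap₂'_toMatrix']

/-- The functional `y ↦ p ⬝ᵥ y`. -/
def dotCLM {k : ℕ} (p : Vec k) : Vec k →L[ℝ] ℝ :=
  LinearMap.toContinuousLinearMap (dotProductBilin ℝ ℝ p)

@[simp] theorem dotCLM_apply {k : ℕ} (p y : Vec k) : dotCLM p y = p ⬝ᵥ y := rfl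

end Matrices

namespace Problem

variable {n l m dphi deta : ℕ} {P : Problem n l m dphi deta}

theorem Regular.contDiff_f (h : P.Regular) (i : Fin (m + 1)) : ContDiff ℝ 2 (P.f i) := (h.1 i).1

theorem Regular.contDiff_F (h : P.Regular) : ContDiff ℝ 2 P.F := by
  have := h.contDiff_f
  unfold Problem.F
  fun_prop

variable (P) in
/-- The partial derivative of the dynamics in the direction `b` of the affine control. -/
def fieldV (b : Vec m) (z : Vec n × Vec l × Vec m) : Vec n :=
  ∑ i : Fin m, b i • P.f i.succ (z.1, z.2.1)

theorem Regular.contDiff_fieldV (h : P.Regular) (b : Vec m) : ContDiff ℝ 2 (P.fieldV b) := by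
  have := h.contDiff_f
  unfold Problem.fieldV
  fun_prop

theorem F_add_affine (b : Vec m) (z : Vec n × Vec l × Vec m) :
    P.F (z + (0, 0, b)) = P.F z + P.fieldV b z := by
  simp [Problem.F, fieldV, add_smul, Finset.sum_add_distrib, add_assoc]

theorem fieldV_add_affine (b c : Vec m) (z : Vec n × Vec l × Vec m) :
    P.fieldV b (z + (0, 0, c)) = P.fieldV b z := by
  simp [fieldV]

theorem Regular.fderiv_F_affine (h : P.Regular) (b : Vec m) (z : Vec n × Vec l × Vec m) :
    fderiv ℝ P.F z (0, 0, b) = P.fieldV b z := by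
  have h1 : DifferentiableAt ℝ P.F z := h.contDiff_F.differentiable (by norm_num) z
  have h2 : HasLineDerivAt ℝ P.F (fderiv ℝ P.F z (0, 0, b)) z (0, 0, b) :=
    h1.hasFDerivAt.hasLineDerivAt _
  have h3 : HasLineDerivAt ℝ P.F (P.fieldV b z) z (0, 0, b) := by
    unfold HasLineDerivAt
    have : (fun t : ℝ => P.F (z + t • ((0 : Vec n), (0 : Vec l), b))) =
        fun t => P.F z + t • P.fieldV b z := by
      ext1 t
      rw [show t • ((0 : Vec n), (0 : Vec l), b) = (0, 0, t • b) by simp, F_add_affine]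
      congr 1
      simp [fieldV, Finset.smul_sum, smul_smul]
    rw [this]
    simpa using ((hasDerivAt_id (0 : ℝ)).smul_const (P.fieldV b z)).const_add (P.F z)
  exact h2.unique h3

/-- Second derivatives of the dynamics with one argument in the affine direction. -/
theorem Regular.sndDeriv_F_affine (h : P.Regular) (b : Vec m) (z d : Vec n × Vec l × Vec m) :
    fderiv ℝ (fderiv ℝ P.F) z d (0, 0, b) = fderiv ℝ (P.fieldV b) z d := by
  have h1 : HasFDerivAt (fderiv ℝ P.F) (fderiv ℝ (fderiv ℝ P.F) z) z :=
    ((contDiff_fderiv h.contDiff_F).differentiable (by norm_num) z).hasFDerivAt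
  have h2 := h1.clm_apply (hasFDerivAt_const ((0 : Vec n), (0 : Vec l), b) z)
  have h3 : (fun y => fderiv ℝ P.F y (0, 0, b)) = P.fieldV b := funext (h.fderiv_F_affine b)
  rw [h3] at h2
  rw [h2.fderiv]
  simp

theorem Regular.sndDeriv_F_affine_affine (h : P.Regular) (b c : Vec m)
    (z : Vec n × Vec l × Vec m) :
    fderiv ℝ (fderiv ℝ P.F) z (0, 0, c) (0, 0, b) = 0 := by
  rw [h.sndDeriv_F_affine]
  have h1 : DifferentiableAt ℝ (P.fieldV b) z :=
    (h.contDiff_fieldV b).differentiable (by norm_num) z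
  have h2 : HasLineDerivAt ℝ (P.fieldV b) (fderiv ℝ (P.fieldV b) z (0, 0, c)) z (0, 0, c) :=
    h1.hasFDerivAt.hasLineDerivAt _
  refine h2.unique ?_
  unfold HasLineDerivAt
  have : (fun t : ℝ => P.fieldV b (z + t • ((0 : Vec n), (0 : Vec l), c))) =
      fun t => P.fieldV b z := by
    ext1 t
    rw [show t • ((0 : Vec n), (0 : Vec l), c) = (0, 0, t • c) by simp, fieldV_add_affine]
  rw [this]
  exact hasDerivAt_const _ _

variable (wh : Triple n l m) (lam : Multiplier n dphi deta)

theorem Regular.fderiv_H (h : P.Regular) (t : ℝ) (z d : Vec n × Vec l × Vec m) :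
    fderiv ℝ (P.H lam t) z d = lam.2.2 t ⬝ᵥ fderiv ℝ P.F z d := by
  have h1 : DifferentiableAt ℝ P.F z := h.contDiff_F.differentiable (by norm_num) z
  have h2 : HasFDerivAt (P.H lam t) ((dotCLM (lam.2.2 t)).comp (fderiv ℝ P.F z)) z :=
    (dotCLM (lam.2.2 t)).hasFDerivAt.comp z h1.hasFDerivAt
  rw [h2.fderiv]
  rfl

theorem Regular.D2H_eq (h : P.Regular) (t : ℝ) (d d₁ : Vec n × Vec l × Vec m) :
    P.D2H wh lam t d d₁ = lam.2.2 t ⬝ᵥ fderiv ℝ (fderiv ℝ P.F) (wh.val t) d d₁ := by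
  have h1 : HasFDerivAt (fderiv ℝ P.F) (fderiv ℝ (fderiv ℝ P.F) (wh.val t)) (wh.val t) :=
    ((contDiff_fderiv h.contDiff_F).differentiable (by norm_num) _).hasFDerivAt
  have h2 : fderiv ℝ (P.H lam t) = fun z =>
      ContinuousLinearMap.compL ℝ _ _ _ (dotCLM (lam.2.2 t)) (fderiv ℝ P.F z) := by
    refine funext fun z => ContinuousLinearMap.ext fun d => ?_
    rw [h.fderiv_H]
    rfl
  have h3 : HasFDerivAt (fderiv ℝ (P.H lam t)) ((ContinuousLinearMap.compL ℝ _ _ _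
      (dotCLM (lam.2.2 t))).comp (fderiv ℝ (fderiv ℝ P.F) (wh.val t))) (wh.val t) := by
    rw [h2]
    exact (ContinuousLinearMap.compL ℝ _ _ _ (dotCLM (lam.2.2 t))).hasFDerivAt.comp _ h1
  rw [D2H, h3.fderiv]
  rfl

/-- The second derivative of the pre-Hamiltonian as a bilinear map. -/
def D2Hbil (h : P.Regular) (t : ℝ) :
    (Vec n × Vec l × Vec m) →ₗ[ℝ] (Vec n × Vec l × Vec m) →ₗ[ℝ] ℝ :=
  LinearMap.mk₂ ℝ (P.D2H wh lam t)
    (fun _ _ _ => by simp only [h.D2H_eq, map_add, add_apply, dotProduct_add])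
    (fun _ _ _ => by simp only [h.D2H_eq, map_smul, smul_apply, dotProduct_smul])
    (fun _ _ _ => by simp only [h.D2H_eq, map_add, dotProduct_add])
    (fun _ _ _ => by simp only [h.D2H_eq, map_smul, dotProduct_smul])

theorem D2Hbil_apply (h : P.Regular) (t : ℝ) (d d₁ : Vec n × Vec l × Vec m) :
    D2Hbil wh lam h t d d₁ = P.D2H wh lam t d d₁ := rfl

theorem Regular.D2H_symm (h : P.Regular) (t : ℝ) (d d₁ : Vec n × Vec l × Vec m) :
    P.D2H wh lam t d d₁ = P.D2H wh lam t d₁ d := by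
  rw [h.D2H_eq, h.D2H_eq, sndDeriv_symm h.contDiff_F]

/-- Embedding of the state space. -/
abbrev inX : Vec n →ₗ[ℝ] Vec n × Vec l × Vec m := LinearMap.inl ℝ _ _

/-- Embedding of the space of the controls `u`. -/
abbrev inU : Vec l →ₗ[ℝ] Vec n × Vec l × Vec m := LinearMap.inr ℝ _ _ ∘ₗ LinearMap.inl ℝ _ _

/-- Embedding of the space of the controls `v`. -/
abbrev inV : Vec m →ₗ[ℝ] Vec n × Vec l × Vec m := LinearMap.inr ℝ _ _ ∘ₗ LinearMap.inr ℝ _ _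

theorem Fx_mulVec (t : ℝ) (x : Vec n) :
    P.Fx wh t *ᵥ x = fderiv ℝ P.F (wh.val t) (x, 0, 0) :=
  of_apply_single_mulVec ((fderiv ℝ P.F (wh.val t)).toLinearMap ∘ₗ inX) x

theorem Fu_mulVec (t : ℝ) (u : Vec l) :
    P.Fu wh t *ᵥ u = fderiv ℝ P.F (wh.val t) (0, u, 0) :=
  of_apply_single_mulVec ((fderiv ℝ P.F (wh.val t)).toLinearMap ∘ₗ inU) u

theorem Fv_mulVec (t : ℝ) (v : Vec m) :
    P.Fv wh t *ᵥ v = fderiv ℝ P.F (wh.val t) (0, 0, v) :=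
  of_apply_single_mulVec ((fderiv ℝ P.F (wh.val t)).toLinearMap ∘ₗ inV) v

theorem linearized_eq (t : ℝ) (x : Vec n) (u : Vec l) (v : Vec m) :
    P.Fx wh t *ᵥ x + P.Fu wh t *ᵥ u + P.Fv wh t *ᵥ v = fderiv ℝ P.F (wh.val t) (x, u, v) := by
  rw [Fx_mulVec, Fu_mulVec, Fv_mulVec, ← map_add, ← map_add]
  simp

theorem dotProduct_Hxx (h : P.Regular) (t : ℝ) (x x' : Vec n) :
    x ⬝ᵥ P.Hxx wh lam t *ᵥ x' = P.D2H wh lam t (x, 0, 0) (x', 0, 0) :=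
  dotProduct_of_single_mulVec ((D2Hbil wh lam h t).compl₁₂ inX inX) x x'

theorem dotProduct_Hux (h : P.Regular) (t : ℝ) (u : Vec l) (x : Vec n) :
    u ⬝ᵥ P.Hux wh lam t *ᵥ x = P.D2H wh lam t (0, u, 0) (x, 0, 0) :=
  dotProduct_of_single_mulVec ((D2Hbil wh lam h t).compl₁₂ inU inX) u x

theorem dotProduct_Hvx (h : P.Regular) (t : ℝ) (v : Vec m) (x : Vec n) :
    v ⬝ᵥ P.Hvx wh lam t *ᵥ x = P.D2H wh lam t (0, 0, v) (x, 0, 0) :=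
  dotProduct_of_single_mulVec ((D2Hbil wh lam h t).compl₁₂ inV inX) v x

theorem dotProduct_Huu (h : P.Regular) (t : ℝ) (u u' : Vec l) :
    u ⬝ᵥ P.Huu wh lam t *ᵥ u' = P.D2H wh lam t (0, u, 0) (0, u', 0) :=
  dotProduct_of_single_mulVec ((D2Hbil wh lam h t).compl₁₂ inU inU) u u'

theorem dotProduct_Hvu (h : P.Regular) (t : ℝ) (v : Vec m) (u : Vec l) :
    v ⬝ᵥ P.Hvu wh lam t *ᵥ u = P.D2H wh lam t (0, 0, v) (0, u, 0) :=
  dotProduct_of_single_mulVec ((D2Hbil wh lam h t).compl₁₂ inV inU) v u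

theorem Regular.D2H_affine_affine (h : P.Regular) (t : ℝ) (b c : Vec m) :
    P.D2H wh lam t (0, 0, b) (0, 0, c) = 0 := by
  rw [h.D2H_eq, h.sndDeriv_F_affine_affine, dotProduct_zero]

theorem Hxx_symm (h : P.Regular) (t : ℝ) : (P.Hxx wh lam t)ᵀ = P.Hxx wh lam t := by
  ext i j
  exact h.D2H_symm wh lam t _ _

/-- The integrand of the second variation is the second derivative of the pre-Hamiltonian. -/
theorem integrand_eq (h : P.Regular) (t : ℝ) (x : Vec n) (u : Vec l) (v : Vec m) :
    (1 / 2) * (x ⬝ᵥ P.Hxx wh lam t *ᵥ x) + u ⬝ᵥ P.Hux wh lam t *ᵥ x + v ⬝ᵥ P.Hvx wh lam t *ᵥ x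
      + (1 / 2) * (u ⬝ᵥ P.Huu wh lam t *ᵥ u) + v ⬝ᵥ P.Hvu wh lam t *ᵥ u =
    (1 / 2) * P.D2H wh lam t (x, u, v) (x, u, v) := by
  rw [dotProduct_Hxx wh lam h, dotProduct_Hux wh lam h, dotProduct_Hvx wh lam h,
    dotProduct_Huu wh lam h, dotProduct_Hvu wh lam h]
  have h0 : ((x, u, v) : Vec n × Vec l × Vec m) = (x, 0, 0) + (0, u, 0) + (0, 0, v) := by simp
  have h1 := h.D2H_affine_affine wh lam t v v
  have h2 := h.D2H_symm wh lam t (x, 0, 0) (0, u, 0)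
  have h3 := h.D2H_symm wh lam t (x, 0, 0) (0, 0, v)
  have h4 := h.D2H_symm wh lam t (0, u, 0) (0, 0, v)
  rw [h0]
  simp only [← D2Hbil_apply wh lam h] at *
  simp only [map_add, LinearMap.add_apply]
  rw [h1, h2, h3, h4]
  ring

end Problem

/-! ### Essentially bounded and Sobolev functions -/

section Sobolev

variable {k : ℕ} {T : ℝ}

theorem exists_ae_bound_of_memLp_top {f : ℝ → Vec k} (hf : MemLp f ∞ (leb T)) :
    ∃ C : NNReal, ∀ᵐ t ∂(leb T), ‖f t‖ ≤ C := by
  have h1 : eLpNorm f ∞ (leb T) ≠ (∞ : ℝ≥0∞) := hf.2.ne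
  rw [eLpNorm_exponent_top] at h1
  refine ⟨(eLpNormEssSup f (leb T)).toNNReal, ?_⟩
  filter_upwards [ae_le_eLpNormEssSup (f := f) (μ := leb T)] with t ht
  rw [← ENNReal.coe_toNNReal h1, enorm_eq_nnnorm, ENNReal.coe_le_coe] at ht
  exact_mod_cast ht

/-- An essentially bounded function has a bounded strongly measurable representative. -/
theorem exists_bddMeas_of_memLp_top {f : ℝ → Vec k} (hf : MemLp f ∞ (leb T)) :
    ∃ g, BddMeas g ∧ f =ᵐ[leb T] g := by
  obtain ⟨C, hC⟩ := exists_ae_bound_of_memLp_top hf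
  set g := hf.1.mk f with hg
  have hgm : StronglyMeasurable g := hf.1.stronglyMeasurable_mk
  have hs : MeasurableSet {t | ‖g t‖ ≤ C} := measurableSet_le hgm.norm.measurable measurable_const
  refine ⟨{t | ‖g t‖ ≤ C}.indicator g, ⟨hgm.indicator hs, C, fun t => ?_⟩, ?_⟩
  · by_cases ht : t ∈ {t | ‖g t‖ ≤ C}
    · rw [indicator_of_mem ht]; exact ht
    · rw [indicator_of_notMem ht, norm_zero]; exact C.2
  · filter_upwards [hC, hf.1.ae_eq_mk] with t h1 h2
    rw [← hg] at h2
    rw [indicator_of_mem]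
    · exact h2
    · rw [mem_ofPred_eq, ← h2]; exact h1

theorem BddMeas.memLp {X : Type*} [NormedAddCommGroup X] {f : ℝ → X} (hf : BddMeas f) (q : ℝ≥0∞) :
    MemLp f q (leb T) := by
  have : IsFiniteMeasure (leb T) := by unfold leb; infer_instance
  obtain ⟨C, hC⟩ := hf.2
  exact MemLp.of_bound hf.1.aestronglyMeasurable C (ae_of_all _ hC)

theorem integrableOn_of_memLp {X : Type*} [NormedAddCommGroup X] {f : ℝ → X} {q : ℝ≥0∞}
    (hq : 1 ≤ q) (hf : MemLp f q (leb T)) : IntegrableOn f (Icc 0 T) := by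
  have : IsFiniteMeasure (leb T) := by unfold leb; infer_instance
  exact hf.integrable hq

/-- An element of a Sobolev space is the primitive of its derivative. -/
theorem IsSobolev.exists_eq_integral (hT : 0 ≤ T) {q : ℝ≥0∞} (hq : 1 ≤ q) {x : ℝ → Vec k}
    (hx : IsSobolev q T x) : ∃ z, MemLp z q (leb T) ∧ IntegrableOn z (Icc 0 T) ∧
      (∀ t ∈ Icc 0 T, x t = x 0 + ∫ s in (0 : ℝ)..t, z s) ∧
      ∀ᵐ t ∂(leb T), HasDerivAt x (z t) t := by
  obtain ⟨z, hz, h⟩ := hx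
  exact ⟨z, hz, integrableOn_of_memLp hq hz, h,
    ae_hasDerivAt_of_eq_integral hT (integrableOn_of_memLp hq hz) h⟩

theorem intervalIntegral_congr_leb {X : Type*} [NormedAddCommGroup X] [NormedSpace ℝ X]
    {f g : ℝ → X} (h : f =ᵐ[leb T] g) {t : ℝ} (ht : t ∈ Icc 0 T) :
    ∫ s in (0 : ℝ)..t, f s = ∫ s in (0 : ℝ)..t, g s := by
  refine intervalIntegral.integral_congr_ae ?_
  rw [leb, EventuallyEq, ae_restrict_iff' measurableSet_Icc] at h
  filter_upwards [h] with s hs hs'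
  rw [uIoc_of_le ht.1] at hs'
  exact hs ⟨hs'.1.le, hs'.2.trans ht.2⟩

/-- A function in `W^{1,∞}` is the primitive of a bounded measurable function. -/
theorem IsSobolev.exists_bddMeas (hT : 0 ≤ T) {x : ℝ → Vec k} (hx : IsSobolev ∞ T x) :
    ∃ z, BddMeas z ∧ (∀ t ∈ Icc 0 T, x t = x 0 + ∫ s in (0 : ℝ)..t, z s) ∧
      (∃ C, LipschitzOnWith C x (Icc 0 T)) ∧ ∀ᵐ t ∂(leb T), HasDerivAt x (z t) t := by
  obtain ⟨z, hz, -, h, -⟩ := hx.exists_eq_integral hT le_top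
  obtain ⟨g, hg, hzg⟩ := exists_bddMeas_of_memLp_top hz
  have h' : ∀ t ∈ Icc 0 T, x t = x 0 + ∫ s in (0 : ℝ)..t, g s := fun t ht => by
    rw [h t ht, intervalIntegral_congr_leb hzg ht]
  obtain ⟨C, hC⟩ := hg.2
  exact ⟨g, hg, h', ⟨C.toNNReal, lipschitzOnWith_of_eq_integral (hg.integrableOn T)
    (ae_of_all _ fun t => (hC t).trans (Real.le_coe_toNNReal C)) h'⟩,
    ae_hasDerivAt_of_eq_integral hT (hg.integrableOn T) h'⟩

theorem lipschitzOnWith_comp_contDiff {X Y : Type*} [NormedAddCommGroup X] [NormedSpace ℝ X]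
    [NormedAddCommGroup Y] [NormedSpace ℝ Y] {g : X → Y} (hg : ContDiff ℝ 1 g) {f : ℝ → X}
    {C : NNReal} (hf : LipschitzOnWith C f (Icc 0 T)) :
    ∃ K, LipschitzOnWith K (fun t => g (f t)) (Icc 0 T) := by
  have h1 : IsCompact (f '' Icc 0 T) := isCompact_Icc.image_of_continuousOn hf.continuousOn
  obtain ⟨K, hK⟩ := (hg.locallyLipschitz.locallyLipschitzOn
    (s := f '' Icc 0 T)).exists_lipschitzOnWith_of_compact h1
  exact ⟨K * C, hK.comp hf (mapsTo_image _ _)⟩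

end Sobolev

/-! ### The costate as a function of the multiplier -/

namespace ControlSystem

variable {X U : Type*} [NormedAddCommGroup X] [NormedSpace ℝ X] [ProperSpace X]
  [NormedAddCommGroup U] [NormedSpace ℝ U] [ProperSpace U]
  {ι₁ ι₂ : Type*} [Fintype ι₁] [Fintype ι₂]
  (Q : ControlSystem X U ((ι₁ → ℝ) × (ι₂ → ℝ)))

theorem pair_add_left (lam lam' y : (ι₁ → ℝ) × (ι₂ → ℝ)) :
    pair (lam + lam') y = pair lam y + pair lam' y := by
  rw [pair_comm, pair_add, pair_comm y, pair_comm y]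

theorem costate_add (lam lam' : (ι₁ → ℝ) × (ι₂ → ℝ)) (t : ℝ) :
    Q.costate (lam + lam') t = Q.costate lam t + Q.costate lam' t := by
  have h : BoundedContinuousFunction.const ℝ ((Q.dEll (lam + lam')).comp
      (ContinuousLinearMap.inr ℝ X X)) = BoundedContinuousFunction.const ℝ ((Q.dEll lam).comp
      (ContinuousLinearMap.inr ℝ X X)) + BoundedContinuousFunction.const ℝ ((Q.dEll lam').comp
      (ContinuousLinearMap.inr ℝ X X)) := by
    refine BoundedContinuousFunction.ext fun t => ContinuousLinearMap.ext fun x => ?_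
    exact pair_add_left _ _ _
  rw [costate, revCostate, h, map_add]
  rfl

theorem costate_smul (c : ℝ) (lam : (ι₁ → ℝ) × (ι₂ → ℝ)) (t : ℝ) :
    Q.costate (c • lam) t = c • Q.costate lam t := by
  have h : BoundedContinuousFunction.const ℝ ((Q.dEll (c • lam)).comp
      (ContinuousLinearMap.inr ℝ X X)) = c • BoundedContinuousFunction.const ℝ ((Q.dEll lam).comp
      (ContinuousLinearMap.inr ℝ X X)) := by
    refine BoundedContinuousFunction.ext fun t => ContinuousLinearMap.ext fun x => ?_
    exact pair_smul_left _ _ _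
  rw [costate, revCostate, h, map_smul]
  rfl

/-- The adjoint equation has only one solution with a given terminal value. -/
theorem eq_costate (lam : (ι₁ → ℝ) × (ι₂ → ℝ)) {q : ℝ → X →L[ℝ] ℝ}
    (hq : ContinuousOn q (Icc 0 Q.T))
    (hqe : ∀ t ∈ Icc 0 Q.T, q t = q 0 + ∫ s in (0 : ℝ)..t, -(q s).comp (Q.A s))
    (hqT : q Q.T = (Q.dEll lam).comp (ContinuousLinearMap.inr ℝ X X)) :
    ∀ t ∈ Icc 0 Q.T, q t = Q.costate lam t := by
  have hT := Q.T_nonneg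
  have hcm : ∀ s, clamp Q.T (Q.T - s) ∈ Icc 0 Q.T := fun s => clamp_mem hT _
  have hcont : Continuous fun s => q (clamp Q.T (Q.T - s)) :=
    hq.comp_continuous ((continuous_clamp Q.T).comp (by fun_prop)) hcm
  obtain ⟨C, hC⟩ := isCompact_Icc.exists_bound_of_continuousOn hq
  let r : ℝ →ᵇ (X →L[ℝ] ℝ) := BoundedContinuousFunction.ofNormedAddCommGroup
    (fun s => q (clamp Q.T (Q.T - s))) hcont C (fun s => hC _ (hcm s))
  have hr : ∀ s, r s = q (clamp Q.T (Q.T - s)) := fun _ => rfl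
  have hi : ∀ t ∈ Icc 0 Q.T, IntervalIntegrable (fun s => -(q s).comp (Q.A s)) volume 0 t := by
    intro t ht
    refine ContinuousOn.intervalIntegrable ?_
    rw [uIcc_of_le ht.1]
    exact ((hq.mono (Icc_subset_Icc_right ht.2)).clm_comp Q.A.continuous.continuousOn).neg
  have hkey : r = Q.revCostate lam := by
    refine (eq_solve_iff hT Q.adjointA _ _).2 ?_
    ext1 s
    rw [BoundedContinuousFunction.add_apply, volterra_apply]
    change r s = _ + primitive Q.T (fun s => Q.adjointA s (r s)) s
    have hint : IntegrableOn (fun s => Q.adjointA s (r s)) (Icc 0 Q.T) :=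
      (BddMeas.clm (bddMeas_bcf _) (bddMeas_bcf _)).integrableOn _
    have hcs : clamp Q.T (Q.T - s) = Q.T - clamp Q.T s := by
      unfold clamp
      rcases le_total s 0 with h | h <;> rcases le_total s Q.T with h' | h' <;>
        simp [h, h', hT]
      linarith
    rw [primitive_apply hT hint, hr, hcs]
    set σ := clamp Q.T s
    have hσ : σ ∈ Icc 0 Q.T := clamp_mem hT s
    have hσ' : Q.T - σ ∈ Icc 0 Q.T := ⟨by linarith [hσ.2], by linarith [hσ.1]⟩
    have h2 := intervalIntegral.integral_comp_sub_left (a := 0) (b := σ)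
      (fun s => (q s).comp (Q.A s)) Q.T
    rw [sub_zero] at h2
    have h3 : ∫ s in (0 : ℝ)..σ, Q.adjointA s (r s) =
        ∫ s in (0 : ℝ)..σ, (q (Q.T - s)).comp (Q.A (Q.T - s)) := by
      refine intervalIntegral.integral_congr fun t ht => ?_
      rw [uIcc_of_le hσ.1] at ht
      change (r t).comp (Q.A (Q.T - t)) = _
      rw [hr, clamp_of_mem ⟨by linarith [ht.2, hσ.2], by linarith [ht.1]⟩]
    have h4 := intervalIntegral.integral_interval_sub_left (hi Q.T ⟨hT, le_rfl⟩) (hi _ hσ')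
    rw [intervalIntegral.integral_neg (a := Q.T - σ)] at h4
    have h5 := hqe _ hσ'
    have h6 := hqe Q.T ⟨hT, le_rfl⟩
    rw [h3, h2, ← hqT]
    change q (Q.T - σ) = q Q.T + _
    rw [h5, h6, ← neg_eq_iff_eq_neg.2 h4]
    abel
  intro t ht
  have := hr (Q.T - t)
  rw [sub_sub_cancel, clamp_of_mem ht, hkey] at this
  exact this.symm

end ControlSystem

/-! ### The control system attached to a reference trajectory -/

namespace Problem

variable {n l m dphi deta : ℕ} {P : Problem n l m dphi deta} {wh : Triple n l m}

variable (P wh) in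
/-- A reference trajectory that is Lipschitz continuous together with its controls. -/
structure Reference : Prop where
  T_pos : 0 < P.T
  regular : P.Regular
  lip : ∃ C, LipschitzOnWith C wh.val (Icc 0 P.T)
  eq : ∀ t ∈ Icc 0 P.T, wh.x t = wh.x 0 + ∫ s in (0 : ℝ)..t, P.F (wh.val s)

theorem IsTrajectory.reference (hT : 0 < P.T) (hreg : P.Regular)
    (hu : ContDiffOn ℝ ∞ wh.u (Set.Icc 0 P.T)) (hv : ContDiffOn ℝ ∞ wh.v (Set.Icc 0 P.T))
    (h : P.IsTrajectory wh) : P.Reference wh where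
  T_pos := hT
  regular := hreg
  lip := by
    obtain ⟨_, _, _, ⟨C, hC⟩, _⟩ := h.1.1.exists_bddMeas hT.le
    obtain ⟨D, hD⟩ := ((hu.of_le (by norm_num)).locallyLipschitzOn
      (convex_Icc 0 P.T)).exists_lipschitzOnWith_of_compact isCompact_Icc
    obtain ⟨E, hE⟩ := ((hv.of_le (by norm_num)).locallyLipschitzOn
      (convex_Icc 0 P.T)).exists_lipschitzOnWith_of_compact isCompact_Icc
    exact ⟨_, hC.prodMk (hD.prodMk hE)⟩
  eq := by
    obtain ⟨z, _, h1, _, h2⟩ := h.1.1.exists_bddMeas hT.le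
    intro t ht
    rw [h1 t ht]
    congr 1
    refine intervalIntegral_congr_leb ?_ ht
    filter_upwards [h.2, h2] with s h3 h4
    rw [← h4.deriv, h3]

namespace Reference

variable (r : P.Reference wh)


theorem T_nonneg (r : P.Reference wh) : 0 ≤ P.T := r.T_pos.le

theorem zero_mem (r : P.Reference wh) : (0 : ℝ) ∈ Icc 0 P.T := ⟨le_rfl, r.T_nonneg⟩

theorem T_mem (r : P.Reference wh) : P.T ∈ Icc 0 P.T := ⟨r.T_nonneg, le_rfl⟩

theorem continuousOn (r : P.Reference wh) : ContinuousOn wh.val (Icc 0 P.T) :=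
  r.lip.choose_spec.continuousOn

/-- The reference process, extended by constants outside `[0, T]`. -/
def process (r : P.Reference wh) : ℝ →ᵇ Vec n × Vec l × Vec m :=
  BoundedContinuousFunction.ofNormedAddCommGroup (fun t => wh.val (clamp P.T t))
    (r.continuousOn.comp_continuous (continuous_clamp P.T) (clamp_mem r.T_nonneg))
    (isCompact_Icc.exists_bound_of_continuousOn r.continuousOn).choose
    (fun t => (isCompact_Icc.exists_bound_of_continuousOn r.continuousOn).choose_spec _
      (clamp_mem r.T_nonneg t))

theorem process_of_mem (r : P.Reference wh) {t : ℝ} (ht : t ∈ Icc 0 P.T) :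
    r.process t = wh.val t := by
  change wh.val (clamp P.T t) = _
  rw [clamp_of_mem ht]

/-- The control system of the problem; its endpoint map collects the cost and the constraints. -/
def sys (r : P.Reference wh) :
    ControlSystem (Vec n) (Vec l × Vec m) ((Fin (dphi + 1) → ℝ) × (Fin deta → ℝ)) where
  T := P.T
  T_nonneg := r.T_nonneg
  F := P.F
  contDiff_F := r.regular.contDiff_F
  G q := (fun i => P.phi i q, fun j => P.eta j q)
  contDiff_G := (contDiff_pi.2 fun i => (r.regular.2.1 i).1).prodMk
    (contDiff_pi.2 fun j => (r.regular.2.2 j).1)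
  w := r.process
  w_eq t := by
    have ht := clamp_mem r.T_nonneg t
    rw [r.process_of_mem r.zero_mem]
    change wh.x (clamp P.T t) = wh.x 0 + _
    rw [r.eq _ ht]
    congr 1
    refine intervalIntegral.integral_congr fun s hs => ?_
    rw [uIcc_of_le ht.1] at hs
    change P.F (wh.val s) = P.F (r.process s)
    rw [r.process_of_mem ⟨hs.1, hs.2.trans ht.2⟩]

theorem dF_eq (r : P.Reference wh) {t : ℝ} (ht : t ∈ Icc 0 P.T) :
    r.sys.dF t = fderiv ℝ P.F (wh.val t) := by
  change fderiv ℝ P.F (r.process t) = _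
  rw [r.process_of_mem ht]

theorem d2F_eq (r : P.Reference wh) {t : ℝ} (ht : t ∈ Icc 0 P.T) :
    r.sys.d2F t = fderiv ℝ (fderiv ℝ P.F) (wh.val t) := by
  change fderiv ℝ (fderiv ℝ P.F) (r.process t) = _
  rw [r.process_of_mem ht]

theorem ends_xh (r : P.Reference wh) : r.sys.ends r.sys.xh = P.ends wh.x := by
  change ((r.process 0).1, (r.process P.T).1) = _
  rw [r.process_of_mem r.zero_mem, r.process_of_mem r.T_mem]
  rfl

/-- The multiplier `(α, β, p)` with the costate determined by `(α, β)`. -/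
def mult (r : P.Reference wh) :
    (Fin (dphi + 1) → ℝ) × (Fin deta → ℝ) →ₗ[ℝ] Multiplier n dphi deta where
  toFun lam := (lam.1, lam.2, fun t i => r.sys.costate lam t (Pi.single i 1))
  map_add' lam lam' := by
    refine Prod.ext rfl (Prod.ext rfl (funext fun t => funext fun i => ?_))
    change r.sys.costate (lam + lam') t _ = r.sys.costate lam t _ + r.sys.costate lam' t _
    rw [r.sys.costate_add]
    rfl
  map_smul' c lam := by
    refine Prod.ext rfl (Prod.ext rfl (funext fun t => funext fun i => ?_))
    change r.sys.costate (c • lam) t _ = c • r.sys.costate lam t _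
    rw [r.sys.costate_smul]
    rfl

theorem dotProduct_of_single {k : ℕ} (f : Vec k →L[ℝ] ℝ) (y : Vec k) :
    (fun i => f (Pi.single i 1)) ⬝ᵥ y = f y := by
  conv_rhs => rw [pi_eq_sum_univ' y, map_sum]
  refine Finset.sum_congr rfl fun i _ => ?_
  have : y i • (Pi.single i (1 : ℝ) : Vec k) = fun j => y i * if i = j then 1 else 0 := by
    ext j
    rw [Pi.smul_apply, Pi.single_apply, smul_eq_mul]
    simp only [eq_comm]
  rw [mul_comm, ← smul_eq_mul, ← map_smul]

theorem mult_dotProduct (r : P.Reference wh) (lam : (Fin (dphi + 1) → ℝ) × (Fin deta → ℝ)) (t : ℝ)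
    (y : Vec n) : (r.mult lam).2.2 t ⬝ᵥ y = r.sys.costate lam t y :=
  dotProduct_of_single _ y

theorem D2H_mult (r : P.Reference wh) (lam : (Fin (dphi + 1) → ℝ) × (Fin deta → ℝ)) {t : ℝ}
    (ht : t ∈ Icc 0 P.T) (d d₁ : Vec n × Vec l × Vec m) :
    P.D2H wh (r.mult lam) t d d₁ = r.sys.costate lam t (r.sys.d2F t d d₁) := by
  rw [r.regular.D2H_eq, mult_dotProduct, d2F_eq r ht]

theorem fderiv_ell (r : P.Reference wh) (lam : Multiplier n dphi deta) (q : Vec n × Vec n) :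
    fderiv ℝ (P.ell lam) (P.ends wh.x) q = r.sys.dEll (lam.1, lam.2.1) q := by
  have h1 : HasFDerivAt r.sys.G r.sys.dG (P.ends wh.x) := by
    rw [← r.ends_xh]
    exact (r.sys.contDiff_G.differentiable (by norm_num) _).hasFDerivAt
  have h2 : HasFDerivAt (P.ell lam) (r.sys.dEll (lam.1, lam.2.1)) (P.ends wh.x) :=
    (LinearMap.toContinuousLinearMap (pairLin (lam.1, lam.2.1))).hasFDerivAt.comp _ h1
  rw [h2.fderiv]

theorem D2ell_eq (r : P.Reference wh) (lam : Multiplier n dphi deta) (q q' : Vec n × Vec n) :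
    P.D2ell wh lam q q' = pair (lam.1, lam.2.1) (r.sys.d2G q q') := by
  set L := LinearMap.toContinuousLinearMap (pairLin (lam.1, lam.2.1)) with hL
  have h1 : HasFDerivAt (fderiv ℝ r.sys.G) r.sys.d2G (P.ends wh.x) := by
    rw [← r.ends_xh]
    exact ((contDiff_fderiv r.sys.contDiff_G).differentiable (by norm_num) _).hasFDerivAt
  have h2 : fderiv ℝ (P.ell lam) = fun z =>
      ContinuousLinearMap.compL ℝ _ _ _ L (fderiv ℝ r.sys.G z) := by
    ext1 z
    have h3 : HasFDerivAt (P.ell lam) (L.comp (fderiv ℝ r.sys.G z)) z :=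
      L.hasFDerivAt.comp _ (r.sys.contDiff_G.differentiable (by norm_num) _).hasFDerivAt
    exact h3.fderiv
  have h3 : HasFDerivAt (fderiv ℝ (P.ell lam))
      ((ContinuousLinearMap.compL ℝ _ _ _ L).comp r.sys.d2G) (P.ends wh.x) := by
    rw [h2]
    exact (ContinuousLinearMap.compL ℝ _ _ _ L).hasFDerivAt.comp _ h1
  rw [D2ell, h3.fderiv]
  rfl

/-- A nonnegative, normalized functional that annihilates the first variation is a Lagrange
multiplier, with the solution of the adjoint equation as costate. -/
theorem mult_mem (r : P.Reference wh) {lam : (Fin (dphi + 1) → ℝ) × (Fin deta → ℝ)}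
    (hn : ∑ i, |lam.1 i| + ∑ j, |lam.2 j| = 1) (hpos : ∀ i, 0 ≤ lam.1 i)
    (h : ∀ z, pair lam (r.sys.first z) = 0) : r.mult lam ∈ P.multipliers wh := by
  obtain ⟨h1, h2⟩ := r.sys.stationarity lam r.T_pos h
  have hq := (r.sys.bddMeas_costate_comp_A lam).neg
  have hder := r.sys.ae_hasDerivAt_costate lam
  have hderiv : ∀ᵐ t ∂(leb P.T), ∀ y : Vec n,
      deriv (r.mult lam).2.2 t ⬝ᵥ y = -r.sys.costate lam t (r.sys.A t y) := by
    filter_upwards [hder] with t ht y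
    have h3 : HasDerivAt (r.mult lam).2.2
        (fun i => (-(r.sys.costate lam t).comp (r.sys.A t)) (Pi.single i 1)) t := by
      rw [hasDerivAt_pi]
      intro i
      have := ht.clm_apply (hasDerivAt_const t (Pi.single i (1 : ℝ) : Vec n))
      rw [map_zero, add_zero] at this
      exact this
    rw [h3.deriv, dotProduct_of_single]
    rfl
  have hmem : ∀ᵐ t ∂(leb P.T), t ∈ Icc 0 P.T := ae_restrict_mem measurableSet_Icc
  refine ⟨hn, hpos, ?_, ?_, ?_, ?_, ?_⟩
  · refine ⟨fun t i => (-(r.sys.costate lam t).comp (r.sys.A t)) (Pi.single i 1), ?_, ?_⟩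
    · refine BddMeas.memLp ?_ _
      have h3 : Continuous fun t => (-(r.sys.costate lam t).comp (r.sys.A t)) :=
        ((r.sys.continuous_costate lam).clm_comp r.sys.A.continuous).neg
      have h4 : Continuous fun t => fun i : Fin n =>
          (-(r.sys.costate lam t).comp (r.sys.A t)) (Pi.single i 1) :=
        continuous_pi fun i => h3.clm_apply continuous_const
      refine ⟨h4.stronglyMeasurable, ?_⟩
      obtain ⟨C, hC⟩ := hq.2
      refine ⟨C, fun t => (pi_norm_le_iff_of_nonneg ((norm_nonneg _).trans (hC 0))).2 fun i => ?_⟩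
      refine (ContinuousLinearMap.le_opNorm _ _).trans ?_
      refine (mul_le_of_le_one_right (norm_nonneg _) ?_).trans (hC t)
      refine (pi_norm_le_iff_of_nonneg zero_le_one).2 fun j => ?_
      rw [Pi.single_apply]
      split_ifs <;> simp
    · intro t ht
      have h3 := r.sys.costate_eq lam ht
      have hint : IntervalIntegrable (fun t => -(r.sys.costate lam t).comp (r.sys.A t))
        volume 0 t := hq.intervalIntegrable 0 t
      ext i
      have h5 : (∫ s in (0 : ℝ)..t, fun i : Fin n =>
          (-(r.sys.costate lam s).comp (r.sys.A s)) (Pi.single i 1)) i =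
          ∫ s in (0 : ℝ)..t, (-(r.sys.costate lam s).comp (r.sys.A s)) (Pi.single i 1) := by
        let L : (Vec n →L[ℝ] ℝ) →L[ℝ] Vec n := ContinuousLinearMap.pi fun i =>
          ContinuousLinearMap.apply ℝ ℝ (Pi.single i 1)
        have h6 := (ContinuousLinearMap.proj (R := ℝ) (φ := fun _ : Fin n => ℝ)
          i).intervalIntegral_comp_comm ⟨L.integrable_comp hint.1, L.integrable_comp hint.2⟩
        exact h6.symm
      rw [Pi.add_apply, h5]
      change r.sys.costate lam t (Pi.single i 1) = r.sys.costate lam 0 (Pi.single i 1) + _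
      rw [h3, add_apply, ← ContinuousLinearMap.intervalIntegral_apply hint]
  · filter_upwards [hderiv, hmem] with t ht htm y
    rw [ht, neg_neg, r.regular.fderiv_H, mult_dotProduct, r.sys.A_apply, dF_eq r htm]
    rfl
  · intro y
    rw [mult_dotProduct, fderiv_ell r]
    exact h1 y
  · intro y
    rw [mult_dotProduct, fderiv_ell r]
    exact r.sys.costate_T lam y
  · filter_upwards [hmem] with t ht
    have h3 := h2 t ht
    rw [dF_eq r ht] at h3
    refine ⟨fun a => ?_, fun b => ?_⟩ <;>
    · rw [r.regular.fderiv_H, mult_dotProduct]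
      exact h3 _

/-- The costate of a Lagrange multiplier is determined by its finite dimensional part. -/
theorem eq_mult (r : P.Reference wh) {lam : Multiplier n dphi deta} (h : lam ∈ P.multipliers wh)
    {t : ℝ} (ht : t ∈ Icc 0 P.T) : lam.2.2 t = (r.mult (lam.1, lam.2.1)).2.2 t := by
  obtain ⟨_, _, hs, hc, _, hTT, _⟩ := h
  obtain ⟨z, hz, hze, ⟨C, hC⟩, hzd⟩ := hs.exists_bddMeas r.T_nonneg
  let L : Vec n →L[ℝ] (Vec n →L[ℝ] ℝ) := LinearMap.toContinuousLinearMap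
    { toFun := dotCLM
      map_add' := fun p q => ContinuousLinearMap.ext fun y => add_dotProduct p q y
      map_smul' := fun c p => ContinuousLinearMap.ext fun y => smul_dotProduct c p y }
  have key := r.sys.eq_costate (lam.1, lam.2.1) (q := fun t => dotCLM (lam.2.2 t))
    (L.continuous.comp_continuousOn hC.continuousOn) ?_ ?_ t ht
  · ext i
    have h1 := DFunLike.congr_fun key (Pi.single i 1)
    rw [dotCLM_apply, dotProduct_single, mul_one] at h1
    exact h1
  · intro t ht
    change t ∈ Icc 0 P.T at ht
    have h1 : dotCLM (lam.2.2 t) = dotCLM (lam.2.2 0) + ∫ s in (0 : ℝ)..t, L (z s) := by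
      rw [L.intervalIntegral_comp_comm (hz.intervalIntegrable 0 t)]
      change L _ = L _ + L _
      rw [← map_add, ← hze t ht]
    rw [h1]
    congr 1
    refine intervalIntegral_congr_leb ?_ ht
    filter_upwards [hc, hzd, ae_restrict_mem measurableSet_Icc] with s h2 h3 hs
    ext1 y
    have h4 := h2 y
    rw [h3.deriv, r.regular.fderiv_H] at h4
    change z s ⬝ᵥ y = -(lam.2.2 s ⬝ᵥ r.sys.A s y)
    rw [r.sys.A_apply, dF_eq r hs, ← neg_eq_iff_eq_neg]
    exact h4
  · ext1 y
    have := hTT y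
    rw [fderiv_ell r] at this
    exact this

end Reference
end Problem

/-! ### Calculus of Lipschitz curves and matrices -/

section LipOn

variable {X Y : Type*} [NormedAddCommGroup X] [NormedSpace ℝ X] [NormedAddCommGroup Y]
  [NormedSpace ℝ Y] {T : ℝ}

/-- Lipschitz continuity on `[0, T]` with an unspecified constant. -/
def LipOn (T : ℝ) (f : ℝ → X) : Prop := ∃ K, LipschitzOnWith K f (Icc 0 T)

theorem LipOn.continuousOn {f : ℝ → X} (hf : LipOn T f) : ContinuousOn f (Icc 0 T) :=
  hf.choose_spec.continuousOn

theorem lipOn_const (c : X) : LipOn T (fun _ => c) := ⟨0, (LipschitzWith.const c).lipschitzOnWith⟩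

theorem LipOn.add {f g : ℝ → X} (hf : LipOn T f) (hg : LipOn T g) :
    LipOn T (fun t => f t + g t) := by
  obtain ⟨K, hK⟩ := hf
  obtain ⟨L, hL⟩ := hg
  exact ⟨K + L, hK.add hL⟩

theorem LipOn.clm_apply {A : ℝ → X →L[ℝ] Y} {f : ℝ → X} (hA : LipOn T A) (hf : LipOn T f) :
    LipOn T (fun t => A t (f t)) := by
  obtain ⟨K, hK⟩ := hA
  obtain ⟨L, hL⟩ := hf
  exact LipschitzOnWith.clm_apply' hK hL

theorem LipOn.clm_comp {f : ℝ → X} (A : X →L[ℝ] Y) (hf : LipOn T f) : LipOn T (fun t => A (f t)) :=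
  (lipOn_const A).clm_apply hf

theorem LipOn.mul {f g : ℝ → ℝ} (hf : LipOn T f) (hg : LipOn T g) :
    LipOn T (fun t => f t * g t) :=
  (hf.clm_comp (ContinuousLinearMap.mul ℝ ℝ)).clm_apply hg

theorem LipOn.sum {ι : Type*} (s : Finset ι) {f : ι → ℝ → X} (hf : ∀ i ∈ s, LipOn T (f i)) :
    LipOn T (fun t => ∑ i ∈ s, f i t) := by
  classical
  induction s using Finset.induction_on with
  | empty => simpa using lipOn_const (0 : X)
  | insert a s ha ih =>
    simp only [Finset.sum_insert ha]
    exact (hf a (Finset.mem_insert_self a s)).add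
      (ih fun i hi => hf i (Finset.mem_insert_of_mem hi))

theorem lipOn_pi {k : ℕ} {f : ℝ → Vec k} : LipOn T f ↔ ∀ i, LipOn T (fun t => f t i) := by
  constructor
  · intro h i
    exact h.clm_comp (ContinuousLinearMap.proj (R := ℝ) (φ := fun _ : Fin k => ℝ) i)
  · intro h
    choose K hK using h
    refine ⟨∑ i, K i, LipschitzOnWith.of_dist_le_mul fun s hs t ht => ?_⟩
    refine (dist_pi_le_iff (by positivity)).2 fun i => ((hK i).dist_le_mul s hs t ht).trans ?_
    refine mul_le_mul_of_nonneg_right ?_ dist_nonneg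
    exact_mod_cast Finset.single_le_sum (f := K) (fun j _ => zero_le) (Finset.mem_univ i)

theorem LipOn.dotProduct {k : ℕ} {x y : ℝ → Vec k} (hx : LipOn T x) (hy : LipOn T y) :
    LipOn T (fun t => x t ⬝ᵥ y t) :=
  LipOn.sum _ fun i _ => (lipOn_pi.1 hx i).mul (lipOn_pi.1 hy i)

theorem LipOn.mulVec {a b : ℕ} {A : ℝ → Matrix (Fin a) (Fin b) ℝ} {x : ℝ → Vec b}
    (hA : ∀ i j, LipOn T (fun t => A t i j)) (hx : LipOn T x) : LipOn T (fun t => A t *ᵥ x t) :=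
  lipOn_pi.2 fun i => (lipOn_pi.2 (hA i)).dotProduct hx

theorem LipOn.ae_hasDerivAt {f : ℝ → ℝ} (hf : LipOn T f) :
    ∀ᵐ t ∂(leb T), HasDerivAt f (deriv f t) t := by
  obtain ⟨K, hK⟩ := hf
  have h1 := hK.ae_differentiableWithinAt_of_mem (μ := volume)
  have h2 : ∀ᵐ t : ℝ, t ≠ 0 ∧ t ≠ T := by
    refine Filter.Eventually.and ?_ ?_ <;> simp [ae_iff, measure_singleton]
  rw [leb, ae_restrict_iff' measurableSet_Icc]
  filter_upwards [h1, h2] with t ht htne htT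
  have hio : Icc 0 T ∈ 𝓝 t :=
    Icc_mem_nhds (lt_of_le_of_ne htT.1 (Ne.symm htne.1)) (lt_of_le_of_ne htT.2 htne.2)
  exact ((ht htT).differentiableAt hio).hasDerivAt

theorem LipOn.exists_deriv_bound {f : ℝ → ℝ} (hf : LipOn T f) :
    ∃ C, 0 ≤ C ∧ ∀ t ∈ Ioo 0 T, |deriv f t| ≤ C := by
  obtain ⟨K, hK⟩ := hf
  refine ⟨K, K.2, fun t ht => ?_⟩
  exact norm_deriv_le_of_lipschitzOn (Icc_mem_nhds ht.1 ht.2) hK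

end LipOn

section MatrixCalculus

variable {a b : ℕ}

theorem hasDerivAt_dotProduct {x y : ℝ → Vec a} {x' y' : Vec a} {t : ℝ} (hx : HasDerivAt x x' t)
    (hy : HasDerivAt y y' t) :
    HasDerivAt (fun t => x t ⬝ᵥ y t) (x' ⬝ᵥ y t + x t ⬝ᵥ y') t := by
  rw [hasDerivAt_pi] at hx hy
  refine (HasDerivAt.fun_sum fun i (_ : i ∈ Finset.univ) => (hx i).mul (hy i)).congr_deriv ?_
  rw [Finset.sum_add_distrib]
  rfl

theorem hasDerivAt_mulVec {A : ℝ → Matrix (Fin a) (Fin b) ℝ} {x : ℝ → Vec b} {x' : Vec b}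
    {t : ℝ} (hA : ∀ i j, HasDerivAt (fun s => A s i j) (dotMatrix A t i j) t)
    (hx : HasDerivAt x x' t) :
    HasDerivAt (fun t => A t *ᵥ x t) (dotMatrix A t *ᵥ x t + A t *ᵥ x') t := by
  refine hasDerivAt_pi.2 fun i => ?_
  exact hasDerivAt_dotProduct (hasDerivAt_pi.2 (hA i)) hx

theorem dotProduct_transpose_mulVec (A : Matrix (Fin a) (Fin b) ℝ) (x : Vec b) (y : Vec a) :
    x ⬝ᵥ Aᵀ *ᵥ y = (A *ᵥ x) ⬝ᵥ y := by
  rw [Matrix.mulVec_transpose, dotProduct_comm, ← Matrix.dotProduct_mulVec, dotProduct_comm]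

/-- The pointwise identity behind Goh's transformation: the difference of the integrands is the
derivative of `y ⬝ᵥ Hvx *ᵥ ξ + 1/2 * y ⬝ᵥ S *ᵥ y`. Here `Fv'`, `Hvx'`, `S'` stand for time
derivatives, `HF` for `Hvx * Fv`, and `S`, `V` for the symmetric and antisymmetric parts of the
latter. -/
theorem goh_pointwise {n l m : ℕ} (ξ : Vec n) (u : Vec l) (y v : Vec m)
    (Fx Hxx : Matrix (Fin n) (Fin n) ℝ) (Fu : Matrix (Fin n) (Fin l) ℝ)
    (Fv Fv' : Matrix (Fin n) (Fin m) ℝ) (Hux : Matrix (Fin l) (Fin n) ℝ)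
    (Hvx Hvx' : Matrix (Fin m) (Fin n) ℝ) (Huu : Matrix (Fin l) (Fin l) ℝ)
    (Hvu : Matrix (Fin m) (Fin l) ℝ) (S' : Matrix (Fin m) (Fin m) ℝ) (hxx : Hxxᵀ = Hxx) :
    (1 / 2) * ((ξ + Fv *ᵥ y) ⬝ᵥ Hxx *ᵥ (ξ + Fv *ᵥ y)) + u ⬝ᵥ Hux *ᵥ (ξ + Fv *ᵥ y)
      + v ⬝ᵥ Hvx *ᵥ (ξ + Fv *ᵥ y) + (1 / 2) * (u ⬝ᵥ Huu *ᵥ u) + v ⬝ᵥ Hvu *ᵥ u =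
    ((1 / 2) * (ξ ⬝ᵥ Hxx *ᵥ ξ) + u ⬝ᵥ Hux *ᵥ ξ
      + y ⬝ᵥ (Fvᵀ * Hxx - Hvx' - Hvx * Fx) *ᵥ ξ
      + (1 / 2) * (u ⬝ᵥ Huu *ᵥ u)
      + y ⬝ᵥ (Fvᵀ * Huxᵀ - Hvx * Fu) *ᵥ u
      + (1 / 2) * (y ⬝ᵥ (Fvᵀ * Hxx * Fv - (Hvx * (Fx * Fv - Fv') + (Hvx * (Fx * Fv - Fv'))ᵀ)
          - S') *ᵥ y)
      + v ⬝ᵥ ((1 / 2 : ℝ) • (Hvx * Fv - (Hvx * Fv)ᵀ)) *ᵥ y)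
    + v ⬝ᵥ Hvu *ᵥ u
    + ((v ⬝ᵥ Hvx *ᵥ ξ + y ⬝ᵥ (Hvx' *ᵥ ξ + Hvx *ᵥ (Fx *ᵥ ξ + Fu *ᵥ u + (Fx * Fv - Fv') *ᵥ y)))
      + (1 / 2) * (v ⬝ᵥ ((1 / 2 : ℝ) • (Hvx * Fv + (Hvx * Fv)ᵀ)) *ᵥ y
        + y ⬝ᵥ (S' *ᵥ y + ((1 / 2 : ℝ) • (Hvx * Fv + (Hvx * Fv)ᵀ)) *ᵥ v))) := by
  have e1 : (Fv *ᵥ y) ⬝ᵥ Hxx *ᵥ ξ = ξ ⬝ᵥ Hxx *ᵥ (Fv *ᵥ y) := by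
    conv_rhs => rw [← hxx, dotProduct_transpose_mulVec, dotProduct_comm]
  have e2 : (Hux *ᵥ (Fv *ᵥ y)) ⬝ᵥ u = u ⬝ᵥ Hux *ᵥ (Fv *ᵥ y) := dotProduct_comm _ _
  have e3 (A : Matrix (Fin m) (Fin m) ℝ) (w w' : Vec m) :
    w ⬝ᵥ Aᵀ *ᵥ w' = w' ⬝ᵥ A *ᵥ w := by rw [dotProduct_transpose_mulVec, dotProduct_comm]
  simp only [Matrix.mulVec_add, Matrix.add_mulVec, Matrix.sub_mulVec, dotProduct_add,
    add_dotProduct, dotProduct_sub, Matrix.smul_mulVec, dotProduct_smul, smul_eq_mul, e3]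
  simp only [← Matrix.mulVec_mulVec, dotProduct_transpose_mulVec, Matrix.mulVec_sub,
    Matrix.sub_mulVec, dotProduct_sub]
  rw [e1, e2]
  ring

end MatrixCalculus

/-! ### Goh's transformation -/

namespace Problem

variable {n l m dphi deta : ℕ} {P : Problem n l m dphi deta} {wh : Triple n l m}

namespace Reference

theorem lipOn_costate (r : P.Reference wh) (lam : (Fin (dphi + 1) → ℝ) × (Fin deta → ℝ)) :
    LipOn P.T (r.sys.costate lam) :=
  r.sys.exists_lipschitz_costate lam

theorem lipOn_comp (r : P.Reference wh) {X : Type*} [NormedAddCommGroup X] [NormedSpace ℝ X]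
    {g : Vec n × Vec l × Vec m → X} (hg : ContDiff ℝ 1 g) : LipOn P.T (fun t => g (wh.val t)) :=
  lipschitzOnWith_comp_contDiff hg r.lip.choose_spec

theorem lipOn_Fv (r : P.Reference wh) (i : Fin n) (j : Fin m) :
    LipOn P.T (fun t => P.Fv wh t i j) := by
  have h : LipOn P.T fun t => fderiv ℝ P.F (wh.val t) (0, 0, Pi.single j 1) :=
    r.lipOn_comp (g := fun z => fderiv ℝ P.F z (0, 0, Pi.single j 1))
      ((contDiff_fderiv r.regular.contDiff_F).clm_apply contDiff_const)
  exact lipOn_pi.1 h i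

theorem lipOn_congr {X : Type*} [NormedAddCommGroup X] {T : ℝ} {f g : ℝ → X} (hf : LipOn T f)
    (h : ∀ t ∈ Icc 0 T, f t = g t) : LipOn T g := by
  obtain ⟨K, hK⟩ := hf
  exact ⟨K, fun s hs t ht => by rw [← h s hs, ← h t ht]; exact hK hs ht⟩

theorem lipOn_Hvx (r : P.Reference wh) (lam : (Fin (dphi + 1) → ℝ) × (Fin deta → ℝ))
    (i : Fin m) (j : Fin n) : LipOn P.T (fun t => P.Hvx wh (r.mult lam) t i j) := by
  have h1 : LipOn P.T fun t =>
      fderiv ℝ (P.fieldV (Pi.single i 1)) (wh.val t) (Pi.single j 1, 0, 0) :=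
    r.lipOn_comp (g := fun z => fderiv ℝ (P.fieldV (Pi.single i 1)) z (Pi.single j 1, 0, 0))
      ((contDiff_fderiv (r.regular.contDiff_fieldV _)).clm_apply contDiff_const)
  refine lipOn_congr ((r.lipOn_costate lam).clm_apply h1) fun t ht => ?_
  change _ = P.D2H wh (r.mult lam) t (0, 0, Pi.single i 1) (Pi.single j 1, 0, 0)
  rw [r.regular.D2H_symm, r.regular.D2H_eq, r.mult_dotProduct, r.regular.sndDeriv_F_affine]

theorem lipOn_HvxFv (r : P.Reference wh) (lam : (Fin (dphi + 1) → ℝ) × (Fin deta → ℝ))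
    (i j : Fin m) : LipOn P.T (fun t => (P.Hvx wh (r.mult lam) t * P.Fv wh t) i j) :=
  LipOn.sum Finset.univ fun k _ => (r.lipOn_Hvx lam i k).mul (r.lipOn_Fv k j)

theorem lipOn_S (r : P.Reference wh) (lam : (Fin (dphi + 1) → ℝ) × (Fin deta → ℝ))
    (i j : Fin m) : LipOn P.T (fun t => P.S wh (r.mult lam) t i j) :=
  (lipOn_const (1 / 2 : ℝ)).mul ((r.lipOn_HvxFv lam i j).add (r.lipOn_HvxFv lam j i))

theorem lipOn_V (r : P.Reference wh) (lam : (Fin (dphi + 1) → ℝ) × (Fin deta → ℝ))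
    (i j : Fin m) : LipOn P.T (fun t => P.V wh (r.mult lam) t i j) := by
  have h := (lipOn_const (1 / 2 : ℝ)).mul ((r.lipOn_HvxFv lam i j).add
    ((lipOn_const (-1 : ℝ)).mul (r.lipOn_HvxFv lam j i)))
  refine lipOn_congr h fun t _ => ?_
  simp only [V, Matrix.smul_apply, Matrix.sub_apply, Matrix.transpose_apply, smul_eq_mul]
  ring

theorem ae_hasDerivAt_matrix {a b : ℕ} {T : ℝ} {A : ℝ → Matrix (Fin a) (Fin b) ℝ}
    (hA : ∀ i j, LipOn T (fun t => A t i j)) :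
    ∀ᵐ t ∂(leb T), ∀ i j, HasDerivAt (fun s => A s i j) (dotMatrix A t i j) t :=
  ae_all_iff.2 fun i => ae_all_iff.2 fun j => (hA i j).ae_hasDerivAt

/-- The state of a variation is Lipschitz continuous and satisfies the linearized equation. -/
theorem lipOn_resp (r : P.Reference wh) (z : Variation (Vec n) (Vec l × Vec m)) :
    LipOn P.T (r.sys.resp z) ∧ ∀ᵐ t ∂(leb P.T), HasDerivAt (r.sys.resp z)
      (P.Fx wh t *ᵥ r.sys.resp z t + P.Fu wh t *ᵥ (z.1.2 t).1 + P.Fv wh t *ᵥ (z.1.2 t).2) t := by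
  have hb := r.sys.bddMeas_dF (r.sys.bddMeas_traj z)
  have he : ∀ t ∈ Icc 0 P.T, r.sys.resp z t =
      r.sys.resp z 0 + ∫ s in (0 : ℝ)..t, r.sys.dF s (r.sys.traj z s) := by
    intro t ht
    have := DFunLike.congr_fun (r.sys.resp_eq z) t
    rw [BoundedContinuousFunction.add_apply,
      primitive_apply r.sys.T_nonneg (hb.integrableOn _)] at this
    change _ = _ + ∫ s in (0 : ℝ)..clamp P.T t, _ at this
    rw [clamp_of_mem ht] at this
    rw [r.sys.resp_zero_time]
    exact this
  obtain ⟨C, hC⟩ := hb.2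
  refine ⟨⟨C.toNNReal, lipschitzOnWith_of_eq_integral (hb.integrableOn _)
    (ae_of_all _ fun t => (hC t).trans (Real.le_coe_toNNReal C)) he⟩, ?_⟩
  filter_upwards [ae_hasDerivAt_of_eq_integral r.T_nonneg (hb.integrableOn _) he,
    ae_restrict_mem measurableSet_Icc] with t h1 ht
  rw [linearized_eq, ← r.dF_eq ht]
  exact h1

/-- The integrand of the transformed second variation. -/
def integrandP (r : P.Reference wh) (lam : (Fin (dphi + 1) → ℝ) × (Fin deta → ℝ))
    (ξ : ℝ → Vec n) (u : ℝ → Vec l) (y v : ℝ → Vec m) (t : ℝ) : ℝ :=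
  (1 / 2) * (ξ t ⬝ᵥ P.Hxx wh (r.mult lam) t *ᵥ ξ t)
      + u t ⬝ᵥ P.Hux wh (r.mult lam) t *ᵥ ξ t
      + y t ⬝ᵥ P.M wh (r.mult lam) t *ᵥ ξ t
      + (1 / 2) * (u t ⬝ᵥ P.Huu wh (r.mult lam) t *ᵥ u t)
      + y t ⬝ᵥ P.E wh (r.mult lam) t *ᵥ u t
      + (1 / 2) * (y t ⬝ᵥ P.R wh (r.mult lam) t *ᵥ y t)
      + v t ⬝ᵥ P.V wh (r.mult lam) t *ᵥ y t

theorem intervalIntegrable_D2H (r : P.Reference wh) (lam : (Fin (dphi + 1) → ℝ) × (Fin deta → ℝ))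
    {d d' : ℝ → Vec n × Vec l × Vec m} (hd : BddMeas d) (hd' : BddMeas d') :
    IntervalIntegrable (fun t => P.D2H wh (r.mult lam) t (d t) (d' t)) volume 0 P.T := by
  have h : BddMeas fun t => r.sys.costate lam t (r.sys.d2F t (d t) (d' t)) :=
    BddMeas.clm (r.sys.bddMeas_costate lam) (r.sys.bddMeas_d2F hd hd')
  refine (h.intervalIntegrable 0 P.T).congr_ae ?_
  rw [uIoc_of_le r.T_nonneg]
  filter_upwards [ae_restrict_mem measurableSet_Ioc] with t ht
  exact (r.D2H_mult lam ⟨ht.1.le, ht.2⟩ _ _).symm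

/-- Goh's identity: the second variation along a variation with affine control `v` agrees with the
transformed second variation, up to the term `v ⬝ᵥ Hvu *ᵥ u`. -/
theorem goh_identity (r : P.Reference wh) (lam : (Fin (dphi + 1) → ℝ) × (Fin deta → ℝ))
    (z : Variation (Vec n) (Vec l × Vec m)) {ξ : ℝ → Vec n} {y : ℝ → Vec m} (hy : LipOn P.T y)
    (hy0 : y 0 = 0) (hyd : ∀ᵐ t ∂(leb P.T), HasDerivAt y (z.1.2 t).2 t)
    (hξ : ∀ t ∈ Icc 0 P.T, r.sys.resp z t = ξ t + P.Fv wh t *ᵥ y t) :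
    IntervalIntegrable (r.integrandP lam ξ (fun t => (z.1.2 t).1) y (fun t => (z.1.2 t).2))
      volume 0 P.T ∧
    (1 / 2) * pair lam (r.sys.second z z) =
      P.OmegaP wh (r.mult lam) ξ (fun t => (z.1.2 t).1) y (fun t => (z.1.2 t).2) (y P.T) +
      ∫ t in (0 : ℝ)..P.T, P.D2H wh (r.mult lam) t (0, 0, (z.1.2 t).2) (0, (z.1.2 t).1, 0) := by
  set μ := r.mult lam with hμ
  obtain ⟨hxl, hxd⟩ := r.lipOn_resp z
  set η : ℝ → Vec n := fun t => r.sys.resp z t - P.Fv wh t *ᵥ y t with hη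
  have hηξ : ∀ t ∈ Icc 0 P.T, ξ t = η t := fun t ht => by rw [hη]; simp [hξ t ht]
  have hηl : LipOn P.T η := by
    have := hxl.add ((LipOn.mulVec r.lipOn_Fv hy).clm_comp (-ContinuousLinearMap.id ℝ _))
    refine lipOn_congr this fun t _ => ?_
    simp [hη, sub_eq_add_neg]
  set Θ : ℝ → ℝ := fun t => y t ⬝ᵥ P.Hvx wh μ t *ᵥ η t + (1 / 2) * (y t ⬝ᵥ P.S wh μ t *ᵥ y t)
    with hΘ
  have hΘl : LipOn P.T Θ :=
    (hy.dotProduct (LipOn.mulVec (r.lipOn_Hvx lam) hηl)).add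
      ((lipOn_const _).mul (hy.dotProduct (LipOn.mulVec (r.lipOn_S lam) hy)))
  set J : ℝ → ℝ := r.integrandP lam ξ (fun t => (z.1.2 t).1) y (fun t => (z.1.2 t).2) with hJ
  set I : ℝ → ℝ := fun t => (1 / 2) * P.D2H wh μ t (r.sys.traj z t) (r.sys.traj z t) with hI
  set N : ℝ → ℝ := fun t => P.D2H wh μ t (0, 0, (z.1.2 t).2) (0, (z.1.2 t).1, 0) with hN
  have hIi : IntervalIntegrable I volume 0 P.T :=
    (r.intervalIntegrable_D2H lam (r.sys.bddMeas_traj z) (r.sys.bddMeas_traj z)).const_mul _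
  have hNi : IntervalIntegrable N volume 0 P.T :=
    r.intervalIntegrable_D2H lam
      (bddMeas_zero.prodMk (bddMeas_zero.prodMk
        (BddMeas.clmConst (ContinuousLinearMap.snd ℝ _ _) z.2)))
      (bddMeas_zero.prodMk ((BddMeas.clmConst (ContinuousLinearMap.fst ℝ _ _) z.2).prodMk
        bddMeas_zero))
  have hder : ∀ᵐ t ∂(leb P.T), HasDerivAt Θ (I t - J t - N t) t := by
    filter_upwards [hxd, hyd, ae_hasDerivAt_matrix r.lipOn_Fv,
      ae_hasDerivAt_matrix (r.lipOn_Hvx lam), ae_hasDerivAt_matrix (r.lipOn_S lam),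
      ae_restrict_mem measurableSet_Icc] with t h1 h2 h3 h4 h5 ht
    have h6 : HasDerivAt η (P.Fx wh t *ᵥ η t + P.Fu wh t *ᵥ (z.1.2 t).1 + P.B wh t *ᵥ y t) t := by
      refine (h1.sub (hasDerivAt_mulVec h3 h2)).congr_deriv ?_
      have : r.sys.resp z t = η t + P.Fv wh t *ᵥ y t := by rw [hη]; simp
      rw [this, B, Matrix.sub_mulVec, Matrix.mulVec_add, ← Matrix.mulVec_mulVec]
      abel
    have h7 := (hasDerivAt_dotProduct h2 (hasDerivAt_mulVec h4 h6)).add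
      ((hasDerivAt_dotProduct h2 (hasDerivAt_mulVec h5 h2)).const_mul (1 / 2 : ℝ))
    refine h7.congr_deriv ?_
    have h8 := goh_pointwise (ξ t) (z.1.2 t).1 (y t) (z.1.2 t).2 (P.Fx wh t) (P.Hxx wh μ t)
      (P.Fu wh t) (P.Fv wh t) (dotMatrix (P.Fv wh) t) (P.Hux wh μ t) (P.Hvx wh μ t)
      (dotMatrix (P.Hvx wh μ) t) (P.Huu wh μ t) (P.Hvu wh μ t) (dotMatrix (P.S wh μ) t)
      (Hxx_symm wh μ r.regular t)
    rw [← hξ t ht, integrand_eq wh μ r.regular] at h8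
    have h9 : N t = (z.1.2 t).2 ⬝ᵥ P.Hvu wh μ t *ᵥ (z.1.2 t).1 :=
      (dotProduct_Hvu wh μ r.regular t _ _).symm
    rw [← hηξ t ht, h9]
    change I t = J t + _ + _ at h8
    rw [h8]
    simp only [B, S]
    ring
  have hΘi := integrable_of_lipschitz r.T_nonneg hΘl.choose_spec hder
  have hJi : IntervalIntegrable J volume 0 P.T := by
    have := (hIi.sub hNi).sub hΘi
    refine this.congr fun t _ => ?_
    change I t - N t - (I t - J t - N t) = J t
    ring
  refine ⟨hJi, ?_⟩
  have hint := integral_eq_sub_of_lipschitz r.T_nonneg hΘl.choose_spec hder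
  rw [intervalIntegral.integral_sub (hIi.sub hJi) hNi, intervalIntegral.integral_sub hIi hJi]
    at hint
  have hΘ0 : Θ 0 = 0 := by simp [hΘ, hy0]
  have hΘT : Θ P.T = y P.T ⬝ᵥ (P.Hvx wh μ P.T *ᵥ ξ P.T + (1 / 2 : ℝ) • (P.S wh μ P.T *ᵥ y P.T)) := by
    rw [hηξ P.T r.T_mem, dotProduct_add, dotProduct_smul, smul_eq_mul]
  have hx0 : r.sys.resp z 0 = ξ 0 := by rw [hξ 0 r.zero_mem, hy0]; simp
  rw [r.sys.pair_second, mul_add, ← intervalIntegral.integral_const_mul]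
  have hII : ∫ t in (0 : ℝ)..P.T,
      (1 / 2) * r.sys.costate lam t (r.sys.d2F t (r.sys.traj z t) (r.sys.traj z t)) =
      ∫ t in (0 : ℝ)..P.T, I t := by
    refine intervalIntegral.integral_congr fun t ht => ?_
    rw [uIcc_of_le r.T_nonneg] at ht
    change _ = _ * _
    rw [hμ, r.D2H_mult lam ht]
  change _ + ∫ t in (0 : ℝ)..P.T, _ = (P.g wh μ (ξ 0) (ξ P.T) (y P.T) +
    ∫ t in (0 : ℝ)..P.T, J t) + ∫ t in (0 : ℝ)..P.T, N t
  rw [hII, g, ← hΘT, D2ell_eq r]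
  have he : r.sys.ends (r.sys.resp z) = (ξ 0, ξ P.T + P.Fv wh P.T *ᵥ y P.T) := by
    rw [← hx0, ← hξ P.T r.T_mem]
    rfl
  rw [he]
  have hp : (μ.1, μ.2.1) = lam := rfl
  rw [hp]
  linarith

end Reference
end Problem

/-! ### Concentrated controls -/

section Bumps

/-- Finitely many normalized smooth functions with disjoint supports close to a given time. -/
theorem exists_bumps {T t₀ δ : ℝ} (h0 : 0 ≤ t₀) (hT : t₀ + δ ≤ T) (hδ : 0 < δ) (K : ℕ) :
    ∃ χ : Fin K → ℝ → ℝ, (∀ i, ContDiff ℝ 1 (χ i)) ∧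
      (∀ i s, χ i s ≠ 0 → t₀ < s ∧ s < t₀ + δ) ∧
      (∀ i j, i ≠ j → ∀ s, χ i s * χ j s = 0) ∧ ∀ i, ∫ s in (0 : ℝ)..T, χ i s ^ 2 = 1 := by
  set d : ℝ := δ / (K + 2) with hd
  have hd0 : 0 < d := by positivity
  have hδd : δ = d * (K + 2) := by rw [hd]; field_simp
  -- the bumps have centers `t₀ + d`, …, `t₀ + K * d` and radius `d / 2`
  let c : Fin K → ℝ := fun i => t₀ + d * (i + 1)
  let b : (i : Fin K) → ContDiffBump (c i) := fun i => ⟨d / 4, d / 2, by linarith, by linarith⟩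
  have hb (i : Fin K) (s : ℝ) (hs : b i s ≠ 0) : |s - c i| < d / 2 := by
    have : s ∈ Function.support (b i) := hs
    rw [(b i).support_eq, Metric.mem_ball, Real.dist_eq] at this
    exact this
  have hci (i : Fin K) : t₀ + d ≤ c i ∧ c i ≤ t₀ + d * K := by
    have h1 : ((i : ℕ) : ℝ) + 1 ≤ K := by exact_mod_cast i.2
    have h2 : (0 : ℝ) ≤ ((i : ℕ) : ℝ) := by positivity
    exact ⟨by simp only [c]; nlinarith, by simp only [c]; nlinarith⟩
  have hsupp (i : Fin K) (s : ℝ) (hs : b i s ≠ 0) : t₀ < s ∧ s < t₀ + δ := by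
    have h1 := abs_lt.1 (hb i s hs)
    have h2 := hci i
    constructor <;> nlinarith
  have hpos (i : Fin K) : 0 < ∫ s in (0 : ℝ)..T, b i s ^ 2 := by
    have h1 := hsupp i (c i) (by rw [(b i).one_of_mem_closedBall (by simp [(b i).rIn_pos.le])];
                                 norm_num)
    refine intervalIntegral.integral_pos (by linarith) ?_ (fun s _ => sq_nonneg _)
      ⟨c i, ⟨by linarith, by linarith⟩, ?_⟩
    · exact ((b i).continuous.pow 2).continuousOn
    · rw [(b i).one_of_mem_closedBall (by simp [(b i).rIn_pos.le])]; norm_num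
  refine ⟨fun i s => (Real.sqrt (∫ s in (0 : ℝ)..T, b i s ^ 2))⁻¹ * b i s, fun i => ?_,
    fun i s hs => hsupp i s (right_ne_zero_of_mul hs), fun i j hij s => ?_, fun i => ?_⟩
  · exact contDiff_const.mul (b i).contDiff
  · by_contra hne
    have h1 := abs_lt.1 (hb i s (right_ne_zero_of_mul (left_ne_zero_of_mul hne)))
    have h2 := abs_lt.1 (hb j s (right_ne_zero_of_mul (right_ne_zero_of_mul hne)))
    have h3 : |c i - c j| < d := abs_lt.2 ⟨by linarith, by linarith⟩
    have h4 : c i - c j = d * ((i : ℕ) - (j : ℕ) : ℝ) := by simp only [c]; ring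
    rw [h4, abs_mul, abs_of_pos hd0, mul_lt_iff_lt_one_right hd0] at h3
    have h5 : |((i : ℕ) : ℤ) - ((j : ℕ) : ℤ)| < 1 := by exact_mod_cast h3
    rw [Int.abs_lt_one_iff] at h5
    exact hij (Fin.ext (by omega))
  · simp only [mul_pow]
    rw [intervalIntegral.integral_const_mul, inv_pow, Real.sq_sqrt (hpos i).le,
      inv_mul_cancel₀ (hpos i).ne']

/-- A family with more members than there are scalar conditions has a normalized combination that
satisfies all of them. -/
theorem exists_kernel_vector {Z Y : Type*} [AddCommGroup Z] [Module ℝ Z] [AddCommGroup Y]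
    [Module ℝ Y] [FiniteDimensional ℝ Y] (S : Finset (Z →ₗ[ℝ] Y)) {K : ℕ}
    (hK : Module.finrank ℝ (S → Y) < K) (ψ : Fin K → Z) :
    ∃ c : Fin K → ℝ, ∑ i, c i ^ 2 = 1 ∧ ∀ f ∈ S, f (∑ i, c i • ψ i) = 0 := by
  let L : (Fin K → ℝ) →ₗ[ℝ] (S → Y) :=
    LinearMap.pi fun f => f.1 ∘ₗ Fintype.linearCombination ℝ ψ
  have h1 : LinearMap.ker L ≠ ⊥ := LinearMap.ker_ne_bot_of_finrank_lt (by simpa using hK)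
  obtain ⟨c, hc, hc0⟩ := (Submodule.ne_bot_iff _).1 h1
  have hpos : 0 < ∑ i, c i ^ 2 := by
    obtain ⟨i, hi⟩ := Function.ne_iff.1 hc0
    exact Finset.sum_pos' (fun j _ => sq_nonneg _) ⟨i, Finset.mem_univ i, by
      have : c i ≠ 0 := hi
      positivity⟩
  refine ⟨fun i => (Real.sqrt (∑ i, c i ^ 2))⁻¹ * c i, ?_, fun f hf => ?_⟩
  · simp only [mul_pow]
    rw [← Finset.mul_sum, inv_pow, Real.sq_sqrt hpos.le, inv_mul_cancel₀ hpos.ne']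
  · have h2 : f (∑ i, c i • ψ i) = 0 := congr_fun (LinearMap.mem_ker.1 hc) ⟨f, hf⟩
    simp only [mul_smul]
    rw [← Finset.smul_sum, map_smul, h2, smul_zero]

variable {K : ℕ} {T : ℝ} {χ : Fin K → ℝ → ℝ}

theorem sq_sum_bumps (hd : ∀ i j, i ≠ j → ∀ s, χ i s * χ j s = 0) (c : Fin K → ℝ) (s : ℝ) :
    (∑ i, c i * χ i s) ^ 2 = ∑ i, c i ^ 2 * χ i s ^ 2 := by
  rw [pow_two, Finset.sum_mul_sum]
  refine Finset.sum_congr rfl fun i _ => ?_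
  rw [Finset.sum_eq_single i]
  · ring
  · intro j _ hj
    linear_combination c i * c j * hd i j hj.symm s
  · simp

theorem integral_sq_sum_bumps (hχ : ∀ i, Continuous (χ i))
    (hd : ∀ i j, i ≠ j → ∀ s, χ i s * χ j s = 0) (hn : ∀ i, ∫ s in (0 : ℝ)..T, χ i s ^ 2 = 1)
    {c : Fin K → ℝ} (hc : ∑ i, c i ^ 2 = 1) :
    ∫ s in (0 : ℝ)..T, (∑ i, c i * χ i s) ^ 2 = 1 := by
  simp only [sq_sum_bumps hd]
  rw [intervalIntegral.integral_finsetSum]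
  · simp only [intervalIntegral.integral_const_mul, hn, mul_one, hc]
  · intro i _
    exact (continuous_const.mul ((hχ i).pow 2)).intervalIntegrable _ _

end Bumps

section PairNorm

variable {ι₁ ι₂ : Type*} [Fintype ι₁] [Fintype ι₂]

open Classical in
/-- The coordinate functionals. -/
def coordUnit : ι₁ ⊕ ι₂ → (ι₁ → ℝ) × (ι₂ → ℝ) :=
  Sum.elim (fun i => (Pi.single i 1, 0)) (fun j => (0, Pi.single j 1))

theorem norm_le_of_coordUnit {y : (ι₁ → ℝ) × (ι₂ → ℝ)} {ε : ℝ} (hε : 0 ≤ ε)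
    (h : ∀ k, |pair (coordUnit k) y| ≤ ε) : ‖y‖ ≤ ε := by
  classical
  refine norm_prod_le_iff.2 ⟨(pi_norm_le_iff_of_nonneg hε).2 fun i => ?_,
    (pi_norm_le_iff_of_nonneg hε).2 fun j => ?_⟩
  · have := h (Sum.inl i)
    simpa [pair, coordUnit, Pi.single_apply] using this
  · have := h (Sum.inr j)
    simpa [pair, coordUnit, Pi.single_apply] using this

end PairNorm

/-! ### The Legendre condition from concentrated controls -/

namespace ControlSystem

variable {X U : Type*} [NormedAddCommGroup X] [NormedSpace ℝ X] [ProperSpace X]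
  [NormedAddCommGroup U] [NormedSpace ℝ U] [ProperSpace U]
  {ι₁ ι₂ : Type*} [Fintype ι₁] [Fintype ι₂]
  (Q : ControlSystem X U ((ι₁ → ℝ) × (ι₂ → ℝ)))

theorem exists_abs_pair_d2G_le (lam : (ι₁ → ℝ) × (ι₂ → ℝ)) :
    ∃ C, 0 ≤ C ∧ ∀ x : ℝ →ᵇ X, |pair lam (Q.d2G (Q.ends x) (Q.ends x))| ≤ C * ‖x‖ ^ 2 := by
  set L := LinearMap.toContinuousLinearMap (pairLin lam)
  refine ⟨‖L‖ * ‖Q.d2G‖ * ‖Q.ends‖ ^ 2, by positivity, fun x => ?_⟩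
  have h1 := L.le_opNorm (Q.d2G (Q.ends x) (Q.ends x))
  have h2 := Q.d2G.le_opNorm₂ (Q.ends x) (Q.ends x)
  have h3 := Q.ends.le_opNorm x
  calc |pair lam (Q.d2G (Q.ends x) (Q.ends x))| ≤ ‖L‖ * ‖Q.d2G (Q.ends x) (Q.ends x)‖ := h1
    _ ≤ ‖L‖ * (‖Q.d2G‖ * (‖Q.ends‖ * ‖x‖) * (‖Q.ends‖ * ‖x‖)) := by
      refine mul_le_mul_of_nonneg_left (h2.trans ?_) (norm_nonneg _)
      gcongr
    _ = _ := by ring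

theorem norm_primitive_le_integral {T : ℝ} (hT : 0 ≤ T) {f : ℝ → X} (hf : BddMeas f) :
    ‖primitive T f‖ ≤ ∫ s in (0 : ℝ)..T, ‖f s‖ := by
  have h0 : (0 : ℝ) ≤ ∫ s in (0 : ℝ)..T, ‖f s‖ :=
    intervalIntegral.integral_nonneg hT fun _ _ => norm_nonneg _
  refine (BoundedContinuousFunction.norm_le h0).2 fun t => ?_
  rw [primitive_apply hT (hf.integrableOn T)]
  have ht := clamp_mem hT t
  refine (intervalIntegral.norm_integral_le_integral_norm ht.1).trans ?_
  exact intervalIntegral.integral_mono_interval le_rfl ht.1 ht.2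
    (ae_of_all _ fun _ => norm_nonneg _) (hf.intervalIntegrable 0 T).norm

/-- The second variation along a control `f • u₀` with small integral is dominated by the quadratic
term in the control. -/
theorem exists_legendre_bound (lam : (ι₁ → ℝ) × (ι₂ → ℝ)) (u₀ : U) :
    ∃ C, 0 ≤ C ∧ ∀ f : ℝ → ℝ, BddMeas f → ∀ z : Variation X U, z.1 = (0, fun s => f s • u₀) →
      |pair lam (Q.second z z) -
          ∫ s in (0 : ℝ)..Q.T, f s ^ 2 * Q.costate lam s (Q.d2F s (0, u₀) (0, u₀))| ≤
        C * (∫ s in (0 : ℝ)..Q.T, |f s|) ^ 2 := by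
  obtain ⟨C₁, hC₁, hG⟩ := Q.exists_abs_pair_d2G_le lam
  set κ := ‖solve Q.T_nonneg Q.A‖ * (‖Q.dF‖ * ‖u₀‖) with hκ
  obtain ⟨D, hD⟩ := (bddMeas_bcf (X := X × U →L[ℝ] X × U →L[ℝ] X) Q.d2F).2
  have hD0 : 0 ≤ D := le_trans (norm_nonneg (Q.d2F 0)) (hD 0)
  set p := ‖Q.revCostate lam‖ * D with hp
  have hT := Q.T_nonneg
  refine ⟨C₁ * κ ^ 2 + (p * κ ^ 2 * Q.T + 2 * p * κ * ‖u₀‖), by positivity,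
    fun f hf z hz => ?_⟩
  set m := ∫ s in (0 : ℝ)..Q.T, |f s| with hm
  have hm0 : 0 ≤ m := intervalIntegral.integral_nonneg hT fun _ _ => abs_nonneg _
  have hz1 : z.1.1 = 0 := by rw [hz]
  have hz2 (s : ℝ) : z.1.2 s = f s • u₀ := by rw [hz]
  have hfu : BddMeas fun s => Q.dF s ((0 : X), z.1.2 s) :=
    Q.bddMeas_dF (bddMeas_zero.prodMk z.2)
  have hfi := hf.intervalIntegrable 0 Q.T
  have hnu (a : ℝ) : ‖((0 : X), a • u₀)‖ = |a| * ‖u₀‖ := by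
    rw [Prod.norm_mk, norm_zero, norm_smul, Real.norm_eq_abs]
    exact max_eq_right (by positivity)
  -- the state is of the order of `∫ |f|`, by boundedness of the solution operator
  have hx : ‖Q.resp z‖ ≤ κ * m := by
    have h1 : Q.forcing z = primitive Q.T (fun s => Q.dF s (0, z.1.2 s)) := by
      change BoundedContinuousFunction.const ℝ z.1.1 + _ = _
      rw [hz1]
      exact zero_add _
    have h2 : ‖Q.forcing z‖ ≤ ‖Q.dF‖ * ‖u₀‖ * m := by
      rw [h1]
      refine (norm_primitive_le_integral hT hfu).trans ?_
      rw [hm, ← intervalIntegral.integral_const_mul]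
      refine intervalIntegral.integral_mono_on hT (hfu.intervalIntegrable 0 Q.T).norm
        (hfi.abs.const_mul _) fun s _ => ?_
      refine ((Q.dF s).le_of_opNorm_le (Q.dF.norm_coe_le_norm s) _).trans (le_of_eq ?_)
      rw [hz2, hnu]
      ring
    refine ((solve Q.T_nonneg Q.A).le_opNorm (Q.forcing z)).trans ?_
    rw [hκ, mul_assoc]
    exact mul_le_mul_of_nonneg_left h2 (norm_nonneg _)
  have hb : ∀ (s : ℝ) (a b : X × U), |Q.costate lam s (Q.d2F s a b)| ≤ p * ‖a‖ * ‖b‖ := by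
    intro s a b
    have h1 := (Q.costate lam s).le_of_opNorm_le ((Q.revCostate lam).norm_coe_le_norm (Q.T - s))
      (Q.d2F s a b)
    refine h1.trans ?_
    have h2 := (Q.d2F s).le_opNorm₂ a b
    have h3 := hD s
    have h4 : ‖Q.d2F s‖ * ‖a‖ * ‖b‖ ≤ D * ‖a‖ * ‖b‖ := by gcongr
    refine (mul_le_mul_of_nonneg_left (h2.trans h4) (norm_nonneg _)).trans (le_of_eq ?_)
    rw [hp]; ring
  have hi1 : IntervalIntegrable (fun t => Q.costate lam t (Q.d2F t (Q.traj z t) (Q.traj z t)))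
      volume 0 Q.T :=
    (BddMeas.clm (Q.bddMeas_costate lam)
      (Q.bddMeas_d2F (Q.bddMeas_traj z) (Q.bddMeas_traj z))).intervalIntegrable 0 Q.T
  have hsq (s : ℝ) : Q.costate lam s (Q.d2F s ((0 : X), z.1.2 s) (0, z.1.2 s)) =
      f s ^ 2 * Q.costate lam s (Q.d2F s (0, u₀) (0, u₀)) := by
    have : ((0 : X), z.1.2 s) = f s • ((0 : X), u₀) := by rw [hz2]; simp
    rw [this]
    simp only [map_smul, smul_apply, smul_eq_mul]
    ring
  have hi2 : IntervalIntegrable (fun s => f s ^ 2 * Q.costate lam s (Q.d2F s (0, u₀) (0, u₀)))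
      volume 0 Q.T := by
    simp only [← hsq]
    exact (BddMeas.clm (Q.bddMeas_costate lam)
      (Q.bddMeas_d2F (bddMeas_zero.prodMk z.2) (bddMeas_zero.prodMk z.2))).intervalIntegrable 0 Q.T
  -- Only the square of the control survives: the mixed term is at most a multiple of
  -- `‖x‖ * ∫ |f|`, and the term quadratic in the state at most a multiple of `‖x‖ ^ 2`.
  have hdiff : |(∫ t in (0 : ℝ)..Q.T, Q.costate lam t (Q.d2F t (Q.traj z t) (Q.traj z t))) -
      ∫ s in (0 : ℝ)..Q.T, f s ^ 2 * Q.costate lam s (Q.d2F s (0, u₀) (0, u₀))| ≤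
      (p * κ ^ 2 * Q.T + 2 * p * κ * ‖u₀‖) * m ^ 2 := by
    rw [← intervalIntegral.integral_sub hi1 hi2]
    have hint : ∫ s in (0 : ℝ)..Q.T, (p * (κ * m) ^ 2 + 2 * p * (κ * m) * ‖u₀‖ * |f s|) =
        (p * κ ^ 2 * Q.T + 2 * p * κ * ‖u₀‖) * m ^ 2 := by
      rw [intervalIntegral.integral_add (by simp) (hfi.abs.const_mul _),
        intervalIntegral.integral_const, intervalIntegral.integral_const_mul, ← hm, smul_eq_mul]
      ring
    rw [← hint]
    have hgi : IntervalIntegrable (fun s => p * (κ * m) ^ 2 + 2 * p * (κ * m) * ‖u₀‖ * |f s|)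
        volume 0 Q.T := (by simp : IntervalIntegrable (fun _ => p * (κ * m) ^ 2) volume 0 Q.T).add
      (hfi.abs.const_mul _)
    rw [← Real.norm_eq_abs]
    refine intervalIntegral.norm_integral_le_of_norm_le hT (ae_of_all _ fun s _ => ?_) hgi
    have htr : Q.traj z s = (Q.resp z s, 0) + (0, z.1.2 s) := by simp [traj]
    have hxs : ‖((Q.resp z s, 0) : X × U)‖ ≤ κ * m := by
      rw [Prod.norm_mk, norm_zero, max_eq_left (norm_nonneg _)]
      exact ((Q.resp z).norm_coe_le_norm s).trans hx
    have hus : ‖((0 : X), z.1.2 s)‖ = |f s| * ‖u₀‖ := by rw [hz2, hnu]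
    have h1 := hb s (Q.resp z s, 0) (Q.resp z s, 0)
    have h2 := hb s (Q.resp z s, 0) (0, z.1.2 s)
    have h3 : Q.d2F s (0, z.1.2 s) (Q.resp z s, 0) = Q.d2F s (Q.resp z s, 0) (0, z.1.2 s) :=
      sndDeriv_symm Q.contDiff_F _ _ _
    have h4 : Q.costate lam s (Q.d2F s (Q.traj z s) (Q.traj z s)) -
        f s ^ 2 * Q.costate lam s (Q.d2F s (0, u₀) (0, u₀)) =
        Q.costate lam s (Q.d2F s (Q.resp z s, 0) (Q.resp z s, 0)) +
        2 * Q.costate lam s (Q.d2F s (Q.resp z s, 0) (0, z.1.2 s)) := by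
      rw [← hsq, htr]
      simp only [map_add, add_apply, h3]
      ring
    rw [h4, Real.norm_eq_abs]
    refine (abs_add_le _ _).trans (add_le_add (h1.trans ?_) ?_)
    · rw [mul_assoc, pow_two]
      gcongr
    · rw [abs_mul, abs_two]
      have h5 : p * ‖((Q.resp z s, 0) : X × U)‖ * ‖((0 : X), z.1.2 s)‖ ≤
          p * (κ * m) * (|f s| * ‖u₀‖) := by rw [hus]; gcongr
      linarith
  rw [Q.pair_second, add_sub_assoc]
  refine (abs_add_le _ _).trans ?_
  have h6 : |pair lam (Q.d2G (Q.ends (Q.resp z)) (Q.ends (Q.resp z)))| ≤ C₁ * (κ * m) ^ 2 :=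
    (hG _).trans (by gcongr)
  linarith

end ControlSystem

section Concentration

variable {T t₀ δ : ℝ}

theorem bddMeas_of_support {X : Type*} [NormedAddCommGroup X] {f : ℝ → X} (hf : Continuous f)
    (hs : ∀ s, f s ≠ 0 → t₀ < s ∧ s < t₀ + δ) : BddMeas f := by
  obtain ⟨C, hC⟩ := (isCompact_Icc (a := t₀) (b := t₀ + δ)).exists_bound_of_continuousOn
    hf.continuousOn
  refine ⟨hf.stronglyMeasurable, max C 0, fun s => ?_⟩
  by_cases h : f s = 0
  · rw [h, norm_zero]; exact le_max_right _ _
  · exact (hC s ⟨(hs s h).1.le, (hs s h).2.le⟩).trans (le_max_left _ _)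

/-- By the Cauchy-Schwarz inequality, concentrated functions have small integrals. -/
theorem sq_integral_abs_le (h0 : 0 ≤ t₀) (hT : t₀ + δ ≤ T) (hδ : 0 < δ) {f : ℝ → ℝ}
    (hf : Continuous f) (hs : ∀ s, f s ≠ 0 → t₀ < s ∧ s < t₀ + δ)
    (hn : ∫ s in (0 : ℝ)..T, f s ^ 2 = 1) : (∫ s in (0 : ℝ)..T, |f s|) ^ 2 ≤ δ := by
  have key (g : ℝ → ℝ) (hg : ∀ s, g s ≠ 0 → f s ≠ 0) :
      ∫ s in (0 : ℝ)..T, g s = ∫ s in t₀..(t₀ + δ), g s := by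
    rw [intervalIntegral.integral_eq_integral_of_support_subset,
      intervalIntegral.integral_eq_integral_of_support_subset]
    · intro s h
      exact ⟨(hs s (hg s h)).1, (hs s (hg s h)).2.le⟩
    · intro s h
      have := hs s (hg s h)
      exact ⟨by linarith, by linarith⟩
  rw [key _ (fun s h h' => h (by rw [h']; simp))] at hn
  rw [key _ (fun s h h' => h (by rw [h']; simp))]
  -- Young's inequality `|f| ≤ r / 2 * f ^ 2 + 1 / (2 * r)`, with the weight that is optimal on an
  -- interval of length `δ`
  set r := Real.sqrt δ with hr
  have hr0 : 0 < r := Real.sqrt_pos.2 hδ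
  have hr2 : r ^ 2 = δ := Real.sq_sqrt hδ.le
  have h1 : ∫ s in t₀..(t₀ + δ), |f s| ≤ ∫ s in t₀..(t₀ + δ), (r / 2 * f s ^ 2 + 1 / (2 * r)) := by
    refine intervalIntegral.integral_mono_on (by linarith) (hf.abs.intervalIntegrable _ _)
      (Continuous.intervalIntegrable (by fun_prop) _ _) fun s _ => ?_
    have h2 : |f s| * (2 * r) ≤ r ^ 2 * f s ^ 2 + 1 := by
      have := sq_nonneg (r * |f s| - 1)
      rw [← sq_abs (f s)]
      nlinarith
    have h3 : r / 2 * f s ^ 2 + 1 / (2 * r) = (r ^ 2 * f s ^ 2 + 1) / (2 * r) := by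
      field_simp
    rw [h3, le_div_iff₀ (by positivity)]
    exact h2
  have h4 : ∫ s in t₀..(t₀ + δ), (r / 2 * f s ^ 2 + 1 / (2 * r)) = r := by
    rw [intervalIntegral.integral_add (Continuous.intervalIntegrable (by fun_prop) _ _)
      (by simp), intervalIntegral.integral_const_mul, hn, intervalIntegral.integral_const,
      smul_eq_mul, add_sub_cancel_left, ← hr2]
    field_simp
    norm_num
  have h5 : 0 ≤ ∫ s in t₀..(t₀ + δ), |f s| :=
    intervalIntegral.integral_nonneg (by linarith) fun _ _ => abs_nonneg _
  exact (pow_le_pow_left₀ h5 (h1.trans h4.le) 2).trans_eq hr2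

/-- A normalized concentrated weight almost evaluates continuous functions. -/
theorem abs_integral_sq_mul_sub_le (h0 : 0 ≤ t₀) (hT : t₀ + δ ≤ T) (hδ : 0 < δ) {f φ : ℝ → ℝ}
    {v ε : ℝ} (hf : Continuous f) (hs : ∀ s, f s ≠ 0 → t₀ < s ∧ s < t₀ + δ)
    (hn : ∫ s in (0 : ℝ)..T, f s ^ 2 = 1) (hφ : ContinuousOn φ (Icc 0 T))
    (hv : ∀ s, t₀ < s → s < t₀ + δ → |φ s - v| ≤ ε) :
    |(∫ s in (0 : ℝ)..T, f s ^ 2 * φ s) - v| ≤ ε := by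
  have hT0 : 0 ≤ T := by linarith
  have hi : IntervalIntegrable (fun s => f s ^ 2 * φ s) volume 0 T := by
    refine ContinuousOn.intervalIntegrable ?_
    rw [uIcc_of_le hT0]
    exact (hf.pow 2).continuousOn.mul hφ
  have hf2 : IntervalIntegrable (fun s => f s ^ 2) volume 0 T :=
    (hf.pow 2).intervalIntegrable _ _
  have h1 : (∫ s in (0 : ℝ)..T, f s ^ 2 * φ s) - v =
      ∫ s in (0 : ℝ)..T, (f s ^ 2 * φ s - f s ^ 2 * v) := by
    rw [intervalIntegral.integral_sub hi (hf2.mul_const _), intervalIntegral.integral_mul_const,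
      hn, one_mul]
  have h2 : ∫ s in (0 : ℝ)..T, f s ^ 2 * ε = ε := by
    rw [intervalIntegral.integral_mul_const, hn, one_mul]
  rw [h1, ← h2]
  rw [← Real.norm_eq_abs]
  refine intervalIntegral.norm_integral_le_of_norm_le hT0 (ae_of_all _ fun s _ => ?_)
    (hf2.mul_const _)
  rw [← mul_sub, Real.norm_eq_abs, abs_mul, abs_of_nonneg (sq_nonneg (f s))]
  by_cases h : f s = 0
  · simp [h]
  · exact mul_le_mul_of_nonneg_left (hv s (hs s h).1 (hs s h).2) (sq_nonneg _)

end Concentration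

namespace ControlSystem

variable {X U : Type*} [NormedAddCommGroup X] [NormedSpace ℝ X] [ProperSpace X]
  [NormedAddCommGroup U] [NormedSpace ℝ U] [ProperSpace U]
  {ι₁ ι₂ : Type*} [Fintype ι₁] [Fintype ι₂]
  (Q : ControlSystem X U ((ι₁ → ℝ) × (ι₂ → ℝ)))

theorem variation_sum_apply {K : ℕ} (c : Fin K → ℝ) (ψ : Fin K → Variation X U) :
    (∑ i, c i • ψ i).1 = (∑ i, c i • (ψ i).1.1, fun s => ∑ i, c i • (ψ i).1.2 s) := by
  have h : (∑ i, c i • ψ i).1 = ∑ i, c i • (ψ i).1 := by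
    rw [← Submodule.coe_subtype, map_sum]
    simp
  rw [h]
  refine Prod.ext ?_ ?_
  · rw [Prod.fst_sum]; rfl
  · rw [Prod.snd_sum]
    ext s
    rw [Finset.sum_apply]
    rfl

/-- The values of the Legendre form are essential values of the second variation. -/
theorem isEssentialValue_legendre {t₀ : ℝ} (ht₀ : t₀ ∈ Ioo 0 Q.T) (u₀ : U)
    {a : (ι₁ → ℝ) × (ι₂ → ℝ)}
    (ha : ∀ lam, pair lam a = (1 / 2) * Q.costate lam t₀ (Q.d2F t₀ (0, u₀) (0, u₀))) :
    IsEssentialValue Q.second a := by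
  intro S ε hε
  let φ (k : ι₁ ⊕ ι₂) (s : ℝ) : ℝ := Q.costate (coordUnit k) s (Q.d2F s (0, u₀) (0, u₀))
  have hφ (k : ι₁ ⊕ ι₂) : Continuous (φ k) :=
    (Q.continuous_costate _).clm_apply
      (((continuous_sndDeriv Q.contDiff_F).comp Q.w.continuous).clm_apply
        continuous_const |>.clm_apply continuous_const)
  choose C hC0 hC using fun k : ι₁ ⊕ ι₂ => Q.exists_legendre_bound (coordUnit k) u₀
  obtain ⟨δ, hδ, hδT, hδC, hδφ⟩ : ∃ δ : ℝ, 0 < δ ∧ t₀ + δ ≤ Q.T ∧ (∀ k, C k * δ ≤ ε) ∧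
      ∀ k, ∀ s, t₀ < s → s < t₀ + δ → |φ k s - φ k t₀| ≤ ε := by
    have h1 : ∀ᶠ δ : ℝ in 𝓝[>] 0, ∀ k, C k * δ ≤ ε := by
      refine eventually_all.2 fun k => nhdsWithin_le_nhds ?_
      have : Tendsto (fun δ => C k * δ) (𝓝 0) (𝓝 (C k * 0)) := tendsto_id.const_mul _
      rw [mul_zero] at this
      exact this.eventually_le_const hε
    have h2 : ∀ᶠ δ : ℝ in 𝓝[>] 0, δ < Q.T - t₀ :=
      nhdsWithin_le_nhds (gt_mem_nhds (by linarith [ht₀.2]))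
    have h3 : ∀ᶠ δ : ℝ in 𝓝[>] 0, ∀ k, ∀ s, t₀ < s → s < t₀ + δ → |φ k s - φ k t₀| ≤ ε := by
      refine eventually_all.2 fun k => nhdsWithin_le_nhds ?_
      obtain ⟨η, hη, h⟩ := Metric.continuousAt_iff.1 (hφ k).continuousAt ε hε
      filter_upwards [gt_mem_nhds hη] with δ hδ s hs hs'
      refine (h ?_).le
      rw [Real.dist_eq, abs_lt]
      constructor <;> linarith
    obtain ⟨δ, ⟨⟨h1, h2⟩, h3⟩, h4⟩ := (((h1.and h2).and h3).and self_mem_nhdsWithin).exists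
    exact ⟨δ, h4, by linarith, h1, h3⟩
  set K := Module.finrank ℝ (S → (ι₁ → ℝ) × (ι₂ → ℝ)) + 1 with hK
  -- there are more bumps than scalar conditions in `S`, so that some combination satisfies them all
  obtain ⟨χ, hχd, hχs, hχo, hχn⟩ := exists_bumps ht₀.1.le hδT hδ K
  have hχb (i : Fin K) : BddMeas fun s => χ i s • u₀ :=
    bddMeas_of_support ((hχd i).continuous.smul continuous_const) fun s h =>
      hχs i s fun h' => h (by rw [h', zero_smul])
  let ψ : Fin K → Variation X U := fun i => ⟨(0, fun s => χ i s • u₀), hχb i⟩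
  obtain ⟨c, hc, hcS⟩ := exists_kernel_vector S (Nat.lt_succ_self _) ψ
  refine ⟨∑ i, c i • ψ i, hcS, ?_⟩
  set z := ∑ i, c i • ψ i with hz
  set f : ℝ → ℝ := fun s => ∑ i, c i * χ i s with hf
  have hfc : Continuous f :=
    continuous_finsetSum _ fun i _ => continuous_const.mul (hχd i).continuous
  have hfs : ∀ s, f s ≠ 0 → t₀ < s ∧ s < t₀ + δ := by
    intro s h
    obtain ⟨i, _, hi⟩ := Finset.exists_ne_zero_of_sum_ne_zero h
    exact hχs i s (right_ne_zero_of_mul hi)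
  have hfn : ∫ s in (0 : ℝ)..Q.T, f s ^ 2 = 1 :=
    integral_sq_sum_bumps (fun i => (hχd i).continuous) hχo hχn hc
  have hz1 : z.1 = (0, fun s => f s • u₀) := by
    rw [hz, variation_sum_apply]
    refine Prod.ext ?_ ?_
    · simp [ψ]
    · ext1 s
      simp only [ψ, hf, Finset.sum_smul, mul_smul]
  refine norm_le_of_coordUnit hε.le fun k => ?_
  have h1 := hC k f (bddMeas_of_support hfc hfs) z hz1
  have h2 := abs_integral_sq_mul_sub_le ht₀.1.le hδT hδ hfc hfs hfn (hφ k).continuousOn (hδφ k)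
  have h3 := (mul_le_mul_of_nonneg_left (sq_integral_abs_le ht₀.1.le hδT hδ hfc hfs hfn)
    (hC0 k)).trans (hδC k)
  have h4 : pair (coordUnit k) ((1 / 2 : ℝ) • Q.second z z - a) =
      (1 / 2) * (pair (coordUnit k) (Q.second z z) - φ k t₀) := by
    rw [sub_eq_add_neg, pair_add, pair_smul, ← neg_one_smul ℝ a, pair_smul, ha]
    ring
  rw [h4, abs_mul, abs_of_pos (by norm_num : (0 : ℝ) < 1 / 2)]
  have h5 := abs_le.1 (h1.trans h3)
  have h6 := abs_le.1 h2
  have h7 : |pair (coordUnit k) (Q.second z z) - φ k t₀| ≤ 2 * ε := by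
    change -ε ≤ _ - (∫ s in (0 : ℝ)..Q.T, f s ^ 2 * φ k s) ∧
      _ - (∫ s in (0 : ℝ)..Q.T, f s ^ 2 * φ k s) ≤ ε at h5
    exact abs_le.2 ⟨by linarith [h5.1, h6.1], by linarith [h5.2, h6.2]⟩
  linarith

end ControlSystem

/-! ### The Goh condition from concentrated oscillating controls -/

section BddMat

variable {T : ℝ} {a b c : ℕ}

/-- A matrix function with bounded entries on `(0, T)`. -/
def BddMat (T : ℝ) (A : ℝ → Matrix (Fin a) (Fin b) ℝ) : Prop :=
  ∃ C, 0 ≤ C ∧ ∀ t ∈ Ioo 0 T, ∀ i j, |A t i j| ≤ C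

theorem bddMat_of_entries {A : ℝ → Matrix (Fin a) (Fin b) ℝ}
    (h : ∀ i j, ∃ C, ∀ t ∈ Ioo 0 T, |A t i j| ≤ C) : BddMat T A := by
  choose C hC using h
  refine ⟨∑ i, ∑ j, |C i j|, by positivity, fun t ht i j => ?_⟩
  refine (hC i j t ht).trans ((le_abs_self _).trans ?_)
  refine (Finset.single_le_sum (f := fun j => |C i j|) (fun j _ => abs_nonneg _)
    (Finset.mem_univ j)).trans ?_
  exact Finset.single_le_sum (f := fun i => ∑ j, |C i j|)
    (fun i _ => Finset.sum_nonneg fun j _ => abs_nonneg _) (Finset.mem_univ i)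

theorem bddMat_of_continuousOn {A : ℝ → Matrix (Fin a) (Fin b) ℝ}
    (h : ∀ i j, ContinuousOn (fun t => A t i j) (Icc 0 T)) : BddMat T A :=
  bddMat_of_entries fun i j => by
    obtain ⟨C, hC⟩ := isCompact_Icc.exists_bound_of_continuousOn (h i j)
    exact ⟨C, fun t ht => hC t ⟨ht.1.le, ht.2.le⟩⟩

theorem bddMat_dotMatrix {A : ℝ → Matrix (Fin a) (Fin b) ℝ}
    (h : ∀ i j, LipOn T (fun t => A t i j)) : BddMat T (dotMatrix A) :=
  bddMat_of_entries fun i j => by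
    obtain ⟨C, _, hC⟩ := (h i j).exists_deriv_bound
    exact ⟨C, hC⟩

theorem BddMat.add {A B : ℝ → Matrix (Fin a) (Fin b) ℝ} (hA : BddMat T A) (hB : BddMat T B) :
    BddMat T (fun t => A t + B t) := by
  obtain ⟨C, _, hC⟩ := hA
  obtain ⟨D, _, hD⟩ := hB
  exact ⟨C + D, by positivity, fun t ht i j =>
    (abs_add_le _ _).trans (add_le_add (hC t ht i j) (hD t ht i j))⟩

theorem BddMat.sub {A B : ℝ → Matrix (Fin a) (Fin b) ℝ} (hA : BddMat T A) (hB : BddMat T B) :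
    BddMat T (fun t => A t - B t) := by
  obtain ⟨C, _, hC⟩ := hA
  obtain ⟨D, _, hD⟩ := hB
  exact ⟨C + D, by positivity, fun t ht i j =>
    (abs_sub _ _).trans (add_le_add (hC t ht i j) (hD t ht i j))⟩

theorem BddMat.transpose {A : ℝ → Matrix (Fin a) (Fin b) ℝ} (hA : BddMat T A) :
    BddMat T (fun t => (A t)ᵀ) := by
  obtain ⟨C, h0, hC⟩ := hA
  exact ⟨C, h0, fun t ht i j => hC t ht j i⟩

theorem BddMat.mul {A : ℝ → Matrix (Fin a) (Fin b) ℝ} {B : ℝ → Matrix (Fin b) (Fin c) ℝ}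
    (hA : BddMat T A) (hB : BddMat T B) : BddMat T (fun t => A t * B t) := by
  obtain ⟨C, _, hC⟩ := hA
  obtain ⟨D, _, hD⟩ := hB
  refine ⟨b * (C * D), by positivity, fun t ht i j => ?_⟩
  change |∑ k, A t i k * B t k j| ≤ _
  refine (Finset.abs_sum_le_sum_abs _ _).trans ?_
  refine (Finset.sum_le_card_nsmul _ _ (C * D) fun k _ => ?_).trans (by simp)
  rw [abs_mul]
  exact mul_le_mul (hC t ht i k) (hD t ht k j) (abs_nonneg _) (by positivity)

theorem abs_dotProduct_mulVec_le {A : Matrix (Fin a) (Fin b) ℝ} {C : ℝ} (hC : 0 ≤ C)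
    (hA : ∀ i j, |A i j| ≤ C) {x : Vec a} {y : Vec b} {p q : ℝ} (hx : ‖x‖ ≤ p) (hy : ‖y‖ ≤ q) :
    |x ⬝ᵥ A *ᵥ y| ≤ a * b * C * (p * q) := by
  have hp : 0 ≤ p := (norm_nonneg _).trans hx
  have hq : 0 ≤ q := (norm_nonneg _).trans hy
  have h1 (i : Fin a) : |(A *ᵥ y) i| ≤ b * (C * q) := by
    change |∑ k, A i k * y k| ≤ _
    refine (Finset.abs_sum_le_sum_abs _ _).trans ?_
    refine (Finset.sum_le_card_nsmul _ _ (C * q) fun k _ => ?_).trans (by simp)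
    rw [abs_mul]
    exact mul_le_mul (hA i k) ((norm_le_pi_norm y k).trans hy) (abs_nonneg _) hC
  refine (Finset.abs_sum_le_sum_abs _ _).trans ?_
  refine (Finset.sum_le_card_nsmul _ _ (p * (b * (C * q))) fun k _ => ?_).trans (le_of_eq ?_)
  · rw [abs_mul]
    exact mul_le_mul ((norm_le_pi_norm x k).trans hx) (h1 k) (abs_nonneg _) hp
  · simp only [Finset.card_univ, Fintype.card_fin, nsmul_eq_mul]
    ring

theorem norm_mulVec_le {A : Matrix (Fin a) (Fin b) ℝ} {C : ℝ} (hC : 0 ≤ C)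
    (hA : ∀ i j, |A i j| ≤ C) {y : Vec b} {q : ℝ} (hy : ‖y‖ ≤ q) :
    ‖A *ᵥ y‖ ≤ b * (C * q) := by
  have hq : 0 ≤ q := (norm_nonneg _).trans hy
  refine (pi_norm_le_iff_of_nonneg (by positivity)).2 fun i => ?_
  change |∑ k, A i k * y k| ≤ _
  refine (Finset.abs_sum_le_sum_abs _ _).trans ?_
  refine (Finset.sum_le_card_nsmul _ _ (C * q) fun k _ => ?_).trans (by simp)
  rw [abs_mul]
  exact mul_le_mul (hA i k) ((norm_le_pi_norm y k).trans hy) (abs_nonneg _) hC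

/-- Integration by parts: the integral of a Lipschitz function against the derivative of a
function is controlled by the supremum of the latter. -/
theorem exists_abs_integral_mul_deriv_le (hT : 0 ≤ T) {f : ℝ → ℝ} (hf : LipOn T f) :
    ∃ C, 0 ≤ C ∧ ∀ (w w' : ℝ → ℝ) (β : ℝ), (∀ t, HasDerivAt w (w' t) t) → Continuous w' →
      w 0 = 0 → (∀ t, |w t| ≤ β) → ∀ t ∈ Icc 0 T, |∫ s in (0 : ℝ)..t, f s * w' s| ≤ C * β := by
  obtain ⟨c₁, hc₁⟩ := isCompact_Icc.exists_bound_of_continuousOn hf.continuousOn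
  obtain ⟨c₂, hc₂0, hc₂⟩ := hf.exists_deriv_bound
  refine ⟨|c₁| + c₂ * T, by positivity, fun w w' β hw hw' hw0 hβ t ht => ?_⟩
  have hβ0 : 0 ≤ β := (abs_nonneg _).trans (hβ 0)
  have hsub : Icc 0 t ⊆ Icc 0 T := Icc_subset_Icc_right ht.2
  have hft : LipOn t f := ⟨_, hf.choose_spec.mono hsub⟩
  have hwt : LipOn t w := by
    have h1 : ContDiff ℝ 1 w := contDiff_one_iff_deriv.2
      ⟨fun s => (hw s).differentiableAt, by rwa [show deriv w = w' from funext fun s => (hw s).deriv]⟩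
    exact (h1.locallyLipschitz.locallyLipschitzOn).exists_lipschitzOnWith_of_compact isCompact_Icc
  have hder : ∀ᵐ s ∂(leb t), HasDerivAt (fun s => f s * w s) (deriv f s * w s + f s * w' s) s := by
    filter_upwards [hft.ae_hasDerivAt] with s hs
    exact hs.mul (hw s)
  have hl := (hft.mul hwt).choose_spec
  have hi := integrable_of_lipschitz ht.1 hl hder
  have hint := integral_eq_sub_of_lipschitz ht.1 hl hder
  have hi2 : IntervalIntegrable (fun s => f s * w' s) volume 0 t := by
    refine ContinuousOn.intervalIntegrable ?_
    rw [uIcc_of_le ht.1]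
    exact hft.continuousOn.mul hw'.continuousOn
  have hi1 : IntervalIntegrable (fun s => deriv f s * w s) volume 0 t := by
    refine (hi.sub hi2).congr fun s _ => ?_
    change deriv f s * w s + f s * w' s - f s * w' s = _
    ring
  rw [intervalIntegral.integral_add hi1 hi2, hw0, mul_zero, sub_zero] at hint
  have h1 : |∫ s in (0 : ℝ)..t, deriv f s * w s| ≤ c₂ * β * t := by
    have := intervalIntegral.norm_integral_le_of_norm_le_const_ae (a := 0) (b := t)
      (C := c₂ * β) (f := fun s => deriv f s * w s) ?_
    · rwa [sub_zero, abs_of_nonneg ht.1] at this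
    · have hne : ∀ᵐ s : ℝ, s ≠ t := by simp [ae_iff, measure_singleton]
      filter_upwards [hne] with s hs hs'
      rw [uIoc_of_le ht.1] at hs'
      rw [Real.norm_eq_abs, abs_mul]
      exact mul_le_mul (hc₂ s ⟨hs'.1, (lt_of_le_of_ne hs'.2 hs).trans_le ht.2⟩) (hβ s)
        (abs_nonneg _) hc₂0
  have h2 : |f t * w t| ≤ |c₁| * β := by
    rw [abs_mul]
    exact mul_le_mul ((hc₁ t ht).trans (le_abs_self _)) (hβ t) (abs_nonneg _) (abs_nonneg _)
  have h3 : ∫ s in (0 : ℝ)..t, f s * w' s = f t * w t - ∫ s in (0 : ℝ)..t, deriv f s * w s := by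
    linarith
  rw [h3]
  refine (abs_sub _ _).trans ?_
  have h4 : c₂ * β * t ≤ c₂ * β * T := mul_le_mul_of_nonneg_left ht.2 (by positivity)
  linarith

end BddMat

namespace Problem

variable {n l m dphi deta : ℕ} {P : Problem n l m dphi deta} {wh : Triple n l m}

namespace Reference

theorem bddMat_Hxx (r : P.Reference wh) (lam : (Fin (dphi + 1) → ℝ) × (Fin deta → ℝ)) :
    BddMat P.T (P.Hxx wh (r.mult lam)) := by
  refine bddMat_of_continuousOn fun i j => ?_
  have h : Continuous fun t => r.sys.costate lam t (r.sys.d2F t (Pi.single i 1, 0, 0)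
      (Pi.single j 1, 0, 0)) :=
    (r.sys.continuous_costate _).clm_apply
      (((continuous_sndDeriv r.sys.contDiff_F).comp r.sys.w.continuous).clm_apply
        continuous_const |>.clm_apply continuous_const)
  exact h.continuousOn.congr fun t ht => r.D2H_mult lam ht _ _

theorem bddMat_Fx (r : P.Reference wh) : BddMat P.T (P.Fx wh) := by
  refine bddMat_of_continuousOn fun i j => ?_
  have h : ContinuousOn (fun t => fderiv ℝ P.F (wh.val t) (Pi.single j 1, 0, 0)) (Icc 0 P.T) :=
    (((contDiff_fderiv r.regular.contDiff_F).continuous.clm_apply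
      continuous_const).comp_continuousOn r.continuousOn)
  exact (continuous_apply i).comp_continuousOn h

theorem bddMat_Fv (r : P.Reference wh) : BddMat P.T (P.Fv wh) :=
  bddMat_of_continuousOn fun i j => (r.lipOn_Fv i j).continuousOn

theorem bddMat_Hvx (r : P.Reference wh) (lam : (Fin (dphi + 1) → ℝ) × (Fin deta → ℝ)) :
    BddMat P.T (P.Hvx wh (r.mult lam)) :=
  bddMat_of_continuousOn fun i j => (r.lipOn_Hvx lam i j).continuousOn

theorem bddMat_B (r : P.Reference wh) : BddMat P.T (P.B wh) :=
  (r.bddMat_Fx.mul r.bddMat_Fv).sub (bddMat_dotMatrix r.lipOn_Fv)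

theorem bddMat_M (r : P.Reference wh) (lam : (Fin (dphi + 1) → ℝ) × (Fin deta → ℝ)) :
    BddMat P.T (P.M wh (r.mult lam)) :=
  ((r.bddMat_Fv.transpose.mul (r.bddMat_Hxx lam)).sub (bddMat_dotMatrix (r.lipOn_Hvx lam))).sub
    ((r.bddMat_Hvx lam).mul r.bddMat_Fx)

theorem bddMat_R (r : P.Reference wh) (lam : (Fin (dphi + 1) → ℝ) × (Fin deta → ℝ)) :
    BddMat P.T (P.R wh (r.mult lam)) :=
  (((r.bddMat_Fv.transpose.mul (r.bddMat_Hxx lam)).mul r.bddMat_Fv).sub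
    (((r.bddMat_Hvx lam).mul r.bddMat_B).add ((r.bddMat_Hvx lam).mul r.bddMat_B).transpose)).sub
    (bddMat_dotMatrix (r.lipOn_S lam))

/-- The state generated by an affine control `y'` is controlled by the supremum of `y`. -/
theorem exists_norm_resp_le (r : P.Reference wh) :
    ∃ κ, 0 ≤ κ ∧ ∀ (y y' : ℝ → Vec m) (β : ℝ), (∀ t, HasDerivAt y (y' t) t) → Continuous y' →
      y 0 = 0 → (∀ t, ‖y t‖ ≤ β) → ∀ z : Variation (Vec n) (Vec l × Vec m),
      z.1 = (0, fun s => (0, y' s)) → ‖r.sys.resp z‖ ≤ κ * β := by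
  choose c hc0 hc using fun (i : Fin n) (j : Fin m) =>
    exists_abs_integral_mul_deriv_le r.T_nonneg (r.lipOn_Fv i j)
  have hs0 : 0 ≤ ∑ i, ∑ j, c i j :=
    Finset.sum_nonneg fun i _ => Finset.sum_nonneg fun j _ => hc0 i j
  refine ⟨‖solve r.sys.T_nonneg r.sys.A‖ * ∑ i, ∑ j, c i j, by positivity,
    fun y y' β hy hy' hy0 hβ z hz => ?_⟩
  have hβ0 : 0 ≤ β := (norm_nonneg _).trans (hβ 0)
  have h1 : r.sys.forcing z = primitive P.T (fun s => r.sys.dF s (0, z.1.2 s)) := by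
    change BoundedContinuousFunction.const ℝ z.1.1 + _ = _
    rw [show z.1.1 = 0 by rw [hz]]
    exact zero_add _
  have hb : BddMeas fun s => r.sys.dF s (0, z.1.2 s) :=
    r.sys.bddMeas_dF (bddMeas_zero.prodMk z.2)
  refine ((solve r.sys.T_nonneg r.sys.A).le_opNorm (r.sys.forcing z)).trans ?_
  rw [mul_assoc]
  refine mul_le_mul_of_nonneg_left ?_ (norm_nonneg _)
  rw [h1]
  refine (BoundedContinuousFunction.norm_le (by positivity)).2 fun t => ?_
  rw [primitive_apply r.T_nonneg (hb.integrableOn _)]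
  set τ := clamp P.T t
  have hτ : τ ∈ Icc 0 P.T := clamp_mem r.T_nonneg t
  refine (pi_norm_le_iff_of_nonneg (by positivity)).2 fun i => ?_
  have h2 : (∫ s in (0 : ℝ)..τ, r.sys.dF s (0, z.1.2 s)) i =
      ∫ s in (0 : ℝ)..τ, ∑ j, P.Fv wh s i j * y' s j := by
    have h3 := (ContinuousLinearMap.proj (R := ℝ) (φ := fun _ : Fin n => ℝ)
      i).intervalIntegral_comp_comm (hb.intervalIntegrable 0 τ)
    refine h3.symm.trans (intervalIntegral.integral_congr fun s hs => ?_)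
    rw [uIcc_of_le hτ.1] at hs
    have h4 : r.sys.dF s (0, z.1.2 s) = P.Fv wh s *ᵥ y' s := by
      rw [Fv_mulVec, r.dF_eq ⟨hs.1, hs.2.trans hτ.2⟩, hz]
    change (r.sys.dF s (0, z.1.2 s)) i = _
    rw [h4]
    rfl
  have hyj (j : Fin m) : Continuous fun s => y' s j := (continuous_apply j).comp hy'
  rw [h2, intervalIntegral.integral_finsetSum]
  · refine (norm_sum_le _ _).trans ?_
    have h5 : ∑ j, ‖∫ s in (0 : ℝ)..τ, P.Fv wh s i j * y' s j‖ ≤ ∑ j, c i j * β := by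
      refine Finset.sum_le_sum fun j _ => ?_
      exact hc i j (fun s => y s j) (fun s => y' s j) β (fun t => hasDerivAt_pi.1 (hy t) j) (hyj j)
        (by rw [hy0]; rfl) (fun t => (norm_le_pi_norm (y t) j).trans (hβ t)) τ hτ
    refine h5.trans ?_
    rw [← Finset.sum_mul]
    refine mul_le_mul_of_nonneg_right ?_ hβ0
    exact Finset.single_le_sum (f := fun i => ∑ j, c i j)
      (fun i _ => Finset.sum_nonneg fun j _ => hc0 i j) (Finset.mem_univ i)
  · intro j _
    refine ContinuousOn.intervalIntegrable ?_
    rw [uIcc_of_le hτ.1]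
    exact ((r.lipOn_Fv i j).continuousOn.mono (Icc_subset_Icc_right hτ.2)).mul
      (hyj j).continuousOn

/-- The second variation along an affine control `y'` with `y` small is dominated by the
integral of `y' ⬝ᵥ V *ᵥ y`. -/
theorem exists_goh_bound (r : P.Reference wh) (lam : (Fin (dphi + 1) → ℝ) × (Fin deta → ℝ)) :
    ∃ C, 0 ≤ C ∧ ∀ (y y' : ℝ → Vec m) (β : ℝ), (∀ t, HasDerivAt y (y' t) t) → Continuous y' →
      y 0 = 0 → y P.T = 0 → (∀ t, ‖y t‖ ≤ β) → ∀ z : Variation (Vec n) (Vec l × Vec m),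
      z.1 = (0, fun s => (0, y' s)) →
      |(1 / 2) * pair lam (r.sys.second z z) -
        ∫ t in (0 : ℝ)..P.T, y' t ⬝ᵥ P.V wh (r.mult lam) t *ᵥ y t| ≤ C * β ^ 2 := by
  obtain ⟨κ, hκ0, hκ⟩ := r.exists_norm_resp_le
  obtain ⟨C₁, hC₁0, hC₁⟩ := r.sys.exists_abs_pair_d2G_le lam
  obtain ⟨F, hF0, hF⟩ := r.bddMat_Fv
  obtain ⟨H, hH0, hH⟩ := r.bddMat_Hxx lam
  obtain ⟨M, hM0, hM⟩ := r.bddMat_M lam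
  obtain ⟨R, hR0, hR⟩ := r.bddMat_R lam
  have hT := r.T_nonneg
  set k := κ + m * F with hk
  have hk0 : 0 ≤ k := by positivity
  set D := (1 / 2) * (n * n * H * (k * k)) + m * n * M * k + (1 / 2) * (m * m * R) with hD
  refine ⟨(1 / 2) * (C₁ * κ ^ 2) + D * P.T, by positivity,
    fun y y' β hy hy' hy0 hyT hβ z hz => ?_⟩
  have hβ0 : 0 ≤ β := (norm_nonneg _).trans (hβ 0)
  have hx := hκ y y' β hy hy' hy0 hβ z hz
  have hyl : LipOn P.T y := by
    have h1 : ContDiff ℝ 1 y := contDiff_one_iff_deriv.2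
      ⟨fun s => (hy s).differentiableAt, by rwa [show deriv y = y' from funext fun s => (hy s).deriv]⟩
    exact (h1.locallyLipschitz.locallyLipschitzOn).exists_lipschitzOnWith_of_compact isCompact_Icc
  have hz1 : (fun t => (z.1.2 t).1) = fun _ => (0 : Vec l) := by rw [hz]
  have hz2 : (fun t => (z.1.2 t).2) = y' := by rw [hz]
  set ξ : ℝ → Vec n := fun t => r.sys.resp z t - P.Fv wh t *ᵥ y t with hξ
  obtain ⟨hJ, hid⟩ := r.goh_identity lam z (ξ := ξ) hyl hy0
    (ae_of_all _ fun t => by rw [show (z.1.2 t).2 = y' t from congr_fun hz2 t]; exact hy t)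
    (fun t _ => by simp [hξ])
  have hN (t : ℝ) : P.D2H wh (r.mult lam) t (0, 0, (z.1.2 t).2) (0, (z.1.2 t).1, 0) = 0 := by
    rw [show (z.1.2 t).1 = 0 from congr_fun hz1 t, ← D2Hbil_apply wh _ r.regular]
    exact map_zero (D2Hbil wh (r.mult lam) r.regular t _)
  simp only [hN, intervalIntegral.integral_zero, add_zero] at hid
  rw [hz1, hz2] at hJ hid
  have hVi : IntervalIntegrable (fun t => y' t ⬝ᵥ P.V wh (r.mult lam) t *ᵥ y t) volume 0 P.T := by
    refine ContinuousOn.intervalIntegrable ?_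
    rw [uIcc_of_le hT]
    have h1 : ContinuousOn (fun t => P.V wh (r.mult lam) t *ᵥ y t) (Icc 0 P.T) :=
      (LipOn.mulVec (r.lipOn_V lam) hyl).continuousOn
    exact continuousOn_finsetSum _ fun i _ =>
      ((continuous_apply i).comp hy').continuousOn.mul ((continuous_apply i).comp_continuousOn h1)
  -- As `y` vanishes at both ends, the endpoint term is that of the state alone. Subtraction of the
  -- integral with `V` then leaves only terms quadratic in `ξ` and `y`, both of order `β`.
  have hO : P.OmegaP wh (r.mult lam) ξ (fun _ => 0) y y' (y P.T) =
      (1 / 2) * pair lam (r.sys.d2G (r.sys.ends (r.sys.resp z)) (r.sys.ends (r.sys.resp z))) +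
      ∫ t in (0 : ℝ)..P.T, r.integrandP lam ξ (fun _ => 0) y y' t := by
    change P.g wh (r.mult lam) (ξ 0) (ξ P.T) (y P.T) + _ = _
    congr 1
    have h1 : ξ 0 = r.sys.resp z 0 := by simp [hξ, hy0]
    have h2 : ξ P.T + P.Fv wh P.T *ᵥ y P.T = r.sys.resp z P.T := by simp [hξ]
    rw [g, h1, h2, hyT, zero_dotProduct, add_zero, D2ell_eq r]
    rfl
  rw [hid, hO, add_sub_assoc, ← intervalIntegral.integral_sub hJ hVi]
  refine (abs_add_le _ _).trans ?_
  have h1 : |(1 / 2) * pair lam (r.sys.d2G (r.sys.ends (r.sys.resp z))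
      (r.sys.ends (r.sys.resp z)))| ≤ (1 / 2) * (C₁ * (κ * β) ^ 2) := by
    rw [abs_mul, abs_of_pos (by norm_num : (0 : ℝ) < 1 / 2)]
    have := (hC₁ (r.sys.resp z)).trans
      (mul_le_mul_of_nonneg_left (pow_le_pow_left₀ (norm_nonneg _) hx 2) hC₁0)
    linarith
  have h2 : |∫ t in (0 : ℝ)..P.T, (r.integrandP lam ξ (fun _ => 0) y y' t -
      y' t ⬝ᵥ P.V wh (r.mult lam) t *ᵥ y t)| ≤ D * β ^ 2 * P.T := by
    have := intervalIntegral.norm_integral_le_of_norm_le_const_ae (a := 0) (b := P.T)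
      (C := D * β ^ 2) (f := fun t => r.integrandP lam ξ (fun _ => 0) y y' t -
      y' t ⬝ᵥ P.V wh (r.mult lam) t *ᵥ y t) ?_
    · rwa [sub_zero, abs_of_nonneg hT] at this
    · have hne : ∀ᵐ s : ℝ, s ≠ P.T := by simp [ae_iff, measure_singleton]
      filter_upwards [hne] with t hs hs'
      rw [uIoc_of_le hT] at hs'
      have ht : t ∈ Ioo 0 P.T := ⟨hs'.1, lt_of_le_of_ne hs'.2 hs⟩
      have hξt : ‖ξ t‖ ≤ k * β := by
        refine (norm_sub_le _ _).trans ?_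
        have h3 := ((r.sys.resp z).norm_coe_le_norm t).trans hx
        have h4 := norm_mulVec_le hF0 (hF t ht) (hβ t)
        rw [hk]
        linarith
      have e1 := abs_dotProduct_mulVec_le hH0 (hH t ht) hξt hξt
      have e2 := abs_dotProduct_mulVec_le hM0 (hM t ht) (hβ t) hξt
      have e3 := abs_dotProduct_mulVec_le hR0 (hR t ht) (hβ t) (hβ t)
      have e4 : r.integrandP lam ξ (fun _ => 0) y y' t - y' t ⬝ᵥ P.V wh (r.mult lam) t *ᵥ y t =
          (1 / 2) * (ξ t ⬝ᵥ P.Hxx wh (r.mult lam) t *ᵥ ξ t) +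
          y t ⬝ᵥ P.M wh (r.mult lam) t *ᵥ ξ t +
          (1 / 2) * (y t ⬝ᵥ P.R wh (r.mult lam) t *ᵥ y t) := by
        simp [integrandP]
      rw [e4, Real.norm_eq_abs]
      refine (abs_add_three _ _ _).trans ?_
      rw [abs_mul, abs_mul, abs_of_pos (by norm_num : (0 : ℝ) < 1 / 2)]
      rw [hD]
      nlinarith [e1, e2, e3]
  rw [mul_pow] at h1
  linarith

end Reference
end Problem

namespace Problem

variable {n l m dphi deta : ℕ} {P : Problem n l m dphi deta} {wh : Triple n l m}

theorem dotProduct_V_antisymm (lam : Multiplier n dphi deta) (t : ℝ) (b c : Vec m) :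
    c ⬝ᵥ P.V wh lam t *ᵥ b = -(b ⬝ᵥ P.V wh lam t *ᵥ c) := by
  have h : (P.V wh lam t)ᵀ = -P.V wh lam t := by
    simp [V, Matrix.transpose_sub]
    rw [← smul_neg, neg_sub]
  have h1 := dotProduct_transpose_mulVec (P.V wh lam t) c b
  rw [h, Matrix.neg_mulVec, dotProduct_neg, dotProduct_comm (P.V wh lam t *ᵥ c)] at h1
  linarith

/-- A rotating vector. -/
def rot (b c : Vec m) (θ : ℝ) : Vec m := Real.cos θ • b + Real.sin θ • c

theorem norm_rot_le (b c : Vec m) (θ : ℝ) : ‖rot b c θ‖ ≤ ‖b‖ + ‖c‖ := by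
  refine (norm_add_le _ _).trans (add_le_add ?_ ?_) <;> rw [norm_smul, Real.norm_eq_abs]
  · exact mul_le_of_le_one_left (norm_nonneg _) (Real.abs_cos_le_one _)
  · exact mul_le_of_le_one_left (norm_nonneg _) (Real.abs_sin_le_one _)

theorem hasDerivAt_rot (b c : Vec m) (ν s : ℝ) :
    HasDerivAt (fun s => rot b c (ν * s)) (ν • rot c (-b) (ν * s)) s := by
  have h0 : HasDerivAt (fun s => ν * s) ν s := by simpa using (hasDerivAt_id s).const_mul ν
  refine ((h0.cos.smul_const b).add (h0.sin.smul_const c)).congr_deriv ?_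
  simp only [rot]
  module

/-- The antisymmetric form of a rotating vector and its velocity is constant. -/
theorem rot_dotProduct_V (lam : Multiplier n dphi deta) (t : ℝ) (b c : Vec m) (p q θ : ℝ) :
    (p • rot b c θ + q • rot c (-b) θ) ⬝ᵥ P.V wh lam t *ᵥ rot b c θ =
      -(q * (b ⬝ᵥ P.V wh lam t *ᵥ c)) := by
  have h1 := dotProduct_V_antisymm (P := P) (wh := wh) lam t b b
  have h2 := dotProduct_V_antisymm (P := P) (wh := wh) lam t c c
  have h3 := dotProduct_V_antisymm (P := P) (wh := wh) lam t b c
  have h1' : b ⬝ᵥ P.V wh lam t *ᵥ b = 0 := by linarith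
  have h2' : c ⬝ᵥ P.V wh lam t *ᵥ c = 0 := by linarith
  have h4 := Real.sin_sq_add_cos_sq θ
  simp only [rot, Matrix.mulVec_add, Matrix.mulVec_smul, dotProduct_add, add_dotProduct,
    smul_dotProduct, dotProduct_smul, neg_dotProduct, smul_eq_mul, h1', h2', h3, smul_neg]
  linear_combination (-q * (b ⬝ᵥ P.V wh lam t *ᵥ c)) * h4

namespace Reference

set_option maxHeartbeats 1600000 in
/-- The values of the antisymmetric form `V` are essential values of the second variation. -/
theorem isEssentialValue_goh (r : P.Reference wh) {t₀ : ℝ} (ht₀ : t₀ ∈ Ioo 0 P.T) (b c : Vec m)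
    {a : (Fin (dphi + 1) → ℝ) × (Fin deta → ℝ)}
    (ha : ∀ lam, pair lam a = -(b ⬝ᵥ P.V wh (r.mult lam) t₀ *ᵥ c)) :
    IsEssentialValue r.sys.second a := by
  intro S ε hε
  let φ (k : Fin (dphi + 1) ⊕ Fin deta) (s : ℝ) : ℝ :=
    b ⬝ᵥ P.V wh (r.mult (coordUnit k)) s *ᵥ c
  have hφ (k : Fin (dphi + 1) ⊕ Fin deta) : ContinuousOn (φ k) (Icc 0 P.T) :=
    ((lipOn_const b).dotProduct (LipOn.mulVec (r.lipOn_V _) (lipOn_const c))).continuousOn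
  choose C hC0 hC using fun k : Fin (dphi + 1) ⊕ Fin deta => r.exists_goh_bound (coordUnit k)
  obtain ⟨δ, hδ, hδT, hδφ⟩ : ∃ δ : ℝ, 0 < δ ∧ t₀ + δ < P.T ∧
      ∀ k, ∀ s, t₀ < s → s < t₀ + δ → |φ k s - φ k t₀| ≤ ε / 2 := by
    have h2 : ∀ᶠ δ : ℝ in 𝓝[>] 0, δ < P.T - t₀ :=
      nhdsWithin_le_nhds (gt_mem_nhds (by linarith [ht₀.2]))
    have h3 : ∀ᶠ δ : ℝ in 𝓝[>] 0, ∀ k, ∀ s, t₀ < s → s < t₀ + δ →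
        |φ k s - φ k t₀| ≤ ε / 2 := by
      refine eventually_all.2 fun k => nhdsWithin_le_nhds ?_
      obtain ⟨η, hη, h⟩ := Metric.continuousAt_iff.1
        ((hφ k).continuousAt (Icc_mem_nhds ht₀.1 ht₀.2)) (ε / 2) (by positivity)
      filter_upwards [gt_mem_nhds hη] with δ hδ s hs hs'
      refine (h ?_).le
      rw [Real.dist_eq, abs_lt]
      constructor <;> linarith
    obtain ⟨δ, ⟨h2, h3⟩, h4⟩ := ((h2.and h3).and self_mem_nhdsWithin).exists
    exact ⟨δ, h4, by linarith, h3⟩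
  set K := Module.finrank ℝ (S → (Fin (dphi + 1) → ℝ) × (Fin deta → ℝ)) + 1 with hK
  obtain ⟨χ, hχd, hχs, hχo, hχn⟩ := exists_bumps ht₀.1.le hδT.le hδ K
  choose D hD using fun i : Fin K => (bddMeas_of_support (hχd i).continuous (hχs i)).2
  have hD0 (i : Fin K) : 0 ≤ D i := (norm_nonneg _).trans (hD i 0)
  set m₀ := (∑ i, D i) * (‖b‖ + ‖c‖) with hm₀
  have hm₀0 : 0 ≤ m₀ := mul_nonneg (Finset.sum_nonneg fun i _ => hD0 i) (by positivity)
  -- the frequency is chosen so large that the remainder in the second variation is negligible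
  obtain ⟨ν, hν, hνC⟩ : ∃ ν : ℝ, 0 < ν ∧ ∀ k, C k * (m₀ ^ 2 / ν) ≤ ε / 2 := by
    have h1 : ∀ᶠ ν : ℝ in atTop, ∀ k, C k * (m₀ ^ 2 / ν) ≤ ε / 2 := by
      refine eventually_all.2 fun k => ?_
      have : Tendsto (fun ν : ℝ => C k * (m₀ ^ 2 / ν)) atTop (𝓝 (C k * 0)) :=
        (tendsto_const_nhds.div_atTop tendsto_id).const_mul _
      rw [mul_zero] at this
      exact this.eventually_le_const (by positivity)
    obtain ⟨ν, h1, h2⟩ := (h1.and (eventually_gt_atTop 0)).exists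
    exact ⟨ν, h2, h1⟩
  -- The amplitude `q` satisfies `q ^ 2 * ν = 1`: the signed area swept by the rotating curve stays
  -- of order one, while the curve itself tends to zero uniformly.
  set q := (Real.sqrt ν)⁻¹ with hq
  have hq0 : 0 < q := by positivity
  have hq2 : q ^ 2 = ν⁻¹ := by rw [hq, inv_pow, Real.sq_sqrt hν.le]
  have hder (i : Fin K) (s : ℝ) : HasDerivAt (χ i) (deriv (χ i) s) s :=
    ((hχd i).differentiable one_ne_zero s).hasDerivAt
  let yd (i : Fin K) (s : ℝ) : Vec m := (q * deriv (χ i) s) • rot b c (ν * s) +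
    (q * ν * χ i s) • rot c (-b) (ν * s)
  have hrot (b c : Vec m) : Continuous fun s => rot b c (ν * s) :=
    continuous_iff_continuousAt.2 fun s => (hasDerivAt_rot b c ν s).continuousAt
  have hydc (i : Fin K) : Continuous (yd i) :=
    ((continuous_const.mul ((hχd i).continuous_deriv le_rfl)).smul (hrot _ _)).add
      ((continuous_const.mul (hχd i).continuous).smul (hrot _ _))
  have hyds (i : Fin K) (s : ℝ) (h : yd i s ≠ 0) : t₀ - δ < s ∧ s < t₀ - δ + 3 * δ := by
    have h1 : s ∈ tsupport (χ i) := by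
      by_contra hs
      have h2 : χ i =ᶠ[𝓝 s] 0 := notMem_tsupport_iff_eventuallyEq.1 hs
      refine h ?_
      simp only [yd]
      rw [h2.deriv_eq, h2.eq_of_nhds]
      simp
    have h2 : tsupport (χ i) ⊆ Icc t₀ (t₀ + δ) :=
      closure_minimal (fun s hs => ⟨(hχs i s hs).1.le, (hχs i s hs).2.le⟩) isClosed_Icc
    have h3 := h2 h1
    constructor <;> linarith [h3.1, h3.2]
  let ψ : Fin K → Variation (Vec n) (Vec l × Vec m) := fun i =>
    ⟨(0, fun s => (0, yd i s)),
      bddMeas_zero.prodMk (bddMeas_of_support (hydc i) (hyds i))⟩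
  obtain ⟨κ, hκ, hκS⟩ := exists_kernel_vector S (Nat.lt_succ_self _) ψ
  refine ⟨∑ i, κ i • ψ i, hκS, ?_⟩
  set z := ∑ i, κ i • ψ i with hz
  set f : ℝ → ℝ := fun s => ∑ i, κ i * χ i s with hf
  set f' : ℝ → ℝ := fun s => ∑ i, κ i * deriv (χ i) s with hf'
  have hfd (s : ℝ) : HasDerivAt f (f' s) s :=
    HasDerivAt.fun_sum fun i _ => (hder i s).const_mul (κ i)
  have hfc : Continuous f := continuous_iff_continuousAt.2 fun s => (hfd s).continuousAt
  have hfs : ∀ s, f s ≠ 0 → t₀ < s ∧ s < t₀ + δ := by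
    intro s h
    obtain ⟨i, _, hi⟩ := Finset.exists_ne_zero_of_sum_ne_zero h
    exact hχs i s (right_ne_zero_of_mul hi)
  have hfn : ∫ s in (0 : ℝ)..P.T, f s ^ 2 = 1 :=
    integral_sq_sum_bumps (fun i => (hχd i).continuous) hχo hχn hκ
  have hfb (s : ℝ) : |f s| ≤ ∑ i, D i := by
    refine (Finset.abs_sum_le_sum_abs _ _).trans (Finset.sum_le_sum fun i _ => ?_)
    rw [abs_mul]
    have h1 : |κ i| ≤ 1 := by
      rw [← sq_le_one_iff_abs_le_one, ← hκ]
      exact Finset.single_le_sum (f := fun i => κ i ^ 2) (fun j _ => sq_nonneg _)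
        (Finset.mem_univ i)
    exact (mul_le_of_le_one_left (abs_nonneg _) h1).trans (hD i s)
  set y : ℝ → Vec m := fun s => (q * f s) • rot b c (ν * s) with hy
  set y' : ℝ → Vec m := fun s => (q * f' s) • rot b c (ν * s) +
    (q * ν * f s) • rot c (-b) (ν * s) with hy'
  have hyder (s : ℝ) : HasDerivAt y (y' s) s := by
    refine (((hfd s).const_mul q).smul (hasDerivAt_rot b c ν s)).congr_deriv ?_
    rw [hy', smul_smul, add_comm]
    congr 2
    ring
  have hyc : Continuous y' := by
    have hf'c : Continuous f' := continuous_finsetSum _ fun i _ =>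
      continuous_const.mul ((hχd i).continuous_deriv le_rfl)
    exact ((continuous_const.mul hf'c).smul (hrot _ _)).add
      ((continuous_const.mul hfc).smul (hrot _ _))
  have hyz (s : ℝ) (hs : s ≤ t₀ ∨ t₀ + δ ≤ s) : y s = 0 := by
    have : f s = 0 := by
      by_contra h
      have := hfs s h
      rcases hs with hs | hs <;> linarith [this.1, this.2]
    rw [hy]
    simp [this]
  have hyb (s : ℝ) : ‖y s‖ ≤ q * m₀ := by
    rw [hy, norm_smul, Real.norm_eq_abs, abs_mul, abs_of_pos hq0, hm₀, mul_assoc]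
    exact mul_le_mul_of_nonneg_left (mul_le_mul (hfb s) (norm_rot_le _ _ _) (norm_nonneg _)
      (Finset.sum_nonneg fun i _ => hD0 i)) hq0.le
  have hz1 : z.1 = (0, fun s => (0, y' s)) := by
    rw [hz, ControlSystem.variation_sum_apply]
    refine Prod.ext ?_ ?_
    · simp [ψ]
    · ext1 s
      refine Prod.ext ?_ ?_
      · simp [ψ, Prod.fst_sum]
      · simp only [ψ, Prod.snd_sum, Prod.smul_mk]
        simp only [yd, hy', hf, hf', smul_add, Finset.sum_add_distrib, smul_smul, Finset.mul_sum,
          Finset.sum_smul]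
        congr 1 <;>
        · refine Finset.sum_congr rfl fun i _ => ?_
          congr 1
          ring
  refine norm_le_of_coordUnit hε.le fun k => ?_
  have h1 := hC k y y' (q * m₀) hyder hyc (hyz 0 (Or.inl ht₀.1.le)) (hyz P.T (Or.inr hδT.le)) hyb z
    hz1
  have h2 := abs_integral_sq_mul_sub_le ht₀.1.le hδT.le hδ hfc hfs hfn (hφ k) (hδφ k)
  have h3 : C k * (q * m₀) ^ 2 ≤ ε / 2 := by
    have := hνC k
    rwa [mul_pow, hq2, inv_mul_eq_div]
  have h4 : ∫ t in (0 : ℝ)..P.T, y' t ⬝ᵥ P.V wh (r.mult (coordUnit k)) t *ᵥ y t =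
      -∫ s in (0 : ℝ)..P.T, f s ^ 2 * φ k s := by
    rw [← intervalIntegral.integral_neg]
    refine intervalIntegral.integral_congr fun t _ => ?_
    change ((q * f' t) • rot b c (ν * t) + (q * ν * f t) • rot c (-b) (ν * t)) ⬝ᵥ
      P.V wh (r.mult (coordUnit k)) t *ᵥ ((q * f t) • rot b c (ν * t)) = _
    rw [Matrix.mulVec_smul, dotProduct_smul, rot_dotProduct_V, smul_eq_mul]
    have h5 : q ^ 2 * ν = 1 := by rw [hq2, inv_mul_cancel₀ hν.ne']
    change _ = -(f t ^ 2 * (b ⬝ᵥ P.V wh (r.mult (coordUnit k)) t *ᵥ c))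
    linear_combination (-(f t ^ 2 * (b ⬝ᵥ P.V wh (r.mult (coordUnit k)) t *ᵥ c))) * h5
  have h5 : pair (coordUnit k) ((1 / 2 : ℝ) • r.sys.second z z - a) =
      (1 / 2) * pair (coordUnit k) (r.sys.second z z) + φ k t₀ := by
    rw [sub_eq_add_neg, pair_add, pair_smul, ← neg_one_smul ℝ a, pair_smul, ha]
    ring
  rw [h5]
  rw [h4] at h1
  have h6 := abs_le.1 (h1.trans h3)
  have h7 := abs_le.1 h2
  exact abs_le.2 ⟨by linarith [h6.1, h7.2], by linarith [h6.2, h7.1]⟩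

end Reference
end Problem

/-! ### Weakly convergent sequences -/

section Weak

variable {T : ℝ} {k : ℕ}

instance (T : ℝ) : IsFiniteMeasure (leb T) := by unfold leb; infer_instance

theorem intervalIntegral_eq_leb (hT : 0 ≤ T) (f : ℝ → ℝ) :
    ∫ t in (0 : ℝ)..T, f t = ∫ t, f t ∂(leb T) := by
  rw [intervalIntegral.integral_of_le hT, ← integral_Icc_eq_integral_Ioc]
  rfl

theorem memLp_apply {g : ℝ → Vec k} (hg : MemLp g 2 (leb T)) (j : Fin k) :
    MemLp (fun t => g t j) 2 (leb T) :=
  (ContinuousLinearMap.proj (R := ℝ) (φ := fun _ : Fin k => ℝ) j).comp_memLp' hg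

theorem WeakL2Tendsto.apply {g : ℕ → ℝ → Vec k} {g₀ : ℝ → Vec k} (h : WeakL2Tendsto T g g₀)
    (j : Fin k) {f : ℝ → ℝ} (hf : MemLp f 2 (leb T)) :
    Tendsto (fun i => ∫ t, f t * g i t j ∂(leb T)) atTop (𝓝 (∫ t, f t * g₀ t j ∂(leb T))) := by
  have h1 : MemLp (fun t => f t • (Pi.single j 1 : Vec k)) 2 (leb T) :=
    (ContinuousLinearMap.toSpanSingleton ℝ (Pi.single j 1 : Vec k)).comp_memLp' hf
  have h2 := h _ h1
  simpa only [smul_dotProduct, single_dotProduct, one_mul, smul_eq_mul] using h2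

/-- Weakly convergent sequences are bounded, by the Banach-Steinhaus theorem. -/
theorem WeakL2Tendsto.exists_bound {g : ℕ → ℝ → Vec k} {g₀ : ℝ → Vec k}
    (h : WeakL2Tendsto T g g₀) (hg : ∀ i, MemLp (g i) 2 (leb T)) :
    ∃ C, 0 ≤ C ∧ ∀ i, ∫ t, ‖g i t‖ ^ 2 ∂(leb T) ≤ C := by
  have h1 (j : Fin k) : ∃ C, 0 ≤ C ∧ ∀ i, ∫ t, (g i t j) ^ 2 ∂(leb T) ≤ C := by
    let G (i : ℕ) : Lp ℝ 2 (leb T) := (memLp_apply (hg i) j).toLp _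
    have h2 (i : ℕ) (f : Lp ℝ 2 (leb T)) : inner ℝ (G i) f = ∫ t, f t * g i t j ∂(leb T) := by
      rw [L2.inner_def]
      refine integral_congr_ae ?_
      filter_upwards [(memLp_apply (hg i) j).coeFn_toLp] with t ht
      rw [ht]
      rfl
    have h3 : ∀ f : Lp ℝ 2 (leb T), ∃ C, ∀ i, ‖innerSL ℝ (G i) f‖ ≤ C := by
      intro f
      obtain ⟨C, hC⟩ := ((h.apply j (Lp.memLp f)).norm).bddAbove_range
      refine ⟨C, fun i => ?_⟩
      rw [innerSL_apply_apply, h2]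
      exact hC ⟨i, rfl⟩
    obtain ⟨C, hC⟩ := banach_steinhaus h3
    refine ⟨C ^ 2, sq_nonneg _, fun i => ?_⟩
    have h4 := hC i
    rw [innerSL_apply_norm] at h4
    have h5 : ∫ t, (g i t j) ^ 2 ∂(leb T) = ‖G i‖ ^ 2 := by
      rw [← real_inner_self_eq_norm_sq, h2]
      refine integral_congr_ae ?_
      filter_upwards [(memLp_apply (hg i) j).coeFn_toLp] with t ht
      rw [ht, pow_two]
    rw [h5]
    exact pow_le_pow_left₀ (norm_nonneg _) h4 2
  choose C hC0 hC using h1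
  refine ⟨∑ j, C j, Finset.sum_nonneg fun j _ => hC0 j, fun i => ?_⟩
  have h6 (j : Fin k) : Integrable (fun t => (g i t j) ^ 2) (leb T) :=
    (memLp_apply (hg i) j).integrable_sq
  calc ∫ t, ‖g i t‖ ^ 2 ∂(leb T) ≤ ∫ t, ∑ j, (g i t j) ^ 2 ∂(leb T) := by
        refine integral_mono (hg i).norm.integrable_sq (integrable_finsetSum _ fun j _ => h6 j)
          fun t => ?_
        have h7 : ‖g i t‖ ≤ Real.sqrt (∑ j, (g i t j) ^ 2) := by
          refine (pi_norm_le_iff_of_nonneg (Real.sqrt_nonneg _)).2 fun j => ?_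
          refine Real.le_sqrt_of_sq_le ?_
          rw [Real.norm_eq_abs, sq_abs]
          exact Finset.single_le_sum (f := fun j => (g i t j) ^ 2) (fun j _ => sq_nonneg _)
            (Finset.mem_univ j)
        refine (pow_le_pow_left₀ (norm_nonneg _) h7 2).trans_eq ?_
        exact Real.sq_sqrt (Finset.sum_nonneg fun j _ => sq_nonneg _)
    _ = ∑ j, ∫ t, (g i t j) ^ 2 ∂(leb T) := integral_finsetSum _ fun j _ => h6 j
    _ ≤ ∑ j, C j := Finset.sum_le_sum fun j _ => hC j i

/-- Primitives of a weakly convergent sequence whose means converge do converge pointwise and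
are uniformly bounded. -/
theorem tendsto_of_primitives (hT : 0 < T) {x z : ℕ → ℝ → ℝ} {x₀ z₀ : ℝ → ℝ}
    (hx : ∀ i, ∀ t ∈ Icc 0 T, x i t = x i 0 + ∫ s in (0 : ℝ)..t, z i s)
    (hx₀ : ∀ t ∈ Icc 0 T, x₀ t = x₀ 0 + ∫ s in (0 : ℝ)..t, z₀ s)
    (hz : ∀ i, IntegrableOn (z i) (Icc 0 T)) (hz₀ : IntegrableOn z₀ (Icc 0 T))
    (h1 : ∀ t ∈ Icc 0 T, Tendsto (fun i => ∫ s in (0 : ℝ)..t, z i s) atTop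
      (𝓝 (∫ s in (0 : ℝ)..t, z₀ s)))
    (h2 : Tendsto (fun i => ∫ t in (0 : ℝ)..T, x i t) atTop (𝓝 (∫ t in (0 : ℝ)..T, x₀ t)))
    {C : ℝ} (hC : ∀ i, ∫ s in (0 : ℝ)..T, |z i s| ≤ C) :
    (∀ t ∈ Icc 0 T, Tendsto (fun i => x i t) atTop (𝓝 (x₀ t))) ∧
      ∃ D, ∀ i, ∀ t ∈ Icc 0 T, |x i t| ≤ D := by
  have hint {z : ℝ → ℝ} (hz : IntegrableOn z (Icc 0 T)) {t : ℝ} (ht : t ∈ Icc 0 T) :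
      IntervalIntegrable z volume 0 t := by
    rw [intervalIntegrable_iff, uIoc_of_le ht.1]
    exact hz.mono_set fun s hs => ⟨hs.1.le, hs.2.trans ht.2⟩
  have hTm : T ∈ Icc 0 T := ⟨hT.le, le_rfl⟩
  have hb : ∀ i, ∀ t ∈ Icc 0 T, |∫ s in (0 : ℝ)..t, z i s| ≤ C := by
    intro i t ht
    refine (intervalIntegral.abs_integral_le_integral_abs ht.1).trans (le_trans ?_ (hC i))
    exact intervalIntegral.integral_mono_interval le_rfl ht.1 ht.2
      (ae_of_all _ fun _ => abs_nonneg _) (hint (hz i) hTm).abs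
  have hcont {z : ℝ → ℝ} (hz : IntegrableOn z (Icc 0 T)) :
      IntervalIntegrable (fun t => ∫ s in (0 : ℝ)..t, z s) volume 0 T := by
    refine ContinuousOn.intervalIntegrable ?_
    exact intervalIntegral.continuousOn_primitive_interval (by rwa [uIcc_of_le hT.le])
  have h3 : Tendsto (fun i => ∫ t in (0 : ℝ)..T, ∫ s in (0 : ℝ)..t, z i s) atTop
      (𝓝 (∫ t in (0 : ℝ)..T, ∫ s in (0 : ℝ)..t, z₀ s)) := by
    refine intervalIntegral.tendsto_integral_filter_of_dominated_convergence (fun _ => C)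
      (Eventually.of_forall fun i => (intervalIntegrable_iff.1 (hcont (hz i))).aestronglyMeasurable)
      (Eventually.of_forall fun i => ae_of_all _ fun t ht => ?_) (by simp)
      (ae_of_all _ fun t ht => ?_) <;> rw [uIoc_of_le hT.le] at ht
    · exact hb i t ⟨ht.1.le, ht.2⟩
    · exact h1 t ⟨ht.1.le, ht.2⟩
  -- the initial value is recovered from the mean and the primitive
  have h4 {x z : ℝ → ℝ} (hx : ∀ t ∈ Icc 0 T, x t = x 0 + ∫ s in (0 : ℝ)..t, z s)
      (hz : IntegrableOn z (Icc 0 T)) :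
      x 0 = T⁻¹ * ((∫ t in (0 : ℝ)..T, x t) - ∫ t in (0 : ℝ)..T, ∫ s in (0 : ℝ)..t, z s) := by
    have : ∫ t in (0 : ℝ)..T, x t = ∫ t in (0 : ℝ)..T, (x 0 + ∫ s in (0 : ℝ)..t, z s) := by
      refine intervalIntegral.integral_congr fun t ht => ?_
      rw [uIcc_of_le hT.le] at ht
      exact hx t ht
    rw [this, intervalIntegral.integral_add (by simp) (hcont hz), intervalIntegral.integral_const,
      smul_eq_mul]
    field_simp
    ring
  have h5 : Tendsto (fun i => x i 0) atTop (𝓝 (x₀ 0)) := by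
    rw [h4 hx₀ hz₀]
    simp only [h4 (hx _) (hz _)]
    exact (h2.sub h3).const_mul _
  refine ⟨fun t ht => ?_, ?_⟩
  · rw [hx₀ t ht]
    simp only [hx _ t ht]
    exact h5.add (h1 t ht)
  · obtain ⟨D, hD⟩ := h5.abs.bddAbove_range
    refine ⟨D + C, fun i t ht => ?_⟩
    rw [hx i t ht]
    exact (abs_add_le _ _).trans (add_le_add (hD ⟨i, rfl⟩) (hb i t ht))

variable {n l m : ℕ}

/-- Weak convergence in `W^{1,2}` implies pointwise convergence and uniform boundedness. -/
theorem tendsto_of_weakL2Tendsto (hT : 0 < T) {x : ℕ → ℝ → Vec n} {x₀ : ℝ → Vec n}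
    (hx : ∀ i, IsSobolev 2 T (x i)) (hx₀ : IsSobolev 2 T x₀)
    (h1 : WeakL2Tendsto T x x₀) (h2 : WeakL2Tendsto T (fun i => deriv (x i)) (deriv x₀)) :
    (∀ t ∈ Icc 0 T, Tendsto (fun i => x i t) atTop (𝓝 (x₀ t))) ∧
      ∃ D, ∀ i, ∀ t ∈ Icc 0 T, ‖x i t‖ ≤ D := by
  have hsob {x : ℝ → Vec n} (hx : IsSobolev 2 T x) : MemLp (deriv x) 2 (leb T) ∧
      ∀ j, ∀ t ∈ Icc 0 T, x t j = x 0 j + ∫ s in (0 : ℝ)..t, deriv x s j := by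
    obtain ⟨z, hz, hzi, hze, hzd⟩ := hx.exists_eq_integral hT.le (by norm_num)
    have hzd' : deriv x =ᵐ[leb T] z := by
      filter_upwards [hzd] with t ht using ht.deriv
    refine ⟨(memLp_congr_ae hzd').2 hz, fun j t ht => ?_⟩
    rw [hze t ht, Pi.add_apply]
    congr 1
    have hi : IntervalIntegrable z volume 0 t := by
      rw [intervalIntegrable_iff, uIoc_of_le ht.1]
      exact hzi.mono_set fun s hs => ⟨hs.1.le, hs.2.trans ht.2⟩
    have h3 := (ContinuousLinearMap.proj (R := ℝ) (φ := fun _ : Fin n => ℝ)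
      j).intervalIntegral_comp_comm hi
    refine h3.symm.trans (intervalIntegral_congr_leb ?_ ht)
    filter_upwards [hzd'] with s hs
    rw [hs]
    rfl
  have hd (i : ℕ) := (hsob (hx i)).1
  obtain ⟨C, hC0, hC⟩ := h2.exists_bound hd
  have hdj {x : ℝ → Vec n} (hx : IsSobolev 2 T x) (j : Fin n) :
      IntegrableOn (fun s => deriv x s j) (Icc 0 T) :=
    integrableOn_of_memLp (q := 2) (by norm_num) (memLp_apply (hsob hx).1 j)
  have key (j : Fin n) := tendsto_of_primitives hT (x := fun i t => x i t j) (x₀ := fun t => x₀ t j)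
    (z := fun i s => deriv (x i) s j) (z₀ := fun s => deriv x₀ s j)
    (fun i t ht => (hsob (hx i)).2 j t ht) (fun t ht => (hsob hx₀).2 j t ht)
    (fun i => hdj (hx i) j) (hdj hx₀ j) (fun t ht => by
      have h3 : MemLp ((Ioc 0 t).indicator fun _ => (1 : ℝ)) 2 (leb T) :=
        (memLp_const (1 : ℝ)).indicator measurableSet_Ioc
      have h4 (f : ℝ → ℝ) : ∫ s in (0 : ℝ)..t, f s =
          ∫ s, (Ioc 0 t).indicator (fun _ => (1 : ℝ)) s * f s ∂(leb T) := by
        have h5 : (fun s => (Ioc 0 t).indicator (fun _ => (1 : ℝ)) s * f s) =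
            (Ioc 0 t).indicator f := by
          ext s
          by_cases hs : s ∈ Ioc 0 t <;> simp [hs]
        rw [h5, integral_indicator measurableSet_Ioc, leb, Measure.restrict_restrict
          measurableSet_Ioc, intervalIntegral.integral_of_le ht.1,
          inter_eq_left.2 (Ioc_subset_Icc_self.trans (Icc_subset_Icc_right ht.2))]
      simp only [h4]
      exact h2.apply j h3) (by
      simp only [intervalIntegral_eq_leb hT.le]
      simpa using h1.apply j (memLp_const (1 : ℝ)))
    (C := T + C) (fun i => by
      have h3 : IntervalIntegrable (fun s => deriv (x i) s j) volume 0 T := by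
        rw [intervalIntegrable_iff, uIoc_of_le hT.le]
        exact (hdj (hx i) j).mono_set Ioc_subset_Icc_self
      have h4 : IntervalIntegrable (fun s => ‖deriv (x i) s‖ ^ 2) volume 0 T := by
        rw [intervalIntegrable_iff, uIoc_of_le hT.le]
        exact IntegrableOn.mono_set (hd i).norm.integrable_sq Ioc_subset_Icc_self
      have h5 : ∫ s in (0 : ℝ)..T, |deriv (x i) s j| ≤
          ∫ s in (0 : ℝ)..T, (1 + ‖deriv (x i) s‖ ^ 2) := by
        refine intervalIntegral.integral_mono_on hT.le h3.abs
          ((by simp : IntervalIntegrable (fun _ => (1 : ℝ)) volume 0 T).add h4) fun s _ => ?_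
        have h6 : |deriv (x i) s j| ≤ ‖deriv (x i) s‖ := norm_le_pi_norm (deriv (x i) s) j
        nlinarith [sq_nonneg (‖deriv (x i) s‖ - 1), sq_nonneg ‖deriv (x i) s‖]
      rw [intervalIntegral.integral_add (by simp) h4, intervalIntegral.integral_const] at h5
      have := hC i
      rw [← intervalIntegral_eq_leb hT.le] at this
      simp only [sub_zero, smul_eq_mul, mul_one] at h5
      linarith)
  refine ⟨fun t ht => tendsto_pi_nhds.2 fun j => (key j).1 t ht, ?_⟩
  choose D hD using fun j => (key j).2
  refine ⟨∑ j, |D j|, fun i t ht => (pi_norm_le_iff_of_nonneg (by positivity)).2 fun j => ?_⟩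
  refine (hD j i t ht).trans ((le_abs_self _).trans ?_)
  exact Finset.single_le_sum (f := fun j => |D j|) (fun j _ => abs_nonneg _) (Finset.mem_univ j)

end Weak

/-! ### Weak lower semicontinuity of the second variation -/

theorem IsSobolev.continuousOn {k : ℕ} {T : ℝ} (hT : 0 ≤ T) {x : ℝ → Vec k} (hx : IsSobolev 2 T x) :
    ContinuousOn x (Icc 0 T) := by
  obtain ⟨z, _, hzi, hze, _⟩ := hx.exists_eq_integral hT (by norm_num)
  have h : ContinuousOn (fun t => x 0 + ∫ s in (0 : ℝ)..t, z s) (Icc 0 T) := by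
    have := intervalIntegral.continuousOn_primitive_interval (f := z) (μ := volume) (a := 0) (b := T)
      (by rwa [uIcc_of_le hT])
    rw [uIcc_of_le hT] at this
    exact continuousOn_const.add this
  exact h.congr hze

theorem memLp_of_continuousOn {k : ℕ} {T : ℝ} {x : ℝ → Vec k} (hx : ContinuousOn x (Icc 0 T)) :
    MemLp x 2 (leb T) := by
  obtain ⟨C, hC⟩ := isCompact_Icc.exists_bound_of_continuousOn hx
  exact MemLp.of_bound (hx.aestronglyMeasurable measurableSet_Icc) C
    ((ae_restrict_mem measurableSet_Icc).mono hC)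

theorem memLp_clm_apply {E W : Type*} [NormedAddCommGroup E] [NormedSpace ℝ E]
    [NormedAddCommGroup W] [NormedSpace ℝ W] {T D : ℝ} {A : ℝ → E →L[ℝ] W} (hA : Continuous A)
    (hD : ∀ t ∈ Icc 0 T, ‖A t‖ ≤ D) {a : ℝ → E} (ha : MemLp a 2 (leb T)) :
    MemLp (fun t => A t (a t)) 2 (leb T) := by
  have hc : Continuous fun p : (E →L[ℝ] W) × E => p.1 p.2 := continuous_fst.clm_apply continuous_snd
  have hm : AEStronglyMeasurable (fun t => A t (a t)) (leb T) :=
    hc.comp_aestronglyMeasurable (hA.aestronglyMeasurable.prodMk ha.1)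
  have hle : ∀ᵐ t ∂(leb T), ‖A t (a t)‖ ≤ D * ‖a t‖ := by
    filter_upwards [ae_restrict_mem measurableSet_Icc] with t ht
    exact ((A t).le_opNorm (a t)).trans (mul_le_mul_of_nonneg_right (hD t ht) (norm_nonneg _))
  exact MemLp.of_le_mul ha hm hle

theorem integrable_clm_apply {E : Type*} [NormedAddCommGroup E] [NormedSpace ℝ E] {T : ℝ}
    {A : ℝ → E →L[ℝ] ℝ} (hA : MemLp A 2 (leb T)) {a : ℝ → E} (ha : MemLp a 2 (leb T)) :
    Integrable (fun t => A t (a t)) (leb T) := by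
  have hc : Continuous fun p : (E →L[ℝ] ℝ) × E => p.1 p.2 :=
    continuous_fst.clm_apply continuous_snd
  refine Integrable.mono' (hA.norm.integrable_sq.add ha.norm.integrable_sq)
    (hc.comp_aestronglyMeasurable (hA.1.prodMk ha.1)) (ae_of_all _ fun t => ?_)
  refine ((A t).le_opNorm (a t)).trans ?_
  change _ ≤ ‖A t‖ ^ 2 + ‖a t‖ ^ 2
  nlinarith [sq_nonneg (‖A t‖ - ‖a t‖), sq_nonneg ‖A t‖, sq_nonneg ‖a t‖]

namespace Problem

variable {n l m dphi deta : ℕ} {P : Problem n l m dphi deta} {wh : Triple n l m}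

theorem InSpace.memLp_val {T : ℝ} (hT : 0 ≤ T) {w : Triple n l m} (hw : w.InSpace 2 T) :
    MemLp w.val 2 (leb T) := by
  have h1 := (ContinuousLinearMap.inl ℝ (Vec n) (Vec l × Vec m)).comp_memLp'
    (memLp_of_continuousOn (hw.1.continuousOn hT))
  have h2 := ((ContinuousLinearMap.inr ℝ (Vec n) (Vec l × Vec m)).comp
    (ContinuousLinearMap.inl ℝ (Vec l) (Vec m))).comp_memLp' hw.2.1
  have h3 := ((ContinuousLinearMap.inr ℝ (Vec n) (Vec l × Vec m)).comp
    (ContinuousLinearMap.inr ℝ (Vec l) (Vec m))).comp_memLp' hw.2.2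
  refine (memLp_congr_ae (ae_of_all _ fun t => ?_)).1 ((h1.add h2).add h3)
  simp [Triple.val]

namespace Reference

/-- The second derivative of the pre-Hamiltonian along the reference process. -/
def hess (r : P.Reference wh) (lam : (Fin (dphi + 1) → ℝ) × (Fin deta → ℝ)) (t : ℝ) :
    (Vec n × Vec l × Vec m) →L[ℝ] (Vec n × Vec l × Vec m) →L[ℝ] ℝ :=
  (ContinuousLinearMap.compL ℝ (Vec n × Vec l × Vec m) (Vec n) ℝ (r.sys.costate lam t)).comp
    (r.sys.d2F t)

theorem hess_apply (r : P.Reference wh) (lam : (Fin (dphi + 1) → ℝ) × (Fin deta → ℝ)) (t : ℝ)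
    (a b : Vec n × Vec l × Vec m) :
    r.hess lam t a b = r.sys.costate lam t (r.sys.d2F t a b) := rfl

theorem hess_symm (r : P.Reference wh) (lam : (Fin (dphi + 1) → ℝ) × (Fin deta → ℝ)) (t : ℝ)
    (a b : Vec n × Vec l × Vec m) : r.hess lam t a b = r.hess lam t b a := by
  rw [hess_apply, hess_apply]
  congr 1
  exact sndDeriv_symm r.sys.contDiff_F _ _ _

theorem continuous_hess (r : P.Reference wh) (lam : (Fin (dphi + 1) → ℝ) × (Fin deta → ℝ)) :
    Continuous (r.hess lam) :=
  ((ContinuousLinearMap.compL ℝ (Vec n × Vec l × Vec m) (Vec n) ℝ).continuous.comp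
    (r.sys.continuous_costate lam)).clm_comp
    ((continuous_sndDeriv r.sys.contDiff_F).comp r.sys.w.continuous)

theorem exists_hess_bound (r : P.Reference wh) (lam : (Fin (dphi + 1) → ℝ) × (Fin deta → ℝ)) :
    ∃ D, 0 ≤ D ∧ ∀ t ∈ Icc 0 P.T, ‖r.hess lam t‖ ≤ D := by
  obtain ⟨D, hD⟩ := isCompact_Icc.exists_bound_of_continuousOn (s := Icc 0 P.T)
    (E := (Vec n × Vec l × Vec m) →L[ℝ] (Vec n × Vec l × Vec m) →L[ℝ] ℝ)
    (r.continuous_hess lam).continuousOn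
  exact ⟨D, (norm_nonneg _).trans (hD 0 r.zero_mem), hD⟩

theorem memLp_hess (r : P.Reference wh) (lam : (Fin (dphi + 1) → ℝ) × (Fin deta → ℝ))
    {a : ℝ → Vec n × Vec l × Vec m} (ha : MemLp a 2 (leb P.T)) :
    MemLp (fun t => r.hess lam t (a t)) 2 (leb P.T) := by
  obtain ⟨D, _, hD⟩ := r.exists_hess_bound lam
  exact memLp_clm_apply (r.continuous_hess lam) hD ha

theorem integrable_hess (r : P.Reference wh) (lam : (Fin (dphi + 1) → ℝ) × (Fin deta → ℝ))
    {a b : ℝ → Vec n × Vec l × Vec m} (ha : MemLp a 2 (leb P.T)) (hb : MemLp b 2 (leb P.T)) :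
    Integrable (fun t => r.hess lam t (a t) (b t)) (leb P.T) :=
  integrable_clm_apply (r.memLp_hess lam ha) hb

theorem Omega_eq_hess (r : P.Reference wh) (lam : (Fin (dphi + 1) → ℝ) × (Fin deta → ℝ))
    (w : Triple n l m) : P.Omega wh (r.mult lam) w =
      (1 / 2) * pair lam (r.sys.d2G (P.ends w.x) (P.ends w.x)) +
      (1 / 2) * ∫ t, r.hess lam t (w.val t) (w.val t) ∂(leb P.T) := by
  rw [Omega, D2ell_eq r, ← intervalIntegral_eq_leb r.T_nonneg,
    ← intervalIntegral.integral_const_mul]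
  congr 1
  refine intervalIntegral.integral_congr fun t ht => ?_
  rw [uIcc_of_le r.T_nonneg] at ht
  refine (integrand_eq wh _ r.regular t _ _ _).trans ?_
  rw [D2H_mult r lam ht]
  rfl

/-- Linear functionals built from the second derivative are weakly continuous. -/
theorem tendsto_integral_hess (r : P.Reference wh)
    (lam : (Fin (dphi + 1) → ℝ) × (Fin deta → ℝ)) {a : ℝ → Vec n × Vec l × Vec m}
    (ha : MemLp a 2 (leb P.T)) {w : ℕ → Triple n l m} {w₀ : Triple n l m}
    (hw : ∀ i, (w i).InSpace 2 P.T) (hw₀ : w₀.InSpace 2 P.T) (h : WeakTendsto P.T w w₀) :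
    Tendsto (fun i => ∫ t, r.hess lam t (a t) ((w i).val t) ∂(leb P.T)) atTop
      (𝓝 (∫ t, r.hess lam t (a t) (w₀.val t) ∂(leb P.T))) := by
  let iX := ContinuousLinearMap.inl ℝ (Vec n) (Vec l × Vec m)
  let iU := (ContinuousLinearMap.inr ℝ (Vec n) (Vec l × Vec m)).comp
    (ContinuousLinearMap.inl ℝ (Vec l) (Vec m))
  let iV := (ContinuousLinearMap.inr ℝ (Vec n) (Vec l × Vec m)).comp
    (ContinuousLinearMap.inr ℝ (Vec l) (Vec m))
  have hA := r.memLp_hess lam ha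
  have hJ {k : ℕ} (i : Vec k →L[ℝ] Vec n × Vec l × Vec m) :
      MemLp (fun t => fun j => r.hess lam t (a t) (i (Pi.single j 1))) 2 (leb P.T) :=
    (ContinuousLinearMap.pi fun j : Fin k => ContinuousLinearMap.apply ℝ ℝ
      (i (Pi.single j 1))).comp_memLp' hA
  have hdot {k : ℕ} (i : Vec k →L[ℝ] Vec n × Vec l × Vec m) (t : ℝ) (x : Vec k) :
      (fun j => r.hess lam t (a t) (i (Pi.single j 1))) ⬝ᵥ x = r.hess lam t (a t) (i x) :=
    dotProduct_of_single ((r.hess lam t (a t)).comp i) x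
  have hsplit {w : Triple n l m} (hw : w.InSpace 2 P.T) :
      ∫ t, r.hess lam t (a t) (w.val t) ∂(leb P.T) =
      ∫ t, (fun j => r.hess lam t (a t) (iX (Pi.single j 1))) ⬝ᵥ w.x t ∂(leb P.T) +
      ∫ t, (fun j => r.hess lam t (a t) (iU (Pi.single j 1))) ⬝ᵥ w.u t ∂(leb P.T) +
      ∫ t, (fun j => r.hess lam t (a t) (iV (Pi.single j 1))) ⬝ᵥ w.v t ∂(leb P.T) := by
    simp only [hdot]
    have i1 := r.integrable_hess lam ha
      (iX.comp_memLp' (memLp_of_continuousOn (hw.1.continuousOn r.T_nonneg)))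
    have i2 := r.integrable_hess lam ha (iU.comp_memLp' hw.2.1)
    have i3 := r.integrable_hess lam ha (iV.comp_memLp' hw.2.2)
    have e1 : ∫ t, r.hess lam t (a t) (w.val t) ∂(leb P.T) =
        ∫ t, (r.hess lam t (a t) (iX (w.x t)) + r.hess lam t (a t) (iU (w.u t)) +
          r.hess lam t (a t) (iV (w.v t))) ∂(leb P.T) := by
      refine integral_congr_ae (ae_of_all _ fun t => ?_)
      change r.hess lam t (a t) (w.val t) = _ + _ + _
      rw [← map_add, ← map_add]
      congr 1
      simp [iX, iU, iV, Triple.val]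
    rw [e1]
    exact (integral_add (i1.add i2) i3).trans (congrArg₂ _ (integral_add i1 i2) rfl)
  rw [hsplit hw₀]
  simp only [hsplit (hw _)]
  exact ((h.1 _ (hJ iX)).add (h.2.2.1 _ (hJ iU))).add (h.2.2.2 _ (hJ iV))

/-- The second variation is bounded along weakly convergent sequences. -/
theorem exists_Omega_bound (r : P.Reference wh) (lam : (Fin (dphi + 1) → ℝ) × (Fin deta → ℝ))
    {w : ℕ → Triple n l m} {w₀ : Triple n l m}
    (hw : ∀ i, (w i).InSpace 2 P.T) (hw₀ : w₀.InSpace 2 P.T) (h : WeakTendsto P.T w w₀) :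
    ∃ C, ∀ i, |P.Omega wh (r.mult lam) (w i)| ≤ C := by
  obtain ⟨D, hD0, hD⟩ := r.exists_hess_bound lam
  obtain ⟨_, X, hX⟩ := tendsto_of_weakL2Tendsto r.T_pos (fun i => (hw i).1) hw₀.1 h.1 h.2.1
  obtain ⟨A, hA0, hA⟩ := h.1.exists_bound fun i =>
    memLp_of_continuousOn ((hw i).1.continuousOn r.T_nonneg)
  obtain ⟨B, hB0, hB⟩ := h.2.2.1.exists_bound fun i => (hw i).2.1
  obtain ⟨C, hC0, hC⟩ := h.2.2.2.exists_bound fun i => (hw i).2.2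
  set L := LinearMap.toContinuousLinearMap (pairLin lam)
  refine ⟨(1 / 2) * (‖L‖ * (‖r.sys.d2G‖ * X * X)) + (1 / 2) * (D * (A + B + C)), fun i => ?_⟩
  have hX0 : 0 ≤ X := (norm_nonneg _).trans (hX i 0 r.zero_mem)
  rw [r.Omega_eq_hess]
  refine (abs_add_le _ _).trans (add_le_add ?_ ?_) <;>
    rw [abs_mul, abs_of_pos (by norm_num : (0 : ℝ) < 1 / 2)] <;>
    refine mul_le_mul_of_nonneg_left ?_ (by norm_num)
  · have h1 : ‖P.ends (w i).x‖ ≤ X :=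
      norm_prod_le_iff.2 ⟨hX i 0 r.zero_mem, hX i P.T r.T_mem⟩
    refine (L.le_opNorm (r.sys.d2G (P.ends (w i).x) (P.ends (w i).x))).trans ?_
    refine mul_le_mul_of_nonneg_left ?_ (norm_nonneg _)
    refine (r.sys.d2G.le_opNorm₂ _ _).trans ?_
    gcongr
  · have hx := (memLp_of_continuousOn ((hw i).1.continuousOn r.T_nonneg)).norm.integrable_sq
    have hu := (hw i).2.1.norm.integrable_sq
    have hv := (hw i).2.2.norm.integrable_sq
    have h1 : |∫ t, r.hess lam t ((w i).val t) ((w i).val t) ∂(leb P.T)| ≤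
        ∫ t, D * (‖(w i).x t‖ ^ 2 + ‖(w i).u t‖ ^ 2 + ‖(w i).v t‖ ^ 2) ∂(leb P.T) := by
      rw [← Real.norm_eq_abs]
      refine norm_integral_le_of_norm_le (((hx.add hu).add hv).const_mul D) ?_
      filter_upwards [ae_restrict_mem measurableSet_Icc] with t ht
      refine ((r.hess lam t).le_opNorm₂ _ _).trans ?_
      have h2 : ‖(w i).val t‖ ^ 2 ≤ ‖(w i).x t‖ ^ 2 + ‖(w i).u t‖ ^ 2 + ‖(w i).v t‖ ^ 2 := by
        rw [Triple.val, Prod.norm_mk, Prod.norm_mk]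
        rcases max_choice ‖(w i).x t‖ (max ‖(w i).u t‖ ‖(w i).v t‖) with h | h <;> rw [h]
        · nlinarith [sq_nonneg ‖(w i).u t‖, sq_nonneg ‖(w i).v t‖]
        · rcases max_choice ‖(w i).u t‖ ‖(w i).v t‖ with h | h <;> rw [h] <;>
            nlinarith [sq_nonneg ‖(w i).u t‖, sq_nonneg ‖(w i).v t‖, sq_nonneg ‖(w i).x t‖]
      rw [mul_assoc, ← pow_two]
      exact mul_le_mul (hD t ht) h2 (sq_nonneg _) hD0
    refine h1.trans ?_
    rw [integral_const_mul]
    refine mul_le_mul_of_nonneg_left ?_ hD0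
    have h3 : ∫ t, (‖(w i).x t‖ ^ 2 + ‖(w i).u t‖ ^ 2 + ‖(w i).v t‖ ^ 2) ∂(leb P.T) =
        ∫ t, ‖(w i).x t‖ ^ 2 ∂(leb P.T) + ∫ t, ‖(w i).u t‖ ^ 2 ∂(leb P.T) +
        ∫ t, ‖(w i).v t‖ ^ 2 ∂(leb P.T) :=
      (integral_add (hx.add hu) hv).trans (congrArg₂ _ (integral_add hx hu) rfl)
    rw [h3]
    exact add_le_add (add_le_add (hA i) (hB i)) (hC i)

/-- Under the Legendre condition the second variation is weakly lower semicontinuous: along a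
weakly convergent sequence the states converge strongly and the form is convex in the controls. -/
theorem omegaWeaklyLsc_of_legendre (r : P.Reference wh)
    (lam : (Fin (dphi + 1) → ℝ) × (Fin deta → ℝ))
    (hleg : ∀ t ∈ Icc 0 P.T, ∀ a : Vec l × Vec m, 0 ≤ r.hess lam t (0, a) (0, a)) :
    P.OmegaWeaklyLsc wh (r.mult lam) := by
  intro w w₀ hwH hw₀H h c hc
  have hw (i : ℕ) := (hwH i).1
  have hw₀ := hw₀H.1
  obtain ⟨D, hD0, hD⟩ := r.exists_hess_bound lam
  obtain ⟨hxt, X, hX⟩ := tendsto_of_weakL2Tendsto r.T_pos (fun i => (hw i).1) hw₀.1 h.1 h.2.1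
  obtain ⟨B, hB0, hB⟩ := h.2.2.1.exists_bound fun i => (hw i).2.1
  obtain ⟨C, hC0, hC⟩ := h.2.2.2.exists_bound fun i => (hw i).2.2
  set μ := leb P.T with hμ
  have hval₀ := InSpace.memLp_val r.T_nonneg hw₀
  have hval (i : ℕ) := InSpace.memLp_val r.T_nonneg (hw i)
  set N := 2 * (B + C) + 2 * (∫ t, ‖w₀.u t‖ ^ 2 ∂μ + ∫ t, ‖w₀.v t‖ ^ 2 ∂μ) with hN
  have hN0 : 0 ≤ N := by
    have h1 : 0 ≤ ∫ t, ‖w₀.u t‖ ^ 2 ∂μ := integral_nonneg fun _ => sq_nonneg _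
    have h2 : 0 ≤ ∫ t, ‖w₀.v t‖ ^ 2 ∂μ := integral_nonneg fun _ => sq_nonneg _
    positivity
  -- the control part of the remainder is made small by the choice of `η`
  obtain ⟨η, hη, hηc⟩ : ∃ η : ℝ, 0 < η ∧ c < P.Omega wh (r.mult lam) w₀ - D * η * N := by
    have h1 : Tendsto (fun η : ℝ => P.Omega wh (r.mult lam) w₀ - D * η * N) (𝓝[>] 0)
        (𝓝 (P.Omega wh (r.mult lam) w₀ - D * 0 * N)) :=
      (((tendsto_id.const_mul D).mul_const N).const_sub _).mono_left nhdsWithin_le_nhds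
    rw [mul_zero, zero_mul, sub_zero] at h1
    obtain ⟨η, h2, h3⟩ := ((h1.eventually_const_lt hc).and self_mem_nhdsWithin).exists
    exact ⟨η, h3, h2⟩
  -- weak convergence of the derivatives makes the states converge strongly
  set Dx : ℕ → ℝ → ℝ := fun i t => ‖(w i).x t - w₀.x t‖ ^ 2 with hDx
  have hDxi (i : ℕ) : Integrable (Dx i) μ :=
    ((memLp_of_continuousOn ((hw i).1.continuousOn r.T_nonneg)).sub
      (memLp_of_continuousOn (hw₀.1.continuousOn r.T_nonneg))).norm.integrable_sq
  have hDx0 : Tendsto (fun i => ∫ t, Dx i t ∂μ) atTop (𝓝 0) := by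
    obtain ⟨X₀, hX₀⟩ := isCompact_Icc.exists_bound_of_continuousOn (hw₀.1.continuousOn r.T_nonneg)
    have h1 := tendsto_integral_of_dominated_convergence (μ := μ) (F := Dx) (f := fun _ => 0)
      (fun _ => (X + X₀) ^ 2) (fun i => (hDxi i).1) (integrable_const _) (fun i => ?_) ?_
    · simpa using h1
    · filter_upwards [ae_restrict_mem measurableSet_Icc] with t ht
      rw [Real.norm_eq_abs, abs_of_nonneg (sq_nonneg _)]
      exact pow_le_pow_left₀ (norm_nonneg _)
        ((norm_sub_le _ _).trans (add_le_add (hX i t ht) (hX₀ t ht))) 2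
    · filter_upwards [ae_restrict_mem measurableSet_Icc] with t ht
      have h2 := ((hxt t ht).sub_const (w₀.x t)).norm.pow 2
      simpa using h2
  have hends : Tendsto (fun i => pair lam (r.sys.d2G (P.ends (w i).x) (P.ends (w i).x))) atTop
      (𝓝 (pair lam (r.sys.d2G (P.ends w₀.x) (P.ends w₀.x)))) := by
    have h1 : Tendsto (fun i => P.ends (w i).x) atTop (𝓝 (P.ends w₀.x)) :=
      (hxt 0 r.zero_mem).prodMk_nhds (hxt P.T r.T_mem)
    have h2 : Continuous fun q : Vec n × Vec n =>
        LinearMap.toContinuousLinearMap (pairLin lam) (r.sys.d2G q q) :=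
      (LinearMap.toContinuousLinearMap (pairLin lam)).continuous.comp
        (r.sys.d2G.continuous.clm_apply continuous_id)
    exact (h2.tendsto _).comp h1
  have hlin := r.tendsto_integral_hess lam hval₀ hw hw₀ h
  set I₀ := ∫ t, r.hess lam t (w₀.val t) (w₀.val t) ∂μ with hI₀
  -- a lower bound that converges
  have hlow : Tendsto (fun i => (1 / 2) * pair lam (r.sys.d2G (P.ends (w i).x) (P.ends (w i).x)) +
      ((1 / 2) * I₀ + ((∫ t, r.hess lam t (w₀.val t) ((w i).val t) ∂μ) - I₀) -
        (D * (1 + 1 / η) * (∫ t, Dx i t ∂μ) + D * η * N))) atTop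
      (𝓝 (P.Omega wh (r.mult lam) w₀ - D * η * N)) := by
    have h1 := (hends.const_mul (1 / 2 : ℝ)).add
      (((hlin.sub_const I₀).const_add ((1 / 2) * I₀)).sub
        ((hDx0.const_mul (D * (1 + 1 / η))).add_const (D * η * N)))
    have h2 : P.Omega wh (r.mult lam) w₀ - D * η * N =
        (1 / 2) * pair lam (r.sys.d2G (P.ends w₀.x) (P.ends w₀.x)) +
          ((1 / 2) * I₀ + (I₀ - I₀) - (D * (1 + 1 / η) * 0 + D * η * N)) := by
      rw [r.Omega_eq_hess]
      ring
    rw [h2]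
    exact h1
  filter_upwards [hlow.eventually_const_lt hηc] with i hi
  refine hi.trans_le ?_
  rw [r.Omega_eq_hess]
  refine add_le_add le_rfl ?_
  have hdi := (hw i).2.1.sub hw₀.2.1
  have hdv := (hw i).2.2.sub hw₀.2.2
  have hsq {k : ℕ} {a b : ℝ → Vec k} (ha : MemLp a 2 μ) (hb : MemLp b 2 μ) :
      ∫ t, ‖a t - b t‖ ^ 2 ∂μ ≤ 2 * ∫ t, ‖a t‖ ^ 2 ∂μ + 2 * ∫ t, ‖b t‖ ^ 2 ∂μ := by
    rw [← integral_const_mul, ← integral_const_mul,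
      ← integral_add (ha.norm.integrable_sq.const_mul 2) (hb.norm.integrable_sq.const_mul 2)]
    refine integral_mono (ha.sub hb).norm.integrable_sq
      ((ha.norm.integrable_sq.const_mul 2).add (hb.norm.integrable_sq.const_mul 2)) fun t => ?_
    have h1 := norm_sub_le (a t) (b t)
    change ‖a t - b t‖ ^ 2 ≤ 2 * ‖a t‖ ^ 2 + 2 * ‖b t‖ ^ 2
    nlinarith [norm_nonneg (a t - b t), sq_nonneg (‖a t‖ - ‖b t‖)]
  -- Pointwise lower bound from expansion at `w₀`: the form in the control difference is nonnegative
  -- by hypothesis and is dropped, the mixed term is split by a weighted Young inequality.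
  have hpt : ∀ᵐ t ∂μ, (1 / 2) * r.hess lam t (w₀.val t) (w₀.val t) +
      (r.hess lam t (w₀.val t) ((w i).val t) - r.hess lam t (w₀.val t) (w₀.val t)) -
      (D * (1 + 1 / η) * Dx i t +
        D * η * (‖(w i).u t - w₀.u t‖ ^ 2 + ‖(w i).v t - w₀.v t‖ ^ 2)) ≤
      (1 / 2) * r.hess lam t ((w i).val t) ((w i).val t) := by
    filter_upwards [ae_restrict_mem measurableSet_Icc] with t ht
    set d := (w i).val t - w₀.val t with hd
    set dx : Vec n × Vec l × Vec m := ((w i).x t - w₀.x t, 0) with hdx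
    set da : Vec n × Vec l × Vec m := (0, (w i).u t - w₀.u t, (w i).v t - w₀.v t) with hda
    have e1 : (w i).val t = w₀.val t + d := by rw [hd]; abel
    have e2 : d = dx + da := by
      rw [hd, hdx, hda]
      simp [Triple.val]
    have e3 : 0 ≤ r.hess lam t da da := hleg t ht _
    have e4 : |r.hess lam t dx dx| ≤ D * ‖dx‖ * ‖dx‖ :=
      ((r.hess lam t).le_opNorm₂ _ _).trans (by gcongr; exact hD t ht)
    have e5 : |r.hess lam t dx da| ≤ D * ‖dx‖ * ‖da‖ :=
      ((r.hess lam t).le_opNorm₂ _ _).trans (by gcongr; exact hD t ht)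
    have e6 : ‖dx‖ ^ 2 = Dx i t := by
      rw [hdx, Prod.norm_mk, norm_zero, max_eq_left (norm_nonneg _)]
    have e7 : ‖da‖ ^ 2 ≤ ‖(w i).u t - w₀.u t‖ ^ 2 + ‖(w i).v t - w₀.v t‖ ^ 2 := by
      rw [hda, Prod.norm_mk, Prod.norm_mk, norm_zero, max_eq_right (by positivity)]
      rcases max_choice ‖(w i).u t - w₀.u t‖ ‖(w i).v t - w₀.v t‖ with h | h <;> rw [h] <;>
        nlinarith [sq_nonneg ‖(w i).u t - w₀.u t‖, sq_nonneg ‖(w i).v t - w₀.v t‖]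
    have e8 : ‖dx‖ * ‖da‖ ≤ 1 / η * ‖dx‖ ^ 2 + η * ‖da‖ ^ 2 := by
      have h1 : 1 / η * ‖dx‖ ^ 2 + η * ‖da‖ ^ 2 - ‖dx‖ * ‖da‖ =
          (1 / η) * ((‖dx‖ - η * ‖da‖ / 2) ^ 2 + 3 / 4 * (η * ‖da‖) ^ 2) := by
        field_simp
        ring
      have h2 : 0 ≤ (1 / η) * ((‖dx‖ - η * ‖da‖ / 2) ^ 2 + 3 / 4 * (η * ‖da‖) ^ 2) := by
        positivity
      linarith
    have e9 := r.hess_symm lam t dx da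
    have e10 := r.hess_symm lam t (w₀.val t) d
    have e11 : r.hess lam t d d = r.hess lam t dx dx + 2 * r.hess lam t dx da +
        r.hess lam t da da := by
      rw [e2]
      simp only [map_add, add_apply, e9]
      ring
    have e12 : r.hess lam t ((w i).val t) ((w i).val t) = r.hess lam t (w₀.val t) (w₀.val t) +
        2 * r.hess lam t (w₀.val t) d + r.hess lam t d d := by
      rw [e1]
      simp only [map_add, add_apply, e10]
      ring
    have e13 : r.hess lam t (w₀.val t) ((w i).val t) = r.hess lam t (w₀.val t) (w₀.val t) +
        r.hess lam t (w₀.val t) d := by rw [e1, map_add]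
    rw [e12, e13, e11, ← e6]
    have f1 := (abs_le.1 e4).1
    have f2 := (abs_le.1 e5).1
    have f3 := mul_le_mul_of_nonneg_left e8 hD0
    have f4 := mul_le_mul_of_nonneg_left e7 (mul_nonneg hD0 hη.le)
    have f5 : 0 ≤ D * ‖dx‖ * ‖dx‖ := by positivity
    have f6 : D * (1 + 1 / η) * ‖dx‖ ^ 2 = D * ‖dx‖ * ‖dx‖ + D * (1 / η * ‖dx‖ ^ 2) := by ring
    have f7 : D * (1 / η * ‖dx‖ ^ 2 + η * ‖da‖ ^ 2) =
      D * (1 / η * ‖dx‖ ^ 2) + D * η * ‖da‖ ^ 2 := by ring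
    have f8 : D * (‖dx‖ * ‖da‖) = D * ‖dx‖ * ‖da‖ := by ring
    linarith
  have i0 := r.integrable_hess lam hval₀ hval₀
  have i1 := r.integrable_hess lam hval₀ (hval i)
  have i2 := r.integrable_hess lam (hval i) (hval i)
  have i3 := hdi.norm.integrable_sq
  have i4 := hdv.norm.integrable_sq
  have j1 := (i0.const_mul (1 / 2 : ℝ)).add (i1.sub i0)
  have j2 := ((hDxi i).const_mul (D * (1 + 1 / η))).add ((i3.add i4).const_mul (D * η))
  have hmono := integral_mono_ae (j1.sub j2) (i2.const_mul (1 / 2 : ℝ)) hpt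
  have k1 := integral_sub j1 j2
  have k2 := integral_add (i0.const_mul (1 / 2 : ℝ)) (i1.sub i0)
  have k3 := integral_sub i1 i0
  have k4 := integral_add ((hDxi i).const_mul (D * (1 + 1 / η))) ((i3.add i4).const_mul (D * η))
  have k5 := integral_add i3 i4
  simp only [Pi.add_apply, Pi.sub_apply, integral_const_mul] at hmono k1 k2 k3 k4 k5
  have l1 := hsq (hw i).2.1 hw₀.2.1
  have l2 := hsq (hw i).2.2 hw₀.2.2
  have l3 : D * η * (∫ t, ‖(w i).u t - w₀.u t‖ ^ 2 ∂μ + ∫ t, ‖(w i).v t - w₀.v t‖ ^ 2 ∂μ) ≤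
      D * η * N := by
    refine mul_le_mul_of_nonneg_left ?_ (mul_nonneg hD0 hη.le)
    have := hB i
    have := hC i
    linarith
  rw [← hμ] at hmono k1 k2 k3 k5 ⊢
  rw [k1, k2, k3, k4, k5, ← hI₀] at hmono
  linarith

end Reference
end Problem

/-! ### Critical directions and competitors -/

theorem LipOn.eq_integral {k : ℕ} {T : ℝ} {x g : ℝ → Vec k} (hx : LipOn T x) (hg : BddMeas g)
    (h : ∀ᵐ t ∂(leb T), HasDerivAt x (g t) t) {t : ℝ} (ht : t ∈ Icc 0 T) :
    x t = x 0 + ∫ s in (0 : ℝ)..t, g s := by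
  have hsub : Icc 0 t ⊆ Icc 0 T := Icc_subset_Icc_right ht.2
  ext i
  have h1 : (∫ s in (0 : ℝ)..t, g s) i = ∫ s in (0 : ℝ)..t, g s i :=
    ((ContinuousLinearMap.proj (R := ℝ) (φ := fun _ : Fin k => ℝ) i).intervalIntegral_comp_comm
      (hg.intervalIntegrable 0 t)).symm
  obtain ⟨K, hK⟩ := lipOn_pi.1 hx i
  have h2 := integral_eq_sub_of_lipschitz ht.1 (hK.mono hsub) (g := fun s => g s i) <| by
    filter_upwards [ae_restrict_of_ae_restrict_of_subset hsub h] with s hs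
    exact hasDerivAt_pi.1 hs i
  rw [Pi.add_apply, h1, h2]
  ring

namespace Problem

variable {n l m dphi deta : ℕ} {P : Problem n l m dphi deta} {wh : Triple n l m}

namespace Reference

/-- Inverse Goh transformation: a transformed critical direction `(ξ, u, y)` comes from the
variation with initial state `ξ 0` and controls `u`, `ẏ`, whose state is `ξ + Fv y`. -/
theorem exists_variation (r : P.Reference wh) {ξ : ℝ → Vec n} {u : ℝ → Vec l} {y : ℝ → Vec m}
    {h : Vec m} (hd : (ξ, u, y, h) ∈ P.coneP wh) :
    ∃ z : Variation (Vec n) (Vec l × Vec m), LipOn P.T y ∧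
      (∀ᵐ t ∂(leb P.T), HasDerivAt y (z.1.2 t).2 t) ∧
      (∀ᵐ t ∂(leb P.T), u t = (z.1.2 t).1) ∧
      ∀ t ∈ Icc 0 P.T, r.sys.resp z t = ξ t + P.Fv wh t *ᵥ y t := by
  obtain ⟨hξ, hu, hy, hy0, -, hode, -⟩ := hd
  change IsSobolev ∞ P.T ξ at hξ
  change MemLp u ∞ (leb P.T) at hu
  change IsSobolev ∞ P.T y at hy
  change y 0 = 0 at hy0
  obtain ⟨ξ', -, -, hξl, hξd⟩ := hξ.exists_bddMeas r.T_nonneg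
  obtain ⟨v, hv, -, hyl, hyd⟩ := hy.exists_bddMeas r.T_nonneg
  obtain ⟨u', hu', huu⟩ := exists_bddMeas_of_memLp_top hu
  let z : Variation (Vec n) (Vec l × Vec m) := ⟨(ξ 0, fun t => (u' t, v t)), hu'.prodMk hv⟩
  refine ⟨z, hyl, hyd, huu, ?_⟩
  set x : ℝ → Vec n := fun t => ξ t + P.Fv wh t *ᵥ y t with hx
  have hxl : LipOn P.T x := LipOn.add hξl (LipOn.mulVec r.lipOn_Fv hyl)
  let X : ℝ →ᵇ Vec n := BoundedContinuousFunction.ofNormedAddCommGroup (fun t => x (clamp P.T t))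
    (hxl.continuousOn.comp_continuous (continuous_clamp P.T) (clamp_mem r.T_nonneg))
    (isCompact_Icc.exists_bound_of_continuousOn hxl.continuousOn).choose
    (fun t => (isCompact_Icc.exists_bound_of_continuousOn hxl.continuousOn).choose_spec _
      (clamp_mem r.T_nonneg t))
  have hX (t : ℝ) (ht : t ∈ Icc 0 P.T) : X t = x t := by
    change x (clamp P.T t) = x t
    rw [clamp_of_mem ht]
  have hb : BddMeas fun s => r.sys.dF s (X s, z.1.2 s) :=
    r.sys.bddMeas_dF ((bddMeas_bcf X).prodMk z.2)
  have hxd : ∀ᵐ t ∂(leb P.T), HasDerivAt x (r.sys.dF t (X t, z.1.2 t)) t := by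
    filter_upwards [hξd, hyd, huu, hode, ae_hasDerivAt_matrix r.lipOn_Fv,
      ae_restrict_mem measurableSet_Icc] with t h1 h2 h3 h4 h5 ht
    refine (h1.add (hasDerivAt_mulVec h5 h2)).congr_deriv ?_
    rw [hX t ht, r.dF_eq ht]
    change _ = fderiv ℝ P.F (wh.val t) (x t, u' t, v t)
    rw [← linearized_eq, ← h1.deriv, h4, ← h3, B, Matrix.sub_mulVec, ← Matrix.mulVec_mulVec, hx,
      Matrix.mulVec_add]
    abel
  have hXe : X = r.sys.resp z := by
    refine r.sys.eq_resp (BoundedContinuousFunction.ext fun t => ?_)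
    rw [BoundedContinuousFunction.add_apply,
      primitive_apply r.sys.T_nonneg (hb.integrableOn _)]
    change x (clamp P.T t) = ξ 0 + ∫ s in (0 : ℝ)..clamp P.T t, _
    rw [hxl.eq_integral hb hxd (clamp_mem r.T_nonneg t)]
    congr 1
    simp [hx, hy0]
  intro t ht
  rw [← hXe, hX t ht]

theorem dG_apply (r : P.Reference wh) (q : Vec n × Vec n) : r.sys.dG q =
    (fun i => fderiv ℝ (P.phi i) (P.ends wh.x) q, fun j => fderiv ℝ (P.eta j) (P.ends wh.x) q) := by
  have h1 : HasFDerivAt r.sys.G ((ContinuousLinearMap.pi fun i =>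
      fderiv ℝ (P.phi i) (P.ends wh.x)).prod (ContinuousLinearMap.pi fun j =>
      fderiv ℝ (P.eta j) (P.ends wh.x))) (P.ends wh.x) :=
    (hasFDerivAt_pi.2 fun i =>
      ((r.regular.2.1 i).1.differentiable (by norm_num) _).hasFDerivAt).prodMk
    (hasFDerivAt_pi.2 fun j =>
      ((r.regular.2.2 j).1.differentiable (by norm_num) _).hasFDerivAt)
  rw [ControlSystem.dG, r.ends_xh, h1.fderiv]
  rfl

/-- Near a weak minimum at which all inequality constraints are active, no trajectory satisfying
the equality constraints improves the cost and all inequality constraints at once. -/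
theorem exists_le_of_isWeakMinimum (r : P.Reference wh) (hmin : P.IsWeakMinimum wh)
    (hactive : ∀ i : Fin dphi, P.phi i.succ (P.ends wh.x) = 0) :
    ∃ ε : ℝ, 0 < ε ∧ ∀ p : ℝ → Vec n × Vec l × Vec m, BddMeas p → Continuous (fun s => (p s).1) →
      (∀ s, ‖p s - r.sys.w s‖ ≤ ε) →
      (∀ s, (p s).1 = (p 0).1 + ∫ σ in (0 : ℝ)..clamp r.sys.T s, r.sys.F (p σ)) →
      (r.sys.G ((p 0).1, (p r.sys.T).1)).2 = (r.sys.G (r.sys.ends r.sys.xh)).2 →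
      ∃ i, (r.sys.G (r.sys.ends r.sys.xh)).1 i ≤ (r.sys.G ((p 0).1, (p r.sys.T).1)).1 i := by
  obtain ⟨hfeas, ε, hε, hε'⟩ := hmin
  refine ⟨ε / 2, half_pos hε, fun p hp _ hpw hpe hG => ?_⟩
  rw [r.ends_xh] at hG ⊢
  by_contra! hlt
  let w : Triple n l m := ⟨fun s => (p s).1, fun s => (p s).2.1, fun s => (p s).2.2⟩
  have hF : BddMeas fun s => P.F (p s) :=
    hp.comp_continuous r.regular.contDiff_F.continuous
  have hwe : ∀ t ∈ Icc 0 P.T, w.x t = w.x 0 + ∫ s in (0 : ℝ)..t, P.F (p s) := by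
    intro t ht
    have h1 := hpe t
    change _ = _ + ∫ s in (0 : ℝ)..clamp P.T t, P.F (p s) at h1
    rw [clamp_of_mem ht] at h1
    exact h1
  have hcl (t : ℝ) (ht : t ∈ Icc 0 P.T) : ‖p t - wh.val t‖ ≤ ε / 2 := by
    have h1 := hpw t
    change ‖p t - r.process t‖ ≤ _ at h1
    rwa [r.process_of_mem ht] at h1
  have hclose {k : ℕ} (f : ℝ → Vec k) (hf : ∀ t, ‖f t‖ ≤ ‖p t - wh.val t‖) :
      eLpNorm f ∞ (leb P.T) < ENNReal.ofReal ε := by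
    rw [eLpNorm_exponent_top]
    refine (eLpNormEssSup_le_of_ae_bound (C := ε / 2) ?_).trans_lt
      ((ENNReal.ofReal_lt_ofReal_iff hε).2 (half_lt_self hε))
    filter_upwards [ae_restrict_mem measurableSet_Icc] with t ht
    exact (hf t).trans (hcl t ht)
  have hw : P.IsFeasible w := by
    refine ⟨⟨⟨⟨_, hF.memLp _, hwe⟩, ?_, ?_⟩, ?_⟩, fun j => ?_, fun i => ?_⟩
    · exact BddMeas.memLp (BddMeas.clmConst ((ContinuousLinearMap.fst ℝ _ _).comp
        (ContinuousLinearMap.snd ℝ _ _)) hp) _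
    · exact BddMeas.memLp (BddMeas.clmConst ((ContinuousLinearMap.snd ℝ _ _).comp
        (ContinuousLinearMap.snd ℝ _ _)) hp) _
    · filter_upwards [ae_hasDerivAt_of_eq_integral r.T_nonneg (hF.integrableOn _) hwe] with t ht
      exact ht.deriv
    · exact (congrFun hG j).trans (hfeas.2.1 j)
    · exact (hlt i.succ).le.trans (hactive i).le
  refine (hlt 0).not_ge (hε' w hw (hclose _ fun t => ?_) (hclose _ fun t => ?_)
    (hclose _ fun t => ?_))
  · exact norm_fst_le (p t - wh.val t)
  · exact (norm_fst_le (p t - wh.val t).2).trans (norm_snd_le _)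
  · exact (norm_snd_le (p t - wh.val t).2).trans (norm_snd_le _)

end Reference
end Problem

/-! ### A multiplier that satisfies the Legendre and Goh conditions -/

namespace Problem

variable {n l m dphi deta : ℕ} {P : Problem n l m dphi deta} {wh : Triple n l m}

theorem Regular.dotProduct_V (hreg : P.Regular) (lam : Multiplier n dphi deta) (t : ℝ)
    (b c : Vec m) : b ⬝ᵥ P.V wh lam t *ᵥ c = lam.2.2 t ⬝ᵥ ((1 / 2 : ℝ) •
      (fderiv ℝ (fderiv ℝ P.F) (wh.val t) (0, 0, b) (P.Fv wh t *ᵥ c, 0, 0) -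
        fderiv ℝ (fderiv ℝ P.F) (wh.val t) (0, 0, c) (P.Fv wh t *ᵥ b, 0, 0))) := by
  have h1 : b ⬝ᵥ (P.Hvx wh lam t * P.Fv wh t)ᵀ *ᵥ c =
      c ⬝ᵥ P.Hvx wh lam t *ᵥ (P.Fv wh t *ᵥ b) := by
    rw [dotProduct_transpose_mulVec, Matrix.mulVec_mulVec, dotProduct_comm]
  rw [V, Matrix.smul_mulVec, Matrix.sub_mulVec, dotProduct_smul, dotProduct_sub, h1,
    ← Matrix.mulVec_mulVec, dotProduct_Hvx wh lam hreg, dotProduct_Hvx wh lam hreg, hreg.D2H_eq,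
    hreg.D2H_eq, dotProduct_smul, dotProduct_sub]

namespace Reference

/-- The entries of `V`, as linear forms in the multiplier. -/
def pairV (r : P.Reference wh) (t : ℝ) (b c : Vec m) :
    (Fin (dphi + 1) → ℝ) × (Fin deta → ℝ) →ₗ[ℝ] ℝ where
  toFun lam := b ⬝ᵥ P.V wh (r.mult lam) t *ᵥ c
  map_add' lam lam' := by
    simp only [r.regular.dotProduct_V, mult_dotProduct, r.sys.costate_add]
    rfl
  map_smul' a lam := by
    simp only [r.regular.dotProduct_V, mult_dotProduct, r.sys.costate_smul]
    rfl

theorem hess_add (r : P.Reference wh) (lam lam' : (Fin (dphi + 1) → ℝ) × (Fin deta → ℝ)) (t : ℝ)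
    (a b : Vec n × Vec l × Vec m) :
    r.hess (lam + lam') t a b = r.hess lam t a b + r.hess lam' t a b := by
  simp only [hess_apply, r.sys.costate_add]
  rfl

theorem hess_smul (r : P.Reference wh) (c : ℝ) (lam : (Fin (dphi + 1) → ℝ) × (Fin deta → ℝ))
    (t : ℝ) (a b : Vec n × Vec l × Vec m) :
    r.hess (c • lam) t a b = c * r.hess lam t a b := by
  simp only [hess_apply, r.sys.costate_smul]
  rfl

/-- The values of the Hessian of the pre-Hamiltonian, as linear forms in the multiplier. -/
def pairHess (r : P.Reference wh) (t : ℝ) (a b : Vec n × Vec l × Vec m) :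
    (Fin (dphi + 1) → ℝ) × (Fin deta → ℝ) →ₗ[ℝ] ℝ where
  toFun lam := r.hess lam t a b
  map_add' lam lam' := r.hess_add lam lam' t a b
  map_smul' c lam := r.hess_smul c lam t a b

theorem eq_zero_of_continuousOn {T : ℝ} (hT : 0 < T) {f : ℝ → ℝ} (hf : ContinuousOn f (Icc 0 T))
    (h : ∀ t ∈ Ioo 0 T, f t = 0) : ∀ t ∈ Icc 0 T, f t = 0 :=
  Set.EqOn.of_subset_closure (f := f) (g := fun _ => 0) h hf continuousOn_const Ioo_subset_Icc_self
    (closure_Ioo hT.ne).ge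

theorem V_eq_zero (r : P.Reference wh) {lam : (Fin (dphi + 1) → ℝ) × (Fin deta → ℝ)}
    (h : ∀ t ∈ Ioo 0 P.T, ∀ b c : Vec m, 0 ≤ -(b ⬝ᵥ P.V wh (r.mult lam) t *ᵥ c)) :
    ∀ t ∈ Icc 0 P.T, P.V wh (r.mult lam) t = 0 := by
  intro t ht
  ext i j
  refine eq_zero_of_continuousOn r.T_pos (r.lipOn_V lam i j).continuousOn (fun s hs => ?_) t ht
  have h1 := h s hs (Pi.single i 1) (Pi.single j 1)
  have h2 := h s hs (-Pi.single i 1) (Pi.single j 1)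
  rw [neg_dotProduct] at h2
  have h3 : (Pi.single i 1 : Vec m) ⬝ᵥ P.V wh (r.mult lam) s *ᵥ Pi.single j 1 =
      P.V wh (r.mult lam) s i j := by simp
  rw [h3] at h1 h2
  linarith

/-- Since the pre-Hamiltonian is affine in `v`, the Legendre condition forces `Hvu` to vanish. -/
theorem D2H_mixed_eq_zero (r : P.Reference wh) {lam : (Fin (dphi + 1) → ℝ) × (Fin deta → ℝ)}
    (hleg : ∀ t ∈ Icc 0 P.T, ∀ a : Vec l × Vec m, 0 ≤ r.hess lam t (0, a) (0, a))
    {t : ℝ} (ht : t ∈ Icc 0 P.T) (u : Vec l) (v : Vec m) :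
    P.D2H wh (r.mult lam) t (0, 0, v) (0, u, 0) = 0 := by
  rw [r.D2H_mult lam ht, ← hess_apply]
  by_contra hne
  set b := r.hess lam t (0, 0, v) (0, u, 0) with hb
  set a := r.hess lam t (0, u, 0) (0, u, 0) with ha
  have hvv : r.hess lam t (0, 0, v) (0, 0, v) = 0 := by
    rw [hess_apply, ← r.D2H_mult lam ht]
    exact r.regular.D2H_affine_affine wh _ t v v
  have key (s : ℝ) : 0 ≤ a + 2 * s * b := by
    have h1 := hleg t ht (u, s • v)
    have h2 : ((0, u, s • v) : Vec n × Vec l × Vec m) = (0, u, 0) + s • (0, 0, v) := by simp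
    rw [h2] at h1
    simp only [map_add, map_smul, add_apply, smul_apply, smul_eq_mul, hvv,
      r.hess_symm lam t (0, u, 0) (0, 0, v)] at h1
    rw [← hb, ← ha] at h1
    linarith
  have h3 := key (-(a + 1) / (2 * b))
  have h4 : 2 * (-(a + 1) / (2 * b)) * b = -(a + 1) := by field_simp
  linarith

/-- The multiplier of the necessary condition: the essential values of the second variation
include those of the Legendre form and of `V` at all interior times. -/
theorem exists_sharp_multiplier (r : P.Reference wh) (hmin : P.IsWeakMinimum wh)
    (hactive : ∀ i : Fin dphi, P.phi i.succ (P.ends wh.x) = 0)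
    (z : Variation (Vec n) (Vec l × Vec m)) (hz₁ : ∀ i, (r.sys.first z).1 i ≤ 0)
    (hz₂ : (r.sys.first z).2 = 0) :
    ∃ lam, r.mult lam ∈ P.multipliersSharp wh ∧ (∀ t ∈ Icc 0 P.T, P.V wh (r.mult lam) t = 0) ∧
      (∀ t ∈ Icc 0 P.T, ∀ u v, P.D2H wh (r.mult lam) t (0, 0, v) (0, u, 0) = 0) ∧
      0 ≤ pair lam (r.sys.second z z) := by
  obtain ⟨ε, hε, hloc⟩ := r.exists_le_of_isWeakMinimum hmin hactive
  obtain ⟨lam, hne, hpos, hfirst, hsecond, hess⟩ :=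
    r.sys.exists_multiplier z hz₁ hz₂ hε hloc
  -- essential values are represented by the linear forms that they define on the multipliers
  have hleg₀ : ∀ t ∈ Ioo 0 P.T, ∀ a : Vec l × Vec m, 0 ≤ r.hess lam t (0, a) (0, a) := by
    intro t ht a
    obtain ⟨q, hq⟩ := exists_pair_eq ((1 / 2 : ℝ) • r.pairHess t (0, a) (0, a))
    have h1 := hess q (r.sys.isEssentialValue_legendre ht a fun lam' => by
      rw [pair_comm, ← hq]
      rfl)
    rw [pair_comm, ← hq] at h1
    change 0 ≤ (1 / 2) * r.hess lam t (0, a) (0, a) at h1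
    linarith
  have hleg : ∀ t ∈ Icc 0 P.T, ∀ a : Vec l × Vec m, 0 ≤ r.hess lam t (0, a) (0, a) := by
    intro t ht a
    have h1 : IsClosed {t | 0 ≤ r.hess lam t (0, a) (0, a)} :=
      isClosed_le continuous_const
        (((r.continuous_hess lam).clm_apply continuous_const).clm_apply continuous_const)
    refine closure_minimal (fun s hs => hleg₀ s hs a) h1 ?_
    rwa [closure_Ioo r.T_pos.ne]
  have hV : ∀ t ∈ Ioo 0 P.T, ∀ b c : Vec m, 0 ≤ -(b ⬝ᵥ P.V wh (r.mult lam) t *ᵥ c) := by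
    intro t ht b c
    obtain ⟨q, hq⟩ := exists_pair_eq (-r.pairV t b c)
    have h1 := hess q (r.isEssentialValue_goh ht b c fun lam' => by
      rw [pair_comm, ← hq]
      rfl)
    rw [pair_comm, ← hq] at h1
    exact h1
  -- the multiplier is rescaled to satisfy the normalization in the definition of `Λ`
  set s := ∑ i, |lam.1 i| + ∑ j, |lam.2 j| with hs
  have hs0 : 0 < s := by
    have h1 : 0 ≤ ∑ i, |lam.1 i| := Finset.sum_nonneg fun _ _ => abs_nonneg _
    have h2 : 0 ≤ ∑ j, |lam.2 j| := Finset.sum_nonneg fun _ _ => abs_nonneg _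
    refine lt_of_le_of_ne (add_nonneg h1 h2) fun h => hne ?_
    have h3 : ∑ i, |lam.1 i| = 0 := by linarith
    have h4 : ∑ j, |lam.2 j| = 0 := by linarith
    rw [Finset.sum_eq_zero_iff_of_nonneg fun _ _ => abs_nonneg _] at h3 h4
    ext i
    · exact abs_eq_zero.1 (h3 i (Finset.mem_univ i))
    · exact abs_eq_zero.1 (h4 i (Finset.mem_univ i))
  have hleg' : ∀ t ∈ Icc 0 P.T, ∀ a : Vec l × Vec m, 0 ≤ r.hess (s⁻¹ • lam) t (0, a) (0, a) := by
    intro t ht a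
    rw [hess_smul]
    exact mul_nonneg (inv_nonneg.2 hs0.le) (hleg t ht a)
  refine ⟨s⁻¹ • lam, ⟨r.mult_mem ?_ (fun i => mul_nonneg (inv_nonneg.2 hs0.le) (hpos i))
    fun z => ?_, r.omegaWeaklyLsc_of_legendre _ hleg'⟩, r.V_eq_zero fun t ht b c => ?_,
    fun t ht u v => r.D2H_mixed_eq_zero hleg' ht u v, ?_⟩
  · simp only [Prod.smul_fst, Prod.smul_snd, Pi.smul_apply, smul_eq_mul, abs_mul,
      ← Finset.mul_sum, ← mul_add, abs_of_pos (inv_pos.2 hs0)]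
    rw [← hs, inv_mul_cancel₀ hs0.ne']
  · rw [pair_smul_left, hfirst, mul_zero]
  · have h1 : b ⬝ᵥ P.V wh (r.mult (s⁻¹ • lam)) t *ᵥ c =
      s⁻¹ * (b ⬝ᵥ P.V wh (r.mult lam) t *ᵥ c) := (r.pairV t b c).map_smul s⁻¹ lam
    rw [h1, ← mul_neg]
    exact mul_nonneg (inv_nonneg.2 hs0.le) (hV t ht b c)
  · rw [pair_smul_left]
    exact mul_nonneg (inv_nonneg.2 hs0.le) hsecond

end Reference
end Problem

/-! ### Compactness of the set of multipliers -/

/-- In finite dimension the convex hull of a compact set is compact, by Carathéodory's theorem. -/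
theorem isCompact_convexHull_of_finiteDimensional {E : Type*} [NormedAddCommGroup E]
    [NormedSpace ℝ E] [FiniteDimensional ℝ E] {s : Set E} (hs : IsCompact s) :
    IsCompact (convexHull ℝ s) := by
  rcases s.eq_empty_or_nonempty with rfl | ⟨x₀, hx₀⟩
  · simp
  set N := Module.finrank ℝ E + 1
  have h1 : IsCompact (stdSimplex ℝ (Fin N) ×ˢ Set.pi univ fun _ : Fin N => s) :=
    (isCompact_stdSimplex ℝ (Fin N)).prod (isCompact_univ_pi fun _ => hs)
  have h2 : Continuous fun q : (Fin N → ℝ) × (Fin N → E) => ∑ i, q.1 i • q.2 i := by fun_prop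
  convert! h1.image h2
  refine Subset.antisymm (fun x hx => ?_) ?_
  · obtain ⟨ι, _, z, w, hz, haff, hw, hw1, rfl⟩ := eq_pos_convex_span_of_mem_convexHull hx
    have hcard : Fintype.card ι ≤ Fintype.card (Fin N) := by
      rw [Fintype.card_fin]
      exact haff.card_le_finrank_succ.trans (Nat.succ_le_succ (Submodule.finrank_le _))
    obtain ⟨e⟩ := Function.Embedding.nonempty_of_card_le hcard
    -- fewer points are padded by `x₀` with weight zero
    obtain ⟨w', hw0, hwe⟩ : ∃ w' : Fin N → ℝ, (∀ j ∉ range e, w' j = 0) ∧ ∀ i, w' (e i) = w i :=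
      ⟨Function.extend e w 0, fun j hj => Function.extend_apply' _ _ _ hj,
        e.injective.extend_apply _ _⟩
    obtain ⟨z', hz0, hze⟩ : ∃ z' : Fin N → E, (∀ j ∉ range e, z' j = x₀) ∧ ∀ i, z' (e i) = z i :=
      ⟨Function.extend e z fun _ => x₀, fun j hj => Function.extend_apply' _ _ _ hj,
        e.injective.extend_apply _ _⟩
    refine ⟨(w', z'), ⟨⟨fun j => ?_, ?_⟩, fun j _ => ?_⟩, ?_⟩
    · by_cases hj : j ∈ range e
      · obtain ⟨i, rfl⟩ := hj
        exact (hw i).le.trans_eq (hwe i).symm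
      · exact (hw0 j hj).ge
    · rw [← hw1]
      exact (Fintype.sum_of_injective e e.injective _ _ hw0 fun i => (hwe i).symm).symm
    · by_cases hj : j ∈ range e
      · obtain ⟨i, rfl⟩ := hj
        change z' (e i) ∈ s
        rw [hze]
        exact hz (mem_range_self i)
      · change z' j ∈ s
        rwa [hz0 j hj]
    · refine (Fintype.sum_of_injective e e.injective _ (fun j => w' j • z' j) (fun j hj => ?_)
        fun i => ?_).symm
      · simp only [hw0 j hj, zero_smul]
      · simp only [hwe, hze]
  · rintro _ ⟨⟨w, z⟩, ⟨hw, hz⟩, rfl⟩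
    exact mem_convexHull_of_exists_fintype w z hw.1 hw.2 (fun i => hz i (mem_univ i)) rfl

namespace Problem

variable {n l m dphi deta : ℕ} {P : Problem n l m dphi deta} {wh : Triple n l m}

namespace Reference

theorem pair_first_of_mem (r : P.Reference wh) {lam : Multiplier n dphi deta}
    (h : lam ∈ P.multipliers wh) (z : Variation (Vec n) (Vec l × Vec m)) :
    pair (lam.1, lam.2.1) (r.sys.first z) = 0 := by
  obtain ⟨-, -, -, -, h0, -, hs⟩ := id h
  have h1 : r.sys.costate (lam.1, lam.2.1) 0 z.1.1 = -r.sys.dEll (lam.1, lam.2.1) (z.1.1, 0) := by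
    rw [← r.fderiv_ell, ← h0, r.eq_mult h r.zero_mem, mult_dotProduct]
  have h2 : ∫ t in (0 : ℝ)..P.T, r.sys.costate (lam.1, lam.2.1) t (r.sys.dF t (0, z.1.2 t)) =
      ∫ t in (0 : ℝ)..P.T, (0 : ℝ) := by
    refine intervalIntegral_congr_leb ?_ r.T_mem
    filter_upwards [hs, ae_restrict_mem measurableSet_Icc] with t ht htm
    have h3 : ((0, z.1.2 t) : Vec n × Vec l × Vec m) =
        (0, (z.1.2 t).1, 0) + (0, 0, (z.1.2 t).2) := by simp
    have h4 := ht.1 (z.1.2 t).1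
    have h5 := ht.2 (z.1.2 t).2
    rw [r.regular.fderiv_H] at h4 h5
    rw [r.dF_eq htm, ← mult_dotProduct, ← r.eq_mult h htm, h3, map_add, dotProduct_add, h4, h5,
      add_zero]
  rw [r.sys.pair_first, h1]
  change _ + ∫ t in (0 : ℝ)..P.T, _ = _
  rw [h2]
  simp

/-- The second variation along an admissible triple depends linearly on the multiplier. -/
theorem exists_pair_Omega (r : P.Reference wh) {w : Triple n l m} (hw : w.InSpace 2 P.T) :
    ∃ a, ∀ lam, P.Omega wh (r.mult lam) w = pair lam a := by
  have hval := InSpace.memLp_val r.T_nonneg hw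
  obtain ⟨a, ha⟩ := exists_pair_eq
    { toFun := fun lam => P.Omega wh (r.mult lam) w
      map_add' := fun lam lam' => by
        have h1 := integral_add (r.integrable_hess lam hval hval)
          (r.integrable_hess lam' hval hval)
        simp only [r.Omega_eq_hess, ControlSystem.pair_add_left, r.hess_add, h1]
        ring
      map_smul' := fun c lam => by
        simp only [r.Omega_eq_hess, pair_smul_left, r.hess_smul, integral_const_mul,
          RingHom.id_apply, smul_eq_mul]
        ring }
  exact ⟨a, fun lam => (ha lam).trans (pair_comm a lam)⟩

/-- Weak lower semicontinuity of the second variation is preserved under limits of multipliers,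
since the second variations converge uniformly on weakly convergent sequences. -/
theorem omegaWeaklyLsc_of_mem_closure (r : P.Reference wh)
    {s : Set ((Fin (dphi + 1) → ℝ) × (Fin deta → ℝ))}
    (hs : ∀ lam ∈ s, P.OmegaWeaklyLsc wh (r.mult lam)) {lam : (Fin (dphi + 1) → ℝ) × (Fin deta → ℝ)}
    (hlam : lam ∈ closure s) : P.OmegaWeaklyLsc wh (r.mult lam) := by
  intro w w₀ hw hw₀ h c hc
  obtain ⟨a₀, ha₀⟩ := r.exists_pair_Omega hw₀.1
  choose a ha using fun i => r.exists_pair_Omega (hw i).1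
  -- The forms are linear in the multiplier and bounded along the sequence, so that passing to a
  -- nearby multiplier in `s` changes all values by at most `δ / 3`.
  choose C hC using fun k : Fin (dphi + 1) ⊕ Fin deta =>
    r.exists_Omega_bound (coordUnit k) (fun i => (hw i).1) hw₀.1 h
  set D := ∑ k, |C k| + ‖a₀‖ with hD
  have hD0 : 0 ≤ D := by positivity
  have haD (i : ℕ) : ‖a i‖ ≤ D := by
    refine norm_le_of_coordUnit hD0 fun k => ?_
    rw [← ha]
    have h1 := Finset.single_le_sum (f := fun k => |C k|) (fun k _ => abs_nonneg _)
      (Finset.mem_univ k)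
    have h2 := norm_nonneg a₀
    have h3 := (hC k i).trans (le_abs_self _)
    linarith
  have ha₀D : ‖a₀‖ ≤ D := by
    have : 0 ≤ ∑ k, |C k| := Finset.sum_nonneg fun _ _ => abs_nonneg _
    linarith
  set N : ℝ := (Fintype.card (Fin (dphi + 1)) + Fintype.card (Fin deta) : ℝ) with hN
  have hN0 : 0 ≤ N := by positivity
  set δ := P.Omega wh (r.mult lam) w₀ - c with hδ
  have hδ0 : 0 < δ := sub_pos.2 hc
  obtain ⟨lam', hlam', hdist⟩ := Metric.mem_closure_iff.1 hlam (δ / (3 * (N * D + 1)))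
    (by positivity)
  rw [dist_eq_norm] at hdist
  have hclose (b : (Fin (dphi + 1) → ℝ) × (Fin deta → ℝ)) (hb : ‖b‖ ≤ D) :
      |pair lam b - pair lam' b| ≤ δ / 3 := by
    have h1 : pair lam b - pair lam' b = pair (lam - lam') b := by
      have := ControlSystem.pair_add_left (lam - lam') lam' b
      rw [sub_add_cancel] at this
      linarith
    rw [h1]
    refine (abs_pair_le _ _).trans ?_
    have h2 : N * (‖lam - lam'‖ * ‖b‖) ≤ N * (δ / (3 * (N * D + 1)) * D) := by gcongr
    refine h2.trans ?_
    have h3 : N * (δ / (3 * (N * D + 1)) * D) = δ / 3 * (N * D / (N * D + 1)) := by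
      have : N * D + 1 ≠ 0 := by positivity
      field_simp
    rw [h3]
    exact mul_le_of_le_one_right (by positivity)
      ((div_le_one (by positivity)).2 (by linarith))
  have h4 : c + δ / 3 < P.Omega wh (r.mult lam') w₀ := by
    have h5 := (abs_le.1 (hclose a₀ ha₀D)).2
    rw [← ha₀, ← ha₀] at h5
    linarith
  filter_upwards [hs lam' hlam' w w₀ hw hw₀ h _ h4] with i hi
  have h5 := (abs_le.1 (hclose (a i) (haD i))).1
  rw [← ha, ← ha] at h5
  linarith

/-- The multipliers with weakly lower semicontinuous second variation form a compact set. -/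
theorem isCompact_sharp (r : P.Reference wh) :
    IsCompact {lam | r.mult lam ∈ P.multipliersSharp wh} := by
  set K := {lam | r.mult lam ∈ P.multipliersSharp wh} with hK
  refine Metric.isCompact_of_isClosed_isBounded (isClosed_of_closure_subset fun lam hlam => ?_) ?_
  · have hcl {s : Set ((Fin (dphi + 1) → ℝ) × (Fin deta → ℝ))} (hs : IsClosed s) (h : K ⊆ s) :
        lam ∈ s := closure_minimal h hs hlam
    refine ⟨r.mult_mem ?_ (fun i => ?_) fun z => ?_,
      r.omegaWeaklyLsc_of_mem_closure (fun lam h => h.2) hlam⟩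
    · exact hcl (s := {lam | ∑ i, |lam.1 i| + ∑ j, |lam.2 j| = 1})
        (isClosed_eq (by fun_prop) continuous_const) fun lam h => h.1.1
    · exact hcl (s := {lam | 0 ≤ lam.1 i})
        (isClosed_le continuous_const (by fun_prop)) fun lam h => h.1.2.1 i
    · exact hcl (s := {lam | pair lam (r.sys.first z) = 0})
        (isClosed_eq (continuous_pair_left _) continuous_const)
        fun lam h => r.pair_first_of_mem h.1 z
  · refine isBounded_iff_forall_norm_le.2 ⟨1, fun lam h => ?_⟩
    have h1 : ∑ i, |lam.1 i| + ∑ j, |lam.2 j| = 1 := h.1.1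
    have h2 : 0 ≤ ∑ i, |lam.1 i| := Finset.sum_nonneg fun _ _ => abs_nonneg _
    have h3 : 0 ≤ ∑ j, |lam.2 j| := Finset.sum_nonneg fun _ _ => abs_nonneg _
    refine norm_prod_le_iff.2 ⟨(pi_norm_le_iff_of_nonneg zero_le_one).2 fun i => ?_,
      (pi_norm_le_iff_of_nonneg zero_le_one).2 fun j => ?_⟩
    · have h4 := Finset.single_le_sum (f := fun i => |lam.1 i|) (fun i _ => abs_nonneg _)
        (Finset.mem_univ i)
      rw [Real.norm_eq_abs]
      linarith
    · have h4 := Finset.single_le_sum (f := fun i => |lam.2 i|) (fun i _ => abs_nonneg _)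
        (Finset.mem_univ j)
      rw [Real.norm_eq_abs]
      linarith

end Reference
end Problem

/-! ### Maximization over the convex hull -/

namespace Problem

variable {n l m dphi deta : ℕ} {P : Problem n l m dphi deta} {wh : Triple n l m}

section Congr

variable {lam lam' : Multiplier n dphi deta}

theorem D2H_congr {t : ℝ} (h : lam.2.2 t = lam'.2.2 t) : P.D2H wh lam t = P.D2H wh lam' t := by
  have h1 : P.H lam t = P.H lam' t := by
    ext z
    rw [H, H, h]
  ext z z'
  rw [D2H, D2H, h1]

theorem V_congr {t : ℝ} (h : lam.2.2 t = lam'.2.2 t) : P.V wh lam t = P.V wh lam' t := by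
  simp only [V, Hvx, D2H_congr h]

theorem Omega_congr (hT : 0 ≤ P.T) (h₁ : lam.1 = lam'.1) (h₂ : lam.2.1 = lam'.2.1)
    (h : ∀ t ∈ Icc 0 P.T, lam.2.2 t = lam'.2.2 t) (w : Triple n l m) :
    P.Omega wh lam w = P.Omega wh lam' w := by
  have h0 : P.ell lam = P.ell lam' := by
    ext q
    rw [ell, ell, h₁, h₂]
  have hI : ∀ t ∈ Icc 0 P.T, P.D2H wh lam t = P.D2H wh lam' t := fun t ht => D2H_congr (h t ht)
  unfold Omega D2ell
  rw [h0]
  congr 1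
  refine intervalIntegral.integral_congr_Ioo_of_le hT fun t ht => ?_
  simp only [Hxx, Hux, Hvx, Huu, Hvu, hI t (Ioo_subset_Icc_self ht)]

theorem dotMatrix_congr {T : ℝ} {a b : ℕ} {A A' : ℝ → Matrix (Fin a) (Fin b) ℝ}
    (h : ∀ t ∈ Ioo 0 T, A t = A' t) {t : ℝ} (ht : t ∈ Ioo 0 T) :
    dotMatrix A t = dotMatrix A' t := by
  ext i j
  refine Filter.EventuallyEq.deriv_eq ?_
  filter_upwards [Ioo_mem_nhds ht.1 ht.2] with s hs
  rw [h s hs]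

theorem OmegaP_congr (hT : 0 ≤ P.T) (h₁ : lam.1 = lam'.1) (h₂ : lam.2.1 = lam'.2.1)
    (h : ∀ t ∈ Icc 0 P.T, lam.2.2 t = lam'.2.2 t) (ξ : ℝ → Vec n) (u : ℝ → Vec l)
    (y v : ℝ → Vec m) (q : Vec m) :
    P.OmegaP wh lam ξ u y v q = P.OmegaP wh lam' ξ u y v q := by
  have h0 : P.ell lam = P.ell lam' := by
    ext q
    rw [ell, ell, h₁, h₂]
  have hI : ∀ t ∈ Icc 0 P.T, P.D2H wh lam t = P.D2H wh lam' t := fun t ht => D2H_congr (h t ht)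
  have hHvx : ∀ t ∈ Icc 0 P.T, P.Hvx wh lam t = P.Hvx wh lam' t := fun t ht => by
    simp only [Hvx, hI t ht]
  have hS : ∀ t ∈ Icc 0 P.T, P.S wh lam t = P.S wh lam' t := fun t ht => by
    simp only [S, hHvx t ht]
  unfold OmegaP g D2ell
  rw [h0, hHvx P.T (right_mem_Icc.2 hT), hS P.T (right_mem_Icc.2 hT)]
  congr 1
  refine intervalIntegral.integral_congr_Ioo_of_le hT fun t ht => ?_
  have ht' := Ioo_subset_Icc_self ht
  have e1 := dotMatrix_congr (fun s hs => hHvx s (Ioo_subset_Icc_self hs)) ht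
  have e2 := dotMatrix_congr (fun s hs => hS s (Ioo_subset_Icc_self hs)) ht
  have e3 := V_congr (P := P) (wh := wh) (h t ht')
  simp only [M, R, E, e1, e2, e3, hHvx t ht', Hxx, Hux, Huu, hI t ht']

end Congr

/-- The finite dimensional part of a multiplier. -/
def finitePart : Multiplier n dphi deta →ₗ[ℝ] (Fin (dphi + 1) → ℝ) × (Fin deta → ℝ) where
  toFun lam := (lam.1, lam.2.1)
  map_add' _ _ := rfl
  map_smul' _ _ := rfl

namespace Reference

theorem mult_finitePart_mem (r : P.Reference wh) {lam : Multiplier n dphi deta}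
    (h : lam ∈ P.multipliersSharp wh) : r.mult (finitePart lam) ∈ P.multipliersSharp wh := by
  refine ⟨r.mult_mem h.1.1 h.1.2.1 fun z => r.pair_first_of_mem h.1 z, ?_⟩
  have h1 := h.2
  unfold OmegaWeaklyLsc at h1 ⊢
  have h2 := Omega_congr (P := P) (wh := wh) (lam := r.mult (finitePart lam)) (lam' := lam)
    r.T_nonneg rfl rfl fun t ht => (r.eq_mult h.1 ht).symm
  simpa only [h2] using h1

theorem eq_mult_of_mem_convexHull (r : P.Reference wh) {lam : Multiplier n dphi deta}
    (h : lam ∈ convexHull ℝ (P.multipliersSharp wh)) :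
    ∀ t ∈ Icc 0 P.T, lam.2.2 t = (r.mult (finitePart lam)).2.2 t := by
  let W : Submodule ℝ (Multiplier n dphi deta) :=
    { carrier := {lam | ∀ t ∈ Icc 0 P.T, lam.2.2 t = (r.mult (finitePart lam)).2.2 t}
      add_mem' := fun {a b} ha hb t ht => by
        rw [map_add, map_add]
        change a.2.2 t + b.2.2 t = _ + _
        rw [ha t ht, hb t ht]
      zero_mem' := fun t _ => by
        rw [map_zero, map_zero]
      smul_mem' := fun c a ha t ht => by
        rw [map_smul, map_smul]
        change c • a.2.2 t = c • _
        rw [ha t ht] }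
  exact convexHull_min (t := (W : Set (Multiplier n dphi deta)))
    (fun lam h t ht => r.eq_mult h.1 ht) W.convex h

/-- The admissible finite dimensional parts. -/
def gohSet (r : P.Reference wh) : Set ((Fin (dphi + 1) → ℝ) × (Fin deta → ℝ)) :=
  convexHull ℝ {lam | r.mult lam ∈ P.multipliersSharp wh} ∩
    {lam | ∀ t ∈ Icc 0 P.T, P.V wh (r.mult lam) t = 0}

theorem isCompact_gohSet (r : P.Reference wh) : IsCompact r.gohSet := by
  refine (isCompact_convexHull_of_finiteDimensional r.isCompact_sharp).inter_right ?_
  have h : {lam | ∀ t ∈ Icc 0 P.T, P.V wh (r.mult lam) t = 0} =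
      ⋂ t ∈ Icc 0 P.T, ⋂ i, ⋂ j, {lam | r.pairV t (Pi.single i 1) (Pi.single j 1) lam = 0} := by
    ext lam
    have h1 (t : ℝ) (i j : Fin m) : r.pairV t (Pi.single i 1) (Pi.single j 1) lam =
        P.V wh (r.mult lam) t i j := by
      change Pi.single i 1 ⬝ᵥ P.V wh (r.mult lam) t *ᵥ Pi.single j 1 = _
      simp
    simp only [mem_ofPred_eq, mem_iInter, h1]
    exact forall₂_congr fun t _ => ⟨fun h i j => by rw [h]; rfl, fun h => Matrix.ext h⟩
  rw [h]
  exact isClosed_biInter fun t _ => isClosed_iInter fun i => isClosed_iInter fun j =>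
    isClosed_eq (r.pairV t _ _).continuous_of_finiteDimensional continuous_const

/-- Maximization over multipliers reduces to a finite dimensional problem. -/
theorem image_gohMultipliers (r : P.Reference wh) (ξ : ℝ → Vec n) (u : ℝ → Vec l)
    (y v : ℝ → Vec m) (q : Vec m) :
    (fun lam => P.OmegaP wh lam ξ u y v q) '' P.gohMultipliers wh =
      (fun lam => P.OmegaP wh (r.mult lam) ξ u y v q) '' r.gohSet := by
  ext c
  constructor
  · rintro ⟨lam, ⟨h1, h2⟩, rfl⟩
    have h3 := r.eq_mult_of_mem_convexHull h1
    refine ⟨finitePart lam, ⟨?_, fun t ht => ?_⟩, ?_⟩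
    · have h4 : finitePart lam ∈ finitePart '' convexHull ℝ (P.multipliersSharp wh) :=
        mem_image_of_mem _ h1
      rw [LinearMap.image_convexHull] at h4
      refine convexHull_mono ?_ h4
      rintro _ ⟨lam', h5, rfl⟩
      exact r.mult_finitePart_mem h5
    · rw [← V_congr (h3 t ht)]
      exact h2 t ht
    · exact (OmegaP_congr (lam := lam) (lam' := r.mult (finitePart lam)) r.T_nonneg rfl rfl h3 ξ u y v q).symm
  · rintro ⟨lam, ⟨h1, h2⟩, rfl⟩
    refine ⟨r.mult lam, ⟨?_, h2⟩, rfl⟩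
    have h4 : r.mult lam ∈ r.mult '' convexHull ℝ {lam | r.mult lam ∈ P.multipliersSharp wh} :=
      mem_image_of_mem _ h1
    rw [LinearMap.image_convexHull] at h4
    refine convexHull_mono ?_ h4
    rintro _ ⟨lam', h5, rfl⟩
    exact h5

theorem OmegaP_congr_ae (r : P.Reference wh) (lam : Multiplier n dphi deta) {ξ : ℝ → Vec n}
    {u u' : ℝ → Vec l} {y v v' : ℝ → Vec m} (hu : ∀ᵐ t ∂(leb P.T), u t = u' t)
    (hv : ∀ᵐ t ∂(leb P.T), v t = v' t) (q : Vec m) :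
    P.OmegaP wh lam ξ u y v q = P.OmegaP wh lam ξ u' y v' q := by
  unfold OmegaP
  congr 1
  refine intervalIntegral_congr_leb ?_ r.T_mem
  filter_upwards [hu, hv] with t h1 h2
  rw [h1, h2]

/-- The transformed second variation depends continuously on the multiplier: by Goh's identity it
is a difference of two forms that are linear in the multiplier. -/
theorem continuous_OmegaP (r : P.Reference wh) (z : Variation (Vec n) (Vec l × Vec m))
    {ξ : ℝ → Vec n} {y : ℝ → Vec m} (hy : LipOn P.T y) (hy0 : y 0 = 0)
    (hyd : ∀ᵐ t ∂(leb P.T), HasDerivAt y (z.1.2 t).2 t)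
    (hξ : ∀ t ∈ Icc 0 P.T, r.sys.resp z t = ξ t + P.Fv wh t *ᵥ y t) :
    Continuous fun lam => P.OmegaP wh (r.mult lam) ξ (fun t => (z.1.2 t).1) y
      (fun t => (z.1.2 t).2) (y P.T) := by
  let a : ℝ → Vec n × Vec l × Vec m := fun t => (0, 0, (z.1.2 t).2)
  let b : ℝ → Vec n × Vec l × Vec m := fun t => (0, (z.1.2 t).1, 0)
  have ha : MemLp a 2 (leb P.T) := BddMeas.memLp (bddMeas_zero.prodMk (bddMeas_zero.prodMk
    (BddMeas.clmConst (ContinuousLinearMap.snd ℝ _ _) z.2))) _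
  have hb : MemLp b 2 (leb P.T) := BddMeas.memLp (bddMeas_zero.prodMk
    ((BddMeas.clmConst (ContinuousLinearMap.fst ℝ _ _) z.2).prodMk bddMeas_zero)) _
  let L : (Fin (dphi + 1) → ℝ) × (Fin deta → ℝ) →ₗ[ℝ] ℝ :=
    { toFun := fun lam => ∫ t, r.hess lam t (a t) (b t) ∂(leb P.T)
      map_add' := fun lam lam' => by
        simp only [r.hess_add]
        exact integral_add (r.integrable_hess lam ha hb) (r.integrable_hess lam' ha hb)
      map_smul' := fun c lam => by
        simp only [r.hess_smul]
        exact integral_const_mul _ _ }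
  have hL (lam) : ∫ t in (0 : ℝ)..P.T, P.D2H wh (r.mult lam) t (a t) (b t) = L lam := by
    change _ = ∫ t, r.hess lam t (a t) (b t) ∂(leb P.T)
    rw [← intervalIntegral_eq_leb r.T_nonneg]
    refine intervalIntegral.integral_congr_Ioo_of_le r.T_nonneg fun t ht => ?_
    exact r.D2H_mult lam (Ioo_subset_Icc_self ht) _ _
  have h : (fun lam => P.OmegaP wh (r.mult lam) ξ (fun t => (z.1.2 t).1) y
      (fun t => (z.1.2 t).2) (y P.T)) = fun lam => (1 / 2) * pair lam (r.sys.second z z) - L lam := by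
    funext lam
    rw [(r.goh_identity lam z hy hy0 hyd hξ).2, ← hL]
    ring
  rw [h]
  exact ((continuous_pair_left _).const_mul _).sub L.continuous_of_finiteDimensional

end Reference
end Problem

end PartiallyAffine

end

theorem mainTheorem2 {n l m dphi deta : ℕ}
    (P : PartiallyAffine.Problem n l m dphi deta) (hT : 0 < P.T) (hreg : P.Regular)
    (wh : PartiallyAffine.Triple n l m)
    (hu : ContDiffOn ℝ ∞ wh.u (Set.Icc 0 P.T)) (hv : ContDiffOn ℝ ∞ wh.v (Set.Icc 0 P.T))
    (hactive : ∀ i : Fin dphi, P.phi i.succ (P.ends wh.x) = 0)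
    (hmin : P.IsWeakMinimum wh) :
    ∀ (ξ : ℝ → PartiallyAffine.Vec n) (u : ℝ → PartiallyAffine.Vec l)
      (y : ℝ → PartiallyAffine.Vec m) (h : PartiallyAffine.Vec m),
      (ξ, u, y, h) ∈ P.coneP wh →
      ∃ c : ℝ,
        IsGreatest ((fun lam => P.OmegaP wh lam ξ u y (deriv y) h) '' P.gohMultipliers wh) c ∧
          0 ≤ c := by
  intro ξ u y h hd
  have r := hmin.1.1.reference hT hreg hu hv
  obtain ⟨z, hyl, hyd, huu, hz⟩ := r.exists_variation hd
  obtain ⟨-, -, -, hy0, hyT, -, heta, hphi⟩ := hd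
  change y 0 = 0 at hy0
  change y P.T = h at hyT
  have hends : r.sys.ends (r.sys.resp z) = (ξ 0, ξ P.T + P.Fv wh P.T *ᵥ h) := by
    change (r.sys.resp z 0, r.sys.resp z P.T) = _
    rw [hz 0 r.zero_mem, hz P.T r.T_mem, hy0, hyT, Matrix.mulVec_zero, add_zero]
  have hfirst := r.sys.first_apply z
  rw [hends, r.dG_apply] at hfirst
  obtain ⟨lam, hlam, hV, hmixed, hnonneg⟩ := r.exists_sharp_multiplier hmin hactive z
    (fun i => by rw [hfirst]; exact hphi i) (by rw [hfirst]; exact funext heta)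
  -- the controls of the variation agree with `u` and `deriv y` almost everywhere
  have hrep (lam) : P.OmegaP wh (r.mult lam) ξ u y (deriv y) h =
      P.OmegaP wh (r.mult lam) ξ (fun t => (z.1.2 t).1) y (fun t => (z.1.2 t).2) (y P.T) := by
    rw [hyT]
    exact r.OmegaP_congr_ae _ huu (hyd.mono fun t ht => ht.deriv) h
  have hmem : lam ∈ r.gohSet := ⟨subset_convexHull ℝ _ hlam, hV⟩
  rw [r.image_gohMultipliers]
  simp only [hrep]
  obtain ⟨c, hc⟩ := (r.isCompact_gohSet.image
    (r.continuous_OmegaP z hyl hy0 hyd hz)).exists_isGreatest (Set.Nonempty.image _ ⟨lam, hmem⟩)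
  refine ⟨c, hc, ?_⟩
  refine le_trans ?_ (hc.2 (Set.mem_image_of_mem _ hmem))
  have h1 := (r.goh_identity lam z hyl hy0 hyd hz).2
  -- the term with `H_vu` in Goh's identity vanishes by the Legendre condition
  have h2 : ∫ t in (0 : ℝ)..P.T, P.D2H wh (r.mult lam) t (0, 0, (z.1.2 t).2)
      (0, (z.1.2 t).1, 0) = ∫ t in (0 : ℝ)..P.T, (0 : ℝ) :=
    intervalIntegral.integral_congr_Ioo_of_le r.T_nonneg fun t ht =>
      hmixed t (Set.Ioo_subset_Icc_self ht) _ _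
  rw [h2, intervalIntegral.integral_zero, add_zero] at h1
  rw [← h1]
  positivity
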